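/- Let $\kappa$ be a field of characteristic $0$, let $Y$ be a smooth separated scheme over $\kappa$, let $X\subset Y$ be a closed subscheme that is smooth over $\kappa$, with ideal sheaf $I_X$ and conormal sheaf $N^*=I_X/I_X^2$, and let $Y^{(k)}\subset Y$ be the closed subscheme defined by $I_X^{k+1}$, with structure sheaf $\mathcal O^{(k)}$, viewed as a sheaf on the topological space $X$. Let $E$ be a vector bundle on $X$. An extension of $E$ to $Y^{(k)}$ is a vector bundle $E^{(k)}$ on $Y^{(k)}$ with an isomorphism $E^{(k)}/I_XE^{(k)}\cong E$; an extension of a given $E^{(1)}$ to $Y^{(2)}$ is a vector bundle $E^{(2)}$ on $Y^{(2)}$ with an isomorphism $E^{(2)}/I_X^2E^{(2)}\cong E^{(1)}$. Isomorphisms of extensions are required to be compatible with these identifications. Choose: a covering of $X$ by affine opens $U_i$ with totally ordered index set; over each $U_i$ an isomorphism $\Phi_i:\mathcal O^{(2)}\cong \mathrm{Sym}^{\le 2}N^*$ of filtered $\kappa$-algebras that is the identity on the associated graded sheaves; and a connection $\nabla_i$ on $E|_{U_i}$. Čech cochains are indexed by increasing tuples $i<j<h<\dots$, with $(\delta n)_{ij}=n_j-n_i$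 and $(\delta m)_{ijh}=m_{jh}-m_{ih}+m_{ij}$; $H^2$ denotes the Čech cohomology of the covering. Put $\varphi_{ij}=\log(\Phi_i\Phi_j^{-1})=\varphi^1_{ij}+\varphi^2_{ij}$, a derivation of $\mathrm{Sym}^{\le2}N^*$ with $\varphi^v_{ij}$ raising the symmetric degree by $v$. Let $\mathbf a^v_{ij}:\Omega^1_X\to \mathrm{Sym}^vN^*$ be the $\mathcal O_X$-linear map with $\varphi^v_{ij}|_{\mathcal O_X}=\mathbf a^v_{ij}\circ d$, and $At(E)_{jh}=\nabla_j-\nabla_h$. Let $s\varphi^1_{ij}$ be the extension of $\mathbf a^1_{ij}\nabla_j:E\to N^*\otimes E$ by the Leibniz rule over $\varphi^1_{ij}$ to $\mathrm{Sym}^{\le2}N^*\otimes E$. Sections $m$ of $\mathrm{Sym}^vN^*\otimes \mathcal End(E)$ are regarded as $\mathrm{Sym}N^*$-linear operators on $\mathrm{Sym}^{\le 2}N^*\otimes E$, and brackets are commutators of operators. **(1)** $\mathbf a^1_{ij}At(E)_{jh}$ is a Čech 2-cocycle with values in $N^*\otimes \mathcal End(E)$, and an extension $E^{(1)}$ of $E$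 to $Y^{(1)}$ exists if and only if there is a 1-cochain $\mathbf m^1$ with values in $N^*\otimes\mathcal End(E)$ such that $$-\delta\mathbf m^1=\mathbf a^1_{ij}At(E)_{jh}.\qquad(*)$$ More precisely: for every extension $E^{(1)}$ there are isomorphisms $\Psi_i:E^{(1)}|_{U_i}\cong (\mathcal O_X\oplus N^*)\otimes E|_{U_i}$, compatible with $\Phi_i$ and the identity on associated graded sheaves; any choice of them determines a unique $\mathbf m^1$ with $\Psi_i\Psi_j^{-1}=\exp(\psi^1_{ij})$, $\psi^1_{ij}|_E=\mathbf a^1_{ij}\nabla_j+\mathbf m^1_{ij}$, and this $\mathbf m^1$ satisfies $(*)$; every solution of $(*)$ arises in this way; and two extensions are isomorphic if and only if the difference of their cochains $\mathbf m^1$ is $\delta n$ for a 0-cochain $n$ with values in $N^*\otimes\mathcal End(E)$. **(2)** Suppose that all $\nabla_i$ are flat, and fix an extension $E^{(1)}$ with isomorphisms $\Psi_i$ and cochain $\mathbf m^1$ as in (1). Then $$\mathbf o_{ijh}=\mathbf a^2_{ij}At(E)_{jh}+\tfrac12[\mathbf m^1_{ij},\mathbf m^1_{jh}]+\tfrac12[s\varphi^1_{ij},\mathbf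 m^1_{jh}]-\tfrac12\big[s\varphi^1_{jh},\ \mathbf m^1_{ij}+\mathbf a^1_{ij}At(E)_{jh}\big]$$ is a Čech 2-cocycle with values in $\mathrm{Sym}^2N^*\otimes\mathcal End(E)$ (in particular it is $\mathcal O_X$-linear), and $E^{(1)}$ extends to a vector bundle $E^{(2)}$ on $Y^{(2)}$ if and only if there is a 1-cochain $\mathbf m^2$ with values in $\mathrm{Sym}^2N^*\otimes\mathcal End(E)$ such that $-\delta\mathbf m^2=\mathbf o$, that is, if and only if the class of $\mathbf o$ in $H^2(X,\mathrm{Sym}^2N^*\otimes\mathcal End(E))$ is zero. For every such $E^{(2)}$ the $\Psi_i$ lift to isomorphisms $E^{(2)}|_{U_i}\cong\mathrm{Sym}^{\le2}N^*\otimes E|_{U_i}$ compatible with $\Phi_i$; any choice of lifts determines a unique $\mathbf m^2$ such that the transition maps are $\exp(\psi^1_{ij}+\psi^2_{ij})$ with $\psi^2_{ij}|_E=\mathbf a^2_{ij}\nabla_j+\mathbf m^2_{ij}$, and this $\mathbf m^2$ satisfies $-\delta\mathbf m^2=\mathbf o$; every solution arises in this way; and two extensions of $E^{(1)}$ are isomorphic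 if and only if the difference of their cochains $\mathbf m^2$ is $\delta n$ for a 0-cochain $n$ with values in $\mathrm{Sym}^2N^*\otimes\mathcal End(E)$. **(3)** Suppose that all $\nabla_i$ are flat. Let $\mathcal End^{0,2}_{ab}$ be the kernel of $(N^*\otimes\mathcal End(E))\oplus\mathcal O^{(2)}\to\mathcal O^{(1)}$, $(m,g)\mapsto \mathrm{Tr}(m)-g|_{Y^{(1)}}$, where $N^*=I_X/I_X^2\subset\mathcal O^{(1)}$. If $E$ has an extension $E^{(2)}$ to $Y^{(2)}$ (with no $E^{(1)}$ fixed), then $$\big(\mathbf a^1_{ij}At(E)_{jh},\ \mathbf a^2_{ij}\mathrm{Tr}\,At(E)_{jh}\big)$$ is a Čech 2-cocycle with values in $\mathcal End^{0,2}_{ab}$ whose class in $H^2(Y^{(2)},\mathcal End^{0,2}_{ab})$ is zero. Here the pair denotes the section $(\mathbf a^1_{ij}At(E)_{jh},g_{ijh})$, where $g_{ijh}\in I_X/I_X^3\subset\mathcal O^{(2)}$ is the function that the isomorphism $\exp(-\tfrac12\varphi_{ij})\circ\Phi_i=\exp(\tfrac12\varphi_{ij})\circ\Phi_j:\mathcal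 O^{(2)}|_{U_{ij}}\cong\mathrm{Sym}^{\le2}N^*|_{U_{ij}}$ maps to $\mathbf a^1_{ij}\mathrm{Tr}\,At(E)_{jh}+\mathbf a^2_{ij}\mathrm{Tr}\,At(E)_{jh}$. -/

import Mathlib

open AlgebraicGeometry CategoryTheory TensorProduct
open scoped TensorProduct

universe u v

noncomputable section

namespace CechExt

/-! ### Commutative algebra: truncated symmetric algebras and their derivations -/

section Algebra

variable {κ : Type u} [Field κ]
variable (A : Type u) [CommRing A] (N : Type u) [AddCommGroup N] [Module A N]

/-- The symmetric square `Sym² N` of an `A`-module. -/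
def SymSq : Type u :=
  (N ⊗[A] N) ⧸ Submodule.span A {t : N ⊗[A] N | ∃ x y : N, t = x ⊗ₜ[A] y - y ⊗ₜ[A] x}

instance : AddCommGroup (SymSq A N) := inferInstanceAs (AddCommGroup (_ ⧸ _))

instance : Module A (SymSq A N) := inferInstanceAs (Module A (_ ⧸ _))

/-- The projection `N ⊗ N → Sym² N`. -/
def SymSq.mk : N ⊗[A] N →ₗ[A] SymSq A N := Submodule.mkQ _

variable {A N}

/-- The product `N × N → Sym² N` of the symmetric algebra. -/
def SymSq.mul : N →ₗ[A] N →ₗ[A] SymSq A N := (TensorProduct.mk A N N).compr₂ (SymSq.mk A N)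

theorem SymSq.mul_comm (x y : N) : SymSq.mul (A := A) x y = SymSq.mul y x := by
  have h : SymSq.mk A N (x ⊗ₜ y - y ⊗ₜ x) = 0 :=
    (Submodule.Quotient.mk_eq_zero _).2 (Submodule.subset_span ⟨x, y, rfl⟩)
  rw [map_sub, sub_eq_zero] at h
  exact h

/-- `Sym²` of a semilinear map. -/
def SymSq.map {B : Type u} [CommRing B] {N' : Type u} [AddCommGroup N'] [Module B N']
    {σ : A →+* B} (f : N →ₛₗ[σ] N') : SymSq A N →ₛₗ[σ] SymSq B N' :=
  Submodule.liftQ _ ((SymSq.mk B N').comp (TensorProduct.map f f)) (by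
    rw [Submodule.span_le]
    rintro _ ⟨x, y, rfl⟩
    change SymSq.mk B N' (TensorProduct.map f f _) = 0
    rw [map_sub, TensorProduct.map_tmul, TensorProduct.map_tmul, map_sub, sub_eq_zero]
    exact SymSq.mul_comm (A := B) (f x) (f y))

variable (A N)

/-- The truncated symmetric algebra `Sym^{≤ 2} N = A ⊕ N ⊕ Sym² N`. -/
@[ext]
structure Trunc where
  c0 : A
  c1 : N
  c2 : SymSq A N

variable {A N}

namespace Trunc

instance : Zero (Trunc A N) := ⟨⟨0, 0, 0⟩⟩
instance : One (Trunc A N) := ⟨⟨1, 0, 0⟩⟩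
instance : Add (Trunc A N) := ⟨fun x y => ⟨x.c0 + y.c0, x.c1 + y.c1, x.c2 + y.c2⟩⟩
instance : Neg (Trunc A N) := ⟨fun x => ⟨-x.c0, -x.c1, -x.c2⟩⟩
instance : Mul (Trunc A N) := ⟨fun x y =>
  ⟨x.c0 * y.c0, x.c0 • y.c1 + y.c0 • x.c1,
    x.c0 • y.c2 + y.c0 • x.c2 + SymSq.mul x.c1 y.c1⟩⟩

@[simp] theorem zero_c0 : (0 : Trunc A N).c0 = 0 := rfl
@[simp] theorem zero_c1 : (0 : Trunc A N).c1 = 0 := rfl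
@[simp] theorem zero_c2 : (0 : Trunc A N).c2 = 0 := rfl
@[simp] theorem one_c0 : (1 : Trunc A N).c0 = 1 := rfl
@[simp] theorem one_c1 : (1 : Trunc A N).c1 = 0 := rfl
@[simp] theorem one_c2 : (1 : Trunc A N).c2 = 0 := rfl
@[simp] theorem add_c0 (x y : Trunc A N) : (x + y).c0 = x.c0 + y.c0 := rfl
@[simp] theorem add_c1 (x y : Trunc A N) : (x + y).c1 = x.c1 + y.c1 := rfl
@[simp] theorem add_c2 (x y : Trunc A N) : (x + y).c2 = x.c2 + y.c2 := rfl
@[simp] theorem neg_c0 (x : Trunc A N) : (-x).c0 = -x.c0 := rfl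
@[simp] theorem neg_c1 (x : Trunc A N) : (-x).c1 = -x.c1 := rfl
@[simp] theorem neg_c2 (x : Trunc A N) : (-x).c2 = -x.c2 := rfl
@[simp] theorem mul_c0 (x y : Trunc A N) : (x * y).c0 = x.c0 * y.c0 := rfl
@[simp] theorem mul_c1 (x y : Trunc A N) : (x * y).c1 = x.c0 • y.c1 + y.c0 • x.c1 := rfl
@[simp] theorem mul_c2 (x y : Trunc A N) :
    (x * y).c2 = x.c0 • y.c2 + y.c0 • x.c2 + SymSq.mul x.c1 y.c1 := rfl

instance : CommRing (Trunc A N) where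
  add_assoc x y z := by ext <;> simp [add_assoc]
  zero_add x := by ext <;> simp
  add_zero x := by ext <;> simp
  add_comm x y := by ext <;> simp [add_comm]
  neg_add_cancel x := by ext <;> simp
  nsmul := nsmulRec
  zsmul := zsmulRec
  left_distrib x y z := by
    ext
    · simp [mul_add]
    · simp only [mul_c1, add_c0, add_c1, smul_add, add_smul]; abel
    · simp only [mul_c2, add_c0, add_c1, add_c2, smul_add, add_smul, map_add]; abel
  right_distrib x y z := by
    ext
    · simp [add_mul]
    · simp only [mul_c1, add_c0, add_c1, smul_add, add_smul]; abel
    · simp only [mul_c2, add_c0, add_c1, add_c2, smul_add, add_smul, map_add,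
        LinearMap.add_apply]; abel
  zero_mul x := by ext <;> simp
  mul_zero x := by ext <;> simp
  one_mul x := by ext <;> simp
  mul_one x := by ext <;> simp
  mul_comm x y := by
    ext
    · simp [_root_.mul_comm]
    · simp [add_comm]
    · simp only [mul_c2]; rw [SymSq.mul_comm, add_comm (x.c0 • y.c2)]
  mul_assoc x y z := by
    ext
    · simp [_root_.mul_assoc]
    · simp only [mul_c1, mul_c0, smul_add, smul_smul]
      rw [_root_.mul_comm z.c0, _root_.mul_comm z.c0]; abel
    · simp only [mul_c2, mul_c1, mul_c0, smul_add, smul_smul, map_add, map_smul,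
        LinearMap.add_apply, LinearMap.smul_apply]
      rw [_root_.mul_comm z.c0, _root_.mul_comm z.c0]; abel

/-- The map of truncated symmetric algebras induced by a semilinear map. -/
def map {B : Type u} [CommRing B] {N' : Type u} [AddCommGroup N'] [Module B N']
    {σ : A →+* B} (f : N →ₛₗ[σ] N') (x : Trunc A N) : Trunc B N' :=
  ⟨σ x.c0, f x.c1, SymSq.map f x.c2⟩

end Trunc

variable (κ A N)

/-- A `κ`-linear derivation `φ = φ¹ + φ²` of `Sym^{≤ 2} N` raising the symmetric degree by `1`
resp. `2`: `φ¹` is given by `A1 : A → N` and `L1 : N → Sym² N`, and `φ²` by `A2 : A → Sym² N`. -/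
structure FiltDer [Algebra κ A] where
  A1 : A →+ N
  A2 : A →+ SymSq A N
  L1 : N →+ SymSq A N
  A1_mul : ∀ f g, A1 (f * g) = f • A1 g + g • A1 f
  A2_mul : ∀ f g, A2 (f * g) = f • A2 g + g • A2 f
  L1_smul : ∀ (f : A) (n : N), L1 (f • n) = f • L1 n + SymSq.mul (A1 f) n
  A1_const : ∀ c : κ, A1 (algebraMap κ A c) = 0
  A2_const : ∀ c : κ, A2 (algebraMap κ A c) = 0

variable {κ A N}

/-- The `A`-linear map `Ω_{A/κ} → M` representing a `κ`-derivation `A → M`. -/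
def kaehlerLift [Algebra κ A] {M : Type u} [AddCommGroup M] [Module A M] (D : A →+ M)
    (hmul : ∀ f g, D (f * g) = f • D g + g • D f)
    (hconst : ∀ c : κ, D (algebraMap κ A c) = 0) : Ω[A⁄κ] →ₗ[A] M :=
  letI : Module κ M := Module.compHom M (algebraMap κ A)
  haveI : IsScalarTower κ A M := IsScalarTower.of_algebraMap_smul fun _ _ => rfl
  Derivation.liftKaehlerDifferential (R := κ) (S := A) (M := M)
    (Derivation.mk'
      { D with
        map_smul' := fun c f => by
          change D (c • f) = algebraMap κ A c • D f
          rw [Algebra.smul_def, hmul, hconst, smul_zero, add_zero] }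
      (fun f g => hmul f g))

namespace FiltDer

variable [Algebra κ A] (φ : FiltDer κ A N)

/-- The linear map `a¹ : Ω → N` with `A1 = a¹ ∘ d`. -/
def a1 : Ω[A⁄κ] →ₗ[A] N := kaehlerLift φ.A1 φ.A1_mul φ.A1_const

/-- The linear map `a² : Ω → Sym² N` with `A2 = a² ∘ d`. -/
def a2 : Ω[A⁄κ] →ₗ[A] SymSq A N := kaehlerLift φ.A2 φ.A2_mul φ.A2_const

end FiltDer

/-- `1/2`, as an element of a `κ`-algebra. -/
def half (κ A : Type u) [Field κ] [CommRing A] [Algebra κ A] : A := algebraMap κ A (1 / 2)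

theorem half_smul_add [CharZero κ] [Algebra κ A] {M : Type u} [AddCommGroup M] [Module A M]
    (x : M) : half κ A • (x + x) = x := by
  rw [← two_smul A x, smul_smul]
  have : half κ A * 2 = 1 := by
    rw [half, ← map_ofNat (algebraMap κ A) 2, ← map_mul]; simp
  rw [this, one_smul]

/-- The logarithm `log Φ = (Φ - 1) - (Φ - 1)² / 2` of a `κ`-algebra automorphism `Φ` of
`Sym^{≤ 2} N` that respects the filtration by degree and is the identity on the associated
graded algebra. -/
def logAut [CharZero κ] [Algebra κ A] (Φ : Trunc A N ≃+* Trunc A N)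
    (h0 : ∀ x, (Φ x).c0 = x.c0) (h1 : ∀ n s, (Φ ⟨0, n, s⟩).c1 = n)
    (hc : ∀ c : κ, Φ ⟨algebraMap κ A c, 0, 0⟩ = ⟨algebraMap κ A c, 0, 0⟩) :
    FiltDer κ A N :=
  have addA : ∀ f g : A, Φ ⟨f + g, 0, 0⟩ = Φ ⟨f, 0, 0⟩ + Φ ⟨g, 0, 0⟩ := fun f g => by
    rw [← map_add]; congr 1; ext <;> simp
  have addN : ∀ n n' : N, Φ ⟨0, n + n', 0⟩ = Φ ⟨0, n, 0⟩ + Φ ⟨0, n', 0⟩ := fun f g => by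
    rw [← map_add]; congr 1; ext <;> simp
  have mulA : ∀ f g : A, Φ ⟨f * g, 0, 0⟩ = Φ ⟨f, 0, 0⟩ * Φ ⟨g, 0, 0⟩ := fun f g => by
    rw [← map_mul]; congr 1; ext <;> simp
  have mulN : ∀ (f : A) (n : N), Φ ⟨0, f • n, 0⟩ = Φ ⟨f, 0, 0⟩ * Φ ⟨0, n, 0⟩ := fun f g => by
    rw [← map_mul]; congr 1; ext <;> simp
  have z : Φ ⟨0, 0, 0⟩ = 0 := map_zero Φ
  have Lsmul : ∀ (f : A) (n : N), (Φ ⟨0, f • n, 0⟩).c2 =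
      f • (Φ ⟨0, n, 0⟩).c2 + SymSq.mul (Φ ⟨f, 0, 0⟩).c1 n := fun f n => by
    rw [mulN]; simp [h0, h1]
  { A1 := ⟨⟨fun f => (Φ ⟨f, 0, 0⟩).c1, by simp [z]⟩, fun f g => by simp [addA]⟩
    L1 := ⟨⟨fun n => (Φ ⟨0, n, 0⟩).c2, by simp [z]⟩, fun f g => by simp [addN]⟩
    A2 := ⟨⟨fun f => (Φ ⟨f, 0, 0⟩).c2 - half κ A • (Φ ⟨0, (Φ ⟨f, 0, 0⟩).c1, 0⟩).c2,
        by simp [z]⟩, fun f g => by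
          simp only [addA, Trunc.add_c1, Trunc.add_c2, addN, smul_add]; abel⟩
    A1_mul := fun f g => by
      change (Φ ⟨f * g, 0, 0⟩).c1 = f • (Φ ⟨g, 0, 0⟩).c1 + g • (Φ ⟨f, 0, 0⟩).c1
      rw [mulA]; simp [h0]
    L1_smul := Lsmul
    A2_mul := fun f g => by
      change (Φ ⟨f * g, 0, 0⟩).c2 - half κ A • (Φ ⟨0, (Φ ⟨f * g, 0, 0⟩).c1, 0⟩).c2 =
        f • ((Φ ⟨g, 0, 0⟩).c2 - half κ A • (Φ ⟨0, (Φ ⟨g, 0, 0⟩).c1, 0⟩).c2) +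
        g • ((Φ ⟨f, 0, 0⟩).c2 - half κ A • (Φ ⟨0, (Φ ⟨f, 0, 0⟩).c1, 0⟩).c2)
      have e1 : (Φ ⟨f * g, 0, 0⟩).c1 = f • (Φ ⟨g, 0, 0⟩).c1 + g • (Φ ⟨f, 0, 0⟩).c1 := by
        rw [mulA]; simp [h0]
      have e2 : (Φ ⟨f * g, 0, 0⟩).c2 = f • (Φ ⟨g, 0, 0⟩).c2 + g • (Φ ⟨f, 0, 0⟩).c2 +
          SymSq.mul (Φ ⟨f, 0, 0⟩).c1 (Φ ⟨g, 0, 0⟩).c1 := by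
        rw [mulA]; simp [h0]
      rw [e1, addN, Trunc.add_c2, Lsmul, Lsmul, e2,
        SymSq.mul_comm (A := A) (Φ ⟨g, 0, 0⟩).c1 (Φ ⟨f, 0, 0⟩).c1]
      have e3 := half_smul_add (κ := κ) (A := A)
        (SymSq.mul (A := A) (Φ ⟨f, 0, 0⟩).c1 (Φ ⟨g, 0, 0⟩).c1)
      simp only [smul_add, smul_sub] at e3 ⊢
      rw [smul_comm (half κ A) f, smul_comm (half κ A) g]
      nth_rewrite 1 [← e3]
      abel
    A1_const := fun c => by
      change (Φ ⟨algebraMap κ A c, 0, 0⟩).c1 = 0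
      rw [hc]
    A2_const := fun c => by
      change (Φ ⟨algebraMap κ A c, 0, 0⟩).c2 -
        half κ A • (Φ ⟨0, (Φ ⟨algebraMap κ A c, 0, 0⟩).c1, 0⟩).c2 = 0
      rw [hc]; simp [z] }

/-! #### Operators on `Sym^{≤ 2} N ⊗ E` -/

variable {E : Type u} [AddCommGroup E] [Module A E]

/-- The product `N × (N ⊗ E) → Sym² N ⊗ E`. -/
def nMul (n : N) : N ⊗[A] E →ₗ[A] SymSq A N ⊗[A] E := LinearMap.rTensor E (SymSq.mul n)

/-- The action of `Sym^{≤ 1} N = A ⊕ N` (through which `Sym^{≤ 2} N` acts) on `(A ⊕ N) ⊗ E`. -/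
def Trunc.act1 (r : Trunc A N) (x : E × (N ⊗[A] E)) : E × (N ⊗[A] E) :=
  (r.c0 • x.1, r.c0 • x.2 + r.c1 ⊗ₜ[A] x.1)

/-- The action of `Sym^{≤ 2} N` on `Sym^{≤ 2} N ⊗ E`. -/
def Trunc.act2 (r : Trunc A N) (x : E × (N ⊗[A] E) × (SymSq A N ⊗[A] E)) :
    E × (N ⊗[A] E) × (SymSq A N ⊗[A] E) :=
  (r.c0 • x.1, r.c0 • x.2.1 + r.c1 ⊗ₜ[A] x.1,
    r.c0 • x.2.2 + nMul r.c1 x.2.1 + r.c2 ⊗ₜ[A] x.1)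

/-- The `Sym N`-linear extension `N ⊗ E → Sym² N ⊗ E`, `n ⊗ e ↦ n · m e`, of an `A`-linear map
`m : E → N ⊗ E`. -/
def extLin (m : E →ₗ[A] N ⊗[A] E) : N ⊗[A] E →ₗ[A] SymSq A N ⊗[A] E :=
  (LinearMap.rTensor E (SymSq.mk A N)).comp
    ((TensorProduct.assoc A N N E).symm.toLinearMap.comp (LinearMap.lTensor N m))

/-- The commutator `[m, m'] : E → Sym² N ⊗ E` of `A`-linear maps `E → N ⊗ E`. -/
def brLin (m m' : E →ₗ[A] N ⊗[A] E) : E →ₗ[A] SymSq A N ⊗[A] E :=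
  (extLin m).comp m' - (extLin m').comp m

/-- A map `E → Ω ⊗ E` satisfying the Leibniz rule, that is, a connection on the `A`-module `E`. -/
def IsConn (κ : Type u) [Field κ] [Algebra κ A] (D : E →+ Ω[A⁄κ] ⊗[A] E) : Prop :=
  ∀ (f : A) (e : E), D (f • e) = KaehlerDifferential.D κ A f ⊗ₜ[A] e + f • D e

/-- Covariant derivative along a derivation of `A`. -/
def covDer [Algebra κ A] (D : E →+ Ω[A⁄κ] ⊗[A] E) (X : Derivation κ A A) : E →+ E :=
  ((TensorProduct.lid A E).toLinearMap.comp
    (LinearMap.rTensor E X.liftKaehlerDifferential)).toAddMonoidHom.comp D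

/-- Vanishing of the curvature. -/
def IsFlatConn (κ : Type u) [Field κ] [Algebra κ A] (D : E →+ Ω[A⁄κ] ⊗[A] E) : Prop :=
  ∀ (X X' : Derivation κ A A) (e : E),
    covDer D X (covDer D X' e) - covDer D X' (covDer D X e) = covDer D ⁅X, X'⁆ e

/-- The difference of two connections, an `A`-linear map. -/
def connDiff [Algebra κ A] (D D' : E →+ Ω[A⁄κ] ⊗[A] E) (hD : IsConn κ D) (hD' : IsConn κ D') :
    E →ₗ[A] Ω[A⁄κ] ⊗[A] E where
  toFun e := D e - D' e
  map_add' x y := by rw [map_add, map_add]; abel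
  map_smul' f x := by rw [hD, hD', RingHom.id_apply, smul_sub]; abel

namespace FiltDer

variable [Algebra κ A] (φ : FiltDer κ A N)

theorem a1_d (f : A) : φ.a1 (KaehlerDifferential.D κ A f) = φ.A1 f := by
  let _ : Module κ N := Module.compHom N (algebraMap κ A)
  have : IsScalarTower κ A N := IsScalarTower.of_algebraMap_smul fun _ _ => rfl
  exact Derivation.liftKaehlerDifferential_comp_D _ _

theorem a2_d (f : A) : φ.a2 (KaehlerDifferential.D κ A f) = φ.A2 f := by
  let _ : Module κ (SymSq A N) := Module.compHom _ (algebraMap κ A)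
  have : IsScalarTower κ A (SymSq A N) := IsScalarTower.of_algebraMap_smul fun _ _ => rfl
  exact Derivation.liftKaehlerDifferential_comp_D _ _

/-- The operator `a¹∇ : E → N ⊗ E`. -/
def s1 (D : E →+ Ω[A⁄κ] ⊗[A] E) : E →+ N ⊗[A] E :=
  (LinearMap.rTensor E φ.a1).toAddMonoidHom.comp D

/-- The operator `a²∇ : E → Sym² N ⊗ E`. -/
def s2 (D : E →+ Ω[A⁄κ] ⊗[A] E) : E →+ SymSq A N ⊗[A] E :=
  (LinearMap.rTensor E φ.a2).toAddMonoidHom.comp D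

/-- The Leibniz extension `N ⊗ E → Sym² N ⊗ E`, `n ⊗ e ↦ φ¹(n) ⊗ e + n · a¹∇ e`, of `a¹∇`.
Together, `s1` and `s1ext` make up the derivation `sφ¹` of `Sym^{≤ 2} N ⊗ E`. -/
def s1ext (D : E →+ Ω[A⁄κ] ⊗[A] E) (hD : IsConn κ D) : N ⊗[A] E →+ SymSq A N ⊗[A] E :=
  TensorProduct.liftAddHom
    (AddMonoidHom.mk' (fun n => AddMonoidHom.mk' (fun e => φ.L1 n ⊗ₜ[A] e + nMul n (φ.s1 D e))
      (fun e e' => by rw [TensorProduct.tmul_add, map_add, map_add]; abel))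
      (fun n n' => by
        ext e
        simp only [AddMonoidHom.mk'_apply, AddMonoidHom.add_apply, nMul, map_add,
          TensorProduct.add_tmul, LinearMap.rTensor_add, LinearMap.add_apply]
        abel))
    (fun f n e => by
      have h : φ.s1 D (f • e) = φ.A1 f ⊗ₜ[A] e + f • φ.s1 D e := by
        change LinearMap.rTensor E φ.a1 (D (f • e)) = _
        rw [hD, map_add, LinearMap.rTensor_tmul, a1_d, map_smul]; rfl
      simp only [AddMonoidHom.mk'_apply]
      rw [h, φ.L1_smul, map_add, map_smul, TensorProduct.add_tmul]
      simp only [nMul, LinearMap.rTensor_tmul, map_smul, LinearMap.rTensor_smul,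
        LinearMap.smul_apply]
      rw [SymSq.mul_comm (A := A) n (φ.A1 f), TensorProduct.smul_tmul]
      abel)

/-- The commutator `[sφ¹, m] : E → Sym² N ⊗ E` with an `A`-linear map `m : E → N ⊗ E`. -/
def br (D : E →+ Ω[A⁄κ] ⊗[A] E) (hD : IsConn κ D) (m : E →ₗ[A] N ⊗[A] E) :
    E →+ SymSq A N ⊗[A] E :=
  (φ.s1ext D hD).comp m.toAddMonoidHom - (extLin m).toAddMonoidHom.comp (φ.s1 D)

end FiltDer

/-- The trace `Hom(E, M ⊗ E) → M`, for a finitely generated projective module `E`: the sum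
`∑ₖ ⟨eᵏ, m eₖ⟩` for a dual basis `(eₖ, eᵏ)` of `E`, on which it does not depend. -/
def trc (M : Type u) [AddCommGroup M] [Module A M] : (E →ₗ[A] M ⊗[A] E) →ₗ[A] M :=
  open Classical in
  if h : ∃ n : ℕ, ∃ p : (Fin n → A) →ₗ[A] E, ∃ q : E →ₗ[A] (Fin n → A), p ∘ₗ q = LinearMap.id then
    ∑ k : Fin h.choose,
      ((TensorProduct.rid A M).toLinearMap.comp
        (LinearMap.lTensor M ((LinearMap.proj k).comp h.choose_spec.choose_spec.choose))).comp
        (LinearMap.applyₗ (h.choose_spec.choose (Pi.single k 1)))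
  else 0

end Algebra

/-! ### Vector bundles and their extensions -/

/-- A sheaf of modules on a scheme is a vector bundle if every point has an open neighbourhood `U`
with finitely many sections over `U` that restrict to a basis of the sections over every open
`V ≤ U`. -/
def IsVectorBundle {S : Scheme.{u}} (M : S.Modules) : Prop :=
  ∀ x : S, ∃ U : S.Opens, x ∈ U ∧ ∃ (n : ℕ) (b : Fin n → Γ(M, U)), ∀ (V : S.Opens) (h : V ≤ U),
    Function.Bijective fun c : Fin n → Γ(S, V) =>
      ∑ k, c k • (M.presheaf.map (homOfLE h).op).hom (b k)

/-- `ρ : M → j_* M'` induces an isomorphism of sheaves `M / I M ≅ j_* M'`, where `I` is the ideal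
sheaf of a closed immersion `j : S' → S`: it is locally surjective, and every section killed by `ρ`
lies locally in `I M`. -/
def IsReduction {S' S : Scheme.{u}} (j : S' ⟶ S) {M : S.Modules} {M' : S'.Modules}
    (ρ : M ⟶ (Scheme.Modules.pushforward j).obj M') : Prop :=
  (∀ (W : S.Opens) (e : Γ((Scheme.Modules.pushforward j).obj M', W)) (x : S), x ∈ W →
    ∃ (W' : S.Opens) (h : W' ≤ W), x ∈ W' ∧ ∃ s : Γ(M, W'), (ρ.app W').hom s =
      (((Scheme.Modules.pushforward j).obj M').presheaf.map (homOfLE h).op).hom e) ∧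
  (∀ (W : S.Opens) (s : Γ(M, W)), (ρ.app W).hom s = 0 → ∀ x : S, x ∈ W →
    ∃ (W' : S.Opens) (h : W' ≤ W), x ∈ W' ∧ (M.presheaf.map (homOfLE h).op).hom s ∈
      RingHom.ker (j.app W').hom • (⊤ : Submodule Γ(S, W') Γ(M, W')))

/-- The map `Γ(W, M) → Γ(j⁻¹ W, M')` given by a morphism `M → j_* M'`. -/
def secMap {S' S : Scheme.{u}} (j : S' ⟶ S) {M : S.Modules} {M' : S'.Modules}
    (ρ : M ⟶ (Scheme.Modules.pushforward j).obj M') (W : S.Opens) :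
    Γ(M, W) →+ Γ(M', j ⁻¹ᵁ W) :=
  (ρ.app W).hom

/-- Multiplication of a section of a sheaf of modules by a function. -/
def smulSec {S : Scheme.{u}} (M : S.Modules) (W : S.Opens) (r : Γ(S, W)) (s : Γ(M, W)) : Γ(M, W) :=
  r • s

/-- A smooth closed subscheme `X` of a smooth separated scheme `Y` over a field. -/
structure SmoothPair (κ : Type u) [Field κ] where
  Y : Scheme.{u}
  str : Y ⟶ Spec (.of κ)
  I : Y.IdealSheafData
  smooth_Y : Smooth str
  separated_Y : IsSeparated str
  smooth_X : Smooth (I.subschemeι ≫ str)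

namespace SmoothPair

variable {κ : Type u} [Field κ] (P : SmoothPair κ)

/-- The closed subscheme `X`. -/
def X : Scheme.{u} := P.I.subscheme

/-- The first order neighbourhood `Y⁽¹⁾` of `X`. -/
def Y1 : Scheme.{u} := (P.I ^ 2).subscheme

/-- The second order neighbourhood `Y⁽²⁾` of `X`. -/
def Y2 : Scheme.{u} := (P.I ^ 3).subscheme

/-- `X → Y⁽¹⁾`. -/
def j01 : P.X ⟶ P.Y1 :=
  Scheme.IdealSheafData.inclusion (fun _ => Ideal.pow_le_self (n := 2) two_ne_zero)

/-- `Y⁽¹⁾ → Y⁽²⁾`. -/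
def j12 : P.Y1 ⟶ P.Y2 :=
  Scheme.IdealSheafData.inclusion (fun _ => Ideal.pow_le_pow_right (m := 2) (n := 3) (by norm_num))

/-- `X → Y⁽²⁾`, a homeomorphism. -/
def j02 : P.X ⟶ P.Y2 := P.j01 ≫ P.j12

/-- The affine open subschemes of `Y⁽²⁾`. As `X → Y⁽²⁾` is a homeomorphism defined by a nilpotent
ideal, these are the same as the affine open subschemes of `X`; sheaves on `X`, `Y⁽¹⁾` and `Y⁽²⁾`
are regarded as sheaves on one and the same topological space. -/
abbrev Aff : Type u := P.Y2.affineOpens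

/-- The ring `𝒪⁽²⁾(V)`. -/
abbrev R (V : P.Aff) : Type u := Γ(P.Y2, V.1)

/-- The part over `V` of the closed subscheme `X`. -/
abbrev preX (V : P.Aff) : P.X.Opens := P.j01 ⁻¹ᵁ (P.j12 ⁻¹ᵁ V.1)

/-- The restriction of functions `𝒪⁽²⁾(V) → Γ(X ∩ V, 𝒪_X)`. -/
def appX (V : P.Aff) : P.R V →+* Γ(P.X, P.preX V) :=
  (P.j01.app (P.j12 ⁻¹ᵁ V.1)).hom.comp (P.j12.app V.1).hom

/-- The ideal `I_X(V)` of `𝒪⁽²⁾(V)`. -/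
def idl (V : P.Aff) : Ideal (P.R V) := RingHom.ker (P.appX V)

/-- The ring `𝒪_X(V) = 𝒪⁽²⁾(V) / I_X(V)`. -/
abbrev O (V : P.Aff) : Type u := P.R V ⧸ P.idl V

/-- The structure morphism of `Y⁽²⁾`. -/
def str2 : P.Y2 ⟶ Spec (.of κ) := (P.I ^ 3).subschemeι ≫ P.str

instance (V : P.Aff) : Algebra κ (P.R V) :=
  ((P.str2.appLE ⊤ V.1 le_top).hom.comp (Scheme.ΓSpecIso (.of κ)).inv.hom).toAlgebra

/-- The restriction `𝒪⁽²⁾(V) → 𝒪⁽²⁾(W)`. -/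
def resR {V W : P.Aff} (h : W ≤ V) : P.R V →+* P.R W := (P.Y2.presheaf.map (homOfLE h).op).hom

theorem preX_mono {V W : P.Aff} (h : W ≤ V) : P.preX W ≤ P.preX V :=
  P.j01.preimage_mono (P.j12.preimage_mono h)

theorem appX_resR {V W : P.Aff} (h : W ≤ V) (r : P.R V) : P.appX W (P.resR h r) =
    (P.X.presheaf.map (homOfLE (P.preX_mono h)).op).hom (P.appX V r) := by
  have e := congrArg (fun f => f.hom r) (P.j12.naturality (homOfLE h).op)
  have e' := congrArg (fun f => f.hom ((P.j12.app V.1).hom r))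
    (P.j01.naturality (homOfLE (P.j12.preimage_mono h)).op)
  exact (congrArg (P.j01.app (P.j12 ⁻¹ᵁ W.1)).hom e).trans e'

theorem resR_idl {V W : P.Aff} (h : W ≤ V) : P.idl V ≤ (P.idl W).comap (P.resR h) := by
  intro r hr
  have hr' : P.appX V r = 0 := hr
  change P.appX W (P.resR h r) = 0
  rw [appX_resR, hr', map_zero]

/-- The restriction `𝒪_X(V) → 𝒪_X(W)`. -/
def resO {V W : P.Aff} (h : W ≤ V) : P.O V →+* P.O W :=
  Ideal.quotientMap _ (P.resR h) (P.resR_idl h)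

theorem resR_algebraMap {V W : P.Aff} (h : W ≤ V) (c : κ) :
    P.resR h (algebraMap κ _ c) = algebraMap κ _ c := by
  have e := Scheme.Hom.appLE_map P.str2 (U := ⊤) (V := V.1) le_top
    (homOfLE h).op
  exact congrArg (fun f => f.hom ((Scheme.ΓSpecIso (.of κ)).inv.hom c)) e

theorem resO_algebraMap {V W : P.Aff} (h : W ≤ V) (c : κ) :
    P.resO h (algebraMap κ _ c) = algebraMap κ _ c := by
  change Ideal.Quotient.mk _ (P.resR h (algebraMap κ _ c)) = _
  rw [resR_algebraMap]; rfl

/-- A family of modules over the rings `𝒪_X(V)`, `V` affine, with restriction maps. -/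
structure ModFam where
  obj : P.Aff → Type u
  [grp : ∀ V, AddCommGroup (obj V)]
  [mod : ∀ V, Module (P.O V) (obj V)]
  res : ∀ {V W : P.Aff} (h : W ≤ V), obj V →ₛₗ[P.resO h] obj W

attribute [instance] ModFam.grp ModFam.mod

variable {P} in
/-- The restriction maps of `F ⊗ G`. -/
def resTensor (F G : P.ModFam) {V W : P.Aff} (h : W ≤ V) :
    F.obj V ⊗[P.O V] G.obj V →ₛₗ[P.resO h] F.obj W ⊗[P.O W] G.obj W :=
  TensorProduct.map (F.res h) (G.res h)

/-- The conormal sheaf `N^* = I_X / I_X²`. -/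
def con : P.ModFam where
  obj V := (P.idl V).Cotangent
  res {V W} h :=
    { toFun := Ideal.mapCotangent (R := ℤ) (P.idl V) (P.idl W) (P.resR h).toIntAlgHom
        (P.resR_idl h)
      map_add' := map_add _
      map_smul' := fun r x => by
        obtain ⟨r, rfl⟩ := Ideal.Quotient.mk_surjective r
        obtain ⟨x, rfl⟩ := Ideal.toCotangent_surjective _ x
        exact (Ideal.mapCotangent_toCotangent (R := ℤ) (P.idl V) (P.idl W)
          (P.resR h).toIntAlgHom (P.resR_idl h) (r • x)).trans
          (congrArg (P.idl W).toCotangent (Subtype.ext (map_mul (P.resR h) r x))) }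

/-- The class in `I_X / I_X²` of a section of `I_X`. -/
def toCon (V : P.Aff) : P.idl V →+ P.con.obj V := (P.idl V).toCotangent.toAddMonoidHom

/-- The inclusion `I_X / I_X² → 𝒪⁽²⁾ / I_X² = 𝒪⁽¹⁾`. -/
def conToO1 (V : P.Aff) : P.con.obj V →+ P.R V ⧸ P.idl V ^ 2 :=
  (P.idl V).cotangentToQuotientSquare.toAddMonoidHom

/-- The symmetric square of the conormal sheaf. -/
abbrev con2 : P.ModFam where
  obj V := SymSq (P.O V) (P.con.obj V)
  res h := SymSq.map (P.con.res h)

/-- The sheaf of differentials `Ω_X` over `κ`. -/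
abbrev omega : P.ModFam where
  obj V := Ω[P.O V⁄κ]
  res {V W} h :=
    letI := (P.resO h).toAlgebra
    haveI : IsScalarTower κ (P.O V) (P.O W) :=
      IsScalarTower.of_algebraMap_eq fun c => (P.resO_algebraMap h c).symm
    { toFun := KaehlerDifferential.map κ κ (P.O V) (P.O W)
      map_add' := map_add _
      map_smul' := fun r x => by
        rw [map_smul]
        exact (algebraMap_smul (P.O W) r _).symm }

variable {P} in
/-- The sections `E(V)` of a sheaf of `𝒪_X`-modules, as an `𝒪_X(V)`-module. -/
def sec (E : P.X.Modules) (V : P.Aff) : Type u := Γ(E, P.preX V)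

instance (E : P.X.Modules) (V : P.Aff) : AddCommGroup (sec E V) :=
  inferInstanceAs (AddCommGroup Γ(E, P.preX V))

instance (E : P.X.Modules) (V : P.Aff) : Module (P.O V) (sec E V) :=
  Module.compHom Γ(E, P.preX V) (RingHom.kerLift (P.appX V))

variable {P} in
/-- The family `V ↦ E(V)` underlying a sheaf `E` of `𝒪_X`-modules. -/
def ofModules (E : P.X.Modules) : P.ModFam where
  obj V := sec E V
  res {V W} h :=
    { toFun := (E.presheaf.map (homOfLE (P.preX_mono h)).op).hom
      map_add' := map_add _
      map_smul' := fun r x => by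
        obtain ⟨r, rfl⟩ := Ideal.Quotient.mk_surjective r
        exact (Scheme.Modules.map_smul E (homOfLE (P.preX_mono h)) (P.appX V r) x).trans
          (congrArg (fun t : Γ(P.X, P.preX W) =>
            t • (E.presheaf.map (homOfLE (P.preX_mono h)).op).hom x) (P.appX_resR h r).symm) }

/-- The affine opens contained in `W`. -/
abbrev AffIn (W : P.Y2.Opens) : Type u := {V : P.Aff // V.1 ≤ W}

variable {P} in
/-- Affine opens contained in `W` are contained in `W'`, if `W ≤ W'`. -/
def AffIn.up {W W' : P.Y2.Opens} (h : W ≤ W') (V : P.AffIn W) : P.AffIn W' := ⟨V.1, V.2.trans h⟩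

variable {P} in
/-- The group of sheaf homomorphisms `E|_W → (F ⊗ E)|_W`: families of `𝒪_X`-linear maps on the
affine opens contained in `W`, compatible with restriction. -/
def endOn (F E : P.ModFam) (W : P.Y2.Opens) :
    AddSubgroup (∀ V : P.AffIn W, E.obj V.1 →ₗ[P.O V.1] F.obj V.1 ⊗[P.O V.1] E.obj V.1) where
  carrier := {m | ∀ (V V' : P.AffIn W) (h : V'.1 ≤ V.1) (x : E.obj V.1),
    resTensor F E h (m V x) = m V' (E.res h x)}
  zero_mem' := fun V V' h x => by simp
  add_mem' := fun {a b} ha hb V V' h x => by simp [ha V V' h x, hb V V' h x]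
  neg_mem' := fun {a} ha V V' h x => by simp [ha V V' h x]

variable {P} in
/-- The sheaf `F ⊗ End(E) = Hom(E, F ⊗ E)`, for locally free `E`. -/
def endSheaf (F E : P.ModFam) : P.Y2.Opensᵒᵖ ⥤ AddCommGrpCat.{u} where
  obj W := AddCommGrpCat.of (endOn F E W.unop)
  map {W W'} i := AddCommGrpCat.ofHom
    { toFun := fun m => ⟨fun V => m.1 (V.up i.unop.le),
        fun V V' h x => m.2 (V.up i.unop.le) (V'.up i.unop.le) h x⟩
      map_zero' := rfl
      map_add' := fun _ _ => rfl }

variable {P} in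
/-- The kernel over `W` of `(N^* ⊗ End E) ⊕ 𝒪⁽²⁾ → 𝒪⁽¹⁾`, the difference of the trace
(with values in `I_X/I_X² ⊆ 𝒪⁽¹⁾`) and the canonical surjection. -/
def endAbOn (E : P.ModFam) (W : P.Y2.Opens) :
    AddSubgroup (endOn P.con E W × Γ(P.Y2, W)) where
  carrier := {x | ∀ V : P.AffIn W,
    P.conToO1 V.1 (trc (P.con.obj V.1) (x.1.1 V)) =
      Ideal.Quotient.mk (P.idl V.1 ^ 2) ((P.Y2.presheaf.map (homOfLE V.2).op).hom x.2)}
  zero_mem' := fun V => by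
    change P.conToO1 V.1 (trc (P.con.obj V.1) 0) = Ideal.Quotient.mk _ (CommRingCat.Hom.hom _ 0)
    rw [map_zero, map_zero, map_zero, map_zero]
  add_mem' := fun {a b} ha hb V => by
    change P.conToO1 V.1 (trc (P.con.obj V.1) (a.1.1 V + b.1.1 V)) =
      Ideal.Quotient.mk _ (CommRingCat.Hom.hom _ (a.2 + b.2))
    rw [map_add, map_add, map_add, map_add, ← ha V, ← hb V]
  neg_mem' := fun {a} ha V => by
    change P.conToO1 V.1 (trc (P.con.obj V.1) (-a.1.1 V)) =
      Ideal.Quotient.mk _ (CommRingCat.Hom.hom _ (-a.2))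
    rw [map_neg, map_neg, map_neg, map_neg, ← ha V]

variable {P} in
/-- The sheaf `ℰnd^{0,2}_{ab}`. -/
def endAb (E : P.ModFam) : P.Y2.Opensᵒᵖ ⥤ AddCommGrpCat.{u} where
  obj W := AddCommGrpCat.of (endAbOn E W.unop)
  map {W W'} i := AddCommGrpCat.ofHom
    (((((endSheaf P.con E).map i).hom.prodMap (P.Y2.presheaf.map i).hom.toAddMonoidHom).comp
      (endAbOn E W.unop).subtype).codRestrict (endAbOn E W'.unop) (fun x V => by
        refine (x.2 (V.up i.unop.le)).trans (congrArg _ ?_)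
        exact congrArg (fun f => f.hom x.1.2)
          (P.Y2.presheaf.map_comp i (homOfLE V.2).op)))
  map_id W := by
    apply AddCommGrpCat.hom_ext
    apply AddMonoidHom.ext
    intro x
    refine Subtype.ext (Prod.ext rfl ?_)
    exact congrArg (fun f => f.hom x.1.2) (P.Y2.presheaf.map_id W)
  map_comp f g := by
    apply AddCommGrpCat.hom_ext
    apply AddMonoidHom.ext
    intro x
    refine Subtype.ext (Prod.ext rfl ?_)
    exact congrArg (fun t => t.hom x.1.2) (P.Y2.presheaf.map_comp f g)

/-- A connection on `E|_W`. -/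
structure Connection (E : P.ModFam) (W : P.Y2.Opens) where
  app : ∀ V : P.AffIn W, E.obj V.1 →+ Ω[P.O V.1⁄κ] ⊗[P.O V.1] E.obj V.1
  leibniz : ∀ V, IsConn κ (app V)
  nat : ∀ (V V' : P.AffIn W) (h : V'.1 ≤ V.1) (x : E.obj V.1),
    resTensor P.omega E h (app V x) = app V' (E.res h x)

variable {P} in
/-- Flatness of a connection. -/
def Connection.IsFlat {E : P.ModFam} {W : P.Y2.Opens} (D : P.Connection E W) : Prop :=
  ∀ V, IsFlatConn κ (D.app V)

/-- An isomorphism `𝒪⁽²⁾|_W ≅ Sym^{≤ 2} N^*|_W` of filtered sheaves of `κ`-algebras which is the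
identity on the associated graded sheaves. (Being the identity on `I_X² = Sym² N^*` follows from
multiplicativity.) -/
structure AlgTriv (W : P.Y2.Opens) where
  app : ∀ V : P.AffIn W, P.R V.1 ≃+* Trunc (P.O V.1) (P.con.obj V.1)
  const : ∀ V (c : κ), app V (algebraMap κ _ c) = ⟨algebraMap κ _ c, 0, 0⟩
  gr0 : ∀ V r, (app V r).c0 = Ideal.Quotient.mk (P.idl V.1) r
  gr1 : ∀ V (r : P.idl V.1), (app V r).c1 = P.toCon V.1 r
  nat : ∀ (V V' : P.AffIn W) (h : V'.1 ≤ V.1) (r : P.R V.1),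
    app V' (P.resR h r) = Trunc.map (P.con.res h) (app V r)

variable {P} in
/-- The derivation `φ = log (Φ ∘ Φ'⁻¹)` comparing two isomorphisms over a common affine open. -/
def AlgTriv.log [CharZero κ] {W W' : P.Y2.Opens} (Φ : P.AlgTriv W) (Φ' : P.AlgTriv W')
    (V : P.Aff) (h : V.1 ≤ W) (h' : V.1 ≤ W') : FiltDer κ (P.O V) (P.con.obj V) :=
  logAut ((Φ'.app ⟨V, h'⟩).symm.trans (Φ.app ⟨V, h⟩))
    (fun x => by
      rw [RingEquiv.trans_apply, Φ.gr0, ← Φ'.gr0 ⟨V, h'⟩, RingEquiv.apply_symm_apply])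
    (fun n s => by
      have e := (Φ'.app ⟨V, h'⟩).apply_symm_apply ⟨0, n, s⟩
      have e0 : (Φ'.app ⟨V, h'⟩).symm ⟨0, n, s⟩ ∈ P.idl V := by
        rw [← Ideal.Quotient.eq_zero_iff_mem]
        exact (Φ'.gr0 ⟨V, h'⟩ _).symm.trans (congrArg Trunc.c0 e)
      exact (Φ.gr1 ⟨V, h⟩ ⟨_, e0⟩).trans
        ((Φ'.gr1 ⟨V, h'⟩ ⟨_, e0⟩).symm.trans (congrArg Trunc.c1 e)))
    (fun c => by
      rw [RingEquiv.trans_apply, ← Φ'.const ⟨V, h'⟩ c, RingEquiv.symm_apply_apply, Φ.const,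
        Φ'.const])

/-! #### Čech cochains -/

section Cech

variable {P}
variable {ι : Type v} [LinearOrder ι]

/-- Restriction of sections. -/
def restr (F : P.Y2.Opensᵒᵖ ⥤ AddCommGrpCat.{u}) {W W' : P.Y2.Opens} (h : W' ≤ W) :
    F.obj (.op W) →+ F.obj (.op W') := (F.map (homOfLE h).op).hom

/-- Pairs `i < j`. -/
abbrev Ix2 (ι : Type v) [LinearOrder ι] : Type v := {p : ι × ι // p.1 < p.2}

/-- Triples `i < j < h`. -/
abbrev Ix3 (ι : Type v) [LinearOrder ι] : Type v :=
  {t : ι × ι × ι // t.1 < t.2.1 ∧ t.2.1 < t.2.2}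

/-- Quadruples `i < j < h < l`. -/
abbrev Ix4 (ι : Type v) [LinearOrder ι] : Type v :=
  {t : ι × ι × ι × ι // t.1 < t.2.1 ∧ t.2.1 < t.2.2.1 ∧ t.2.2.1 < t.2.2.2}

variable (U : ι → P.Aff)

/-- `U_ij`. -/
abbrev U2 (p : Ix2 ι) : P.Y2.Opens := (U p.1.1).1 ⊓ (U p.1.2).1

/-- `U_ijh`. -/
abbrev U3 (t : Ix3 ι) : P.Y2.Opens := (U t.1.1).1 ⊓ ((U t.1.2.1).1 ⊓ (U t.1.2.2).1)

/-- `U_ijhl`. -/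
abbrev U4 (t : Ix4 ι) : P.Y2.Opens :=
  (U t.1.1).1 ⊓ ((U t.1.2.1).1 ⊓ ((U t.1.2.2.1).1 ⊓ (U t.1.2.2.2).1))

/-- The pair `ij` of a triple `ijh`. -/
def ij (t : Ix3 ι) : Ix2 ι := ⟨(t.1.1, t.1.2.1), t.2.1⟩

/-- The pair `jh` of a triple `ijh`. -/
def jh (t : Ix3 ι) : Ix2 ι := ⟨(t.1.2.1, t.1.2.2), t.2.2⟩

/-- The pair `ih` of a triple `ijh`. -/
def ih (t : Ix3 ι) : Ix2 ι := ⟨(t.1.1, t.1.2.2), t.2.1.trans t.2.2⟩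

theorem U3_ij (t : Ix3 ι) : U3 U t ≤ U2 U (ij t) :=
  le_inf inf_le_left (inf_le_right.trans inf_le_left)
theorem U3_jh (t : Ix3 ι) : U3 U t ≤ U2 U (jh t) := inf_le_right
theorem U3_ih (t : Ix3 ι) : U3 U t ≤ U2 U (ih t) :=
  le_inf inf_le_left (inf_le_right.trans inf_le_right)

variable (F : P.Y2.Opensᵒᵖ ⥤ AddCommGrpCat.{u})

/-- Čech `0`-cochains of the covering `U` with values in `F`. -/
abbrev C0 : Type (max u v) := ∀ i : ι, F.obj (.op (U i).1)

/-- Čech `1`-cochains. -/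
abbrev C1 : Type (max u v) := ∀ p : Ix2 ι, F.obj (.op (U2 U p))

/-- Čech `2`-cochains. -/
abbrev C2 : Type (max u v) := ∀ t : Ix3 ι, F.obj (.op (U3 U t))

/-- Čech `3`-cochains. -/
abbrev C3 : Type (max u v) := ∀ t : Ix4 ι, F.obj (.op (U4 U t))

/-- `(δn)_ij = n_j - n_i`. -/
def d0 : C0 U F →+ C1 U F := AddMonoidHom.mk'
  (fun n p => restr F inf_le_right (n p.1.2) - restr F inf_le_left (n p.1.1))
  (fun a b => by funext p; simp only [Pi.add_apply, map_add]; abel)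

/-- `(δm)_ijh = m_jh - m_ih + m_ij`. -/
def d1 : C1 U F →+ C2 U F := AddMonoidHom.mk'
  (fun m t => restr F (U3_jh U t) (m (jh t)) - restr F (U3_ih U t) (m (ih t)) +
    restr F (U3_ij U t) (m (ij t)))
  (fun a b => by funext p; simp only [Pi.add_apply, map_add]; abel)

/-- `(δz)_ijhl = z_jhl - z_ihl + z_ijl - z_ijh`. -/
def d2 : C2 U F →+ C3 U F := AddMonoidHom.mk'
  (fun z t =>
    restr F (W := U3 U ⟨(t.1.2.1, t.1.2.2.1, t.1.2.2.2), t.2.2.1, t.2.2.2⟩) inf_le_right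
        (z ⟨(t.1.2.1, t.1.2.2.1, t.1.2.2.2), t.2.2.1, t.2.2.2⟩) -
      restr F (W := U3 U ⟨(t.1.1, t.1.2.2.1, t.1.2.2.2), t.2.1.trans t.2.2.1, t.2.2.2⟩)
        (inf_le_inf_left _ inf_le_right)
        (z ⟨(t.1.1, t.1.2.2.1, t.1.2.2.2), t.2.1.trans t.2.2.1, t.2.2.2⟩) +
      restr F (W := U3 U ⟨(t.1.1, t.1.2.1, t.1.2.2.2), t.2.1, t.2.2.1.trans t.2.2.2⟩)
        (inf_le_inf_left _ (inf_le_inf_left _ inf_le_right))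
        (z ⟨(t.1.1, t.1.2.1, t.1.2.2.2), t.2.1, t.2.2.1.trans t.2.2.2⟩) -
      restr F (W := U3 U ⟨(t.1.1, t.1.2.1, t.1.2.2.1), t.2.1, t.2.2.1⟩)
        (inf_le_inf_left _ (inf_le_inf_left _ inf_le_left))
        (z ⟨(t.1.1, t.1.2.1, t.1.2.2.1), t.2.1, t.2.2.1⟩))
  (fun a b => by funext p; simp only [Pi.add_apply, map_add]; abel)

/-- The second Čech cohomology group of the covering `U` with values in `F`. -/
abbrev H2 : Type (max u v) := (d2 U F).ker ⧸ (d1 U F).range.addSubgroupOf (d2 U F).ker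

/-- The class of a `2`-cocycle. -/
def H2.mk (z : C2 U F) (hz : d2 U F z = 0) : H2 U F := QuotientAddGroup.mk ⟨z, hz⟩

/-- The value on an affine open `V` of a section of `F ⊗ End(E)`. -/
def ev {F E : P.ModFam} {W : P.Y2.Opens} (m : (endSheaf F E).obj (.op W)) (V : P.Aff)
    (h : V.1 ≤ W) : E.obj V →ₗ[P.O V] F.obj V ⊗[P.O V] E.obj V :=
  Subtype.val (p := (· ∈ endOn F E W)) m ⟨V, h⟩

/-- The first component, on an affine open `V`, of a section of `ℰnd^{0,2}_{ab}`. -/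
def evAb1 {E : P.ModFam} {W : P.Y2.Opens} (x : (endAb E).obj (.op W)) (V : P.Aff) (h : V.1 ≤ W) :
    E.obj V →ₗ[P.O V] P.con.obj V ⊗[P.O V] E.obj V :=
  (Subtype.val (p := (· ∈ endAbOn E W)) x).1.1 ⟨V, h⟩

/-- The second component, on an affine open `V`, of a section of `ℰnd^{0,2}_{ab}`. -/
def evAb2 {E : P.ModFam} {W : P.Y2.Opens} (x : (endAb E).obj (.op W)) (V : P.Aff) (h : V.1 ≤ W) :
    P.R V :=
  (P.Y2.presheaf.map (homOfLE h).op).hom (Subtype.val (p := (· ∈ endAbOn E W)) x).2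

end Cech

variable {P}

/-- The choices underlying the Čech description: an affine open covering, on each member `U_i` an
isomorphism `Φ_i : 𝒪⁽²⁾ ≅ Sym^{≤ 2} N^*` as in `AlgTriv`, and a connection on `E`. -/
structure CechData (E : P.ModFam) (ι : Type v) [LinearOrder ι] where
  U : ι → P.Aff
  cover : ⨆ i, (U i).1 = ⊤
  Φ : ∀ i, P.AlgTriv (U i).1
  conn : ∀ i, P.Connection E (U i).1

namespace CechData

variable {E : P.ModFam} {ι : Type v} [LinearOrder ι] (C : CechData E ι)

/-- The connection `∇_i` over an affine open `V ≤ U_i`. -/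
def nab (i : ι) (V : P.Aff) (h : V.1 ≤ (C.U i).1) : E.obj V →+ Ω[P.O V⁄κ] ⊗[P.O V] E.obj V :=
  (C.conn i).app ⟨V, h⟩

theorem nab_leibniz (i : ι) (V : P.Aff) (h : V.1 ≤ (C.U i).1) : IsConn κ (C.nab i V h) :=
  (C.conn i).leibniz _

/-- The Atiyah cocycle `At(E)_jh = ∇_j - ∇_h`, over `U_ijh`. -/
def atiyah (t : Ix3 ι) (V : P.Aff) (h : V.1 ≤ U3 C.U t) :
    E.obj V →ₗ[P.O V] Ω[P.O V⁄κ] ⊗[P.O V] E.obj V :=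
  connDiff (C.nab t.1.2.1 V (h.trans (inf_le_right.trans inf_le_left)))
    (C.nab t.1.2.2 V (h.trans (inf_le_right.trans inf_le_right)))
    (C.nab_leibniz _ _ _) (C.nab_leibniz _ _ _)

variable [CharZero κ]

/-- `φ_ij = log (Φ_i Φ_j⁻¹)`. -/
def phi (p : Ix2 ι) (V : P.Aff) (h : V.1 ≤ U2 C.U p) : FiltDer κ (P.O V) (P.con.obj V) :=
  (C.Φ p.1.1).log (C.Φ p.1.2) V (h.trans inf_le_left) (h.trans inf_le_right)

/-- `a¹_ij At(E)_jh`. -/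
def a1At (t : Ix3 ι) (V : P.Aff) (h : V.1 ≤ U3 C.U t) :
    E.obj V →ₗ[P.O V] P.con.obj V ⊗[P.O V] E.obj V :=
  (LinearMap.rTensor _ (C.phi (ij t) V (h.trans (U3_ij C.U t))).a1).comp (C.atiyah t V h)

/-- `a²_ij At(E)_jh`. -/
def a2At (t : Ix3 ι) (V : P.Aff) (h : V.1 ≤ U3 C.U t) :
    E.obj V →ₗ[P.O V] P.con2.obj V ⊗[P.O V] E.obj V :=
  (LinearMap.rTensor _ (C.phi (ij t) V (h.trans (U3_ij C.U t))).a2).comp (C.atiyah t V h)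

/-- The commutator `[sφ¹_ij, m] : E → Sym² N^* ⊗ E`, where `sφ¹_ij` is the Leibniz extension of
`a¹_ij ∇_j`. -/
def brs (p : Ix2 ι) (V : P.Aff) (h : V.1 ≤ U2 C.U p)
    (m : E.obj V →ₗ[P.O V] P.con.obj V ⊗[P.O V] E.obj V) :
    E.obj V →+ P.con2.obj V ⊗[P.O V] E.obj V :=
  (C.phi p V h).br (C.nab p.1.2 V (h.trans inf_le_right)) (C.nab_leibniz _ _ _) m

/-- The operator
`a²_ij At(E)_jh + ½ [m_ij, m_jh] + ½ [sφ¹_ij, m_jh] - ½ [sφ¹_jh, m_ij + a¹_ij At(E)_jh]`,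
where `sφ¹_ij` is formed with `∇_j` and `sφ¹_jh` with `∇_h`. -/
def obs2 (m : C1 C.U (endSheaf P.con E)) (t : Ix3 ι) (V : P.Aff) (h : V.1 ≤ U3 C.U t)
    (e : E.obj V) : P.con2.obj V ⊗[P.O V] E.obj V :=
  have hij := h.trans (U3_ij C.U t)
  have hjh := h.trans (U3_jh C.U t)
  C.a2At t V h e +
    half κ (P.O V) • brLin (ev (m (ij t)) V hij) (ev (m (jh t)) V hjh) e +
    half κ (P.O V) • C.brs (ij t) V hij (ev (m (jh t)) V hjh) e -
    half κ (P.O V) • C.brs (jh t) V hjh (ev (m (ij t)) V hij + C.a1At t V h) e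

/-- The local section of `𝒪⁽²⁾` that is the second component of the element
`(a¹_ij At(E)_jh, a²_ij Tr At(E)_jh)` of `ℰnd^{0,2}_{ab}`: the section `g` that the isomorphism
`exp(-φ_ij/2) ∘ Φ_i = exp(φ_ij/2) ∘ Φ_j`, midway between `Φ_i` and `Φ_j`, sends to
`(0, a¹_ij Tr At(E)_jh, a²_ij Tr At(E)_jh)`. Thus `Φ_i g` is the image of this element under
`exp(φ_ij/2)`. -/
def trObs (t : Ix3 ι) (V : P.Aff) (h : V.1 ≤ U3 C.U t) : P.R V :=
  let φ := C.phi (ij t) V (h.trans (U3_ij C.U t))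
  let τ : Ω[P.O V⁄κ] := trc _ (C.atiyah t V h)
  ((C.Φ t.1.1).app ⟨V, h.trans inf_le_left⟩).symm
    ⟨0, φ.a1 τ, φ.a2 τ + half κ (P.O V) • φ.L1 (φ.a1 τ)⟩

/-- The operator `M¹_ij = a¹_ij ∇_j + m¹_ij : E → N^* ⊗ E`. -/
def M1 (m : C1 C.U (endSheaf P.con E)) (p : Ix2 ι) (V : P.Aff) (h : V.1 ≤ U2 C.U p) :
    E.obj V →+ P.con.obj V ⊗[P.O V] E.obj V :=
  (C.phi p V h).s1 (C.nab p.1.2 V (h.trans inf_le_right)) + (ev (m p) V h).toAddMonoidHom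

/-- The Leibniz extension `N^* ⊗ E → Sym² N^* ⊗ E` of `M¹_ij`. -/
def M1ext (m : C1 C.U (endSheaf P.con E)) (p : Ix2 ι) (V : P.Aff) (h : V.1 ≤ U2 C.U p) :
    P.con.obj V ⊗[P.O V] E.obj V →+ P.con2.obj V ⊗[P.O V] E.obj V :=
  (C.phi p V h).s1ext (C.nab p.1.2 V (h.trans inf_le_right)) (C.nab_leibniz _ _ _) +
    (extLin (ev (m p) V h)).toAddMonoidHom

/-- The operator `M²_ij = a²_ij ∇_j + m²_ij : E → Sym² N^* ⊗ E`. -/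
def M2 (m : C1 C.U (endSheaf P.con2 E)) (p : Ix2 ι) (V : P.Aff) (h : V.1 ≤ U2 C.U p) :
    E.obj V →+ P.con2.obj V ⊗[P.O V] E.obj V :=
  (C.phi p V h).s2 (C.nab p.1.2 V (h.trans inf_le_right)) + (ev (m p) V h).toAddMonoidHom

end CechData

/-! #### Extensions of `E` -/

/-- `(E1, ρ)` is an extension of `E` to a vector bundle on `Y⁽¹⁾`. -/
def IsExt1 {E : P.X.Modules} {E1 : P.Y1.Modules}
    (ρ : E1 ⟶ (Scheme.Modules.pushforward P.j01).obj E) : Prop :=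
  IsVectorBundle E1 ∧ IsReduction P.j01 ρ

/-- `(E2, ρ)` is an extension of `E1` to a vector bundle on `Y⁽²⁾`. -/
def IsExt12 {E1 : P.Y1.Modules} {E2 : P.Y2.Modules}
    (ρ : E2 ⟶ (Scheme.Modules.pushforward P.j12).obj E1) : Prop :=
  IsVectorBundle E2 ∧ IsReduction P.j12 ρ

/-- `(E2, ρ)` is an extension of `E` to a vector bundle on `Y⁽²⁾`. -/
def IsExt2 {E : P.X.Modules} {E2 : P.Y2.Modules}
    (ρ : E2 ⟶ (Scheme.Modules.pushforward P.j02).obj E) : Prop :=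
  IsVectorBundle E2 ∧ IsReduction P.j02 ρ

/-- The reduction map `E1(V) → E(V)`. -/
def red1 {E : P.X.Modules} {E1 : P.Y1.Modules}
    (ρ : E1 ⟶ (Scheme.Modules.pushforward P.j01).obj E) (V : P.Aff) :
    Γ(E1, P.j12 ⁻¹ᵁ V.1) →+ (ofModules E).obj V :=
  secMap P.j01 ρ (P.j12 ⁻¹ᵁ V.1)

/-- The reduction map `E2(V) → E1(V)`. -/
def red12 {E1 : P.Y1.Modules} {E2 : P.Y2.Modules}
    (ρ : E2 ⟶ (Scheme.Modules.pushforward P.j12).obj E1) (V : P.Aff) :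
    Γ(E2, V.1) →+ Γ(E1, P.j12 ⁻¹ᵁ V.1) :=
  secMap P.j12 ρ V.1

/-- An isomorphism `Ψ : E1|_W ≅ (𝒪_X ⊕ N^*) ⊗ E|_W` of filtered sheaves, compatible with the module
structures via `Φ`, which is the identity on the associated graded sheaves. -/
structure Triv1 {W : P.Y2.Opens} (Φ : P.AlgTriv W) {E : P.X.Modules} {E1 : P.Y1.Modules}
    (ρ : E1 ⟶ (Scheme.Modules.pushforward P.j01).obj E) where
  app : ∀ V : P.AffIn W, Γ(E1, P.j12 ⁻¹ᵁ V.1.1) ≃+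
    (ofModules E).obj V.1 × (P.con.obj V.1 ⊗[P.O V.1] (ofModules E).obj V.1)
  gr0 : ∀ V s, (app V s).1 = red1 ρ V.1 s
  smul : ∀ (V : P.AffIn W) (r : P.R V.1) (s : Γ(E1, P.j12 ⁻¹ᵁ V.1.1)),
    app V (smulSec E1 (P.j12 ⁻¹ᵁ V.1.1) ((P.j12.app V.1.1).hom r) s) =
      (Φ.app V r).act1 (app V s)
  nat : ∀ (V V' : P.AffIn W) (h : V'.1 ≤ V.1) s,
    app V' ((E1.presheaf.map (homOfLE (P.j12.preimage_mono h)).op).hom s) =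
      ((ofModules E).res h (app V s).1, resTensor P.con (ofModules E) h (app V s).2)

/-- An isomorphism `E2|_W ≅ Sym^{≤ 2} N^* ⊗ E|_W` of filtered sheaves, compatible with the module
structures via `Φ`, which lifts a given isomorphism `Ψ : E1|_W ≅ (𝒪_X ⊕ N^*) ⊗ E|_W`. -/
structure Triv2 {W : P.Y2.Opens} {Φ : P.AlgTriv W} {E : P.X.Modules} {E1 : P.Y1.Modules}
    {ρ1 : E1 ⟶ (Scheme.Modules.pushforward P.j01).obj E} (Ψ : Triv1 Φ ρ1) {E2 : P.Y2.Modules}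
    (ρ : E2 ⟶ (Scheme.Modules.pushforward P.j12).obj E1) where
  app : ∀ V : P.AffIn W, Γ(E2, V.1.1) ≃+
    (ofModules E).obj V.1 × (P.con.obj V.1 ⊗[P.O V.1] (ofModules E).obj V.1) ×
      (P.con2.obj V.1 ⊗[P.O V.1] (ofModules E).obj V.1)
  lift : ∀ V s, ((app V s).1, (app V s).2.1) = Ψ.app V (red12 ρ V.1 s)
  smul : ∀ (V : P.AffIn W) (r : P.R V.1) (s : Γ(E2, V.1.1)),
    app V (smulSec E2 V.1.1 r s) = (Φ.app V r).act2 (app V s)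
  nat : ∀ (V V' : P.AffIn W) (h : V'.1 ≤ V.1) s,
    app V' ((E2.presheaf.map (homOfLE h).op).hom s) =
      ((ofModules E).res h (app V s).1, resTensor P.con (ofModules E) h (app V s).2.1,
        resTensor P.con2 (ofModules E) h (app V s).2.2)

namespace CechData

variable [CharZero κ] {E : P.X.Modules} {ι : Type v} [LinearOrder ι]
  (C : CechData (ofModules E) ι)

/-- `Ψ_i Ψ_j⁻¹ = exp(ψ_ij)` on `(𝒪_X ⊕ N^*) ⊗ E`, where `ψ_ij` is the derivation given by `φ_ij` and
`M¹_ij = a¹_ij ∇_j + m¹_ij`. -/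
def IsGluing1 {E1 : P.Y1.Modules} {ρ : E1 ⟶ (Scheme.Modules.pushforward P.j01).obj E}
    (Ψ : ∀ i, Triv1 (C.Φ i) ρ) (m : C1 C.U (endSheaf P.con (ofModules E))) : Prop :=
  ∀ (p : Ix2 ι) (V : P.Aff) (h : V.1 ≤ U2 C.U p) (s : Γ(E1, P.j12 ⁻¹ᵁ V.1)),
    let x := (Ψ p.1.2).app ⟨V, h.trans inf_le_right⟩ s
    (Ψ p.1.1).app ⟨V, h.trans inf_le_left⟩ s = (x.1, x.2 + C.M1 m p V h x.1)

/-- `Ψ_i Ψ_j⁻¹ = exp(ψ_ij)` on `Sym^{≤ 2} N^* ⊗ E`, where `ψ_ij` is the derivation given by `φ_ij`,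
`M¹_ij = a¹_ij ∇_j + m¹_ij` and `M²_ij = a²_ij ∇_j + m²_ij`. -/
def IsGluing2 {E1 : P.Y1.Modules} {ρ1 : E1 ⟶ (Scheme.Modules.pushforward P.j01).obj E}
    {Ψ1 : ∀ i, Triv1 (C.Φ i) ρ1} {E2 : P.Y2.Modules}
    {ρ : E2 ⟶ (Scheme.Modules.pushforward P.j12).obj E1} (Ψ : ∀ i, Triv2 (Ψ1 i) ρ)
    (m1 : C1 C.U (endSheaf P.con (ofModules E)))
    (m2 : C1 C.U (endSheaf P.con2 (ofModules E))) : Prop :=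
  ∀ (p : Ix2 ι) (V : P.Aff) (h : V.1 ≤ U2 C.U p) (s : Γ(E2, V.1)),
    let x := (Ψ p.1.2).app ⟨V, h.trans inf_le_right⟩ s
    (Ψ p.1.1).app ⟨V, h.trans inf_le_left⟩ s =
      (x.1, x.2.1 + C.M1 m1 p V h x.1,
        x.2.2 + C.M2 m2 p V h x.1 + C.M1ext m1 p V h x.2.1 +
          half κ (P.O V) • C.M1ext m1 p V h (C.M1 m1 p V h x.1))

end CechData

/-- Isomorphism of extensions: an isomorphism compatible with the reduction maps. -/
def ExtIso {S' S : Scheme.{u}} (j : S' ⟶ S) {M' : S'.Modules} {M N : S.Modules}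
    (ρ : M ⟶ (Scheme.Modules.pushforward j).obj M')
    (σ : N ⟶ (Scheme.Modules.pushforward j).obj M') : Prop :=
  ∃ f : M ≅ N, f.hom ≫ σ = ρ

end SmoothPair

end CechExt
end

open CechExt CechExt.SmoothPair

/-!
An extension of `E` to a neighbourhood `Y⁽ᵏ⁾` is locally trivial in the filtered sense: over a
member `U_i` of the covering it becomes isomorphic, through `Φ_i`, to the *model*
`Sym^{≤ k} N^* ⊗ E`. The whole statement is therefore about the transition maps between the copies
of the model.

**Transition maps and obstructions.** A transition map over `U_i ∩ U_j` is semilinear over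
`Φ_i Φ_j⁻¹ = exp φ_ij` and is the identity on the associated graded. The exponential of an operator
satisfying the Leibniz rule over `φ_ij` is semilinear in this sense (`exp1_act`, `exp2_act`), so the
lifts `a¹∇`, `a²∇` of `φ_ij` by a connection give one system of transition maps (`transition1`,
`transition2`). Two systems that agree below the top degree differ by a cochain of linear maps from
`E` to the top degree (`FilMod.exists_linear`, `Transition.existsUnique_twist`). For the same reason
the failure of a system to be a cocycle is a 2-cochain `z` of linear maps, which is closed by
associativity (`IsDefect.d2_eq_zero`), and twisting by `m` replaces `z` by `z + δm`
(`IsDefect.twist_isCocycle_iff`): the twisted system is a cocycle exactly when `-δm = z`.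

In the first order `z` is `a¹At(E)`, since `φ¹` is additive (`exists_isDefect1`). In the second
order the product of two exponentials contains half the commutator of the linear terms (`exp2_comp`).
Flatness of the connections says that the commutator of two lifted derivations is the lift of their
commutator, so this part is absorbed by `a²∇` (`s2_of_exp_comp`), and the remaining terms are the
stated cocycle `o` (`obstruction_formula`, `exists_isDefect2`).

**From cochains to bundles and back.** The models over `Y⁽¹⁾` and `Y⁽²⁾` are treated together, as
`Model`s with a `Frame` (the neighbourhood) and a `Target` (the sheaf to be extended). An extension is
isomorphic to the model over each `U_i` because a vector bundle on an affine scheme is projective, so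
that its dual basis can be lifted along a nilpotent ideal (`nonempty_framing`). Conversely, models are
glued along any cocycle of transition maps (`exists_isGluing`), and isomorphisms of extensions are
`0`-cochains `1 + n`, which change `m` by `δn` (`extIso_iff`). This gives the first two parts
(`classification1`, `classification2`).

**Traces.** An extension of `E` to `Y⁽²⁾` yields `m¹` and `m²` with `-δm¹ = a¹At(E)` and `-δm² = o`
(`exists_isCocycle2`). In `Tr o` the commutator of linear maps disappears, and the commutator with the
lift of a derivation becomes the derivative of the trace (`IsDualBasis.sum_contr_br`). Hence the pair
consisting of `-m¹` and of the function that `exp(-φ_ij / 2) ∘ Φ_i` maps to `-(Tr m¹ + Tr m²)` is a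
1-cochain of `ℰnd^{0,2}_{ab}` with the stated coboundary (`trace_identity`, `exists_abCoboundary`).
-/


noncomputable section

namespace CechExt

/-! ### Sheaves of modules and bases of the topology -/

section Basis

/-- The open sets `o b` form a basis of the topology. -/
def IsOpensBasis {X : TopCat.{u}} {B : Type*} (o : B → TopologicalSpace.Opens X) : Prop :=
  ∀ (W : TopologicalSpace.Opens X) (x : X), x ∈ W → ∃ b, x ∈ o b ∧ o b ≤ W

/-- Gluing of sections that are given on a sieve of basic open sets. -/
theorem exists_glue_of_isOpensBasis {C : Type (u+1)} [Category.{u} C] {FC : C → C → Type u}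
    {CC : C → Type u} [∀ X Y, FunLike (FC X Y) (CC X) (CC Y)] [ConcreteCategory.{u} C FC]
    [Limits.HasLimits C] [(forget C).ReflectsIsomorphisms]
    [Limits.PreservesLimits (forget C)]
    {X : TopCat.{u}} (F : TopCat.Sheaf C X) {B : Type*} {o : B → TopologicalSpace.Opens X}
    (hB : IsOpensBasis o) (W : TopologicalSpace.Opens X) (p : B → Prop)
    (hp : ∀ b b', p b → o b' ≤ o b → p b') (hle : ∀ b, p b → o b ≤ W)
    (hcov : ∀ x ∈ W, ∃ b, p b ∧ x ∈ o b)
    (s : ∀ b, p b → ToType (F.1.obj (.op (o b))))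
    (hs : ∀ b b' (hb : p b) (hb' : p b') (h : o b' ≤ o b),
      F.1.map (homOfLE h).op (s b hb) = s b' hb') :
    ∃ t : ToType (F.1.obj (.op W)), ∀ b hb, F.1.map (homOfLE (hle b hb)).op t = s b hb := by
  obtain ⟨t, ht, -⟩ := F.existsUnique_gluing' (fun b : {b // p b} => o b.1) W
    (fun b => homOfLE (hle b.1 b.2))
    (fun x hx => by
      obtain ⟨b, hb, hxb⟩ := hcov x hx
      exact TopologicalSpace.Opens.mem_iSup.2 ⟨⟨b, hb⟩, hxb⟩)
    (fun b => s b.1 b.2) (by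
      rintro ⟨b, hb⟩ ⟨b', hb'⟩
      refine F.eq_of_locally_eq' (fun c : {c // o c ≤ o b ⊓ o b'} => o c.1) _
        (fun c => homOfLE c.2) (fun x hx => ?_) _ _ ?_
      · obtain ⟨c, hxc, hc⟩ := hB _ x hx
        exact TopologicalSpace.Opens.mem_iSup.2 ⟨⟨c, hc⟩, hxc⟩
      · rintro ⟨c, hc⟩
        have hpc := hp b c hb (hc.trans inf_le_left)
        rw [← ConcreteCategory.comp_apply, ← F.1.map_comp, ← ConcreteCategory.comp_apply,
          ← F.1.map_comp]
        exact (hs b c hb hpc (hc.trans inf_le_left)).trans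
          (hs b' c hb' hpc (hc.trans inf_le_right)).symm)
  exact ⟨t, fun b hb => ht ⟨b, hb⟩⟩

variable {S : Scheme.{u}}

/-- Restriction of functions. -/
def funRes (S : Scheme.{u}) {W W' : S.Opens} (h : W' ≤ W) : Γ(S, W) →+* Γ(S, W') :=
  (S.presheaf.map (homOfLE h).op).hom

/-- Restriction of sections of a sheaf of modules. -/
def secRes (M : S.Modules) {W W' : S.Opens} (h : W' ≤ W) : Γ(M, W) →+ Γ(M, W') :=
  (M.presheaf.map (homOfLE h).op).hom

theorem funRes_self (W : S.Opens) (x : Γ(S, W)) : funRes S le_rfl x = x :=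
  congrArg (fun f => f.hom x) (S.presheaf.map_id (.op W))

theorem funRes_funRes {W W' W'' : S.Opens} (h : W' ≤ W) (h' : W'' ≤ W') (x : Γ(S, W)) :
    funRes S h' (funRes S h x) = funRes S (h'.trans h) x :=
  (congrArg (fun f => f.hom x) (S.presheaf.map_comp (homOfLE h).op (homOfLE h').op)).symm

variable (M : S.Modules)

theorem secRes_self (W : S.Opens) (x : Γ(M, W)) : secRes M le_rfl x = x :=
  congrArg (fun f => f.hom x) (M.presheaf.map_id (.op W))

theorem secRes_secRes {W W' W'' : S.Opens} (h : W' ≤ W) (h' : W'' ≤ W') (x : Γ(M, W)) :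
    secRes M h' (secRes M h x) = secRes M (h'.trans h) x :=
  (congrArg (fun f => f.hom x) (M.presheaf.map_comp (homOfLE h).op (homOfLE h').op)).symm

theorem secRes_smul {W W' : S.Opens} (h : W' ≤ W) (r : Γ(S, W)) (x : Γ(M, W)) :
    secRes M h (r • x) = funRes S h r • secRes M h x :=
  Scheme.Modules.map_smul M (homOfLE h) r x

variable {M} in
theorem hom_app_secRes {N : S.Modules} (f : M ⟶ N) {W W' : S.Opens} (h : W' ≤ W) (x : Γ(M, W)) :
    (f.app W').hom (secRes M h x) = secRes N h ((f.app W).hom x) :=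
  congrArg (fun f => f.hom x) (f.mapPresheaf.naturality (homOfLE h).op)

theorem eq_of_locally_eq {W : S.Opens} (s t : Γ(M, W))
    (h : ∀ x ∈ W, ∃ (W' : S.Opens) (h : W' ≤ W), x ∈ W' ∧ secRes M h s = secRes M h t) :
    s = t := by
  refine TopCat.Sheaf.eq_of_locally_eq' ⟨M.presheaf, M.isSheaf⟩
    (fun c : {c : S.Opens // ∃ h : c ≤ W, secRes M h s = secRes M h t} => c.1) W
    (fun c => homOfLE c.2.1) (fun x hx => ?_) _ _ (fun c => c.2.2)
  obtain ⟨c, hc, hxc, e⟩ := h x hx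
  exact TopologicalSpace.Opens.mem_iSup.2 ⟨⟨c, hc, e⟩, hxc⟩

theorem fun_eq_of_locally_eq {W : S.Opens} (s t : Γ(S, W))
    (h : ∀ x ∈ W, ∃ (W' : S.Opens) (h : W' ≤ W), x ∈ W' ∧ funRes S h s = funRes S h t) :
    s = t := by
  refine TopCat.Sheaf.eq_of_locally_eq' S.sheaf
    (fun c : {c : S.Opens // ∃ h : c ≤ W, funRes S h s = funRes S h t} => c.1) W
    (fun c => homOfLE c.2.1) (fun x hx => ?_) _ _ (fun c => c.2.2)
  obtain ⟨c, hc, hxc, e⟩ := h x hx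
  exact TopologicalSpace.Opens.mem_iSup.2 ⟨⟨c, hc, e⟩, hxc⟩

theorem exists_glue {B : Type*} {o : B → S.Opens} (hB : IsOpensBasis o) (W : S.Opens)
    (p : B → Prop) (hp : ∀ b b', p b → o b' ≤ o b → p b') (hle : ∀ b, p b → o b ≤ W)
    (hcov : ∀ x ∈ W, ∃ b, p b ∧ x ∈ o b) (s : ∀ b, p b → Γ(M, o b))
    (hs : ∀ b b' (hb : p b) (hb' : p b') (h : o b' ≤ o b), secRes M h (s b hb) = s b' hb') :
    ∃ t : Γ(M, W), ∀ b hb, secRes M (hle b hb) t = s b hb :=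
  exists_glue_of_isOpensBasis ⟨M.presheaf, M.isSheaf⟩ hB W p hp hle hcov s hs

theorem fun_exists_glue {B : Type*} {o : B → S.Opens} (hB : IsOpensBasis o) (W : S.Opens)
    (p : B → Prop) (hp : ∀ b b', p b → o b' ≤ o b → p b') (hle : ∀ b, p b → o b ≤ W)
    (hcov : ∀ x ∈ W, ∃ b, p b ∧ x ∈ o b) (s : ∀ b, p b → Γ(S, o b))
    (hs : ∀ b b' (hb : p b) (hb' : p b') (h : o b' ≤ o b), funRes S h (s b hb) = s b' hb') :
    ∃ t : Γ(S, W), ∀ b hb, funRes S (hle b hb) t = s b hb :=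
  exists_glue_of_isOpensBasis S.sheaf hB W p hp hle hcov s hs

/-- A morphism of sheaves of modules can be prescribed on a basis of the topology. -/
theorem exists_hom_of_basis {M N : S.Modules} {B : Type*} {o : B → S.Opens}
    (hB : IsOpensBasis o) (f : ∀ b, Γ(M, o b) →+ Γ(N, o b))
    (hsmul : ∀ b (r : Γ(S, o b)) (x : Γ(M, o b)), f b (r • x) = r • f b x)
    (hnat : ∀ b b' (h : o b' ≤ o b) (x : Γ(M, o b)), f b' (secRes M h x) = secRes N h (f b x)) :
    ∃ F : M ⟶ N, ∀ b (x : Γ(M, o b)), (F.app (o b)).hom x = f b x := by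
  have key : ∀ (W : S.Opens) (x : Γ(M, W)), ∃ y : Γ(N, W), ∀ b (h : o b ≤ W),
      secRes N h y = f b (secRes M h x) := fun W x =>
    exists_glue N hB W (fun b => o b ≤ W) (fun b b' hb h => h.trans hb) (fun _ h => h)
      (fun x hx => let ⟨b, h, h'⟩ := hB W x hx; ⟨b, h', h⟩) (fun b h => f b (secRes M h x))
      (fun b b' hb hb' h => by rw [← hnat, secRes_secRes])
  choose g hg using key
  have uniq : ∀ (W : S.Opens) (y y' : Γ(N, W)),
      (∀ b (h : o b ≤ W), secRes N h y = secRes N h y') → y = y' := fun W y y' h =>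
    eq_of_locally_eq N y y' fun x hx => let ⟨b, hxb, hb⟩ := hB W x hx; ⟨o b, hb, hxb, h b hb⟩
  have gadd : ∀ W x x', g W (x + x') = g W x + g W x' := fun W x x' => uniq W _ _ fun b h => by
    simp only [map_add, hg]
  have gsmul : ∀ W (r : Γ(S, W)) x, g W (r • x) = r • g W x := fun W r x => uniq W _ _ fun b h => by
    simp only [secRes_smul, hg, hsmul]
  have gnat : ∀ (W W' : S.Opens) (h : W' ≤ W) x, g W' (secRes M h x) = secRes N h (g W x) :=
    fun W W' h x => uniq _ _ _ fun b hb => by rw [hg, secRes_secRes, secRes_secRes, hg]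
  let φ : M.val.presheaf ⟶ N.val.presheaf :=
    { app := fun W => AddCommGrpCat.ofHom (AddMonoidHom.mk' (g W.unop) (gadd W.unop))
      naturality := fun W W' i => by
        ext x
        exact gnat W.unop W'.unop i.unop.le x }
  refine ⟨⟨PresheafOfModules.homMk φ fun W r x => gsmul W.unop r x⟩, fun b x => ?_⟩
  have := hg (o b) x b le_rfl
  rw [secRes_self, secRes_self] at this
  exact this

theorem hom_ext_of_basis {M N : S.Modules} {B : Type*} {o : B → S.Opens} (hB : IsOpensBasis o)
    {f g : M ⟶ N} (h : ∀ b (x : Γ(M, o b)), (f.app (o b)).hom x = (g.app (o b)).hom x) :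
    f = g := by
  refine Scheme.Modules.hom_ext _ _ fun W => ?_
  ext x
  refine eq_of_locally_eq N _ _ fun y hy => ?_
  obtain ⟨b, hyb, hb⟩ := hB W y hy
  refine ⟨o b, hb, hyb, ?_⟩
  exact (hom_app_secRes f hb x).symm.trans ((h b _).trans (hom_app_secRes g hb x))

end Basis
end CechExt

namespace CechExt

/-! ### Sheaves of modules from their sections on a basis -/

/-- A sheaf of modules on a basis of the topology. The sheaf condition is imposed for sieves of
basic open sets that cover a basic open set. -/
structure BasisModule (S : Scheme.{u}) where
  B : Type u
  o : B → S.Opens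
  isBasis : IsOpensBasis o
  G : B → Type u
  [grp : ∀ b, AddCommGroup (G b)]
  [mod : ∀ b, Module Γ(S, o b) (G b)]
  res : ∀ {b b'}, o b' ≤ o b → G b →+ G b'
  res_smul : ∀ {b b'} (h : o b' ≤ o b) (r : Γ(S, o b)) (x : G b),
    res h (r • x) = funRes S h r • res h x
  res_self : ∀ b (x : G b), res le_rfl x = x
  res_res : ∀ {b b' b''} (h : o b' ≤ o b) (h' : o b'' ≤ o b') (x : G b),
    res h' (res h x) = res (h'.trans h) x
  sep : ∀ b (x : G b), (∀ y ∈ o b, ∃ b', ∃ h : o b' ≤ o b, y ∈ o b' ∧ res h x = 0) → x = 0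
  glue : ∀ b (p : B → Prop), (∀ b b', p b → o b' ≤ o b → p b') → ∀ hle : ∀ b', p b' → o b' ≤ o b,
    (∀ y ∈ o b, ∃ b', p b' ∧ y ∈ o b') → ∀ s : ∀ b', p b' → G b',
    (∀ b b' (hb : p b) (hb' : p b') (h : o b' ≤ o b), res h (s b hb) = s b' hb') →
    ∃ t : G b, ∀ b' hb', res (hle b' hb') t = s b' hb'

attribute [instance] BasisModule.grp BasisModule.mod

namespace BasisModule

variable {S : Scheme.{u}} (D : BasisModule S)

/-- The sections over an open set `W`: compatible families of sections over the basic open sets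
contained in `W`. -/
def sections (W : S.Opens) : AddSubgroup (∀ b : {b // D.o b ≤ W}, D.G b.1) where
  carrier := {s | ∀ (b b' : {b // D.o b ≤ W}) (h : D.o b'.1 ≤ D.o b.1), D.res h (s b) = s b'}
  zero_mem' := fun b b' h => map_zero _
  add_mem' := fun {x y} hx hy b b' h => by
    rw [Pi.add_apply, Pi.add_apply, map_add, hx, hy]
  neg_mem' := fun {x} hx b b' h => by rw [Pi.neg_apply, Pi.neg_apply, map_neg, hx]

instance (W : S.Opens) : Module Γ(S, W) (D.sections W) where
  smul r s := ⟨fun b => funRes S b.2 r • s.1 b, fun b b' h => by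
    rw [D.res_smul, funRes_funRes, s.2 b b' h]⟩
  one_smul s := Subtype.ext (funext fun b => by
    change funRes S b.2 1 • s.1 b = _; rw [map_one, one_smul])
  mul_smul r r' s := Subtype.ext (funext fun b => by
    change funRes S b.2 (r * r') • s.1 b = funRes S b.2 r • funRes S b.2 r' • s.1 b
    rw [map_mul, mul_smul])
  smul_zero r := Subtype.ext (funext fun b => smul_zero _)
  smul_add r s s' := Subtype.ext (funext fun b => smul_add _ _ _)
  add_smul r r' s := Subtype.ext (funext fun b => by
    change funRes S b.2 (r + r') • s.1 b = funRes S b.2 r • s.1 b + funRes S b.2 r' • s.1 b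
    rw [map_add, add_smul])
  zero_smul s := Subtype.ext (funext fun b => by
    change funRes S b.2 0 • s.1 b = 0; rw [map_zero, zero_smul])

/-- Restriction of sections. -/
def sectionsRes {W W' : S.Opens} (h : W' ≤ W) : D.sections W →+ D.sections W' :=
  AddMonoidHom.mk' (fun s => ⟨fun b => s.1 ⟨b.1, b.2.trans h⟩,
    fun b b' hb => s.2 ⟨b.1, b.2.trans h⟩ ⟨b'.1, b'.2.trans h⟩ hb⟩)
    (fun _ _ => rfl)

/-- The underlying presheaf of abelian groups. -/
def presheafAb : S.Opensᵒᵖ ⥤ AddCommGrpCat.{u} where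
  obj W := AddCommGrpCat.of (D.sections W.unop)
  map i := AddCommGrpCat.ofHom (D.sectionsRes i.unop.le)
  map_id _ := rfl
  map_comp _ _ := rfl

instance (W : S.Opensᵒᵖ) : Module (S.ringCatSheaf.obj.obj W) (D.presheafAb.obj W) :=
  inferInstanceAs (Module Γ(S, W.unop) (D.sections W.unop))

/-- The underlying presheaf of modules. -/
def presheaf : PresheafOfModules S.ringCatSheaf.obj :=
  PresheafOfModules.ofPresheaf D.presheafAb fun {W W'} i r s => by
    refine Subtype.ext (funext fun b => ?_)
    exact congrArg (fun t => t • s.1 ⟨b.1, b.2.trans i.unop.le⟩)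
      (funRes_funRes i.unop.le b.2 r).symm

/-- The sections are given by the values on the members of the basis, so that gluing is checked
there: a value over `o b` is glued from its values on the members of the basis inside `o b` and
inside some member of the cover. -/
theorem isSheaf : TopCat.Presheaf.IsSheaf (X := S.toTopCat) D.presheafAb := by
  rw [TopCat.Presheaf.isSheaf_iff_isSheafUniqueGluing]
  intro ι U sf hsf
  have compat : ∀ (i j : ι) (b) (h : D.o b ≤ U i) (h' : D.o b ≤ U j),
      (sf i).1 ⟨b, h⟩ = (sf j).1 ⟨b, h'⟩ := fun i j b h h' =>
    congrFun (congrArg Subtype.val (hsf i j)) ⟨b, le_inf h h'⟩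
  have key : ∀ b : {b // D.o b ≤ iSup U}, ∃ t : D.G b.1, ∀ b' (i : ι) (h : D.o b' ≤ D.o b.1)
      (h' : D.o b' ≤ U i), D.res h t = (sf i).1 ⟨b', h'⟩ := by
    rintro ⟨b, hb⟩
    obtain ⟨t, ht⟩ := D.glue b (fun b' => D.o b' ≤ D.o b ∧ ∃ i, D.o b' ≤ U i)
      (fun b' b'' h h' => ⟨h'.trans h.1, h.2.imp fun i hi => h'.trans hi⟩) (fun _ h => h.1)
      (fun y hy => by
        obtain ⟨i, hi⟩ := TopologicalSpace.Opens.mem_iSup.1 (hb hy)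
        obtain ⟨b', hyb', hb'⟩ := D.isBasis (D.o b ⊓ U i) y ⟨hy, hi⟩
        exact ⟨b', ⟨hb'.trans inf_le_left, i, hb'.trans inf_le_right⟩, hyb'⟩)
      (fun b' h => (sf h.2.choose).1 ⟨b', h.2.choose_spec⟩)
      (fun b' b'' h h' hle => ((sf h.2.choose).2 ⟨b', h.2.choose_spec⟩
        ⟨b'', hle.trans h.2.choose_spec⟩ hle).trans (compat _ _ _ _ _))
    exact ⟨t, fun b' i h h' => (ht b' ⟨h, i, h'⟩).trans (compat _ _ _ _ _)⟩
  choose t ht using key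
  have uniq : ∀ (b : {b // D.o b ≤ iSup U}) (x y : D.G b.1),
      (∀ b' (i : ι) (h : D.o b' ≤ D.o b.1), D.o b' ≤ U i → D.res h x = D.res h y) → x = y := by
    rintro ⟨b, hb⟩ x y hxy
    rw [← sub_eq_zero]
    refine D.sep b _ fun z hz => ?_
    obtain ⟨i, hi⟩ := TopologicalSpace.Opens.mem_iSup.1 (hb hz)
    obtain ⟨b', hyb', hb'⟩ := D.isBasis (D.o b ⊓ U i) z ⟨hz, hi⟩
    exact ⟨b', hb'.trans inf_le_left, hyb', by
      rw [map_sub, hxy b' i _ (hb'.trans inf_le_right), sub_self]⟩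
  refine ⟨⟨t, fun b b' h => uniq _ _ _ fun b'' i h' hi => ?_⟩, fun i => ?_, fun s hs => ?_⟩
  · rw [D.res_res, ht b b'' i _ hi, ht b' b'' i _ hi]
  · refine Subtype.ext (funext fun b => ?_)
    have := ht ⟨b.1, b.2.trans (le_iSup U i)⟩ b.1 i le_rfl b.2
    rw [D.res_self] at this
    exact this
  · refine Subtype.ext (funext fun b => uniq _ _ _ fun b' i h hi => ?_)
    rw [ht b b' i h hi, s.2 b ⟨b', h.trans b.2⟩ h]
    exact congrFun (congrArg Subtype.val (hs i)) ⟨b', hi⟩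

/-- The sheaf of modules with prescribed sections on a basis. -/
def toModules : S.Modules := ⟨D.presheaf, D.isSheaf⟩

/-- The sections of `D.toModules` over a basic open set. -/
def ev (b : D.B) : Γ(D.toModules, D.o b) →+ D.G b :=
  AddMonoidHom.mk' (fun s => Subtype.val (p := (· ∈ D.sections (D.o b))) s ⟨b, le_rfl⟩)
    fun _ _ => rfl

theorem ev_smul (b : D.B) (r : Γ(S, D.o b)) (s : Γ(D.toModules, D.o b)) :
    D.ev b (r • s) = r • D.ev b s :=
  congrArg (fun t => t • D.ev b s) (funRes_self _ r)

theorem ev_secRes {b b' : D.B} (h : D.o b' ≤ D.o b) (s : Γ(D.toModules, D.o b)) :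
    D.ev b' (secRes D.toModules h s) = D.res h (D.ev b s) :=
  ((Subtype.prop (p := (· ∈ D.sections (D.o b))) s) ⟨b, le_rfl⟩ ⟨b', h⟩ h).symm

theorem ev_bijective (b : D.B) : Function.Bijective (D.ev b) := by
  constructor
  · intro s s' h
    refine Subtype.ext (funext fun b' => ?_)
    have e := (Subtype.prop (p := (· ∈ D.sections (D.o b))) s) ⟨b, le_rfl⟩ b' b'.2
    have e' := (Subtype.prop (p := (· ∈ D.sections (D.o b))) s') ⟨b, le_rfl⟩ b' b'.2
    exact e.symm.trans ((congrArg (D.res b'.2) h).trans e')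
  · intro x
    exact ⟨⟨fun b' => D.res b'.2 x, fun b' b'' h => D.res_res _ _ _⟩, D.res_self b x⟩

end BasisModule
end CechExt

namespace CechExt

/-! ### Sections of vector bundles over affine open sets -/

section VectorBundle

variable {S : Scheme.{u}} {M : S.Modules}

/-- The sections `b` over `U` restrict to a basis over every smaller open set. -/
def IsBasisOn (M : S.Modules) {U : S.Opens} {n : ℕ} (b : Fin n → Γ(M, U)) : Prop :=
  ∀ (V : S.Opens) (h : V ≤ U),
    Function.Bijective fun c : Fin n → Γ(S, V) => ∑ k, c k • secRes M h (b k)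

theorem IsBasisOn.restrict {U : S.Opens} {n : ℕ} {b : Fin n → Γ(M, U)} (hb : IsBasisOn M b)
    {U' : S.Opens} (h : U' ≤ U) : IsBasisOn M fun k => secRes M h (b k) := fun V hV => by
  simpa only [secRes_secRes] using hb V (hV.trans h)

theorem secRes_sum_smul {U V W : S.Opens} {n : ℕ} (b : Fin n → Γ(M, U)) (h : V ≤ U) (h' : W ≤ V)
    (c : Fin n → Γ(S, V)) : secRes M h' (∑ k, c k • secRes M h (b k)) =
      ∑ k, funRes S h' (c k) • secRes M (h'.trans h) (b k) := by
  simp only [map_sum, secRes_smul, secRes_secRes]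

theorem fun_pow_mul_eq_zero {V W : S.Opens} (hV : IsAffineOpen V) (f : Γ(S, V))
    (hW : W = S.basicOpen f) (h : W ≤ V) (a : Γ(S, V)) (ha : funRes S h a = 0) :
    ∃ N : ℕ, f ^ N * a = 0 := by
  subst hW
  have := hV.isLocalization_basicOpen f
  obtain ⟨⟨_, N, rfl⟩, hN⟩ := IsLocalization.exists_of_eq (M := Submonoid.powers f)
    (S := Γ(S, S.basicOpen f)) (x := a) (y := 0) (ha.trans (map_zero _).symm)
  exact ⟨N, by simpa using hN⟩

theorem fun_exists_pow_mul {V W : S.Opens} (hV : IsAffineOpen V) (f : Γ(S, V))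
    (hW : W = S.basicOpen f) (h : W ≤ V) (a : Γ(S, W)) :
    ∃ (N : ℕ) (a' : Γ(S, V)), funRes S h a' = funRes S h f ^ N * a := by
  subst hW
  have := hV.isLocalization_basicOpen f
  obtain ⟨⟨a', _, N, rfl⟩, hN⟩ := IsLocalization.surj (M := Submonoid.powers f) a
  refine ⟨N, a', ?_⟩
  rw [mul_comm, ← map_pow]
  exact hN.symm

theorem exists_finset_basicOpen_cover {V : S.Opens} (hV : IsAffineOpen V) (p : Γ(S, V) → Prop)
    (hp : ∀ x ∈ V, ∃ g, p g ∧ x ∈ S.basicOpen g) :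
    ∃ t : Finset Γ(S, V), (∀ g ∈ t, p g) ∧ Ideal.span (t : Set Γ(S, V)) = ⊤ := by
  have h : Ideal.span {g | p g} = ⊤ := by
    rw [← hV.self_le_iSup_basicOpen_iff]
    intro x hx
    obtain ⟨g, hg, hxg⟩ := hp x hx
    exact TopologicalSpace.Opens.mem_iSup.2 ⟨⟨g, hg⟩, hxg⟩
  obtain ⟨t, ht, e⟩ := (Ideal.span_eq_top_iff_finite _).1 h
  exact ⟨t, fun g hg => ht hg, e⟩

theorem exists_basicOpen_isBasisOn (hM : IsVectorBundle M) {V : S.Opens} (hV : IsAffineOpen V)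
    (x : S) (hx : x ∈ V) : ∃ g : Γ(S, V), x ∈ S.basicOpen g ∧
      ∃ (n : ℕ) (b : Fin n → Γ(M, S.basicOpen g)), IsBasisOn M b := by
  obtain ⟨U, hxU, n, b, hb⟩ := hM x
  obtain ⟨g, hg, hxg⟩ := hV.exists_basicOpen_le (V := U) ⟨x, hxU⟩ hx
  exact ⟨g, hxg, n, _, IsBasisOn.restrict hb hg⟩

theorem exists_finset_isBasisOn (hM : IsVectorBundle M) {V : S.Opens} (hV : IsAffineOpen V) :
    ∃ t : Finset Γ(S, V), (∀ g ∈ t, ∃ (n : ℕ) (b : Fin n → Γ(M, S.basicOpen g)), IsBasisOn M b) ∧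
      Ideal.span (t : Set Γ(S, V)) = ⊤ :=
  exists_finset_basicOpen_cover hV _ fun x hx =>
    let ⟨g, hxg, h⟩ := exists_basicOpen_isBasisOn hM hV x hx; ⟨g, h, hxg⟩

theorem exists_mem_basicOpen_of_span {V : S.Opens} (hV : IsAffineOpen V) {t : Finset Γ(S, V)}
    (ht : Ideal.span (t : Set Γ(S, V)) = ⊤) (x : S) (hx : x ∈ V) :
    ∃ g ∈ t, x ∈ S.basicOpen g := by
  have := (hV.self_le_iSup_basicOpen_iff (s := (t : Set Γ(S, V)))).2 ht hx
  obtain ⟨⟨g, hg⟩, h⟩ := TopologicalSpace.Opens.mem_iSup.1 this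
  exact ⟨g, hg, h⟩

/-- The case of a free bundle of `pow_smul_eq_zero`. -/
theorem IsBasisOn.pow_smul_eq_zero {V W : S.Opens} (hV : IsAffineOpen V) {n : ℕ}
    {b : Fin n → Γ(M, V)} (hb : IsBasisOn M b) (f : Γ(S, V)) (hW : W = S.basicOpen f) (h : W ≤ V)
    (s : Γ(M, V)) (hs : secRes M h s = 0) : ∃ N : ℕ, f ^ N • s = 0 := by
  obtain ⟨c, rfl⟩ := (hb V le_rfl).2 s
  rw [secRes_sum_smul] at hs
  have hc : (fun k => funRes S h (c k)) = 0 := (hb W h).1 (by simpa using hs)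
  choose N hN using fun k => fun_pow_mul_eq_zero hV f hW h (c k) (congrFun hc k)
  refine ⟨∑ k, N k, ?_⟩
  simp only [Finset.smul_sum, smul_smul]
  refine Finset.sum_eq_zero fun k hk => ?_
  rw [← Finset.add_sum_erase _ _ hk, pow_add, mul_assoc, mul_left_comm, hN, mul_zero, zero_smul]

/-- The case of a free bundle of `exists_pow_smul`. -/
theorem IsBasisOn.exists_pow_smul {V W : S.Opens} (hV : IsAffineOpen V) {n : ℕ}
    {b : Fin n → Γ(M, V)} (hb : IsBasisOn M b) (f : Γ(S, V)) (hW : W = S.basicOpen f) (h : W ≤ V)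
    (s : Γ(M, W)) : ∃ (N : ℕ) (s' : Γ(M, V)), secRes M h s' = funRes S h f ^ N • s := by
  obtain ⟨c, rfl⟩ := (hb W h).2 s
  choose N a ha using fun k => fun_exists_pow_mul hV f hW h (c k)
  refine ⟨∑ k, N k, ∑ k, (f ^ (∑ l ∈ Finset.univ.erase k, N l) * a k) • secRes M le_rfl (b k), ?_⟩
  rw [secRes_sum_smul, Finset.smul_sum]
  refine Finset.sum_congr rfl fun k hk => ?_
  rw [smul_smul, map_mul, ha, map_pow, ← mul_assoc, ← pow_add, add_comm,
    Finset.add_sum_erase _ _ hk]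

/-- A section over an affine open set that vanishes where `f` is invertible is killed by a power
of `f`. -/
theorem pow_smul_eq_zero (hM : IsVectorBundle M) {V W : S.Opens} (hV : IsAffineOpen V)
    (f : Γ(S, V)) (hW : W = S.basicOpen f) (h : W ≤ V) (s : Γ(M, V)) (hs : secRes M h s = 0) :
    ∃ N : ℕ, f ^ N • s = 0 := by
  obtain ⟨t, ht, hspan⟩ := exists_finset_isBasisOn hM hV
  have key : ∀ g : t, ∃ N : ℕ, secRes M (S.basicOpen_le g.1) (f ^ N • s) = 0 := fun g => by
    obtain ⟨n, b, hb⟩ := ht g.1 g.2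
    obtain ⟨N, hN⟩ := hb.pow_smul_eq_zero (hV.basicOpen g.1) (funRes S (S.basicOpen_le g.1) f)
      (S.basicOpen_res _ _).symm inf_le_left (secRes M (S.basicOpen_le g.1) s) (by
        rw [secRes_secRes, ← secRes_secRes M h (by rw [hW]; exact inf_le_right), hs, map_zero])
    exact ⟨N, by rw [secRes_smul, map_pow, hN]⟩
  choose N hN using key
  refine ⟨∑ g, N g, eq_of_locally_eq M _ _ fun x hx => ?_⟩
  classical
  obtain ⟨g, hg, hxg⟩ := exists_mem_basicOpen_of_span hV hspan x hx
  refine ⟨_, S.basicOpen_le g, hxg, ?_⟩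
  rw [← Finset.sum_erase_add _ _ (Finset.mem_univ (⟨g, hg⟩ : t)), pow_add, mul_smul, secRes_smul,
    hN ⟨g, hg⟩, smul_zero, map_zero]

theorem exists_glue_of_cover (M : S.Modules) {ι : Type*} {U : ι → S.Opens} {V : S.Opens}
    (hU : ∀ i, U i ≤ V) (hcov : ∀ x ∈ V, ∃ i, x ∈ U i) (s : ∀ i, Γ(M, U i))
    (hs : ∀ i j, secRes M (inf_le_left : U i ⊓ U j ≤ U i) (s i) = secRes M inf_le_right (s j)) :
    ∃ t : Γ(M, V), ∀ i, secRes M (hU i) t = s i :=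
  (TopCat.Sheaf.existsUnique_gluing' ⟨M.presheaf, M.isSheaf⟩ U V (fun i => homOfLE (hU i))
    (fun x hx => TopologicalSpace.Opens.mem_iSup.2 (hcov x hx)) s hs).exists

set_option maxHeartbeats 1000000 in
/-- Up to a power of `f`, sections over the locus where `f` is invertible extend to the affine open
set on which `f` is defined. -/
theorem exists_pow_smul (hM : IsVectorBundle M) {V W : S.Opens} (hV : IsAffineOpen V)
    (f : Γ(S, V)) (hW : W = S.basicOpen f) (h : W ≤ V) (s : Γ(M, W)) :
    ∃ (N : ℕ) (s' : Γ(M, V)), secRes M h s' = funRes S h f ^ N • s := by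
  obtain ⟨t, ht, hspan⟩ := exists_finset_isBasisOn hM hV
  have leg : ∀ g : t, S.basicOpen g.1 ≤ V := fun g => S.basicOpen_le g.1
  have leW : ∀ g : t, S.basicOpen g.1 ⊓ S.basicOpen f ≤ W := fun g => by rw [hW]; exact inf_le_right
  -- extensions over the members of a trivializing covering
  have key : ∀ g : t, ∃ (N : ℕ) (s' : Γ(M, S.basicOpen g.1)), ∀ N', N ≤ N' →
      ∃ s'' : Γ(M, S.basicOpen g.1),
      secRes M (inf_le_left : S.basicOpen g.1 ⊓ S.basicOpen f ≤ _) s'' =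
        funRes S ((leW g).trans h) f ^ N' • secRes M (leW g) s := fun g => by
    obtain ⟨n, b, hb⟩ := ht g.1 g.2
    obtain ⟨N, s', hN⟩ := hb.exists_pow_smul (hV.basicOpen g.1) (funRes S (leg g) f)
      (S.basicOpen_res _ _).symm inf_le_left (secRes M (leW g) s)
    refine ⟨N, s', fun N' hN' => ⟨funRes S (leg g) f ^ (N' - N) • s', ?_⟩⟩
    rw [secRes_smul, hN, map_pow, funRes_funRes, smul_smul, ← pow_add, Nat.sub_add_cancel hN']
  choose N s' hs' using key
  choose s₁ hs₁ using fun g => hs' g (∑ g, N g) (Finset.single_le_sum (f := N) (fun _ _ => Nat.zero_le _) (Finset.mem_univ g))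
  -- after multiplication with a further power of `f`, they agree on the overlaps
  have leI : ∀ g g' : t, S.basicOpen g.1 ⊓ S.basicOpen g'.1 ≤ V := fun g g' =>
    inf_le_left.trans (leg g)
  have key₂ : ∀ g g' : t, ∃ K : ℕ, (funRes S (leI g g') f ^ K) •
      (secRes M (inf_le_left : S.basicOpen g.1 ⊓ S.basicOpen g'.1 ≤ S.basicOpen g.1) (s₁ g) -
        secRes M (inf_le_right : S.basicOpen g.1 ⊓ S.basicOpen g'.1 ≤ S.basicOpen g'.1) (s₁ g')) =
      (0 : Γ(M, S.basicOpen g.1 ⊓ S.basicOpen g'.1)) := fun g g' => by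
    have haff : IsAffineOpen (S.basicOpen g.1 ⊓ S.basicOpen g'.1) := by
      rw [← S.basicOpen_mul]; exact hV.basicOpen _
    refine pow_smul_eq_zero hM haff (funRes S (leI g g') f) (S.basicOpen_res f _).symm
      inf_le_left _ ?_
    have e := congrArg (secRes M (le_inf (inf_le_left.trans inf_le_left) inf_le_right :
      (S.basicOpen g.1 ⊓ S.basicOpen g'.1) ⊓ S.basicOpen f ≤ S.basicOpen g.1 ⊓ S.basicOpen f))
      (hs₁ g)
    have e' := congrArg (secRes M (le_inf (inf_le_left.trans inf_le_right) inf_le_right :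
      (S.basicOpen g.1 ⊓ S.basicOpen g'.1) ⊓ S.basicOpen f ≤ S.basicOpen g'.1 ⊓ S.basicOpen f))
      (hs₁ g')
    simp only [secRes_smul, secRes_secRes, map_pow, funRes_funRes] at e e'
    rw [map_sub, secRes_secRes, secRes_secRes, sub_eq_zero, e, e']
  choose K hK using key₂
  have agree : ∀ g g' : t, secRes M (inf_le_left : S.basicOpen g.1 ⊓ S.basicOpen g'.1 ≤ _)
      (funRes S (leg g) f ^ (∑ g, ∑ g', K g g') • s₁ g) =
      secRes M inf_le_right (funRes S (leg g') f ^ (∑ g, ∑ g', K g g') • s₁ g') := fun g g' => by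
    have hle : K g g' ≤ ∑ g, ∑ g', K g g' :=
      (Finset.single_le_sum (f := fun g' => K g g') (fun _ _ => Nat.zero_le _)
        (Finset.mem_univ g')).trans
      (Finset.single_le_sum (f := fun g => ∑ g', K g g') (fun _ _ => Nat.zero_le _)
        (Finset.mem_univ g))
    obtain ⟨d, hd⟩ := Nat.exists_eq_add_of_le' hle
    rw [secRes_smul, secRes_smul, map_pow, map_pow, funRes_funRes, funRes_funRes, ← sub_eq_zero,
      ← smul_sub, hd, pow_add, mul_smul, hK, smul_zero]
  obtain ⟨r, hr⟩ := exists_glue_of_cover M leg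
    (fun x hx => let ⟨g, hg, hxg⟩ := exists_mem_basicOpen_of_span hV hspan x hx; ⟨⟨g, hg⟩, hxg⟩)
    (fun g => funRes S (leg g) f ^ (∑ g, ∑ g', K g g') • s₁ g) agree
  refine ⟨(∑ g, ∑ g', K g g') + ∑ g, N g, r, eq_of_locally_eq M _ _ fun x hx => ?_⟩
  obtain ⟨g, hg, hxg⟩ := exists_mem_basicOpen_of_span hV hspan x (h hx)
  refine ⟨S.basicOpen g ⊓ S.basicOpen f, leW ⟨g, hg⟩, ⟨hxg, hW ▸ hx⟩, ?_⟩
  have e := congrArg (secRes M (inf_le_left : S.basicOpen g ⊓ S.basicOpen f ≤ _)) (hr ⟨g, hg⟩)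
  rw [secRes_secRes, secRes_smul, hs₁ ⟨g, hg⟩, map_pow, funRes_funRes, smul_smul, ← pow_add] at e
  rw [secRes_secRes, secRes_smul, map_pow, funRes_funRes, e]

end VectorBundle
end CechExt

namespace CechExt

section VectorBundle

variable {S : Scheme.{u}} {M : S.Modules}

theorem isUnit_funRes {V U : S.Opens} (f : Γ(S, V)) (hU : U ≤ S.basicOpen f) (h : U ≤ V) :
    IsUnit (funRes S h f) := by
  have := RingedSpace.isUnit_res_basicOpen S.toRingedSpace f
  have e : funRes S hU (funRes S (S.basicOpen_le f) f) = funRes S h f := funRes_funRes _ _ _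
  rw [← e]
  exact RingHom.isUnit_map _ this

/-- The coordinates with respect to a basis. -/
def IsBasisOn.equiv {V : S.Opens} {n : ℕ} {b : Fin n → Γ(M, V)} (hb : IsBasisOn M b)
    {W : S.Opens} (h : W ≤ V) : (Fin n → Γ(S, W)) ≃ₗ[Γ(S, W)] Γ(M, W) :=
  LinearEquiv.ofBijective
    { toFun := fun c => ∑ k, c k • secRes M h (b k)
      map_add' := fun c c' => by simp [add_smul, Finset.sum_add_distrib]
      map_smul' := fun r c => by simp [mul_smul, Finset.smul_sum] } (hb W h)

/-- A vector bundle over an affine open set is given by a finitely generated projective module: its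
sections over basic open sets are the localizations of the sections over `V`, and these are free for
basic open sets that generate the unit ideal. -/
theorem IsVectorBundle.finite_projective (hM : IsVectorBundle M) {V : S.Opens}
    (hV : IsAffineOpen V) :
    Module.Finite Γ(S, V) Γ(M, V) ∧ Module.Projective Γ(S, V) Γ(M, V) := by
  obtain ⟨t, ht, hspan⟩ := exists_finset_isBasisOn hM hV
  let s : Set Γ(S, V) := t
  let Rp : s → Type u := fun g => Γ(S, S.basicOpen g.1)
  let Mp : s → Type u := fun g => Γ(M, S.basicOpen g.1)
  let _ : ∀ g, CommRing (Rp g) := fun g => inferInstanceAs (CommRing Γ(S, S.basicOpen g.1))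
  let _ : ∀ g, AddCommGroup (Mp g) := fun g => inferInstanceAs (AddCommGroup Γ(M, S.basicOpen g.1))
  let _ : ∀ g, Module (Rp g) (Mp g) := fun g =>
    inferInstanceAs (Module Γ(S, S.basicOpen g.1) Γ(M, S.basicOpen g.1))
  let _ : ∀ g, Algebra Γ(S, V) (Rp g) := fun g => (funRes S (S.basicOpen_le g.1)).toAlgebra
  let _ : ∀ g, Module Γ(S, V) (Mp g) := fun g => Module.compHom (Mp g) (algebraMap Γ(S, V) (Rp g))
  have _ : ∀ g, IsScalarTower Γ(S, V) (Rp g) (Mp g) := fun g =>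
    IsScalarTower.of_algebraMap_smul fun _ _ => rfl
  have _ : ∀ g : s, IsLocalization.Away g.1 (Rp g) := fun g => hV.isLocalization_basicOpen g.1
  let φ : ∀ g, Γ(M, V) →ₗ[Γ(S, V)] Mp g := fun g =>
    { toFun := secRes M (S.basicOpen_le g.1)
      map_add' := map_add _
      map_smul' := fun r x => secRes_smul M _ r x }
  have hpow : ∀ (g : s) (N : ℕ) (y : Mp g), (g.1 ^ N) • y =
      (funRes S (S.basicOpen_le g.1) g.1 ^ N : Rp g) • y := fun g N y => by
    rw [← map_pow]; rfl
  -- Sections over a basic open set are the localization of the sections over `V`.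
  have hφ : ∀ g : s, IsLocalizedModule (Submonoid.powers g.1) (φ g) := fun g =>
    { map_units := by
        rintro ⟨_, N, rfl⟩
        have hu : IsUnit (algebraMap Γ(S, V) (Rp g) (g.1 ^ N)) := by
          rw [map_pow]
          exact (isUnit_funRes g.1 le_rfl (S.basicOpen_le g.1)).pow N
        rw [Module.End.isUnit_iff]
        have := (Module.End.isUnit_iff _).1 (hu.map (algebraMap (Rp g) (Module.End (Rp g) (Mp g))))
        exact this
      surj := fun y => by
        obtain ⟨N, s', hs'⟩ := exists_pow_smul hM hV g.1 rfl (S.basicOpen_le g.1) y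
        exact ⟨⟨s', ⟨_, N, rfl⟩⟩, (hpow g N y).trans hs'.symm⟩
      exists_of_eq := fun {x y} hxy => by
        obtain ⟨N, hN⟩ := pow_smul_eq_zero hM hV g.1 rfl (S.basicOpen_le g.1) (x - y)
          (by rw [map_sub]; exact sub_eq_zero.2 hxy)
        exact ⟨⟨_, N, rfl⟩, by rw [smul_sub, sub_eq_zero] at hN; exact hN⟩ }
  have hfree : ∀ g : s, ∃ n, Nonempty ((Fin n → Rp g) ≃ₗ[Rp g] Mp g) := fun g =>
    let ⟨n, _, hb⟩ := ht g.1 g.2; ⟨n, ⟨hb.equiv le_rfl⟩⟩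
  have hfp : ∀ g, Module.FinitePresentation (Rp g) (Mp g) := fun g =>
    let ⟨n, ⟨e⟩⟩ := hfree g
    Module.FinitePresentation.of_equiv e
  have hflat' : ∀ g, Module.Flat (Rp g) (Mp g) := fun g =>
    let ⟨n, ⟨e⟩⟩ := hfree g
    Module.Flat.of_linearEquiv e.symm
  have hflat : ∀ g : s, Module.Flat Γ(S, V) (Mp g) := fun g => by
    have := hflat' g
    have : Module.Flat Γ(S, V) (Rp g) := IsLocalization.flat _ (Submonoid.powers g.1)
    exact Module.Flat.trans Γ(S, V) (Rp g) (Mp g)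
  have h1 : Module.FinitePresentation Γ(S, V) Γ(M, V) :=
    Module.FinitePresentation.of_localizationSpan' s hspan (Mₚ := Mp) (Rₚ := Rp) φ hfp
  have h2 : Module.Flat Γ(S, V) Γ(M, V) :=
    Module.flat_of_isLocalized_span (R := Γ(S, V)) Γ(S, V) _ s hspan Mp φ hflat
  exact ⟨inferInstance, Module.Flat.projective_of_finitePresentation⟩

theorem exists_dualBasis_section (hM : IsVectorBundle M) {V : S.Opens} (hV : IsAffineOpen V) :
    ∃ (n : ℕ) (e : Fin n → Γ(M, V)) (l : Fin n → Γ(M, V) →ₗ[Γ(S, V)] Γ(S, V)),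
      ∀ x, ∑ k, l k x • e k = x := by
  obtain ⟨_, _⟩ := hM.finite_projective hV
  obtain ⟨n, p, hp⟩ := Module.Finite.exists_fin' Γ(S, V) Γ(M, V)
  obtain ⟨q, hq⟩ := Module.projective_lifting_property p LinearMap.id hp
  refine ⟨n, fun k => p (fun j => if k = j then 1 else 0), fun k => (LinearMap.proj k).comp q, fun x => ?_⟩
  have := LinearMap.congr_fun hq x
  rw [LinearMap.comp_apply, LinearMap.pi_apply_eq_sum_univ p] at this
  exact this

theorem exists_fun_glue_of_cover {ι : Type*} {U : ι → S.Opens} {V : S.Opens}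
    (hU : ∀ i, U i ≤ V) (hcov : ∀ x ∈ V, ∃ i, x ∈ U i) (s : ∀ i, Γ(S, U i))
    (hs : ∀ i j, funRes S (inf_le_left : U i ⊓ U j ≤ U i) (s i) = funRes S inf_le_right (s j)) :
    ∃ t : Γ(S, V), ∀ i, funRes S (hU i) t = s i :=
  (TopCat.Sheaf.existsUnique_gluing' S.sheaf U V (fun i => homOfLE (hU i))
    (fun x hx => TopologicalSpace.Opens.mem_iSup.2 (hcov x hx)) s hs).exists

/-- `y` is the value at `x ∈ M(W)` of the extension to `W` of the linear form `l` on `M(V)`. -/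
def IsExtValue {V : S.Opens} (l : Γ(M, V) →ₗ[Γ(S, V)] Γ(S, V)) {W : S.Opens} (hW : W ≤ V)
    (x : Γ(M, W)) (y : Γ(S, W)) : Prop :=
  ∀ (g : Γ(S, V)) (U : S.Opens) (_ : U = S.basicOpen g) (h : U ≤ W) (N : ℕ) (t : Γ(M, V)),
    secRes M (h.trans hW) t = funRes S (h.trans hW) g ^ N • secRes M h x →
    funRes S (h.trans hW) (l t) = funRes S (h.trans hW) g ^ N * funRes S h y

variable {V : S.Opens} {l : Γ(M, V) →ₗ[Γ(S, V)] Γ(S, V)}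

theorem IsExtValue.res {W : S.Opens} {hW : W ≤ V} {x : Γ(M, W)} {y : Γ(S, W)}
    (h : IsExtValue l hW x y) {W' : S.Opens} (hW' : W' ≤ W) :
    IsExtValue l (hW'.trans hW) (secRes M hW' x) (funRes S hW' y) := fun g U hU hUW N t ht => by
  rw [funRes_funRes]
  rw [secRes_secRes] at ht
  exact h g U hU (hUW.trans hW') N t ht

theorem IsExtValue.unique (hM : IsVectorBundle M) (hV : IsAffineOpen V) {W : S.Opens}
    {hW : W ≤ V} {x : Γ(M, W)} {y y' : Γ(S, W)} (h : IsExtValue l hW x y)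
    (h' : IsExtValue l hW x y') : y = y' := by
  refine fun_eq_of_locally_eq _ _ fun z hz => ?_
  obtain ⟨g, hg, hzg⟩ := hV.exists_basicOpen_le (V := W) ⟨z, hz⟩ (hW hz)
  refine ⟨_, hg, hzg, ?_⟩
  obtain ⟨N, t, ht⟩ := exists_pow_smul hM hV g rfl (hg.trans hW) (secRes M hg x)
  have e := (h g _ rfl hg N t ht).symm.trans (h' g _ rfl hg N t ht)
  exact ((isUnit_funRes g le_rfl (hg.trans hW)).pow N).mul_left_cancel e

/-- Linear forms on the sections over an affine open set extend to all smaller open sets: to basic open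
sets by localization, and then by gluing. -/
theorem exists_isExtValue (hM : IsVectorBundle M) (hV : IsAffineOpen V) {W : S.Opens}
    (hW : W ≤ V) (x : Γ(M, W)) : ∃ y, IsExtValue l hW x y := by
  -- the value over a basic open set
  have key : ∀ (f : Γ(S, V)) (hf : S.basicOpen f ≤ W), ∃ y,
      IsExtValue l (hf.trans hW) (secRes M hf x) y := fun f hf => by
    obtain ⟨N, t, ht⟩ := exists_pow_smul hM hV f rfl (hf.trans hW) (secRes M hf x)
    obtain ⟨u, hu⟩ := (isUnit_funRes f le_rfl (hf.trans hW)).pow N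
    refine ⟨(u⁻¹ : _ˣ) * funRes S (hf.trans hW) (l t), fun g U hU hUf K t' ht' => ?_⟩
    have e := congrArg (secRes M hUf) ht
    rw [secRes_secRes, secRes_smul, map_pow, funRes_funRes] at e
    obtain ⟨L, hL⟩ := pow_smul_eq_zero hM hV g hU (hUf.trans (hf.trans hW))
      (f ^ N • t' - g ^ K • t) (by
        rw [map_sub, secRes_smul, secRes_smul, map_pow, map_pow, ht', e, smul_comm, sub_self])
    have e₂ := congrArg (fun a => funRes S (hUf.trans (hf.trans hW)) (l a)) hL
    simp only [map_smul, map_sub, smul_eq_mul, map_mul, map_pow, map_zero] at e₂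
    have e₃ := sub_eq_zero.1 (((isUnit_funRes g hU.le (hUf.trans (hf.trans hW))).pow
      L).mul_right_eq_zero.1 e₂)
    have hu' := congrArg (funRes S hUf) hu
    rw [map_pow, funRes_funRes] at hu'
    rw [← hu'] at e₃
    have hinv : funRes S hUf (u : _) * funRes S hUf ((u⁻¹ : _ˣ) : _) = 1 := by
      rw [← map_mul, Units.mul_inv, map_one]
    rw [map_mul, funRes_funRes, mul_left_comm, ← e₃, mul_left_comm, ← mul_assoc, hinv, one_mul]
  choose y hy using key
  -- By uniqueness, these values agree on overlaps.
  obtain ⟨r, hr⟩ := exists_fun_glue_of_cover (U := fun f : {f : Γ(S, V) // S.basicOpen f ≤ W} =>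
      S.basicOpen f.1) (V := W) (fun f => f.2)
    (fun z hz => by
      obtain ⟨g, hg, hzg⟩ := hV.exists_basicOpen_le (V := W) ⟨z, hz⟩ (hW hz)
      exact ⟨⟨g, hg⟩, hzg⟩)
    (fun f => y f.1 f.2) (fun f f' => by
      have h₁ := (hy f.1 f.2).res (inf_le_left : S.basicOpen f.1 ⊓ S.basicOpen f'.1 ≤ _)
      have h₂ := (hy f'.1 f'.2).res (inf_le_right : S.basicOpen f.1 ⊓ S.basicOpen f'.1 ≤ _)
      rw [secRes_secRes] at h₁ h₂
      exact h₁.unique hM hV h₂)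
  refine ⟨r, fun g U hU hUW N t ht => ?_⟩
  subst hU
  rw [hr ⟨g, hUW⟩]
  have := hy g hUW g _ rfl le_rfl N t (by rw [secRes_self]; exact ht)
  rwa [funRes_self] at this

set_option maxHeartbeats 1000000 in
/-- A vector bundle over an affine open set `V` has a dual basis: generating sections `e k` over
`V`, together with morphisms `l k` to the structure sheaf, given by their values over all open
subsets of `V`. -/
theorem exists_dualBasis (hM : IsVectorBundle M) (hV : IsAffineOpen V) :
    ∃ (n : ℕ) (e : Fin n → Γ(M, V))
      (l : ∀ W : S.Opens, W ≤ V → Fin n → (Γ(M, W) →ₗ[Γ(S, W)] Γ(S, W))),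
      (∀ (W W' : S.Opens) (hW : W ≤ V) (h : W' ≤ W) k x,
        funRes S h (l W hW k x) = l W' (h.trans hW) k (secRes M h x)) ∧
      ∀ (W : S.Opens) (hW : W ≤ V) x, ∑ k, l W hW k x • secRes M hW (e k) = x := by
  obtain ⟨n, e, l, hl⟩ := exists_dualBasis_section hM hV
  choose y hy using fun (W : S.Opens) (hW : W ≤ V) (k : Fin n) (x : Γ(M, W)) =>
    exists_isExtValue (l := l k) hM hV hW x
  -- All identities are checked over basic open sets, where a multiple of a section by a power of
  -- `g` comes from `V`.
  refine ⟨n, e, fun W hW k =>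
    { toFun := y W hW k
      map_add' := fun x x' => ?_
      map_smul' := fun r x => ?_ }, fun W W' hW h k x => ?_, fun W hW x => ?_⟩
  · refine fun_eq_of_locally_eq _ _ fun z hz => ?_
    obtain ⟨g, hg, hzg⟩ := hV.exists_basicOpen_le (V := W) ⟨z, hz⟩ (hW hz)
    refine ⟨_, hg, hzg, ?_⟩
    obtain ⟨N, t, ht⟩ := exists_pow_smul hM hV g rfl (hg.trans hW) (secRes M hg x)
    obtain ⟨N', t', ht'⟩ := exists_pow_smul hM hV g rfl (hg.trans hW) (secRes M hg x')
    have a := hy W hW k x g _ rfl hg N t ht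
    have a' := hy W hW k x' g _ rfl hg N' t' ht'
    have a₂ := hy W hW k (x + x') g _ rfl hg (N + N') (g ^ N' • t + g ^ N • t') (by
      simp only [map_add, secRes_smul, ht, ht', map_pow, smul_smul, smul_add]
      rw [pow_add, mul_comm])
    refine ((isUnit_funRes g le_rfl (hg.trans hW)).pow (N + N')).mul_left_cancel ?_
    rw [← a₂]
    simp only [map_add, map_smul, smul_eq_mul, map_mul, map_pow, a, a']
    ring
  · refine fun_eq_of_locally_eq _ _ fun z hz => ?_
    obtain ⟨g, hg, hzg⟩ := hV.exists_basicOpen_le (V := W) ⟨z, hz⟩ (hW hz)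
    refine ⟨_, hg, hzg, ?_⟩
    obtain ⟨N, t, ht⟩ := exists_pow_smul hM hV g rfl (hg.trans hW) (secRes M hg x)
    obtain ⟨N', r', hr'⟩ := fun_exists_pow_mul hV g rfl (hg.trans hW) (funRes S hg r)
    have a := hy W hW k x g _ rfl hg N t ht
    have a₂ := hy W hW k (r • x) g _ rfl hg (N' + N) (r' • t) (by
      simp only [secRes_smul, ht, hr', smul_smul]
      congr 1
      ring)
    refine ((isUnit_funRes g le_rfl (hg.trans hW)).pow (N' + N)).mul_left_cancel ?_
    rw [← a₂]
    simp only [map_smul, smul_eq_mul, map_mul, a, hr', RingHom.id_apply]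
    ring
  · exact ((hy W hW k x).res h).unique hM hV (hy W' _ k _)
  · refine eq_of_locally_eq M _ _ fun z hz => ?_
    obtain ⟨g, hg, hzg⟩ := hV.exists_basicOpen_le (V := W) ⟨z, hz⟩ (hW hz)
    refine ⟨_, hg, hzg, ?_⟩
    obtain ⟨N, t, ht⟩ := exists_pow_smul hM hV g rfl (hg.trans hW) (secRes M hg x)
    obtain ⟨u, hu⟩ := (isUnit_funRes g le_rfl (hg.trans hW)).pow N
    have a := fun k => hy W hW k x g _ rfl hg N t ht
    have ht₂ := congrArg (secRes M (hg.trans hW)) (hl t)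
    rw [ht] at ht₂
    simp only [map_sum, secRes_smul, a] at ht₂
    simp only [LinearMap.coe_mk, AddHom.coe_mk, map_sum, secRes_smul, secRes_secRes]
    simp only [mul_smul] at ht₂
    rw [← Finset.smul_sum] at ht₂
    have cancel : ∀ m m' : Γ(M, S.basicOpen g), funRes S (hg.trans hW) g ^ N • m =
        funRes S (hg.trans hW) g ^ N • m' → m = m' := fun m m' h => by
      rw [← hu] at h
      have := congrArg (fun m => ((u⁻¹ : _ˣ) : Γ(S, S.basicOpen g)) • m) h
      simpa only [smul_smul, Units.inv_mul, one_smul] using this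
    exact cancel _ _ ht₂

end VectorBundle
end CechExt

namespace CechExt

/-! ### Reduction of vector bundles modulo the ideal of a closed subscheme -/

section Reduction

variable {S' S : Scheme.{u}} {j : S' ⟶ S} {M : S.Modules} {M' : S'.Modules}
  (ρ : M ⟶ (Scheme.Modules.pushforward j).obj M')

theorem secMap_smul {W : S.Opens} (r : Γ(S, W)) (s : Γ(M, W)) :
    secMap j ρ W (r • s) = ((j.app W).hom r : Γ(S', j ⁻¹ᵁ W)) • secMap j ρ W s :=
  Scheme.Modules.Hom.app_smul ρ r s

theorem secMap_secRes {W W' : S.Opens} (h : W' ≤ W) (s : Γ(M, W)) :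
    secMap j ρ W' (secRes M h s) = secRes M' (j.preimage_mono h) (secMap j ρ W s) :=
  hom_app_secRes ρ h s

theorem app_funRes {W W' : S.Opens} (h : W' ≤ W) (r : Γ(S, W)) :
    (j.app W').hom (funRes S h r) = funRes S' (j.preimage_mono h) ((j.app W).hom r) :=
  congrArg (fun f => f.hom r) (j.naturality (homOfLE h).op)

theorem eq_top_of_locally_pow_mem {V : S.Opens} (hV : IsAffineOpen V) (J : Ideal Γ(S, V))
    (h : ∀ x ∈ V, ∃ g : Γ(S, V), (∃ N, g ^ N ∈ J) ∧ x ∈ S.basicOpen g) : J = ⊤ := by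
  obtain ⟨t, ht, hspan⟩ := exists_finset_basicOpen_cover hV (· ∈ J) fun x hx => by
    obtain ⟨g, ⟨N, hN⟩, hxg⟩ := h x hx
    refine ⟨g ^ (N + 1), by rw [pow_succ]; exact J.mul_mem_right _ hN, ?_⟩
    rw [S.basicOpen_pow _ N.succ_pos]
    exact hxg
  rw [eq_top_iff, ← hspan, Ideal.span_le]
  exact ht

variable {ρ}

/-- Over an affine open set, a vector bundle surjects onto its reduction. -/
theorem IsReduction.surjective (hρ : IsReduction j ρ) [IsAffineHom j] (hM : IsVectorBundle M)
    (hM' : IsVectorBundle M') {V : S.Opens} (hV : IsAffineOpen V) :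
    Function.Surjective (secMap j ρ V) := fun e => by
  -- The functions `r` for which `r • e` lifts form an ideal that contains powers of local
  -- generators.
  let J : Ideal Γ(S, V) :=
    { carrier := {r | ∃ s, secMap j ρ V s = ((j.app V).hom r : Γ(S', j ⁻¹ᵁ V)) • e}
      add_mem' := by
        rintro a b ⟨s, hs⟩ ⟨s', hs'⟩
        exact ⟨s + s', by rw [map_add, hs, hs', map_add, add_smul]⟩
      zero_mem' := ⟨0, by rw [map_zero, map_zero, zero_smul]⟩
      smul_mem' := by
        rintro c a ⟨s, hs⟩
        exact ⟨c • s, by rw [secMap_smul, hs, smul_smul, smul_eq_mul, map_mul]⟩ }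
  have hJ : J = ⊤ := eq_top_of_locally_pow_mem hV J fun x hx => by
    obtain ⟨W, hW, hxW, s, hs⟩ := hρ.1 V e x hx
    obtain ⟨g, hg, hxg⟩ := hV.exists_basicOpen_le (V := W) ⟨x, hxW⟩ hx
    have hgV := S.basicOpen_le g
    refine ⟨g, ?_, hxg⟩
    obtain ⟨N, t, ht⟩ := exists_pow_smul hM hV g rfl hgV (secRes M hg s)
    have hs' : secMap j ρ _ (secRes M hg s) = secRes M' (j.preimage_mono hgV) e := by
      rw [secMap_secRes]
      exact (congrArg _ hs).trans (secRes_secRes M' _ _ _)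
    obtain ⟨K, hK⟩ := pow_smul_eq_zero hM' (hV.preimage j) ((j.app V).hom g)
      (Scheme.preimage_basicOpen j g) (j.preimage_mono hgV)
      (secMap j ρ V t - ((j.app V).hom (g ^ N) : Γ(S', j ⁻¹ᵁ V)) • e) (by
        rw [map_sub, ← secMap_secRes ρ hgV, ht, secMap_smul, secRes_smul, hs', ← app_funRes hgV, map_pow, map_pow, map_pow,
          sub_self])
    refine ⟨K + N, g ^ K • t, ?_⟩
    rw [smul_sub, sub_eq_zero, ← map_pow, smul_smul, ← map_mul, ← pow_add] at hK
    rw [secMap_smul, hK]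
  obtain ⟨s, hs⟩ : (1 : Γ(S, V)) ∈ J := by rw [hJ]; trivial
  exact ⟨s, by rw [hs, map_one, one_smul]⟩

theorem smul_top_restrict {V W : S.Opens} (h : W ≤ V) {s : Γ(M, V)}
    (hs : s ∈ RingHom.ker (j.app V).hom • (⊤ : Submodule Γ(S, V) Γ(M, V))) :
    secRes M h s ∈ RingHom.ker (j.app W).hom • (⊤ : Submodule Γ(S, W) Γ(M, W)) := by
  induction hs using Submodule.smul_induction_on' with
  | smul r hr n hn =>
    rw [secRes_smul]
    refine Submodule.smul_mem_smul ?_ trivial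
    rw [RingHom.mem_ker] at hr ⊢
    rw [app_funRes, hr, map_zero]
  | add x hx y hy ihx ihy => rw [map_add]; exact add_mem ihx ihy

/-- Over an affine open set, the kernel of the reduction is generated by the ideal. -/
theorem IsReduction.mem_smul_top (hρ : IsReduction j ρ) [IsAffineHom j] (hM : IsVectorBundle M)
    {V : S.Opens} (hV : IsAffineOpen V) (s : Γ(M, V)) (hs : secMap j ρ V s = 0) :
    s ∈ RingHom.ker (j.app V).hom • (⊤ : Submodule Γ(S, V) Γ(M, V)) := by
  set K := RingHom.ker (j.app V).hom • (⊤ : Submodule Γ(S, V) Γ(M, V)) with hK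
  -- The functions `r` with `r • s ∈ K`.
  let J : Ideal Γ(S, V) := K.comap (LinearMap.toSpanSingleton Γ(S, V) Γ(M, V) s)
  have hJ : J = ⊤ := eq_top_of_locally_pow_mem hV J fun x hx => by
    obtain ⟨W, hW, hxW, hsW⟩ := hρ.2 V s hs x hx
    obtain ⟨g, hg, hxg⟩ := hV.exists_basicOpen_le (V := W) ⟨x, hxW⟩ hx
    have hgV := S.basicOpen_le g
    refine ⟨g, ?_, hxg⟩
    have hs' : secRes M hgV s ∈ RingHom.ker (j.app (S.basicOpen g)).hom •
        (⊤ : Submodule Γ(S, S.basicOpen g) Γ(M, S.basicOpen g)) := by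
      have := smul_top_restrict hg hsW
      change secRes M hg (secRes M hW s) ∈ _ at this
      rwa [secRes_secRes] at this
    -- elements of the submodule over the basic open set extend, up to powers of `g`
    have key : ∀ y ∈ RingHom.ker (j.app (S.basicOpen g)).hom •
        (⊤ : Submodule Γ(S, S.basicOpen g) Γ(M, S.basicOpen g)),
        ∃ (N : ℕ), ∃ k ∈ K, secRes M hgV k = funRes S hgV g ^ N • y := fun y hy => by
      induction hy using Submodule.smul_induction_on' with
      | smul r hr n hn =>
        obtain ⟨N, a, ha⟩ := fun_exists_pow_mul hV g rfl hgV r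
        obtain ⟨N', t, ht⟩ := exists_pow_smul hM hV g rfl hgV n
        obtain ⟨L, hL⟩ := fun_pow_mul_eq_zero (hV.preimage j) ((j.app V).hom g)
          (Scheme.preimage_basicOpen j g) (j.preimage_mono hgV) ((j.app V).hom a) (by
            rw [RingHom.mem_ker] at hr
            rw [← app_funRes hgV, ha, map_mul, hr, mul_zero])
        refine ⟨L + N + N', (g ^ L * a) • t, Submodule.smul_mem_smul ?_ trivial, ?_⟩
        · rw [RingHom.mem_ker, map_mul, map_pow, hL]
        · rw [secRes_smul, map_mul, ha, ht, smul_smul, smul_smul, map_pow]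
          congr 1
          ring
      | add y hy y' hy' ih ih' =>
        obtain ⟨N, k, hk, e⟩ := ih
        obtain ⟨N', k', hk', e'⟩ := ih'
        refine ⟨N + N', g ^ N' • k + g ^ N • k', add_mem (K.smul_mem _ hk) (K.smul_mem _ hk'), ?_⟩
        rw [map_add, secRes_smul, secRes_smul, e, e', map_pow, map_pow, smul_smul, smul_smul,
          smul_add, pow_add, mul_comm]
    obtain ⟨N, k, hk, e⟩ := key _ hs'
    obtain ⟨L, hL⟩ := pow_smul_eq_zero hM hV g rfl hgV (g ^ N • s - k) (by
      rw [map_sub, secRes_smul, e, map_pow, sub_self])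
    refine ⟨L + N, ?_⟩
    rw [smul_sub, sub_eq_zero, smul_smul, ← pow_add] at hL
    change g ^ (L + N) • s ∈ K
    rw [hL]
    exact K.smul_mem _ hk
  have h1 : (1 : Γ(S, V)) ∈ J := by rw [hJ]; trivial
  have : (1 : Γ(S, V)) • s ∈ K := h1
  rwa [one_smul] at this

end Reduction
end CechExt

namespace CechExt

/-! ### Modules over the truncated symmetric algebra -/

section FilMod

variable {A : Type u} [CommRing A] {N : Type u} [AddCommGroup N] [Module A N]
  {E : Type u} [AddCommGroup E] [Module A E]

theorem SymSq.induction_on {p : SymSq A N → Prop} (t : SymSq A N) (h0 : p 0)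
    (hmul : ∀ x y : N, p (SymSq.mul x y)) (hadd : ∀ t t', p t → p t' → p (t + t')) : p t := by
  obtain ⟨u, rfl⟩ := Submodule.mkQ_surjective _ t
  induction u using TensorProduct.induction_on with
  | zero => rw [map_zero]; exact h0
  | tmul x y => exact hmul x y
  | add x y hx hy => rw [map_add]; exact hadd _ _ hx hy

theorem nMul_tmul (n n' : N) (e : E) : nMul n (n' ⊗ₜ[A] e) = SymSq.mul n n' ⊗ₜ[A] e := rfl

theorem nMul_add_left (n n' : N) (x : N ⊗[A] E) : nMul (n + n') x = nMul n x + nMul n' x := by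
  simp only [nMul, map_add, LinearMap.rTensor_add, LinearMap.add_apply]

theorem nMul_smul_left (f : A) (n : N) (x : N ⊗[A] E) : nMul (f • n) x = f • nMul n x := by
  simp only [nMul, map_smul, LinearMap.rTensor_smul, LinearMap.smul_apply]

theorem nMul_zero_left (x : N ⊗[A] E) : nMul (0 : N) x = 0 := by
  simp only [nMul, map_zero, LinearMap.rTensor_zero, LinearMap.zero_apply]

theorem extLin_tmul (m : E →ₗ[A] N ⊗[A] E) (n : N) (e : E) :
    extLin m (n ⊗ₜ[A] e) = nMul n (m e) := by
  change LinearMap.rTensor E (SymSq.mk A N)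
    ((TensorProduct.assoc A N N E).symm (n ⊗ₜ[A] m e)) = nMul n (m e)
  induction m e using TensorProduct.induction_on with
  | zero => simp
  | tmul n' e' => rfl
  | add x y hx hy => rw [TensorProduct.tmul_add, map_add, map_add, map_add, hx, hy]

namespace Trunc

theorem act1_add (r : Trunc A N) (x y : E × (N ⊗[A] E)) :
    r.act1 (x + y) = r.act1 x + r.act1 y := by
  refine Prod.ext (smul_add _ _ _) ?_
  change r.c0 • (x.2 + y.2) + r.c1 ⊗ₜ[A] (x.1 + y.1) =
    (r.c0 • x.2 + r.c1 ⊗ₜ[A] x.1) + (r.c0 • y.2 + r.c1 ⊗ₜ[A] y.1)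
  rw [smul_add, TensorProduct.tmul_add]; abel

theorem one_act1 (x : E × (N ⊗[A] E)) : (1 : Trunc A N).act1 x = x := by simp [act1]

theorem zero_act1 (x : E × (N ⊗[A] E)) : (0 : Trunc A N).act1 x = 0 := by simp [act1]

theorem add_act1 (r s : Trunc A N) (x : E × (N ⊗[A] E)) :
    (r + s).act1 x = r.act1 x + s.act1 x := by
  refine Prod.ext (add_smul _ _ _) ?_
  change (r.c0 + s.c0) • x.2 + (r.c1 + s.c1) ⊗ₜ[A] x.1 =
    (r.c0 • x.2 + r.c1 ⊗ₜ[A] x.1) + (s.c0 • x.2 + s.c1 ⊗ₜ[A] x.1)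
  rw [add_smul, TensorProduct.add_tmul]; abel

theorem mul_act1 (r s : Trunc A N) (x : E × (N ⊗[A] E)) :
    (r * s).act1 x = r.act1 (s.act1 x) := by
  refine Prod.ext (mul_smul _ _ _) ?_
  change (r.c0 * s.c0) • x.2 + (r.c0 • s.c1 + s.c0 • r.c1) ⊗ₜ[A] x.1 =
    r.c0 • (s.c0 • x.2 + s.c1 ⊗ₜ[A] x.1) + r.c1 ⊗ₜ[A] (s.c0 • x.1)
  rw [mul_smul, TensorProduct.add_tmul, smul_add, TensorProduct.smul_tmul', TensorProduct.tmul_smul,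
    ← TensorProduct.smul_tmul' s.c0]; abel

theorem act2_add (r : Trunc A N) (x y : E × (N ⊗[A] E) × (SymSq A N ⊗[A] E)) :
    r.act2 (x + y) = r.act2 x + r.act2 y := by
  refine Prod.ext (smul_add _ _ _) (Prod.ext ?_ ?_)
  · change r.c0 • (x.2.1 + y.2.1) + r.c1 ⊗ₜ[A] (x.1 + y.1) =
      (r.c0 • x.2.1 + r.c1 ⊗ₜ[A] x.1) + (r.c0 • y.2.1 + r.c1 ⊗ₜ[A] y.1)
    rw [smul_add, TensorProduct.tmul_add]; abel
  · change r.c0 • (x.2.2 + y.2.2) + nMul r.c1 (x.2.1 + y.2.1) + r.c2 ⊗ₜ[A] (x.1 + y.1) =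
      (r.c0 • x.2.2 + nMul r.c1 x.2.1 + r.c2 ⊗ₜ[A] x.1) +
        (r.c0 • y.2.2 + nMul r.c1 y.2.1 + r.c2 ⊗ₜ[A] y.1)
    rw [smul_add, TensorProduct.tmul_add, map_add]; abel

theorem one_act2 (x : E × (N ⊗[A] E) × (SymSq A N ⊗[A] E)) : (1 : Trunc A N).act2 x = x := by
  simp [act2, nMul_zero_left]

theorem zero_act2 (x : E × (N ⊗[A] E) × (SymSq A N ⊗[A] E)) : (0 : Trunc A N).act2 x = 0 := by
  simp [act2, nMul_zero_left]

theorem add_act2 (r s : Trunc A N) (x : E × (N ⊗[A] E) × (SymSq A N ⊗[A] E)) :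
    (r + s).act2 x = r.act2 x + s.act2 x := by
  refine Prod.ext (add_smul _ _ _) (Prod.ext ?_ ?_)
  · change (r.c0 + s.c0) • x.2.1 + (r.c1 + s.c1) ⊗ₜ[A] x.1 =
      (r.c0 • x.2.1 + r.c1 ⊗ₜ[A] x.1) + (s.c0 • x.2.1 + s.c1 ⊗ₜ[A] x.1)
    rw [add_smul, TensorProduct.add_tmul]; abel
  · change (r.c0 + s.c0) • x.2.2 + nMul (r.c1 + s.c1) x.2.1 + (r.c2 + s.c2) ⊗ₜ[A] x.1 =
      (r.c0 • x.2.2 + nMul r.c1 x.2.1 + r.c2 ⊗ₜ[A] x.1) +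
        (s.c0 • x.2.2 + nMul s.c1 x.2.1 + s.c2 ⊗ₜ[A] x.1)
    rw [add_smul, TensorProduct.add_tmul, nMul_add_left]; abel

theorem mul_act2 (r s : Trunc A N) (x : E × (N ⊗[A] E) × (SymSq A N ⊗[A] E)) :
    (r * s).act2 x = r.act2 (s.act2 x) := by
  refine Prod.ext (mul_smul _ _ _) (Prod.ext ?_ ?_)
  · change (r.c0 * s.c0) • x.2.1 + (r.c0 • s.c1 + s.c0 • r.c1) ⊗ₜ[A] x.1 =
      r.c0 • (s.c0 • x.2.1 + s.c1 ⊗ₜ[A] x.1) + r.c1 ⊗ₜ[A] (s.c0 • x.1)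
    rw [mul_smul, TensorProduct.add_tmul, smul_add, TensorProduct.smul_tmul',
      TensorProduct.tmul_smul, ← TensorProduct.smul_tmul' s.c0]; abel
  · change (r.c0 * s.c0) • x.2.2 + nMul (r.c0 • s.c1 + s.c0 • r.c1) x.2.1 +
        (r.c0 • s.c2 + s.c0 • r.c2 + SymSq.mul r.c1 s.c1) ⊗ₜ[A] x.1 =
      r.c0 • (s.c0 • x.2.2 + nMul s.c1 x.2.1 + s.c2 ⊗ₜ[A] x.1) +
        nMul r.c1 (s.c0 • x.2.1 + s.c1 ⊗ₜ[A] x.1) + r.c2 ⊗ₜ[A] (s.c0 • x.1)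
    simp only [mul_smul, TensorProduct.add_tmul, smul_add, map_add, map_smul, nMul_add_left,
      nMul_smul_left, nMul_tmul, TensorProduct.tmul_smul, ← TensorProduct.smul_tmul']
    abel

end Trunc

variable (A N E) in
/-- `A ⊕ N` acts on `(A ⊕ N) ⊗ E`. -/
def act1Hom : Trunc A N →+* AddMonoid.End (E × (N ⊗[A] E)) where
  toFun r := AddMonoidHom.mk' (r.act1) r.act1_add
  map_one' := AddMonoidHom.ext Trunc.one_act1
  map_zero' := AddMonoidHom.ext Trunc.zero_act1
  map_add' r s := AddMonoidHom.ext (Trunc.add_act1 r s)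
  map_mul' r s := AddMonoidHom.ext (Trunc.mul_act1 r s)

variable (A N E) in
/-- `Sym^{≤ 2} N` acts on `Sym^{≤ 2} N ⊗ E`. -/
def act2Hom : Trunc A N →+* AddMonoid.End (E × (N ⊗[A] E) × (SymSq A N ⊗[A] E)) where
  toFun r := AddMonoidHom.mk' (r.act2) r.act2_add
  map_one' := AddMonoidHom.ext Trunc.one_act2
  map_zero' := AddMonoidHom.ext Trunc.zero_act2
  map_add' r s := AddMonoidHom.ext (Trunc.add_act2 r s)
  map_mul' r s := AddMonoidHom.ext (Trunc.mul_act2 r s)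

/-- A filtered module over `Sym^{≤ 2} N` that is generated by a copy of the module `E` of degree
`0`, together with its part of top degree `K`. -/
structure FilMod (A N E K X : Type u) [CommRing A] [AddCommGroup N] [Module A N]
    [AddCommGroup E] [Module A E] [AddCommGroup K] [Module A K] [AddCommGroup X] where
  act : Trunc A N →+* AddMonoid.End X
  p : X →+ E
  sec : E →+ X
  inc : K →+ X
  inc_injective : Function.Injective inc
  p_inc : ∀ ν, p (inc ν) = 0
  p_sec : ∀ e, p (sec e) = e
  p_act : ∀ r x, p (act r x) = r.c0 • p x
  act_inc : ∀ r ν, act r (inc ν) = inc (r.c0 • ν)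
  act_sec : ∀ (f : A) e, act ⟨f, 0, 0⟩ (sec e) = sec (f • e)
  gen : ∀ x, x ∈ AddSubgroup.closure {y | ∃ r e, y = act r (sec e)}

/-- `(A ⊕ N) ⊗ E`. -/
def filMod1 (A N E : Type u) [CommRing A] [AddCommGroup N] [Module A N]
    [AddCommGroup E] [Module A E] : FilMod A N E (N ⊗[A] E) (E × (N ⊗[A] E)) where
  act := act1Hom A N E
  p := AddMonoidHom.fst _ _
  sec := AddMonoidHom.inl _ _
  inc := AddMonoidHom.inr _ _
  inc_injective := fun _ _ h => congrArg Prod.snd h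
  p_inc _ := rfl
  p_sec _ := rfl
  p_act _ _ := rfl
  act_inc r ν := by
    change r.act1 (0, ν) = (0, r.c0 • ν)
    simp [Trunc.act1]
  act_sec f e := by
    change Trunc.act1 ⟨f, 0, 0⟩ (e, 0) = (f • e, 0)
    simp [Trunc.act1]
  gen := by
    rintro ⟨e, x⟩
    have h1 : ((e, 0) : E × (N ⊗[A] E)) ∈ AddSubgroup.closure {y : E × (N ⊗[A] E) |
        ∃ (r : Trunc A N) (e : E), y = act1Hom A N E r (AddMonoidHom.inl _ _ e)} :=
      AddSubgroup.subset_closure ⟨1, e, by rw [map_one]; rfl⟩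
    have h2 : ((0, x) : E × (N ⊗[A] E)) ∈ AddSubgroup.closure {y : E × (N ⊗[A] E) |
        ∃ (r : Trunc A N) (e : E), y = act1Hom A N E r (AddMonoidHom.inl _ _ e)} := by
      induction x using TensorProduct.induction_on with
      | zero => exact zero_mem _
      | tmul n e' =>
        refine AddSubgroup.subset_closure ⟨⟨0, n, 0⟩, e', ?_⟩
        change _ = Trunc.act1 ⟨0, n, 0⟩ (e', 0)
        simp [Trunc.act1]
      | add x y hx hy =>
        have := add_mem hx hy
        rwa [Prod.mk_add_mk, add_zero] at this
    have := add_mem h1 h2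
    rwa [Prod.mk_add_mk, add_zero, zero_add] at this

/-- `Sym^{≤ 2} N ⊗ E`. -/
def filMod2 (A N E : Type u) [CommRing A] [AddCommGroup N] [Module A N]
    [AddCommGroup E] [Module A E] :
    FilMod A N E (SymSq A N ⊗[A] E) (E × (N ⊗[A] E) × (SymSq A N ⊗[A] E)) where
  act := act2Hom A N E
  p := AddMonoidHom.fst _ _
  sec := AddMonoidHom.inl _ _
  inc := (AddMonoidHom.inr _ _).comp (AddMonoidHom.inr _ _)
  inc_injective := fun _ _ h => congrArg (fun t => t.2.2) h
  p_inc _ := rfl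
  p_sec _ := rfl
  p_act _ _ := rfl
  act_inc r ν := by
    change r.act2 (0, 0, ν) = (0, 0, r.c0 • ν)
    simp [Trunc.act2]
  act_sec f e := by
    change Trunc.act2 ⟨f, 0, 0⟩ (e, 0, 0) = (f • e, 0, 0)
    simp [Trunc.act2]
  gen := by
    rintro ⟨e, x, y⟩
    set C := AddSubgroup.closure {y : E × (N ⊗[A] E) × (SymSq A N ⊗[A] E) |
        ∃ (r : Trunc A N) (e : E), y = act2Hom A N E r (AddMonoidHom.inl _ _ e)} with hC
    have h1 : ((e, 0, 0) : E × (N ⊗[A] E) × (SymSq A N ⊗[A] E)) ∈ C :=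
      AddSubgroup.subset_closure ⟨1, e, by rw [map_one]; rfl⟩
    have h2 : ((0, x, 0) : E × (N ⊗[A] E) × (SymSq A N ⊗[A] E)) ∈ C := by
      induction x using TensorProduct.induction_on with
      | zero => exact zero_mem _
      | tmul n e' =>
        refine AddSubgroup.subset_closure ⟨⟨0, n, 0⟩, e', ?_⟩
        change _ = Trunc.act2 ⟨0, n, 0⟩ (e', 0, 0)
        simp [Trunc.act2]
      | add x y hx hy =>
        have := add_mem hx hy
        rwa [Prod.mk_add_mk, Prod.mk_add_mk, add_zero, add_zero] at this
    have h3 : ((0, 0, y) : E × (N ⊗[A] E) × (SymSq A N ⊗[A] E)) ∈ C := by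
      induction y using TensorProduct.induction_on with
      | zero => exact zero_mem _
      | tmul n e' =>
        refine AddSubgroup.subset_closure ⟨⟨0, 0, n⟩, e', ?_⟩
        change _ = Trunc.act2 ⟨0, 0, n⟩ (e', 0, 0)
        simp [Trunc.act2]
      | add x y hx hy =>
        have := add_mem hx hy
        rwa [Prod.mk_add_mk, Prod.mk_add_mk, add_zero, add_zero] at this
    have := add_mem (add_mem h1 h2) h3
    simpa using this

namespace FilMod

variable {K X : Type u} [AddCommGroup K] [Module A K] [AddCommGroup X] (F : FilMod A N E K X)

/-- Two maps that are semilinear over the same map `σ` and agree modulo the top degree differ by a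
linear map from degree `0` to the top degree. -/
theorem exists_linear (U U' : X →+ X) (σ : Trunc A N → Trunc A N) (hσ : ∀ r, (σ r).c0 = r.c0)
    (hact : ∀ r x, U (F.act r x) = F.act (σ r) (U x))
    (hact' : ∀ r x, U' (F.act r x) = F.act (σ r) (U' x))
    (hU : ∀ x, ∃ ν, U x = U' x + F.inc ν) :
    ∃ n : E →ₗ[A] K, ∀ x, U x = U' x + F.inc (n (F.p x)) := by
  -- The difference on the generators `F.sec e` is linear in `e`, and determines it everywhere.
  choose ν hν using fun e => hU (F.sec e)
  have add : ∀ e e', ν (e + e') = ν e + ν e' := fun e e' => by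
    apply F.inc_injective
    have := hν (e + e')
    rw [map_add, map_add, map_add, hν, hν] at this
    rw [map_add]
    refine (add_left_cancel (a := U' (F.sec e) + U' (F.sec e')) ?_).symm
    rw [← this]; abel
  have smul : ∀ (f : A) e, ν (f • e) = f • ν e := fun f e => by
    apply F.inc_injective
    have := hν (f • e)
    rw [← F.act_sec, hact, hact', hν, map_add, F.act_inc, hσ] at this
    exact (add_left_cancel this).symm
  have ν_zero : ν 0 = 0 := by simpa using smul 0 0
  refine ⟨{ toFun := ν, map_add' := add, map_smul' := smul }, fun x => ?_⟩
  have hx := F.gen x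
  induction hx using AddSubgroup.closure_induction with
  | mem x hx =>
    obtain ⟨r, e, rfl⟩ := hx
    rw [hact, hact', hν, map_add, F.act_inc, F.p_act, F.p_sec, hσ]
    congr 2
    exact (smul r.c0 e).symm
  | zero =>
    change U 0 = U' 0 + F.inc (ν (F.p 0))
    rw [map_zero, map_zero, map_zero, ν_zero, map_zero, add_zero]
  | add x y _ _ hx hy => rw [map_add, hx, hy, map_add, map_add, map_add, map_add]; abel
  | neg x _ hx => rw [map_neg, hx, map_neg, map_neg, map_neg, map_neg]; abel

theorem linear_unique {n n' : E →ₗ[A] K} (h : ∀ x, F.inc (n (F.p x)) = F.inc (n' (F.p x))) :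
    n = n' := by
  ext e
  have := F.inc_injective (h (F.sec e))
  rwa [F.p_sec] at this

end FilMod

end FilMod
end CechExt

namespace CechExt

/-! ### Exponentials of derivations -/

section Exponential

variable {κ : Type u} [Field κ] {A : Type u} [CommRing A] [Algebra κ A]
  {N : Type u} [AddCommGroup N] [Module A N] {E : Type u} [AddCommGroup E] [Module A E]

namespace FiltDer

/-- The automorphism `exp φ = 1 + φ + φ² / 2` of `Sym^{≤ 2} N`. -/
def exp (φ : FiltDer κ A N) (r : Trunc A N) : Trunc A N :=
  ⟨r.c0, r.c1 + φ.A1 r.c0,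
    r.c2 + φ.L1 r.c1 + φ.A2 r.c0 + half κ A • φ.L1 (φ.A1 r.c0)⟩

/-- An automorphism that is the identity on the associated graded algebra is the exponential of its
logarithm. -/
theorem exp_logAut [CharZero κ] (Φ : Trunc A N ≃+* Trunc A N)
    (h0 : ∀ x, (Φ x).c0 = x.c0) (h1 : ∀ n s, (Φ ⟨0, n, s⟩).c1 = n)
    (hc : ∀ c : κ, Φ ⟨algebraMap κ A c, 0, 0⟩ = ⟨algebraMap κ A c, 0, 0⟩) (r : Trunc A N) :
    (logAut Φ h0 h1 hc).exp r = Φ r := by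
  have top : ∀ s : SymSq A N, Φ ⟨0, 0, s⟩ = ⟨0, 0, s⟩ := fun s => by
    induction s using SymSq.induction_on with
    | h0 => exact map_zero Φ
    | hmul x y =>
      have e : (⟨0, 0, SymSq.mul x y⟩ : Trunc A N) = ⟨0, x, 0⟩ * ⟨0, y, 0⟩ := by
        ext <;> simp
      rw [e, map_mul]
      ext <;> simp [h0, h1]
    | hadd t t' ht ht' =>
      have e : (⟨0, 0, t + t'⟩ : Trunc A N) = ⟨0, 0, t⟩ + ⟨0, 0, t'⟩ := by
        ext <;> simp
      rw [e, map_add, ht, ht']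
  have e : r = ⟨r.c0, 0, 0⟩ + ⟨0, r.c1, 0⟩ + ⟨0, 0, r.c2⟩ := by ext <;> simp
  conv_rhs => rw [e, map_add, map_add, top]
  ext
  · simp [exp, h0]
  · simp only [exp, Trunc.add_c1, h1, add_zero]
    rw [add_comm]; rfl
  · simp only [exp, Trunc.add_c2]
    change r.c2 + (Φ ⟨0, r.c1, 0⟩).c2 + ((Φ ⟨r.c0, 0, 0⟩).c2 -
      half κ A • (Φ ⟨0, (Φ ⟨r.c0, 0, 0⟩).c1, 0⟩).c2) +
      half κ A • (Φ ⟨0, (Φ ⟨r.c0, 0, 0⟩).c1, 0⟩).c2 = _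
    abel

section Composition

variable {φ φ' φ'' : FiltDer κ A N}

theorem A1_of_exp_comp (h : ∀ r, φ''.exp r = φ.exp (φ'.exp r)) (f : A) : φ''.A1 f = φ.A1 f + φ'.A1 f := by
  have := congrArg Trunc.c1 (h ⟨f, 0, 0⟩)
  simp only [exp, zero_add] at this
  rw [this, add_comm]

theorem L1_of_exp_comp (h : ∀ r, φ''.exp r = φ.exp (φ'.exp r)) (n : N) : φ''.L1 n = φ.L1 n + φ'.L1 n := by
  have := congrArg Trunc.c2 (h ⟨0, n, 0⟩)
  simp only [exp, zero_add, map_zero, smul_zero, add_zero] at this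
  rw [this, add_comm]

/-- In degree `1` the Baker–Campbell–Hausdorff formula is additive. -/
theorem a1_of_exp_comp (h : ∀ r, φ''.exp r = φ.exp (φ'.exp r)) :
    φ''.a1 = φ.a1 + φ'.a1 := by
  refine LinearMap.ext fun ω => ?_
  have hω : ω ∈ Submodule.span A (Set.range (KaehlerDifferential.D κ A)) := by
    rw [KaehlerDifferential.span_range_derivation]; trivial
  induction hω using Submodule.span_induction with
  | mem x hx =>
    obtain ⟨f, rfl⟩ := hx
    rw [LinearMap.add_apply, a1_d, a1_d, a1_d, A1_of_exp_comp h]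
  | zero => rw [map_zero, map_zero]
  | add x y _ _ hx hy => rw [map_add, map_add, hx, hy]
  | smul a x _ hx => rw [map_smul, map_smul, hx]

variable [CharZero κ]

/-- In degree `2` the Baker–Campbell–Hausdorff formula contains half the commutator. -/
theorem A2_of_exp_comp (h : ∀ r, φ''.exp r = φ.exp (φ'.exp r)) (f : A) :
    φ''.A2 f = φ.A2 f + φ'.A2 f +
    half κ A • (φ.L1 (φ'.A1 f) - φ'.L1 (φ.A1 f)) := by
  have := congrArg Trunc.c2 (h ⟨f, 0, 0⟩)
  simp only [exp, zero_add, map_zero] at this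
  rw [A1_of_exp_comp h, L1_of_exp_comp h, map_add, map_add, smul_add, smul_add, smul_add] at this
  rw [smul_sub]
  have e := half_smul_add (κ := κ) (A := A) (φ.L1 (φ'.A1 f))
  rw [smul_add] at e
  have e2 := eq_sub_of_add_eq this
  rw [e2]
  nth_rewrite 1 [← e]
  abel

end Composition

end FiltDer

theorem half_add_half [CharZero κ] {M : Type u} [AddCommGroup M] [Module A M]
    (x : M) : half κ A • x + half κ A • x = x := by
  rw [← smul_add, half_smul_add]

/-- Operators `M¹ : E → N ⊗ E` and its extension `N ⊗ E → Sym² N ⊗ E` that satisfy the Leibniz rule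
over `φ¹`. -/
structure IsLeibniz1 (φ : FiltDer κ A N) (M : E →+ N ⊗[A] E)
    (Mx : N ⊗[A] E →+ SymSq A N ⊗[A] E) : Prop where
  smul : ∀ (f : A) e, M (f • e) = φ.A1 f ⊗ₜ e + f • M e
  tmul : ∀ n e, Mx (n ⊗ₜ e) = φ.L1 n ⊗ₜ e + nMul n (M e)

/-- An operator `M² : E → Sym² N ⊗ E` that satisfies the Leibniz rule over `φ²`. -/
def IsLeibniz2 (φ : FiltDer κ A N) (M : E →+ SymSq A N ⊗[A] E) : Prop :=
  ∀ (f : A) e, M (f • e) = φ.A2 f ⊗ₜ e + f • M e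

theorem IsLeibniz1.ext_smul {φ : FiltDer κ A N} {M : E →+ N ⊗[A] E}
    {Mx : N ⊗[A] E →+ SymSq A N ⊗[A] E} (h : IsLeibniz1 φ M Mx) (f : A) (x : N ⊗[A] E) :
    Mx (f • x) = nMul (φ.A1 f) x + f • Mx x := by
  induction x using TensorProduct.induction_on with
  | zero => simp
  | tmul n e =>
    rw [TensorProduct.smul_tmul', h.tmul, h.tmul, φ.L1_smul, nMul_smul_left, nMul_tmul,
      TensorProduct.add_tmul, smul_add, ← TensorProduct.smul_tmul']
    abel
  | add x y hx hy => rw [smul_add, map_add, hx, hy, map_add, map_add, smul_add]; abel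

/-- `exp ψ` on `(A ⊕ N) ⊗ E`, where the derivation `ψ` is given by `M` on `E`. -/
def exp1 (M : E →+ N ⊗[A] E) : E × (N ⊗[A] E) →+ E × (N ⊗[A] E) :=
  AddMonoidHom.mk' (fun x => (x.1, x.2 + M x.1)) (fun x y => Prod.ext rfl (by
    change x.2 + y.2 + M (x.1 + y.1) = (x.2 + M x.1) + (y.2 + M y.1)
    rw [map_add]; abel))

theorem exp1_act {φ : FiltDer κ A N} {M : E →+ N ⊗[A] E}
    (h : ∀ (f : A) e, M (f • e) = φ.A1 f ⊗ₜ e + f • M e) (r : Trunc A N)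
    (x : E × (N ⊗[A] E)) : exp1 M (r.act1 x) = (φ.exp r).act1 (exp1 M x) := by
  refine Prod.ext rfl ?_
  change r.c0 • x.2 + r.c1 ⊗ₜ[A] x.1 + M (r.c0 • x.1) =
    r.c0 • (x.2 + M x.1) + (r.c1 + φ.A1 r.c0) ⊗ₜ[A] x.1
  rw [h, smul_add, TensorProduct.add_tmul]; abel

variable (κ) in
/-- `exp ψ` on `Sym^{≤ 2} N ⊗ E`, where the derivation `ψ` is given by `M¹ + M²` on `E` and by `Mx`
on `N ⊗ E`. -/
def exp2 (M1 : E →+ N ⊗[A] E) (Mx : N ⊗[A] E →+ SymSq A N ⊗[A] E)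
    (M2 : E →+ SymSq A N ⊗[A] E) :
    E × (N ⊗[A] E) × (SymSq A N ⊗[A] E) →+ E × (N ⊗[A] E) × (SymSq A N ⊗[A] E) :=
  AddMonoidHom.mk' (fun x => (x.1, x.2.1 + M1 x.1,
      x.2.2 + M2 x.1 + Mx x.2.1 + half κ A • Mx (M1 x.1)))
    (fun x y => Prod.ext rfl (Prod.ext (by
      change x.2.1 + y.2.1 + M1 (x.1 + y.1) = (x.2.1 + M1 x.1) + (y.2.1 + M1 y.1)
      rw [map_add]; abel) (by
      change x.2.2 + y.2.2 + M2 (x.1 + y.1) + Mx (x.2.1 + y.2.1) +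
          half κ A • Mx (M1 (x.1 + y.1)) =
        (x.2.2 + M2 x.1 + Mx x.2.1 + half κ A • Mx (M1 x.1)) +
          (y.2.2 + M2 y.1 + Mx y.2.1 + half κ A • Mx (M1 y.1))
      simp only [map_add, smul_add]; abel)))

theorem exp2_act [CharZero κ] {φ : FiltDer κ A N} {M1 : E →+ N ⊗[A] E}
    {Mx : N ⊗[A] E →+ SymSq A N ⊗[A] E} {M2 : E →+ SymSq A N ⊗[A] E}
    (h1 : IsLeibniz1 φ M1 Mx) (h2 : IsLeibniz2 φ M2) (r : Trunc A N)
    (x : E × (N ⊗[A] E) × (SymSq A N ⊗[A] E)) :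
    exp2 κ M1 Mx M2 (r.act2 x) = (φ.exp r).act2 (exp2 κ M1 Mx M2 x) := by
  refine Prod.ext rfl (Prod.ext ?_ ?_)
  · change r.c0 • x.2.1 + r.c1 ⊗ₜ[A] x.1 + M1 (r.c0 • x.1) =
      r.c0 • (x.2.1 + M1 x.1) + (r.c1 + φ.A1 r.c0) ⊗ₜ[A] x.1
    rw [h1.smul, smul_add, TensorProduct.add_tmul]; abel
  · change r.c0 • x.2.2 + nMul r.c1 x.2.1 + r.c2 ⊗ₜ[A] x.1 + M2 (r.c0 • x.1) +
        Mx (r.c0 • x.2.1 + r.c1 ⊗ₜ[A] x.1) + half κ A • Mx (M1 (r.c0 • x.1)) =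
      r.c0 • (x.2.2 + M2 x.1 + Mx x.2.1 + half κ A • Mx (M1 x.1)) +
        nMul (r.c1 + φ.A1 r.c0) (x.2.1 + M1 x.1) +
        (r.c2 + φ.L1 r.c1 + φ.A2 r.c0 + half κ A • φ.L1 (φ.A1 r.c0)) ⊗ₜ[A] x.1
    rw [h1.smul, h2, map_add, h1.ext_smul, h1.tmul, map_add, h1.tmul, h1.ext_smul]
    simp only [smul_add, nMul_add_left, map_add, TensorProduct.add_tmul]
    have e := half_add_half (κ := κ) (A := A) (nMul (φ.A1 r.c0) (M1 x.1))
    rw [smul_comm r.c0 (half κ A), TensorProduct.smul_tmul']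
    nth_rewrite 3 [← e]
    abel

/-- The product of two exponentials, by the Baker–Campbell–Hausdorff formula. -/
theorem exp2_comp [CharZero κ] {φ φ' φ'' : FiltDer κ A N}
    {M1 M1' M1'' : E →+ N ⊗[A] E} {Mx Mx' Mx'' : N ⊗[A] E →+ SymSq A N ⊗[A] E}
    (h : IsLeibniz1 φ M1 Mx) (h' : IsLeibniz1 φ' M1' Mx') (h'' : IsLeibniz1 φ'' M1'' Mx'')
    (hφ : ∀ r, φ''.exp r = φ.exp (φ'.exp r))
    (hM : ∀ e, M1'' e = M1 e + M1' e) (M2 M2' M2'' : E →+ SymSq A N ⊗[A] E)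
    (x : E × (N ⊗[A] E) × (SymSq A N ⊗[A] E)) :
    exp2 κ M1 Mx M2 (exp2 κ M1' Mx' M2' x) = exp2 κ M1'' Mx'' M2'' x +
      (0, 0, M2 x.1 + M2' x.1 - M2'' x.1 +
        half κ A • (Mx (M1' x.1) - Mx' (M1 x.1))) := by
  have hx : ∀ y, Mx'' y = Mx y + Mx' y := fun y => by
    induction y using TensorProduct.induction_on with
    | zero => simp
    | tmul n e =>
      rw [h.tmul, h'.tmul, h''.tmul, hM, FiltDer.L1_of_exp_comp hφ, TensorProduct.add_tmul,
        map_add]; abel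
    | add x y hx hy => rw [map_add, hx, hy, map_add, map_add]; abel
  refine Prod.ext (add_zero _).symm (Prod.ext ?_ ?_)
  · change x.2.1 + M1' x.1 + M1 x.1 = x.2.1 + M1'' x.1 + 0
    rw [hM]; abel
  · change x.2.2 + M2' x.1 + Mx' x.2.1 + half κ A • Mx' (M1' x.1) + M2 x.1 +
        Mx (x.2.1 + M1' x.1) + half κ A • Mx (M1 x.1) =
      x.2.2 + M2'' x.1 + Mx'' x.2.1 + half κ A • Mx'' (M1'' x.1) +
        (M2 x.1 + M2' x.1 - M2'' x.1 + half κ A • (Mx (M1' x.1) - Mx' (M1 x.1)))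
    rw [hx, hx, hM]
    simp only [map_add, smul_add, smul_sub]
    have e := half_add_half (κ := κ) (A := A) (Mx (M1' x.1))
    nth_rewrite 1 [← e]
    abel

/-! ### Lifts of derivations by a connection -/

namespace FiltDer

variable (φ : FiltDer κ A N) {D : E →+ Ω[A⁄κ] ⊗[A] E}

theorem s1_smul (hD : IsConn κ D) (f : A) (e : E) :
    φ.s1 D (f • e) = φ.A1 f ⊗ₜ[A] e + f • φ.s1 D e := by
  change LinearMap.rTensor E φ.a1 (D (f • e)) = _
  rw [hD, map_add, LinearMap.rTensor_tmul, a1_d, map_smul]; rfl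

theorem s2_smul (hD : IsConn κ D) : IsLeibniz2 φ (φ.s2 D) := fun f e => by
  change LinearMap.rTensor E φ.a2 (D (f • e)) = _
  rw [hD, map_add, LinearMap.rTensor_tmul, a2_d, map_smul]; rfl

theorem s1ext_tmul (hD : IsConn κ D) (n : N) (e : E) :
    φ.s1ext D hD (n ⊗ₜ e) = φ.L1 n ⊗ₜ e + nMul n (φ.s1 D e) := rfl

theorem isLeibniz1 (hD : IsConn κ D) : IsLeibniz1 φ (φ.s1 D) (φ.s1ext D hD) :=
  ⟨φ.s1_smul hD, φ.s1ext_tmul hD⟩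

end FiltDer

theorem IsLeibniz1.add_linear {φ : FiltDer κ A N} {M : E →+ N ⊗[A] E}
    {Mx : N ⊗[A] E →+ SymSq A N ⊗[A] E} (h : IsLeibniz1 φ M Mx) (m : E →ₗ[A] N ⊗[A] E) :
    IsLeibniz1 φ (M + m.toAddMonoidHom) (Mx + (extLin m).toAddMonoidHom) where
  smul f e := by
    change M (f • e) + m (f • e) = _ + f • (M e + m e)
    rw [h.smul, map_smul, smul_add, add_assoc]
  tmul n e := by
    change Mx (n ⊗ₜ e) + extLin m (n ⊗ₜ e) = _ + nMul n (M e + m e)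
    rw [h.tmul, extLin_tmul, map_add, add_assoc]

end Exponential

end CechExt

namespace CechExt

/-! ### Flat connections and commutators -/

section Flat

variable {κ : Type u} [Field κ] {A : Type u} [CommRing A] [Algebra κ A]
  {N : Type u} [AddCommGroup N] [Module A N] {E : Type u} [AddCommGroup E] [Module A E]

theorem kaehler_hom_ext {M : Type u} [AddCommGroup M] [Module A M] {f g : Ω[A⁄κ] →ₗ[A] M}
    (h : ∀ a, f (KaehlerDifferential.D κ A a) = g (KaehlerDifferential.D κ A a)) : f = g := by
  refine LinearMap.ext fun ω => ?_
  have hω : ω ∈ Submodule.span A (Set.range (KaehlerDifferential.D κ A)) := by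
    rw [KaehlerDifferential.span_range_derivation]; trivial
  induction hω using Submodule.span_induction with
  | mem x hx => obtain ⟨a, rfl⟩ := hx; exact h a
  | zero => rw [map_zero, map_zero]
  | add x y _ _ hx hy => rw [map_add, map_add, hx, hy]
  | smul a x _ hx => rw [map_smul, map_smul, hx]

/-- Vector fields `X k` dual to generators `w k` of the differentials. They allow computing with
connections as in local coordinates. -/
theorem exists_derivation_dualBasis [Module.Finite A Ω[A⁄κ]] [Module.Projective A Ω[A⁄κ]] :
    ∃ (n : ℕ) (w : Fin n → Ω[A⁄κ]) (X : Fin n → Derivation κ A A),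
      ∀ ω, ∑ k, (X k).liftKaehlerDifferential ω • w k = ω := by
  obtain ⟨n, f, g, -, -, h⟩ := Module.Finite.exists_comp_eq_id_of_projective A Ω[A⁄κ]
  refine ⟨n, fun k => f (Pi.single k 1),
    fun k => ((LinearMap.proj k).comp g).compDer (KaehlerDifferential.D κ A), fun ω => ?_⟩
  have e : ∀ k, (((LinearMap.proj k).comp g).compDer
      (KaehlerDifferential.D κ A)).liftKaehlerDifferential = (LinearMap.proj k).comp g :=
    fun k => kaehler_hom_ext fun a => Derivation.liftKaehlerDifferential_comp_D _ _
  simp only [e]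
  conv_rhs => rw [← LinearMap.id_apply (R := A) ω, ← h, LinearMap.comp_apply,
    LinearMap.pi_apply_eq_sum_univ f]
  refine Finset.sum_congr rfl fun k _ => ?_
  congr 2
  ext i
  simp [Pi.single_apply, eq_comm]

variable {D : E →+ Ω[A⁄κ] ⊗[A] E}

theorem tmul_covDer {M : Type u} [AddCommGroup M] [Module A M] (s : M) (X : Derivation κ A A)
    (e : E) : s ⊗ₜ[A] covDer D X e = LinearMap.rTensor E
      ((LinearMap.toSpanSingleton A M s).comp X.liftKaehlerDifferential) (D e) := by
  change s ⊗ₜ[A] (TensorProduct.lid A E (LinearMap.rTensor E X.liftKaehlerDifferential (D e))) = _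
  induction D e using TensorProduct.induction_on with
  | zero => simp
  | tmul ω e =>
    rw [LinearMap.rTensor_tmul, LinearMap.rTensor_tmul, TensorProduct.lid_tmul,
      ← TensorProduct.smul_tmul]
    rfl
  | add x y hx hy => rw [map_add, map_add, TensorProduct.tmul_add, hx, hy, map_add]

theorem rTensor_eq_sum_covDer {M : Type u} [AddCommGroup M] [Module A M] {n : ℕ}
    {w : Fin n → Ω[A⁄κ]} {X : Fin n → Derivation κ A A}
    (h : ∀ ω, ∑ k, (X k).liftKaehlerDifferential ω • w k = ω) (a : Ω[A⁄κ] →ₗ[A] M) (e : E) :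
    LinearMap.rTensor E a (D e) = ∑ k, a (w k) ⊗ₜ[A] covDer D (X k) e := by
  have : a = ∑ k, (LinearMap.toSpanSingleton A M (a (w k))).comp
      (X k).liftKaehlerDifferential := by
    refine LinearMap.ext fun ω => ?_
    conv_lhs => rw [← h ω, map_sum]
    simp only [LinearMap.sum_apply, map_smul]
    rfl
  simp only [tmul_covDer]
  conv_lhs => rw [this]
  rw [← LinearMap.coe_rTensorHom, map_sum, LinearMap.sum_apply]

/-- For a flat connection, the commutator of the lifts of two derivations is the lift of their
commutator. As that commutator is twice the quadratic term of the Baker–Campbell–Hausdorff formula,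
the operators `a²∇` absorb it. -/
theorem s2_of_exp_comp [CharZero κ] [Module.Finite A Ω[A⁄κ]] [Module.Projective A Ω[A⁄κ]]
    {φ φ' φ'' : FiltDer κ A N} (hφ : ∀ r, φ''.exp r = φ.exp (φ'.exp r))
    (hD : IsConn κ D) (hflat : IsFlatConn κ D) (e : E) :
    φ''.s2 D e = φ.s2 D e + φ'.s2 D e +
      half κ A • (φ.s1ext D hD (φ'.s1 D e) - φ'.s1ext D hD (φ.s1 D e)) := by
  obtain ⟨n, w, X, hX⟩ := exists_derivation_dualBasis (κ := κ) (A := A)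
  have hs : ∀ (ψ : FiltDer κ A N) (e : E),
      ψ.s1 D e = ∑ k, ψ.a1 (w k) ⊗ₜ[A] covDer D (X k) e :=
    fun ψ e => rTensor_eq_sum_covDer hX ψ.a1 e
  have hA : ∀ (ψ : FiltDer κ A N) (f : A), ψ.A1 f = ∑ k, X k f • ψ.a1 (w k) := fun ψ f => by
    rw [← ψ.a1_d]
    conv_lhs => rw [← hX (KaehlerDifferential.D κ A f), map_sum]
    simp only [map_smul, Derivation.liftKaehlerDifferential_comp_D]
  have hss : ∀ ψ ψ' : FiltDer κ A N, ψ.s1ext D hD (ψ'.s1 D e) =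
      ∑ k, ψ.L1 (ψ'.a1 (w k)) ⊗ₜ[A] covDer D (X k) e +
        ∑ k, ∑ l, SymSq.mul (ψ'.a1 (w k)) (ψ.a1 (w l)) ⊗ₜ[A]
          covDer D (X l) (covDer D (X k) e) := fun ψ ψ' => by
    rw [hs ψ', map_sum, ← Finset.sum_add_distrib]
    refine Finset.sum_congr rfl fun k _ => ?_
    rw [ψ.s1ext_tmul, hs ψ, map_sum]
    rfl
  have hLL : ∀ (ψ ψ' : FiltDer κ A N) (f : A), ψ.L1 (ψ'.A1 f) =
      ∑ k, X k f • ψ.L1 (ψ'.a1 (w k)) +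
        ∑ k, ∑ l, X l (X k f) • SymSq.mul (ψ'.a1 (w k)) (ψ.a1 (w l)) := fun ψ ψ' f => by
    rw [hA ψ', map_sum, ← Finset.sum_add_distrib]
    refine Finset.sum_congr rfl fun k _ => ?_
    rw [ψ.L1_smul, hA ψ, map_sum, LinearMap.sum_apply]
    refine congrArg _ (Finset.sum_congr rfl fun l _ => ?_)
    rw [map_smul, LinearMap.smul_apply, SymSq.mul_comm]
  -- The commutator of the two derivations, as a linear map on differentials.
  let b : Ω[A⁄κ] →ₗ[A] SymSq A N :=
    ∑ k, (LinearMap.toSpanSingleton A _ (φ.L1 (φ'.a1 (w k)) - φ'.L1 (φ.a1 (w k)))).comp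
      (X k).liftKaehlerDifferential +
    ∑ k, ∑ l, (LinearMap.toSpanSingleton A _ (SymSq.mul (φ'.a1 (w k)) (φ.a1 (w l)))).comp
      (⁅X l, X k⁆ : Derivation κ A A).liftKaehlerDifferential
  have hb : LinearMap.rTensor E b (D e) =
      φ.s1ext D hD (φ'.s1 D e) - φ'.s1ext D hD (φ.s1 D e) := by
    rw [hss, hss]
    simp only [b, LinearMap.rTensor_add, ← LinearMap.coe_rTensorHom, map_sum, LinearMap.add_apply,
      LinearMap.sum_apply]
    -- The terms with second derivatives combine by flatness.
    have hbr : ∀ X X' : Derivation κ A A, covDer D ⁅X, X'⁆ e =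
        covDer D X (covDer D X' e) - covDer D X' (covDer D X e) := fun X X' => (hflat X X' e).symm
    simp only [LinearMap.coe_rTensorHom, ← tmul_covDer, hbr, TensorProduct.tmul_sub,
      TensorProduct.sub_tmul, Finset.sum_sub_distrib]
    rw [Finset.sum_comm (f := fun k l => SymSq.mul (φ'.a1 (w k)) (φ.a1 (w l)) ⊗ₜ[A]
      covDer D (X k) (covDer D (X l) e))]
    simp only [SymSq.mul_comm (A := A) (φ'.a1 _) (φ.a1 _)]
    abel
  have ha : φ''.a2 = φ.a2 + φ'.a2 + half κ A • b := by
    refine kaehler_hom_ext fun f => ?_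
    rw [LinearMap.add_apply, LinearMap.add_apply, LinearMap.smul_apply, φ.a2_d, φ'.a2_d, φ''.a2_d,
      FiltDer.A2_of_exp_comp hφ]
    congr 2
    rw [hLL, hLL]
    simp only [b, LinearMap.add_apply, LinearMap.sum_apply, LinearMap.comp_apply,
      Derivation.liftKaehlerDifferential_comp_D, LinearMap.toSpanSingleton_apply,
      Derivation.commutator_apply, sub_smul, smul_sub, Finset.sum_sub_distrib]
    rw [Finset.sum_comm (f := fun k l => X k (X l f) • SymSq.mul (φ'.a1 (w k)) (φ.a1 (w l)))]
    simp only [SymSq.mul_comm (A := A) (φ'.a1 _) (φ.a1 _)]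
    abel
  change LinearMap.rTensor E φ''.a2 (D e) = LinearMap.rTensor E φ.a2 (D e) +
    LinearMap.rTensor E φ'.a2 (D e) + _
  rw [ha, LinearMap.rTensor_add, LinearMap.rTensor_add, LinearMap.rTensor_smul, ← hb]
  rfl

theorem s1_eq_add_connDiff (φ : FiltDer κ A N) {D D' : E →+ Ω[A⁄κ] ⊗[A] E} (hD : IsConn κ D)
    (hD' : IsConn κ D') (e : E) :
    φ.s1 D e = φ.s1 D' e + LinearMap.rTensor E φ.a1 (connDiff D D' hD hD' e) := by
  change LinearMap.rTensor E φ.a1 (D e) = LinearMap.rTensor E φ.a1 (D' e) +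
    LinearMap.rTensor E φ.a1 (D e - D' e)
  rw [map_sub]; abel

theorem s2_eq_add_connDiff (φ : FiltDer κ A N) {D D' : E →+ Ω[A⁄κ] ⊗[A] E} (hD : IsConn κ D)
    (hD' : IsConn κ D') (e : E) :
    φ.s2 D e = φ.s2 D' e + LinearMap.rTensor E φ.a2 (connDiff D D' hD hD' e) := by
  change LinearMap.rTensor E φ.a2 (D e) = LinearMap.rTensor E φ.a2 (D' e) +
    LinearMap.rTensor E φ.a2 (D e - D' e)
  rw [map_sub]; abel

theorem s1ext_eq_add_connDiff (φ : FiltDer κ A N) {D D' : E →+ Ω[A⁄κ] ⊗[A] E} (hD : IsConn κ D)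
    (hD' : IsConn κ D') (x : N ⊗[A] E) :
    φ.s1ext D hD x = φ.s1ext D' hD' x +
      extLin ((LinearMap.rTensor E φ.a1).comp (connDiff D D' hD hD')) x := by
  induction x using TensorProduct.induction_on with
  | zero => simp
  | tmul n e =>
    rw [φ.s1ext_tmul, φ.s1ext_tmul, extLin_tmul, s1_eq_add_connDiff φ hD hD', map_add,
      LinearMap.comp_apply]; abel
  | add x y hx hy => rw [map_add, map_add, map_add, hx, hy]; abel

/-- The quadratic part of the failure of the exponentials of `a¹∇ + m¹ + a²∇` to be a cocycle. -/
theorem obstruction_formula [CharZero κ] [Module.Finite A Ω[A⁄κ]] [Module.Projective A Ω[A⁄κ]]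
    {φ φ' φ'' : FiltDer κ A N}
    (hφ : ∀ r, φ''.exp r = φ.exp (φ'.exp r)) {D D' : E →+ Ω[A⁄κ] ⊗[A] E} (hD : IsConn κ D)
    (hD' : IsConn κ D') (hflat : IsFlatConn κ D') (m m' : E →ₗ[A] N ⊗[A] E) (e : E) :
    φ.s2 D e + φ'.s2 D' e - φ''.s2 D' e +
      half κ A • ((φ.s1ext D hD + (extLin m).toAddMonoidHom)
          ((φ'.s1 D' + m'.toAddMonoidHom) e) -
        (φ'.s1ext D' hD' + (extLin m').toAddMonoidHom) ((φ.s1 D + m.toAddMonoidHom) e)) =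
    LinearMap.rTensor E φ.a2 (connDiff D D' hD hD' e) + half κ A • brLin m m' e +
      half κ A • φ.br D hD m' e - half κ A • φ'.br D' hD'
        (m + (LinearMap.rTensor E φ.a1).comp (connDiff D D' hD hD')) e := by
  -- All lifts are expressed by the connection `D'`, which is flat.
  set α := (LinearMap.rTensor E φ.a1).comp (connDiff D D' hD hD') with hα
  have h1 : φ.s1 D e = φ.s1 D' e + α e := s1_eq_add_connDiff φ hD hD' e
  have h2 : ∀ x, φ.s1ext D hD x = φ.s1ext D' hD' x + extLin α x := fun x =>
    s1ext_eq_add_connDiff φ hD hD' x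
  have h3 : ∀ x, extLin (m + α) x = extLin m x + extLin α x := fun x => by
    induction x using TensorProduct.induction_on with
    | zero => simp
    | tmul n e => rw [extLin_tmul, extLin_tmul, extLin_tmul, LinearMap.add_apply, map_add]
    | add x y hx hy => rw [map_add, map_add, map_add, hx, hy]; abel
  rw [s2_of_exp_comp hφ hD' hflat, s2_eq_add_connDiff φ hD hD']
  change _ + _ + _ - _ + half κ A • ((φ.s1ext D hD (φ'.s1 D' e + m' e) +
      extLin m (φ'.s1 D' e + m' e)) - (φ'.s1ext D' hD' (φ.s1 D e + m e) +
        extLin m' (φ.s1 D e + m e))) =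
    _ + half κ A • (extLin m (m' e) - extLin m' (m e)) +
      half κ A • (φ.s1ext D hD (m' e) - extLin m' (φ.s1 D e)) -
      half κ A • (φ'.s1ext D' hD' (m e + α e) - extLin (m + α) (φ'.s1 D' e))
  simp only [h1, h2, h3, map_add, smul_sub, smul_add]
  abel

end Flat

/-! ### Traces -/

section Trace

variable {κ : Type u} [Field κ] {A : Type u} [CommRing A]
  {N : Type u} [AddCommGroup N] [Module A N] {E : Type u} [AddCommGroup E] [Module A E]
  {M : Type u} [AddCommGroup M] [Module A M]

/-- The contraction `M ⊗ E → M` with a linear form on `E`. -/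
def contr (l : E →ₗ[A] A) : M ⊗[A] E →ₗ[A] M :=
  (TensorProduct.rid A M).toLinearMap.comp (LinearMap.lTensor M l)

theorem contr_tmul (l : E →ₗ[A] A) (x : M) (e : E) : contr l (x ⊗ₜ[A] e) = l e • x := rfl

/-- `(e_k, l_k)` is a dual basis of `E`. -/
def IsDualBasis {n : ℕ} (e : Fin n → E) (l : Fin n → E →ₗ[A] A) : Prop :=
  ∀ x, ∑ k, l k x • e k = x

variable {n : ℕ} {e : Fin n → E} {l : Fin n → E →ₗ[A] A}

theorem IsDualBasis.sum_contr_tmul (h : IsDualBasis e l) (x : M ⊗[A] E) :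
    ∑ k, contr (l k) x ⊗ₜ[A] e k = x := by
  induction x using TensorProduct.induction_on with
  | zero => simp
  | tmul m y =>
    simp only [contr_tmul, TensorProduct.smul_tmul]
    rw [← TensorProduct.tmul_sum, h]
  | add x y hx hy => simp only [map_add, TensorProduct.add_tmul, Finset.sum_add_distrib, hx, hy]

theorem IsDualBasis.sum_smul_contr (h : IsDualBasis e l) (l' : E →ₗ[A] A) (x : M ⊗[A] E) :
    ∑ k, l' (e k) • contr (l k) x = contr l' x := by
  conv_rhs => rw [← h.sum_contr_tmul x, map_sum]
  rfl

/-- The trace may be computed with any dual basis. -/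
theorem IsDualBasis.trc_eq (h : IsDualBasis e l) (m : E →ₗ[A] M ⊗[A] E) :
    trc M m = ∑ k, contr (l k) (m (e k)) := by
  classical
  have key : ∀ {n' : ℕ} {e' : Fin n' → E} {l' : Fin n' → E →ₗ[A] A}, IsDualBasis e' l' →
      ∑ k, contr (l' k) (m (e' k)) = ∑ k, contr (l k) (m (e k)) := fun {n' e' l'} h' => by
    have e1 : ∀ k, m (e' k) = ∑ j, l j (e' k) • m (e j) := fun k => by
      conv_lhs => rw [← h (e' k), map_sum]
      simp only [map_smul]
    simp only [e1, map_sum, map_smul]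
    rw [Finset.sum_comm]
    exact Finset.sum_congr rfl fun j _ => h'.sum_smul_contr (l j) (m (e j))
  have hex : ∃ n : ℕ, ∃ p : (Fin n → A) →ₗ[A] E, ∃ q : E →ₗ[A] (Fin n → A),
      p ∘ₗ q = LinearMap.id := by
    refine ⟨n, Fintype.linearCombination A e, LinearMap.pi l, LinearMap.ext fun x => ?_⟩
    exact h x
  rw [trc, dif_pos hex, LinearMap.sum_apply]
  refine key (e' := fun k => hex.choose_spec.choose (Pi.single k 1))
    (l' := fun k => (LinearMap.proj k).comp hex.choose_spec.choose_spec.choose) fun x => ?_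
  have := LinearMap.congr_fun hex.choose_spec.choose_spec.choose_spec x
  rw [LinearMap.comp_apply, LinearMap.pi_apply_eq_sum_univ] at this
  refine Eq.trans (Finset.sum_congr rfl fun k _ => ?_) this
  refine congrArg (fun t => _ • hex.choose_spec.choose t) (funext fun i => ?_)
  simp [Pi.single_apply, eq_comm]

theorem contr_rTensor {M' : Type u} [AddCommGroup M'] [Module A M'] (f : M →ₗ[A] M')
    (l : E →ₗ[A] A) (x : M ⊗[A] E) : contr l (LinearMap.rTensor E f x) = f (contr l x) := by
  induction x using TensorProduct.induction_on with
  | zero => simp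
  | tmul m y => rw [LinearMap.rTensor_tmul, contr_tmul, contr_tmul, map_smul]
  | add x y hx hy => rw [map_add, map_add, hx, hy, map_add, map_add]

theorem IsDualBasis.trc_rTensor {M' : Type u} [AddCommGroup M'] [Module A M']
    (h : IsDualBasis e l) (f : M →ₗ[A] M') (m : E →ₗ[A] M ⊗[A] E) :
    trc M' ((LinearMap.rTensor E f).comp m) = f (trc M m) := by
  rw [h.trc_eq, h.trc_eq, map_sum]
  exact Finset.sum_congr rfl fun k _ => contr_rTensor _ _ _

theorem contr_nMul (l : E →ₗ[A] A) (ν : N) (x : N ⊗[A] E) :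
    contr l (nMul ν x) = SymSq.mul ν (contr l x) := contr_rTensor _ _ _

theorem IsDualBasis.contr_extLin (h : IsDualBasis e l) (m : E →ₗ[A] N ⊗[A] E) (l' : E →ₗ[A] A)
    (x : N ⊗[A] E) :
    contr l' (extLin m x) = ∑ j, SymSq.mul (contr (l j) x) (contr l' (m (e j))) := by
  conv_lhs => rw [← h.sum_contr_tmul x, map_sum, map_sum]
  simp only [extLin_tmul, contr_nMul]

theorem IsDualBasis.sum_contr_brLin (h : IsDualBasis e l) (m m' : E →ₗ[A] N ⊗[A] E) :
    ∑ k, contr (l k) (brLin m m' (e k)) = 0 := by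
  have : ∀ k, contr (l k) (brLin m m' (e k)) =
      contr (l k) (extLin m (m' (e k))) - contr (l k) (extLin m' (m (e k))) := fun k =>
    map_sub _ _ _
  simp only [this, h.contr_extLin, Finset.sum_sub_distrib]
  rw [Finset.sum_comm, sub_eq_zero]
  simp only [SymSq.mul_comm (A := A) (contr _ (m' _)) _]

/-- The trace of the commutator of `m` with the lift of a derivation is the derivative of the trace
of `m`. -/
theorem IsDualBasis.sum_contr_br [Algebra κ A] (h : IsDualBasis e l) (φ : FiltDer κ A N)
    {D : E →+ Ω[A⁄κ] ⊗[A] E} (hD : IsConn κ D) (m : E →ₗ[A] N ⊗[A] E) :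
    ∑ k, contr (l k) (φ.br D hD m (e k)) = φ.L1 (trc N m) := by
  -- The Leibniz rule makes `y ↦ ⟨l, a¹∇ y⟩ - φ¹ ⟨l, y⟩` linear.
  let θ : Fin n → E →ₗ[A] N := fun k =>
    { toFun := fun y => contr (l k) (φ.s1 D y) - φ.A1 (l k y)
      map_add' := fun y y' => by simp only [map_add]; abel
      map_smul' := fun f y => by
        rw [φ.s1_smul hD, map_add, map_smul, contr_tmul, map_smul, smul_eq_mul, φ.A1_mul,
          RingHom.id_apply, smul_sub]
        abel }
  have hθ : ∀ k y, contr (l k) (φ.s1 D y) = θ k y + φ.A1 (l k y) := fun k y =>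
    (sub_add_cancel _ _).symm
  have e1 : ∀ k (x : N ⊗[A] E), contr (l k) (φ.s1ext D hD x) = φ.L1 (contr (l k) x) +
      ∑ j, SymSq.mul (contr (l j) x) (θ k (e j)) := fun k x => by
    induction x using TensorProduct.induction_on with
    | zero => simp
    | tmul ν y =>
      rw [φ.s1ext_tmul, map_add, contr_tmul, contr_tmul, contr_nMul, hθ, φ.L1_smul, map_add,
        SymSq.mul_comm (A := A) (φ.A1 _)]
      conv_lhs => rw [← h y, map_sum (θ k), map_sum (SymSq.mul ν)]
      simp only [contr_tmul, map_smul, LinearMap.smul_apply, h y]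
      abel
    | add x y hx hy =>
      simp only [map_add, hx, hy, LinearMap.add_apply, Finset.sum_add_distrib]; abel
  -- Expanding `e_k` in the dual basis inside `∑ ⟨l_k, m (a¹∇ e_k)⟩` reproduces this sum, and the
  -- derivatives of the coefficients `l_j e_k` are left over.
  have e2 : ∑ k, ∑ j, SymSq.mul (A := A) (φ.A1 (l j (e k))) (contr (l k) (m (e j))) = 0 := by
    have e3 : ∀ k, contr (l k) (extLin m (φ.s1 D (e k))) =
        ∑ j, SymSq.mul (A := A) (φ.A1 (l j (e k))) (contr (l k) (m (e j))) +
          ∑ j, l j (e k) • contr (l k) (extLin m (φ.s1 D (e j))) := fun k => by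
      conv_lhs => rw [← h (e k), map_sum, map_sum, map_sum]
      rw [← Finset.sum_add_distrib]
      refine Finset.sum_congr rfl fun j _ => ?_
      rw [φ.s1_smul hD, map_add, map_add, extLin_tmul, contr_nMul, map_smul, map_smul]
    have e4 : ∑ k, ∑ j, l j (e k) • contr (l k) (extLin m (φ.s1 D (e j))) =
        ∑ j, contr (l j) (extLin m (φ.s1 D (e j))) := by
      rw [Finset.sum_comm]
      exact Finset.sum_congr rfl fun j _ => h.sum_smul_contr _ _
    have e5 := Finset.sum_congr (rfl : Finset.univ = Finset.univ) fun k _ => e3 k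
    rw [Finset.sum_add_distrib, e4] at e5
    exact left_eq_add.1 (e5.trans (add_comm _ _))
  have e6 : ∀ k, contr (l k) (φ.br D hD m (e k)) =
      contr (l k) (φ.s1ext D hD (m (e k))) - contr (l k) (extLin m (φ.s1 D (e k))) := fun k =>
    map_sub _ _ _
  simp only [e6, e1, h.contr_extLin, hθ, map_add, LinearMap.add_apply, Finset.sum_sub_distrib,
    Finset.sum_add_distrib, e2, h.trc_eq, map_sum]
  rw [Finset.sum_comm (f := fun k j => SymSq.mul (contr (l j) (m (e k))) (θ k (e j)))]
  have e8 : ∀ k j, SymSq.mul (A := A) (θ k (e j)) (contr (l j) (m (e k))) =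
      SymSq.mul (contr (l j) (m (e k))) (θ k (e j)) := fun k j => SymSq.mul_comm _ _
  simp only [e8]
  abel

end Trace

end CechExt

namespace CechExt
namespace SmoothPair

/-! ### Transition maps and their failure to be a cocycle -/

variable {κ : Type u} [Field κ] {P : SmoothPair κ}

section Sections

variable {F E : P.ModFam}

theorem endSheaf_ext {W : P.Y2.Opens} {m m' : (endSheaf F E).obj (.op W)}
    (h : ∀ V hV, ev m V hV = ev m' V hV) : m = m' :=
  Subtype.ext (funext fun V => h V.1 V.2)

theorem exists_endSheaf {W : P.Y2.Opens}
    (f : ∀ V : P.Aff, V.1 ≤ W → (E.obj V →ₗ[P.O V] F.obj V ⊗[P.O V] E.obj V))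
    (hf : ∀ (V V' : P.Aff) (hV : V.1 ≤ W) (h : V' ≤ V) x,
      resTensor F E h (f V hV x) = f V' (le_trans h hV) (E.res h x)) :
    ∃ m : (endSheaf F E).obj (.op W), ∀ V hV, ev m V hV = f V hV :=
  ⟨⟨fun V => f V.1 V.2, fun V V' h x => hf V.1 V'.1 V.2 h x⟩, fun _ _ => rfl⟩

theorem ev_nat {W : P.Y2.Opens} (m : (endSheaf F E).obj (.op W)) {V V' : P.Aff} (hV : V.1 ≤ W)
    (h : V' ≤ V) (x) : resTensor F E h (ev m V hV x) = ev m V' (le_trans h hV) (E.res h x) :=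
  Subtype.prop (p := (· ∈ endOn F E W)) m ⟨V, hV⟩ ⟨V', le_trans h hV⟩ h x

theorem ev_neg {W : P.Y2.Opens} (m : (endSheaf F E).obj (.op W)) (V : P.Aff) (h : V.1 ≤ W) :
    ev (-m) V h = -ev m V h := rfl

variable {ι : Type v} [LinearOrder ι] (U : ι → P.Aff)

theorem ev_d0 (n : C0 U (endSheaf F E)) (p : Ix2 ι) (V : P.Aff) (h : V.1 ≤ U2 U p) :
    ev (d0 U _ n p) V h =
      ev (n p.1.2) V (h.trans inf_le_right) - ev (n p.1.1) V (h.trans inf_le_left) := rfl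

theorem ev_d1 (m : C1 U (endSheaf F E)) (t : Ix3 ι) (V : P.Aff) (h : V.1 ≤ U3 U t) :
    ev (d1 U _ m t) V h = ev (m (jh t)) V (h.trans (U3_jh U t)) -
      ev (m (ih t)) V (h.trans (U3_ih U t)) + ev (m (ij t)) V (h.trans (U3_ij U t)) := rfl

theorem ev_d2 (z : C2 U (endSheaf F E)) {i j k l : ι} (hij : i < j) (hjk : j < k) (hkl : k < l)
    (V : P.Aff) (hi : V.1 ≤ (U i).1) (hj : V.1 ≤ (U j).1) (hk : V.1 ≤ (U k).1)
    (hl : V.1 ≤ (U l).1) :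
    ev (d2 U _ z ⟨(i, j, k, l), hij, hjk, hkl⟩) V (le_inf hi (le_inf hj (le_inf hk hl))) =
      ev (z ⟨(j, k, l), hjk, hkl⟩) V (le_inf hj (le_inf hk hl)) -
        ev (z ⟨(i, k, l), hij.trans hjk, hkl⟩) V (le_inf hi (le_inf hk hl)) +
        ev (z ⟨(i, j, l), hij, hjk.trans hkl⟩) V (le_inf hi (le_inf hj hl)) -
        ev (z ⟨(i, j, k), hij, hjk⟩) V (le_inf hi (le_inf hj hk)) := rfl

end Sections

/-- A family of filtered modules over `Sym^{≤ 2} N^*` generated by `E`, with top degree part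
`F ⊗ E`, and their restriction maps. -/
structure Model (F E : P.ModFam) where
  X : P.Aff → Type u
  [grp : ∀ V, AddCommGroup (X V)]
  fm : ∀ V, FilMod (P.O V) (P.con.obj V) (E.obj V) (F.obj V ⊗[P.O V] E.obj V) (X V)
  res : ∀ {V W : P.Aff}, W ≤ V → X V →+ X W
  res_self : ∀ (V : P.Aff) (x : X V), res le_rfl x = x
  res_res : ∀ {V V' V'' : P.Aff} (h : V' ≤ V) (h' : V'' ≤ V') (x : X V),
    res h' (res h x) = res (h'.trans h) x
  p_res : ∀ {V W : P.Aff} (h : W ≤ V) (x : X V), (fm W).p (res h x) = E.res h ((fm V).p x)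
  res_inc : ∀ {V W : P.Aff} (h : W ≤ V) (ν : F.obj V ⊗[P.O V] E.obj V),
    res h ((fm V).inc ν) = (fm W).inc (resTensor F E h ν)
  res_act : ∀ {V W : P.Aff} (h : W ≤ V) (r : Trunc (P.O V) (P.con.obj V)) (x : X V),
    res h ((fm V).act r x) = (fm W).act (Trunc.map (P.con.res h) r) (res h x)

attribute [instance] Model.grp

variable {F E : P.ModFam} {ι : Type v} [LinearOrder ι]

/-- The action of `𝒪⁽²⁾` on a model through the isomorphism `Φ_i`. -/
def Model.actR (L : Model F E) (C : CechData E ι) (i : ι) (V : P.Aff) (h : V.1 ≤ (C.U i).1) :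
    P.R V →+* AddMonoid.End (L.X V) :=
  (L.fm V).act.comp ((C.Φ i).app ⟨V, h⟩).toRingHom

theorem Model.actR_apply (L : Model F E) (C : CechData E ι) (i : ι) (V : P.Aff)
    (h : V.1 ≤ (C.U i).1) (r : P.R V) (x : L.X V) :
    L.actR C i V h r x = (L.fm V).act ((C.Φ i).app ⟨V, h⟩ r) x := rfl

theorem Model.res_actR (L : Model F E) (C : CechData E ι) (i : ι) {V W : P.Aff}
    (h : V.1 ≤ (C.U i).1) (hW : W ≤ V) (r : P.R V) (x : L.X V) :
    L.res hW (L.actR C i V h r x) = L.actR C i W (le_trans hW h) (P.resR hW r) (L.res hW x) := by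
  rw [L.actR_apply, L.res_act, L.actR_apply]
  congr 2
  exact ((C.Φ i).nat ⟨V, h⟩ ⟨W, le_trans hW h⟩ hW r).symm

/-- Transition maps between the copies of a model over the members of the covering: equivariant
maps that preserve the bottom and the top degree. -/
structure Transition (L : Model F E) (C : CechData E ι) where
  T : ∀ (p : Ix2 ι) (V : P.Aff), V.1 ≤ U2 C.U p → (L.X V →+ L.X V)
  act : ∀ p V h r x, T p V h (L.actR C p.1.2 V (h.trans inf_le_right) r x) =
    L.actR C p.1.1 V (h.trans inf_le_left) r (T p V h x)
  inc : ∀ p V h ν, T p V h ((L.fm V).inc ν) = (L.fm V).inc ν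
  p : ∀ p V h x, (L.fm V).p (T p V h x) = (L.fm V).p x
  nat : ∀ p V h (W : P.Aff) (hW : W ≤ V) x,
    L.res hW (T p V h x) = T p W (le_trans hW h) (L.res hW x)

namespace Transition

variable {L : Model F E} {C : CechData E ι}

theorem exists_linear {i k : ι} {V : P.Aff} (hi : V.1 ≤ (C.U i).1) (hk : V.1 ≤ (C.U k).1)
    (T T' : L.X V →+ L.X V)
    (hT : ∀ r x, T (L.actR C k V hk r x) = L.actR C i V hi r (T x))
    (hT' : ∀ r x, T' (L.actR C k V hk r x) = L.actR C i V hi r (T' x))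
    (h : ∀ x, ∃ ν, T x = T' x + (L.fm V).inc ν) :
    ∃ n : E.obj V →ₗ[P.O V] F.obj V ⊗[P.O V] E.obj V,
      ∀ x, T x = T' x + (L.fm V).inc (n ((L.fm V).p x)) := by
  refine (L.fm V).exists_linear T T'
    (fun r => (C.Φ i).app ⟨V, hi⟩ (((C.Φ k).app ⟨V, hk⟩).symm r)) (fun r => ?_) (fun r x => ?_)
    (fun r x => ?_) h
  · rw [(C.Φ i).gr0, ← (C.Φ k).gr0 ⟨V, hk⟩, RingEquiv.apply_symm_apply]
  · have := hT (((C.Φ k).app ⟨V, hk⟩).symm r) x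
    rwa [L.actR_apply, RingEquiv.apply_symm_apply] at this
  · have := hT' (((C.Φ k).app ⟨V, hk⟩).symm r) x
    rwa [L.actR_apply, RingEquiv.apply_symm_apply] at this

/-- Naturality of the linear maps of `exists_linear`. -/
theorem linear_nat {V W : P.Aff} (hW : W ≤ V) {T T' : L.X V →+ L.X V} {T₁ T₁' : L.X W →+ L.X W}
    (hT : ∀ x, L.res hW (T x) = T₁ (L.res hW x)) (hT' : ∀ x, L.res hW (T' x) = T₁' (L.res hW x))
    {n : E.obj V →ₗ[P.O V] F.obj V ⊗[P.O V] E.obj V}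
    {n₁ : E.obj W →ₗ[P.O W] F.obj W ⊗[P.O W] E.obj W}
    (h : ∀ x, T x = T' x + (L.fm V).inc (n ((L.fm V).p x)))
    (h₁ : ∀ x, T₁ x = T₁' x + (L.fm W).inc (n₁ ((L.fm W).p x))) (e : E.obj V) :
    resTensor F E hW (n e) = n₁ (E.res hW e) := by
  apply (L.fm W).inc_injective
  have e1 := congrArg (L.res hW) (h ((L.fm V).sec e))
  rw [hT, map_add, hT', h₁, L.res_inc, L.p_res, (L.fm V).p_sec] at e1
  exact (add_left_cancel e1).symm

theorem comp_act (T : Transition L C) (t : Ix3 ι) (V : P.Aff) (h : V.1 ≤ U3 C.U t) (r x) :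
    ((T.T (ij t) V (h.trans (U3_ij C.U t))).comp (T.T (jh t) V (h.trans (U3_jh C.U t))))
      (L.actR C t.1.2.2 V (h.trans (inf_le_right.trans inf_le_right)) r x) =
    L.actR C t.1.1 V (h.trans inf_le_left) r
      (((T.T (ij t) V (h.trans (U3_ij C.U t))).comp (T.T (jh t) V (h.trans (U3_jh C.U t)))) x) := by
  have e1 := T.act (jh t) V (h.trans (U3_jh C.U t)) r x
  have e2 := T.act (ij t) V (h.trans (U3_ij C.U t)) r (T.T (jh t) V (h.trans (U3_jh C.U t)) x)
  exact (congrArg (T.T (ij t) V (h.trans (U3_ij C.U t))) e1).trans e2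

/-- `z` is the failure of `T` to be a cocycle. -/
def IsDefect (T : Transition L C) (z : C2 C.U (endSheaf F E)) : Prop :=
  ∀ (t : Ix3 ι) (V : P.Aff) (h : V.1 ≤ U3 C.U t) x,
    T.T (ij t) V (h.trans (U3_ij C.U t)) (T.T (jh t) V (h.trans (U3_jh C.U t)) x) =
    T.T (ih t) V (h.trans (U3_ih C.U t)) x + (L.fm V).inc (ev (z t) V h ((L.fm V).p x))

/-- If a system of transition maps is a cocycle modulo the top degree, then its failure to be a cocycle
is a cochain of linear maps. -/
theorem exists_isDefect (T : Transition L C)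
    (hT : ∀ (t : Ix3 ι) (V : P.Aff) (h : V.1 ≤ U3 C.U t) x, ∃ ν, T.T (ij t) V (h.trans (U3_ij C.U t))
      (T.T (jh t) V (h.trans (U3_jh C.U t)) x) =
      T.T (ih t) V (h.trans (U3_ih C.U t)) x + (L.fm V).inc ν) : ∃ z, T.IsDefect z := by
  have key : ∀ t : Ix3 ι, ∃ z : (endSheaf F E).obj (.op (U3 C.U t)),
      ∀ (V : P.Aff) (h : V.1 ≤ U3 C.U t) x,
      T.T (ij t) V (h.trans (U3_ij C.U t)) (T.T (jh t) V (h.trans (U3_jh C.U t)) x) =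
      T.T (ih t) V (h.trans (U3_ih C.U t)) x + (L.fm V).inc (ev z V h ((L.fm V).p x)) := fun t => by
    choose n hn using fun (V : P.Aff) (h : V.1 ≤ U3 C.U t) =>
      exists_linear (h.trans inf_le_left) (h.trans (inf_le_right.trans inf_le_right))
        ((T.T (ij t) V (h.trans (U3_ij C.U t))).comp (T.T (jh t) V (h.trans (U3_jh C.U t))))
        (T.T (ih t) V (h.trans (U3_ih C.U t))) (T.comp_act t V h)
        (T.act (ih t) V (h.trans (U3_ih C.U t))) (hT t V h)
    obtain ⟨z, hz⟩ := exists_endSheaf n fun V V' hV h x =>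
      linear_nat h (fun x => by
        rw [AddMonoidHom.comp_apply, T.nat, T.nat]; rfl) (fun x => T.nat _ _ _ _ h x)
        (hn V hV) (hn V' (le_trans h hV)) x
    refine ⟨z, fun V h x => ?_⟩
    rw [hz]
    exact hn V h x
  choose z hz using key
  exact ⟨z, hz⟩

theorem IsDefect.unique {T : Transition L C} {z z' : C2 C.U (endSheaf F E)} (h : T.IsDefect z)
    (h' : T.IsDefect z') : z = z' := funext fun t => endSheaf_ext fun V hV => by
  refine (L.fm V).linear_unique fun x => ?_
  exact add_left_cancel ((h t V hV x).symm.trans (h' t V hV x))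

/-- The failure of transition maps to be a cocycle is a cocycle, by associativity. -/
theorem IsDefect.d2_eq_zero {T : Transition L C} {z : C2 C.U (endSheaf F E)} (h : T.IsDefect z) :
    d2 C.U _ z = 0 := by
  funext t
  refine endSheaf_ext fun V hV => (L.fm V).linear_unique fun x => ?_
  obtain ⟨⟨i, j, k, l⟩, hij, hjk, hkl⟩ := t
  have hi : V.1 ≤ (C.U i).1 := hV.trans inf_le_left
  have hj : V.1 ≤ (C.U j).1 := hV.trans (inf_le_right.trans inf_le_left)
  have hk : V.1 ≤ (C.U k).1 := hV.trans (inf_le_right.trans (inf_le_right.trans inf_le_left))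
  have hl : V.1 ≤ (C.U l).1 := hV.trans (inf_le_right.trans (inf_le_right.trans inf_le_right))
  -- The product `T_ij T_jk T_kl` is compared with `T_il` in two ways.
  have e1 : T.T ⟨(j, k), hjk⟩ V (le_inf hj hk) (T.T ⟨(k, l), hkl⟩ V (le_inf hk hl) x) = _ :=
    h ⟨(j, k, l), hjk, hkl⟩ V (le_inf hj (le_inf hk hl)) x
  have e2 : T.T ⟨(i, j), hij⟩ V (le_inf hi hj)
      (T.T ⟨(j, l), hjk.trans hkl⟩ V (le_inf hj hl) x) = _ :=
    h ⟨(i, j, l), hij, hjk.trans hkl⟩ V (le_inf hi (le_inf hj hl)) x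
  have e3 : T.T ⟨(i, k), hij.trans hjk⟩ V (le_inf hi hk)
      (T.T ⟨(k, l), hkl⟩ V (le_inf hk hl) x) = _ :=
    h ⟨(i, k, l), hij.trans hjk, hkl⟩ V (le_inf hi (le_inf hk hl)) x
  have e4 : T.T ⟨(i, j), hij⟩ V (le_inf hi hj) (T.T ⟨(j, k), hjk⟩ V (le_inf hj hk)
      (T.T ⟨(k, l), hkl⟩ V (le_inf hk hl) x)) =
      T.T ⟨(i, k), hij.trans hjk⟩ V (le_inf hi hk) (T.T ⟨(k, l), hkl⟩ V (le_inf hk hl) x) +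
        (L.fm V).inc (ev (z ⟨(i, j, k), hij, hjk⟩) V (le_inf hi (le_inf hj hk))
          ((L.fm V).p (T.T ⟨(k, l), hkl⟩ V (le_inf hk hl) x))) :=
    h ⟨(i, j, k), hij, hjk⟩ V (le_inf hi (le_inf hj hk)) _
  rw [e1, T.p, e3, map_add, T.inc] at e4
  have e5 := (congrArg (· + (L.fm V).inc (ev (z ⟨(j, k, l), hjk, hkl⟩) V
    (le_inf hj (le_inf hk hl)) ((L.fm V).p x))) e2).symm.trans e4
  have e6 : ∀ y a b c d : L.X V, y + c + a = y + b + d → a - b + c - d = 0 :=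
    fun y a b c d e => by
      rw [add_assoc, add_assoc] at e
      have := add_left_cancel e
      rw [sub_eq_zero, sub_add_eq_add_sub, sub_eq_iff_eq_add, add_comm d b, ← this, add_comm]
  have e7 : ev ((0 : C3 C.U (endSheaf F E)) ⟨(i, j, k, l), hij, hjk, hkl⟩) V hV = 0 := rfl
  rw [e7, ev_d2 C.U z hij hjk hkl V hi hj hk hl, LinearMap.zero_apply, LinearMap.sub_apply,
    LinearMap.add_apply, LinearMap.sub_apply, map_zero, map_sub, map_add, map_sub]
  exact e6 _ _ _ _ _ e5

/-- Modification of transition maps by a cochain. -/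
def twist (T : Transition L C) (m : C1 C.U (endSheaf F E)) : Transition L C where
  T p V h := T.T p V h +
    (L.fm V).inc.comp ((ev (m p) V h).toAddMonoidHom.comp (L.fm V).p)
  act p V h r x := by
    change T.T p V h _ + (L.fm V).inc (ev (m p) V h ((L.fm V).p _)) =
      L.actR C p.1.1 V _ r (T.T p V h x + (L.fm V).inc (ev (m p) V h ((L.fm V).p x)))
    rw [T.act, map_add, L.actR_apply, L.actR_apply, L.actR_apply, (L.fm V).p_act, (L.fm V).act_inc,
      map_smul, AlgTriv.gr0, AlgTriv.gr0]
  inc p V h ν := by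
    change T.T p V h _ + (L.fm V).inc (ev (m p) V h ((L.fm V).p _)) = _
    rw [T.inc, (L.fm V).p_inc, map_zero, map_zero, add_zero]
  p p V h x := by
    change (L.fm V).p (T.T p V h _ + (L.fm V).inc (ev (m p) V h ((L.fm V).p _))) = _
    rw [map_add, T.p, (L.fm V).p_inc, add_zero]
  nat p V h W hW x := by
    change L.res hW (T.T p V h x + (L.fm V).inc (ev (m p) V h ((L.fm V).p x))) =
      T.T p W _ (L.res hW x) + (L.fm W).inc (ev (m p) W _ ((L.fm W).p (L.res hW x)))
    rw [map_add, T.nat, L.res_inc, L.p_res, ev_nat]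

theorem twist_apply (T : Transition L C) (m : C1 C.U (endSheaf F E)) (p V h x) :
    (T.twist m).T p V h x = T.T p V h x + (L.fm V).inc (ev (m p) V h ((L.fm V).p x)) := rfl

/-- The cocycle condition. -/
def IsCocycle (T : Transition L C) : Prop :=
  ∀ (t : Ix3 ι) (V : P.Aff) (h : V.1 ≤ U3 C.U t) x,
    T.T (ij t) V (h.trans (U3_ij C.U t)) (T.T (jh t) V (h.trans (U3_jh C.U t)) x) =
    T.T (ih t) V (h.trans (U3_ih C.U t)) x

theorem IsDefect.twist {T : Transition L C} {z : C2 C.U (endSheaf F E)} (h : T.IsDefect z)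
    (m : C1 C.U (endSheaf F E)) : (T.twist m).IsDefect (z + d1 C.U _ m) := fun t V hV x => by
  rw [twist_apply, twist_apply, twist_apply, map_add, T.inc, h t V hV, map_add, T.p, (L.fm V).p_inc,
    add_zero]
  change _ = _ + (L.fm V).inc ((ev (z t) V hV + ev (d1 C.U _ m t) V hV) ((L.fm V).p x))
  rw [ev_d1, LinearMap.add_apply, LinearMap.add_apply, LinearMap.sub_apply, map_add, map_add,
    map_sub]
  abel

/-- Transition maps can be corrected to a cocycle exactly when the failure is a coboundary. -/
theorem IsDefect.twist_isCocycle_iff {T : Transition L C} {z : C2 C.U (endSheaf F E)}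
    (h : T.IsDefect z) (m : C1 C.U (endSheaf F E)) :
    (T.twist m).IsCocycle ↔ z = -d1 C.U _ m := by
  have h0 : (T.twist m).IsCocycle ↔ (T.twist m).IsDefect 0 := by
    refine forall₄_congr fun t V hV x => ?_
    change _ ↔ _ = _ + (L.fm V).inc ((0 : E.obj V →ₗ[P.O V] F.obj V ⊗[P.O V] E.obj V) _)
    rw [LinearMap.zero_apply, map_zero, add_zero]
  rw [h0, eq_neg_iff_add_eq_zero]
  exact ⟨fun h' => (h.twist m).unique h', fun e => e ▸ h.twist m⟩

/-- Transition maps that agree modulo the top degree differ by a cochain. -/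
theorem existsUnique_twist (T : Transition L C)
    (T' : ∀ (p : Ix2 ι) (V : P.Aff), V.1 ≤ U2 C.U p → (L.X V →+ L.X V))
    (hact : ∀ (p : Ix2 ι) (V : P.Aff) (h : V.1 ≤ U2 C.U p) r x, T' p V h (L.actR C p.1.2 V (h.trans inf_le_right) r x) =
      L.actR C p.1.1 V (h.trans inf_le_left) r (T' p V h x))
    (hnat : ∀ p V h (W : P.Aff) (hW : W ≤ V) x,
      L.res hW (T' p V h x) = T' p W (le_trans hW h) (L.res hW x))
    (hT : ∀ p V h x, ∃ ν, T' p V h x = T.T p V h x + (L.fm V).inc ν) :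
    ∃! m : C1 C.U (endSheaf F E), ∀ p V h x, T' p V h x = (T.twist m).T p V h x := by
  have key : ∀ p : Ix2 ι, ∃ m : (endSheaf F E).obj (.op (U2 C.U p)), ∀ V h x,
      T' p V h x = T.T p V h x + (L.fm V).inc (ev m V h ((L.fm V).p x)) := fun p => by
    choose n hn using fun (V : P.Aff) (h : V.1 ≤ U2 C.U p) =>
      exists_linear (h.trans inf_le_left) (h.trans inf_le_right) (T' p V h) (T.T p V h)
        (hact p V h) (T.act p V h) (hT p V h)
    obtain ⟨m, hm⟩ := exists_endSheaf n fun V V' hV h x =>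
      linear_nat h (fun x => hnat p V hV V' h x) (fun x => T.nat p V hV V' h x)
        (hn V hV) (hn V' (le_trans h hV)) x
    refine ⟨m, fun V h x => ?_⟩
    rw [hm]
    exact hn V h x
  choose m hm using key
  refine ⟨m, hm, fun m' hm' => funext fun p => endSheaf_ext fun V hV => ?_⟩
  refine (L.fm V).linear_unique fun x => ?_
  exact add_left_cancel ((hm' p V hV x).symm.trans (hm p V hV x))

end Transition

end SmoothPair
end CechExt

namespace CechExt

/-! ### Naturality -/

section Naturality

variable {κ : Type u} [Field κ] {A B : Type u} [CommRing A] [CommRing B]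
  {N N' : Type u} [AddCommGroup N] [Module A N] [AddCommGroup N'] [Module B N']
  {σ : A →+* B} (g : N →ₛₗ[σ] N')

theorem SymSq.map_mul (x y : N) :
    SymSq.map g (SymSq.mul (A := A) x y) = SymSq.mul (A := B) (g x) (g y) := rfl

theorem nMul_nat {E E' : Type u} [AddCommGroup E] [Module A E] [AddCommGroup E'] [Module B E']
    (k : E →ₛₗ[σ] E') (n : N) (x : N ⊗[A] E) :
    TensorProduct.map (SymSq.map g) k (nMul n x) = nMul (g n) (TensorProduct.map g k x) := by
  induction x using TensorProduct.induction_on with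
  | zero => simp
  | tmul n' e => rfl
  | add x y hx hy => rw [map_add, map_add, hx, hy, map_add, map_add]

variable [Algebra κ A] [Algebra κ B] {g} {φ : FiltDer κ A N} {φ' : FiltDer κ B N'}
  (h : ∀ x, Trunc.map g (φ.exp x) = φ'.exp (Trunc.map g x))

namespace FiltDer

theorem A1_nat (h : ∀ x, Trunc.map g (φ.exp x) = φ'.exp (Trunc.map g x)) (f : A) :
    g (φ.A1 f) = φ'.A1 (σ f) := by
  have := congrArg Trunc.c1 (h ⟨f, 0, 0⟩)
  simpa only [Trunc.map, exp, zero_add, map_zero] using this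

theorem L1_nat (h : ∀ x, Trunc.map g (φ.exp x) = φ'.exp (Trunc.map g x)) (n : N) :
    SymSq.map g (φ.L1 n) = φ'.L1 (g n) := by
  have := congrArg Trunc.c2 (h ⟨0, n, 0⟩)
  simpa only [Trunc.map, exp, zero_add, map_zero, add_zero, smul_zero] using this

theorem map_half (hσ : ∀ c : κ, σ (algebraMap κ A c) = algebraMap κ B c) :
    σ (half κ A) = half κ B := hσ _

theorem A2_nat (h : ∀ x, Trunc.map g (φ.exp x) = φ'.exp (Trunc.map g x))
    (hσ : ∀ c : κ, σ (algebraMap κ A c) = algebraMap κ B c) (f : A) :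
    SymSq.map g (φ.A2 f) = φ'.A2 (σ f) := by
  have := congrArg Trunc.c2 (h ⟨f, 0, 0⟩)
  simp only [Trunc.map, exp, zero_add, map_zero, add_zero, map_add, map_smulₛₗ, L1_nat h,
    A1_nat h, map_half hσ] at this
  exact add_right_cancel this

end FiltDer

end Naturality

namespace SmoothPair

variable {κ : Type u} [Field κ] {P : SmoothPair κ}

theorem resTensor_tmul (F E : P.ModFam) {V W : P.Aff} (h : W ≤ V) (x : F.obj V) (e : E.obj V) :
    resTensor F E h (x ⊗ₜ e) = F.res h x ⊗ₜ E.res h e := rfl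

theorem resR_self (V : P.Aff) (r : P.R V) : P.resR le_rfl r = r := funRes_self _ r

theorem resR_resR {V V' V'' : P.Aff} (h : V' ≤ V) (h' : V'' ≤ V') (r : P.R V) :
    P.resR h' (P.resR h r) = P.resR (h'.trans h) r := funRes_funRes _ _ r

/-- The restriction maps are functorial. -/
structure ModFam.IsPresheaf (F : P.ModFam) : Prop where
  res_self : ∀ (V : P.Aff) (x : F.obj V), F.res le_rfl x = x
  res_res : ∀ {V V' V'' : P.Aff} (h : V' ≤ V) (h' : V'' ≤ V') (x : F.obj V),
    F.res h' (F.res h x) = F.res (h'.trans h) x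

theorem ofModules_isPresheaf (E : P.X.Modules) : (ofModules E).IsPresheaf where
  res_self _ x := secRes_self E _ x
  res_res h h' x := secRes_secRes E (P.preX_mono h) (P.preX_mono h') x

theorem con_res_toCon {V W : P.Aff} (h : W ≤ V) (r : P.idl V) :
    P.con.res h (P.toCon V r) = P.toCon W ⟨P.resR h r, P.resR_idl h r.2⟩ :=
  Ideal.mapCotangent_toCotangent (R := ℤ) (P.idl V) (P.idl W) (P.resR h).toIntAlgHom
    (P.resR_idl h) r

theorem toCon_surjective (V : P.Aff) : Function.Surjective (P.toCon V) :=
  Ideal.toCotangent_surjective _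

theorem con_isPresheaf : P.con.IsPresheaf where
  res_self V x := by
    obtain ⟨r, rfl⟩ := P.toCon_surjective V x
    rw [con_res_toCon]
    exact congrArg _ (Subtype.ext (resR_self V _))
  res_res {V _ _} h h' x := by
    obtain ⟨r, rfl⟩ := P.toCon_surjective V x
    rw [con_res_toCon, con_res_toCon, con_res_toCon]
    exact congrArg _ (Subtype.ext (resR_resR h h' _))

theorem con2_isPresheaf : P.con2.IsPresheaf where
  res_self V x := by
    change SymSq.map (P.con.res (le_refl V)) x = x
    induction x using SymSq.induction_on with
    | h0 => exact map_zero _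
    | hmul x y => rw [SymSq.map_mul, con_isPresheaf.res_self, con_isPresheaf.res_self]
    | hadd x y hx hy => rw [map_add, hx, hy]
  res_res h h' x := by
    change SymSq.map (P.con.res h') (SymSq.map (P.con.res h) x) = SymSq.map (P.con.res _) x
    induction x using SymSq.induction_on with
    | h0 => rw [map_zero, map_zero, map_zero]
    | hmul x y =>
      rw [SymSq.map_mul, SymSq.map_mul, SymSq.map_mul, con_isPresheaf.res_res,
        con_isPresheaf.res_res]
    | hadd x y hx hy => rw [map_add, map_add, map_add, hx, hy]

theorem resTensor_self {F E : P.ModFam} (hF : F.IsPresheaf) (hE : E.IsPresheaf) (V : P.Aff)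
    (x : F.obj V ⊗[P.O V] E.obj V) : resTensor F E le_rfl x = x := by
  induction x using TensorProduct.induction_on with
  | zero => rw [map_zero]
  | tmul n e => rw [resTensor_tmul, hF.res_self, hE.res_self]
  | add x y hx hy => rw [map_add, hx, hy]

theorem resTensor_resTensor {F E : P.ModFam} (hF : F.IsPresheaf) (hE : E.IsPresheaf)
    {V V' V'' : P.Aff} (h : V' ≤ V) (h' : V'' ≤ V') (x : F.obj V ⊗[P.O V] E.obj V) :
    resTensor F E h' (resTensor F E h x) = resTensor F E (h'.trans h) x := by
  induction x using TensorProduct.induction_on with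
  | zero => rw [map_zero, map_zero, map_zero]
  | tmul n e => rw [resTensor_tmul, resTensor_tmul, resTensor_tmul, hF.res_res, hE.res_res]
  | add x y hx hy => rw [map_add, map_add, map_add, hx, hy]

/-- The model `(𝒪_X ⊕ N^*) ⊗ E` of an extension to `Y⁽¹⁾`. -/
def model1 {E : P.ModFam} (hE : E.IsPresheaf) : Model P.con E where
  X V := E.obj V × (P.con.obj V ⊗[P.O V] E.obj V)
  fm V := filMod1 _ _ _
  res h := (E.res h).toAddMonoidHom.prodMap (resTensor P.con E h).toAddMonoidHom
  res_self V x := Prod.ext (hE.res_self V _) (resTensor_self con_isPresheaf hE V _)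
  res_res h h' x := Prod.ext (hE.res_res h h' _) (resTensor_resTensor con_isPresheaf hE h h' _)
  p_res h x := rfl
  res_inc h ν := Prod.ext (map_zero (E.res h)) rfl
  res_act {V W} h r x := by
    refine Prod.ext ((E.res h).map_smulₛₗ r.c0 x.1) ?_
    change resTensor P.con E h (r.c0 • x.2 + r.c1 ⊗ₜ x.1) = P.resO h r.c0 • resTensor P.con E h x.2 +
      P.con.res h r.c1 ⊗ₜ E.res h x.1
    rw [map_add, map_smulₛₗ, resTensor_tmul]

/-- The model `Sym^{≤ 2} N^* ⊗ E` of an extension to `Y⁽²⁾`. -/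
def model2 {E : P.ModFam} (hE : E.IsPresheaf) : Model P.con2 E where
  X V := E.obj V × (P.con.obj V ⊗[P.O V] E.obj V) × (P.con2.obj V ⊗[P.O V] E.obj V)
  fm V := filMod2 _ _ _
  res h := (E.res h).toAddMonoidHom.prodMap ((resTensor P.con E h).toAddMonoidHom.prodMap
    (resTensor P.con2 E h).toAddMonoidHom)
  res_self V x := Prod.ext (hE.res_self V _) (Prod.ext (resTensor_self con_isPresheaf hE V _)
    (resTensor_self con2_isPresheaf hE V _))
  res_res h h' x := Prod.ext (hE.res_res h h' _) (Prod.ext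
    (resTensor_resTensor con_isPresheaf hE h h' _) (resTensor_resTensor con2_isPresheaf hE h h' _))
  p_res h x := rfl
  res_inc h ν := Prod.ext (map_zero (E.res h)) (Prod.ext (map_zero (resTensor P.con E h)) rfl)
  res_act {V W} h r x := by
    refine Prod.ext ((E.res h).map_smulₛₗ r.c0 x.1) (Prod.ext ?_ ?_)
    · change resTensor P.con E h (r.c0 • x.2.1 + r.c1 ⊗ₜ x.1) =
        P.resO h r.c0 • resTensor P.con E h x.2.1 + P.con.res h r.c1 ⊗ₜ E.res h x.1
      rw [map_add, map_smulₛₗ, resTensor_tmul]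
    · change resTensor P.con2 E h (r.c0 • x.2.2 + nMul r.c1 x.2.1 + r.c2 ⊗ₜ x.1) =
        P.resO h r.c0 • resTensor P.con2 E h x.2.2 +
          nMul (P.con.res h r.c1) (resTensor P.con E h x.2.1) +
          SymSq.map (P.con.res h) r.c2 ⊗ₜ E.res h x.1
      rw [map_add, map_add, map_smulₛₗ, resTensor_tmul]
      congr 2
      exact nMul_nat (P.con.res h) (E.res h) r.c1 x.2.1

theorem omega_res_D {V W : P.Aff} (h : W ≤ V) (f : P.O V) :
    P.omega.res h (KaehlerDifferential.D κ _ f) = KaehlerDifferential.D κ _ (P.resO h f) := by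
  let _ := (P.resO h).toAlgebra
  have : IsScalarTower κ (P.O V) (P.O W) :=
    IsScalarTower.of_algebraMap_eq fun c => (P.resO_algebraMap h c).symm
  exact KaehlerDifferential.map_D κ κ (P.O V) (P.O W) f

theorem omega_hom_ext {V : P.Aff} {B M : Type u} [CommRing B] [AddCommGroup M] [Module B M]
    {σ : P.O V →+* B} {f g : Ω[P.O V⁄κ] →ₛₗ[σ] M}
    (h : ∀ a, f (KaehlerDifferential.D κ _ a) = g (KaehlerDifferential.D κ _ a)) (ω) :
    f ω = g ω := by
  have hω : ω ∈ Submodule.span (P.O V) (Set.range (KaehlerDifferential.D κ (P.O V))) := by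
    rw [KaehlerDifferential.span_range_derivation]; trivial
  induction hω using Submodule.span_induction with
  | mem x hx => obtain ⟨a, rfl⟩ := hx; exact h a
  | zero => rw [map_zero, map_zero]
  | add x y _ _ hx hy => rw [map_add, map_add, hx, hy]
  | smul a x _ hx => rw [map_smulₛₗ, map_smulₛₗ, hx]

/-- Restriction commutes with maps obtained from natural `𝒪_X`-linear maps. -/
theorem resTensor_rTensor {F G E : P.ModFam} {V W : P.Aff} (h : W ≤ V)
    (a : F.obj V →ₗ[P.O V] G.obj V) (a' : F.obj W →ₗ[P.O W] G.obj W)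
    (ha : ∀ x, G.res h (a x) = a' (F.res h x)) (x : F.obj V ⊗[P.O V] E.obj V) :
    resTensor G E h (LinearMap.rTensor _ a x) = LinearMap.rTensor _ a' (resTensor F E h x) := by
  induction x using TensorProduct.induction_on with
  | zero => simp only [map_zero]
  | tmul n e => rw [LinearMap.rTensor_tmul, resTensor_tmul, resTensor_tmul,
      LinearMap.rTensor_tmul, ha]
  | add x y hx hy => simp only [map_add, hx, hy]

theorem resTensor_extLin {E : P.ModFam} {V W : P.Aff} (h : W ≤ V)
    (m : E.obj V →ₗ[P.O V] P.con.obj V ⊗[P.O V] E.obj V)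
    (m' : E.obj W →ₗ[P.O W] P.con.obj W ⊗[P.O W] E.obj W)
    (hm : ∀ x, resTensor P.con E h (m x) = m' (E.res h x)) (x : P.con.obj V ⊗[P.O V] E.obj V) :
    resTensor P.con2 E h (extLin m x) = extLin m' (resTensor P.con E h x) := by
  induction x using TensorProduct.induction_on with
  | zero => simp only [map_zero]
  | tmul n e =>
    rw [extLin_tmul, resTensor_tmul, extLin_tmul, ← hm]
    exact nMul_nat (P.con.res h) (E.res h) n (m e)
  | add x y hx hy => simp only [map_add, hx, hy]

namespace CechData

variable {E : P.ModFam} {ι : Type v} [LinearOrder ι] (C : CechData E ι)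

theorem nab_nat (i : ι) (V : P.Aff) (h : V.1 ≤ (C.U i).1) {W : P.Aff} (hW : W ≤ V) (x) :
    resTensor P.omega E hW (C.nab i V h x) = C.nab i W (le_trans hW h) (E.res hW x) :=
  (C.conn i).nat ⟨V, h⟩ ⟨W, le_trans hW h⟩ hW x

variable [CharZero κ]

theorem phi_exp (p : Ix2 ι) (V : P.Aff) (h : V.1 ≤ U2 C.U p) (r : P.R V) :
    (C.phi p V h).exp ((C.Φ p.1.2).app ⟨V, h.trans inf_le_right⟩ r) =
      (C.Φ p.1.1).app ⟨V, h.trans inf_le_left⟩ r := by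
  unfold CechData.phi AlgTriv.log
  erw [FiltDer.exp_logAut]
  rw [RingEquiv.trans_apply, RingEquiv.symm_apply_apply]

theorem phi_exp_comp (t : Ix3 ι) (V : P.Aff) (h : V.1 ≤ U3 C.U t) (r) :
    (C.phi (ih t) V (h.trans (U3_ih C.U t))).exp r =
      (C.phi (ij t) V (h.trans (U3_ij C.U t))).exp
        ((C.phi (jh t) V (h.trans (U3_jh C.U t))).exp r) := by
  obtain ⟨r, rfl⟩ := ((C.Φ t.1.2.2).app
    ⟨V, h.trans (inf_le_right.trans inf_le_right)⟩).surjective r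
  have e1 := C.phi_exp (ih t) V (h.trans (U3_ih C.U t)) r
  have e2 := C.phi_exp (jh t) V (h.trans (U3_jh C.U t)) r
  have e3 := C.phi_exp (ij t) V (h.trans (U3_ij C.U t)) r
  exact e1.trans (e3.symm.trans (congrArg _ e2.symm))

theorem phi_exp_nat (p : Ix2 ι) (V : P.Aff) (h : V.1 ≤ U2 C.U p) {W : P.Aff} (hW : W ≤ V) (r) :
    Trunc.map (P.con.res hW) ((C.phi p V h).exp r) =
      (C.phi p W (le_trans hW h)).exp (Trunc.map (P.con.res hW) r) := by
  obtain ⟨r, rfl⟩ := ((C.Φ p.1.2).app ⟨V, h.trans inf_le_right⟩).surjective r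
  rw [phi_exp]
  have e1 := (C.Φ p.1.1).nat ⟨V, h.trans inf_le_left⟩
    ⟨W, le_trans hW (h.trans inf_le_left)⟩ hW r
  have e2 := (C.Φ p.1.2).nat ⟨V, h.trans inf_le_right⟩
    ⟨W, le_trans hW (h.trans inf_le_right)⟩ hW r
  rw [← e1, ← e2, phi_exp]

theorem a1_nat (p : Ix2 ι) (V : P.Aff) (h : V.1 ≤ U2 C.U p) {W : P.Aff} (hW : W ≤ V)
    (ω : P.omega.obj V) : P.con.res hW ((C.phi p V h).a1 ω) =
      (C.phi p W (le_trans hW h)).a1 (P.omega.res hW ω) := by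
  refine omega_hom_ext (f := (P.con.res hW).comp (C.phi p V h).a1)
    (g := (C.phi p W (le_trans hW h)).a1.comp (P.omega.res hW)) (fun a => ?_) ω
  rw [LinearMap.comp_apply, LinearMap.comp_apply, FiltDer.a1_d, omega_res_D, FiltDer.a1_d]
  exact FiltDer.A1_nat (C.phi_exp_nat p V h hW) a

theorem a2_nat (p : Ix2 ι) (V : P.Aff) (h : V.1 ≤ U2 C.U p) {W : P.Aff} (hW : W ≤ V)
    (ω : P.omega.obj V) : P.con2.res hW ((C.phi p V h).a2 ω) =
      (C.phi p W (le_trans hW h)).a2 (P.omega.res hW ω) := by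
  refine omega_hom_ext (f := (P.con2.res hW).comp (C.phi p V h).a2)
    (g := (C.phi p W (le_trans hW h)).a2.comp (P.omega.res hW)) (fun a => ?_) ω
  rw [LinearMap.comp_apply, LinearMap.comp_apply, FiltDer.a2_d, omega_res_D, FiltDer.a2_d]
  exact FiltDer.A2_nat (C.phi_exp_nat p V h hW) (P.resO_algebraMap hW) a

theorem s1_nat (p : Ix2 ι) (i : ι) (V : P.Aff) (h : V.1 ≤ U2 C.U p) (hi : V.1 ≤ (C.U i).1)
    {W : P.Aff} (hW : W ≤ V) (x) : resTensor P.con E hW ((C.phi p V h).s1 (C.nab i V hi) x) =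
      (C.phi p W (le_trans hW h)).s1 (C.nab i W (le_trans hW hi)) (E.res hW x) := by
  refine (resTensor_rTensor (F := P.omega) hW _ _ (C.a1_nat p V h hW) _).trans ?_
  rw [nab_nat]; rfl

theorem s2_nat (p : Ix2 ι) (i : ι) (V : P.Aff) (h : V.1 ≤ U2 C.U p) (hi : V.1 ≤ (C.U i).1)
    {W : P.Aff} (hW : W ≤ V) (x) : resTensor P.con2 E hW ((C.phi p V h).s2 (C.nab i V hi) x) =
      (C.phi p W (le_trans hW h)).s2 (C.nab i W (le_trans hW hi)) (E.res hW x) := by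
  refine (resTensor_rTensor (F := P.omega) hW _ _ (C.a2_nat p V h hW) _).trans ?_
  rw [nab_nat]; rfl

theorem s1ext_nat (p : Ix2 ι) (i : ι) (V : P.Aff) (h : V.1 ≤ U2 C.U p) (hi : V.1 ≤ (C.U i).1)
    {W : P.Aff} (hW : W ≤ V) (x) :
    resTensor P.con2 E hW ((C.phi p V h).s1ext (C.nab i V hi) (C.nab_leibniz _ _ _) x) =
      (C.phi p W (le_trans hW h)).s1ext (C.nab i W (le_trans hW hi)) (C.nab_leibniz _ _ _)
        (resTensor P.con E hW x) := by
  induction x using TensorProduct.induction_on with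
  | zero => simp only [map_zero]
  | tmul n e =>
    rw [FiltDer.s1ext_tmul, map_add, resTensor_tmul, resTensor_tmul, FiltDer.s1ext_tmul, ← s1_nat]
    · congr 1
      · exact congrArg (· ⊗ₜ[P.O W] E.res hW e) (FiltDer.L1_nat (C.phi_exp_nat p V h hW) n)
      · exact nMul_nat (P.con.res hW) (E.res hW) n _
  | add x y hx hy => simp only [map_add, hx, hy]

variable (m : C1 C.U (endSheaf P.con E)) (p : Ix2 ι) (V : P.Aff) (h : V.1 ≤ U2 C.U p)

theorem M1_nat {W : P.Aff} (hW : W ≤ V) (x) :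
    resTensor P.con E hW (C.M1 m p V h x) = C.M1 m p W (le_trans hW h) (E.res hW x) := by
  change resTensor P.con E hW (_ + ev (m p) V h x) = _ + ev (m p) W _ (E.res hW x)
  rw [map_add, s1_nat, ev_nat]

theorem M1ext_nat {W : P.Aff} (hW : W ≤ V) (x) :
    resTensor P.con2 E hW (C.M1ext m p V h x) =
      C.M1ext m p W (le_trans hW h) (resTensor P.con E hW x) := by
  change resTensor P.con2 E hW (_ + extLin (ev (m p) V h) x) =
    _ + extLin (ev (m p) W _) (resTensor P.con E hW x)
  rw [map_add, s1ext_nat, resTensor_extLin hW _ _ (fun y => ev_nat (m p) h hW y)]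

theorem M1_isLeibniz1 : IsLeibniz1 (C.phi p V h) (C.M1 m p V h) (C.M1ext m p V h) :=
  ((C.phi p V h).isLeibniz1 _).add_linear _

/-- The exponentials of `a¹_ij ∇_j`. -/
def transition1 (hE : E.IsPresheaf) : Transition (model1 hE) C where
  T p V h := exp1 ((C.phi p V h).s1 (C.nab p.1.2 V (h.trans inf_le_right)))
  act p V h r x := by
    refine (exp1_act ((C.phi p V h).s1_smul (C.nab_leibniz _ _ _)) _ x).trans ?_
    exact congrArg (fun t => Trunc.act1 t (exp1 _ x)) (C.phi_exp p V h r)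
  inc p V h ν := Prod.ext rfl (by
    change ν + (C.phi p V h).s1 _ 0 = ν
    rw [map_zero, add_zero])
  p p V h x := rfl
  nat p V h W hW x := Prod.ext rfl (by
    change resTensor P.con E hW (x.2 + (C.phi p V h).s1 _ x.1) = resTensor P.con E hW x.2 + _
    rw [map_add, s1_nat]; rfl)

/-- The exponentials of the derivations given by `M¹_ij = a¹_ij ∇_j + m¹_ij` and `a²_ij ∇_j`. -/
def transition2 (hE : E.IsPresheaf) (m : C1 C.U (endSheaf P.con E)) :
    Transition (model2 hE) C where
  T p V h := exp2 κ (C.M1 m p V h) (C.M1ext m p V h)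
    ((C.phi p V h).s2 (C.nab p.1.2 V (h.trans inf_le_right)))
  act p V h r x := by
    refine (exp2_act (C.M1_isLeibniz1 m p V h)
      ((C.phi p V h).s2_smul (C.nab_leibniz _ _ _)) _ x).trans ?_
    exact congrArg (fun t => Trunc.act2 t (exp2 κ _ _ _ x)) (C.phi_exp p V h r)
  inc p V h ν := Prod.ext rfl (Prod.ext (by
      change 0 + C.M1 m p V h 0 = 0
      rw [map_zero, add_zero]) (by
      change ν + (C.phi p V h).s2 _ 0 + C.M1ext m p V h 0 +
        half κ (P.O V) • C.M1ext m p V h (C.M1 m p V h 0) = ν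
      rw [map_zero, map_zero, map_zero, map_zero, smul_zero, add_zero, add_zero, add_zero]))
  p p V h x := rfl
  nat p V h W hW x := Prod.ext rfl (Prod.ext (by
      change resTensor P.con E hW (x.2.1 + C.M1 m p V h x.1) = resTensor P.con E hW x.2.1 + _
      rw [map_add, M1_nat]; rfl) (by
      change resTensor P.con2 E hW (x.2.2 + (C.phi p V h).s2 _ x.1 + C.M1ext m p V h x.2.1 +
        half κ (P.O V) • C.M1ext m p V h (C.M1 m p V h x.1)) =
        resTensor P.con2 E hW x.2.2 + _ + _ + half κ (P.O W) • _
      rw [map_add, map_add, map_add, map_smulₛₗ, s2_nat, M1ext_nat, M1ext_nat, M1_nat,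
        FiltDer.map_half (P.resO_algebraMap hW)]
      rfl))

end CechData

end SmoothPair
end CechExt

namespace CechExt
namespace SmoothPair
namespace CechData

/-! ### The two obstruction cocycles -/

variable {κ : Type u} [Field κ] [CharZero κ] {P : SmoothPair κ} {E : P.ModFam} {ι : Type v}
  [LinearOrder ι] (C : CechData E ι) (hE : E.IsPresheaf)

theorem twist_transition1_apply (m : C1 C.U (endSheaf P.con E)) (p : Ix2 ι) (V : P.Aff)
    (h : V.1 ≤ U2 C.U p) (x : E.obj V × (P.con.obj V ⊗[P.O V] E.obj V)) :
    ((C.transition1 hE).twist m).T p V h x = (x.1, x.2 + C.M1 m p V h x.1) := by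
  change ((x.1 + 0, x.2 + (C.phi p V h).s1 (C.nab p.1.2 V (h.trans inf_le_right)) x.1 +
    ev (m p) V h x.1) : E.obj V × (P.con.obj V ⊗[P.O V] E.obj V)) = _
  refine Prod.ext (add_zero _) ?_
  change x.2 + (C.phi p V h).s1 _ x.1 + ev (m p) V h x.1 =
    x.2 + ((C.phi p V h).s1 _ x.1 + ev (m p) V h x.1)
  rw [add_assoc]

theorem twist_transition2_apply (m : C1 C.U (endSheaf P.con E)) (m2 : C1 C.U (endSheaf P.con2 E))
    (p : Ix2 ι) (V : P.Aff) (h : V.1 ≤ U2 C.U p)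
    (x : E.obj V × (P.con.obj V ⊗[P.O V] E.obj V) × (P.con2.obj V ⊗[P.O V] E.obj V)) :
    ((C.transition2 hE m).twist m2).T p V h x =
      (x.1, x.2.1 + C.M1 m p V h x.1,
        x.2.2 + C.M2 m2 p V h x.1 + C.M1ext m p V h x.2.1 +
          half κ (P.O V) • C.M1ext m p V h (C.M1 m p V h x.1)) := by
  change ((x.1 + 0, x.2.1 + C.M1 m p V h x.1 + 0,
    x.2.2 + (C.phi p V h).s2 (C.nab p.1.2 V (h.trans inf_le_right)) x.1 +
      C.M1ext m p V h x.2.1 + half κ (P.O V) • C.M1ext m p V h (C.M1 m p V h x.1) +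
      ev (m2 p) V h x.1) :
    E.obj V × (P.con.obj V ⊗[P.O V] E.obj V) × (P.con2.obj V ⊗[P.O V] E.obj V)) = _
  refine Prod.ext (add_zero _) (Prod.ext (add_zero _) ?_)
  change x.2.2 + (C.phi p V h).s2 _ x.1 + C.M1ext m p V h x.2.1 +
      half κ (P.O V) • C.M1ext m p V h (C.M1 m p V h x.1) + ev (m2 p) V h x.1 =
    x.2.2 + ((C.phi p V h).s2 _ x.1 + ev (m2 p) V h x.1) + C.M1ext m p V h x.2.1 +
      half κ (P.O V) • C.M1ext m p V h (C.M1 m p V h x.1)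
  abel

theorem transition1_comp (t : Ix3 ι) (V : P.Aff) (h : V.1 ≤ U3 C.U t)
    (x : E.obj V × (P.con.obj V ⊗[P.O V] E.obj V)) :
    (C.transition1 hE).T (ij t) V (h.trans (U3_ij C.U t))
        ((C.transition1 hE).T (jh t) V (h.trans (U3_jh C.U t)) x) =
      (C.transition1 hE).T (ih t) V (h.trans (U3_ih C.U t)) x +
        ((model1 hE).fm V).inc (C.a1At t V h x.1) := by
  refine Prod.ext (α := E.obj V) (β := P.con.obj V ⊗[P.O V] E.obj V)
    (add_zero (M := E.obj V) _).symm ?_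
  have e1 := s1_eq_add_connDiff (C.phi (ij t) V (h.trans (U3_ij C.U t)))
    (C.nab_leibniz t.1.2.1 V (h.trans (inf_le_right.trans inf_le_left)))
    (C.nab_leibniz t.1.2.2 V (h.trans (inf_le_right.trans inf_le_right))) x.1
  have e2 : (C.phi (ih t) V (h.trans (U3_ih C.U t))).s1
      (C.nab t.1.2.2 V (h.trans (inf_le_right.trans inf_le_right))) x.1 = _ :=
    congrArg (fun a => LinearMap.rTensor (E.obj V) a
      (C.nab t.1.2.2 V (h.trans (inf_le_right.trans inf_le_right)) x.1))
      (FiltDer.a1_of_exp_comp (C.phi_exp_comp t V h))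
  rw [LinearMap.rTensor_add, LinearMap.add_apply] at e2
  have e3 : ∀ y a b d : P.con.obj V ⊗[P.O V] E.obj V, y + b + (a + d) = y + (a + b) + d :=
    fun y a b d => by abel
  exact (congrArg (x.2 + (C.phi (jh t) V (h.trans (U3_jh C.U t))).s1
      (C.nab t.1.2.2 V (h.trans (inf_le_right.trans inf_le_right))) x.1 + ·) e1).trans
    ((e3 _ _ _ _).trans (congrArg (x.2 + · + C.a1At t V h x.1) e2.symm))

/-- The obstruction to the existence of an extension to `Y⁽¹⁾`. -/
theorem exists_isDefect1 : ∃ z : C2 C.U (endSheaf P.con E),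
    (∀ t V h, ev (z t) V h = C.a1At t V h) ∧ (C.transition1 hE).IsDefect z := by
  obtain ⟨z, hz⟩ := (C.transition1 hE).exists_isDefect fun t V h x =>
    ⟨C.a1At t V h x.1, C.transition1_comp hE t V h x⟩
  refine ⟨z, fun t V h => ((model1 hE).fm V).linear_unique fun x => ?_, hz⟩
  exact add_left_cancel ((hz t V h x).symm.trans (C.transition1_comp hE t V h x))

variable {C hE}

/-- The cocycle condition in degree `1`, for the operators `a¹∇ + m¹`. -/
theorem M1_add {m : C1 C.U (endSheaf P.con E)}
    (hm : ((C.transition1 hE).twist m).IsCocycle) (t : Ix3 ι) (V : P.Aff) (h : V.1 ≤ U3 C.U t)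
    (e : E.obj V) : C.M1 m (ih t) V (h.trans (U3_ih C.U t)) e =
      C.M1 m (ij t) V (h.trans (U3_ij C.U t)) e + C.M1 m (jh t) V (h.trans (U3_jh C.U t)) e := by
  have e0 := hm t V h (e, 0)
  rw [twist_transition1_apply, twist_transition1_apply] at e0
  have e1 := congrArg (fun x : E.obj V × (P.con.obj V ⊗[P.O V] E.obj V) => x.2)
    (e0.trans (C.twist_transition1_apply hE m (ih t) V _ (e, 0)))
  simp only [zero_add] at e1
  rw [← e1, add_comm]

theorem transition2_comp (hΩ : ∀ V : P.Aff, Module.Finite (P.O V) Ω[P.O V⁄κ] ∧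
    Module.Projective (P.O V) Ω[P.O V⁄κ]) (hflat : ∀ i, (C.conn i).IsFlat)
    {m : C1 C.U (endSheaf P.con E)} (hm : ((C.transition1 hE).twist m).IsCocycle) (t : Ix3 ι)
    (V : P.Aff) (h : V.1 ≤ U3 C.U t)
    (x : E.obj V × (P.con.obj V ⊗[P.O V] E.obj V) × (P.con2.obj V ⊗[P.O V] E.obj V)) :
    (C.transition2 hE m).T (ij t) V (h.trans (U3_ij C.U t))
        ((C.transition2 hE m).T (jh t) V (h.trans (U3_jh C.U t)) x) =
      (C.transition2 hE m).T (ih t) V (h.trans (U3_ih C.U t)) x +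
        ((model2 hE).fm V).inc (C.obs2 m t V h x.1) := by
  have := (hΩ V).1
  have := (hΩ V).2
  refine (exp2_comp (C.M1_isLeibniz1 m (ij t) V (h.trans (U3_ij C.U t)))
    (C.M1_isLeibniz1 m (jh t) V (h.trans (U3_jh C.U t)))
    (C.M1_isLeibniz1 m (ih t) V (h.trans (U3_ih C.U t))) (C.phi_exp_comp t V h)
    (M1_add hm t V h) _ _
    ((C.phi (ih t) V (h.trans (U3_ih C.U t))).s2
      (C.nab t.1.2.2 V (h.trans (inf_le_right.trans inf_le_right)))) x).trans ?_
  refine congrArg (fun y => _ + ((model2 hE).fm V).inc y) ?_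
  exact obstruction_formula (C.phi_exp_comp t V h)
    (C.nab_leibniz t.1.2.1 V (h.trans (inf_le_right.trans inf_le_left)))
    (C.nab_leibniz t.1.2.2 V (h.trans (inf_le_right.trans inf_le_right)))
    (hflat t.1.2.2 ⟨V, h.trans (inf_le_right.trans inf_le_right)⟩) (ev (m (ij t)) V _)
    (ev (m (jh t)) V _) x.1

/-- The obstruction to the existence of an extension to `Y⁽²⁾`. -/
theorem exists_isDefect2 (hΩ : ∀ V : P.Aff, Module.Finite (P.O V) Ω[P.O V⁄κ] ∧
    Module.Projective (P.O V) Ω[P.O V⁄κ]) (hflat : ∀ i, (C.conn i).IsFlat)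
    {m : C1 C.U (endSheaf P.con E)} (hm : ((C.transition1 hE).twist m).IsCocycle) :
    ∃ z : C2 C.U (endSheaf P.con2 E), (∀ t V h e, ev (z t) V h e = C.obs2 m t V h e) ∧
      (C.transition2 hE m).IsDefect z := by
  obtain ⟨z, hz⟩ := (C.transition2 hE m).exists_isDefect fun t V h x =>
    ⟨C.obs2 m t V h x.1, transition2_comp hΩ hflat hm t V h x⟩
  refine ⟨z, fun t V h e => ?_, hz⟩
  have e1 := add_left_cancel ((hz t V h (e, 0, 0)).symm.trans
    (transition2_comp hΩ hflat hm t V h (e, 0, 0)))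
  exact congrArg (fun x : E.obj V × (P.con.obj V ⊗[P.O V] E.obj V) ×
    (P.con2.obj V ⊗[P.O V] E.obj V) => x.2.2) e1

end CechData
end SmoothPair
end CechExt

namespace CechExt
namespace SmoothPair

/-! ### Geometry of the infinitesimal neighbourhoods -/

variable {κ : Type u} [Field κ] (P : SmoothPair κ)

/-- The embedding of `X` in `Y`. -/
def emb0 : P.X ⟶ P.Y := P.I.subschemeι

/-- The embedding of `Y⁽¹⁾` in `Y`. -/
def emb1 : P.Y1 ⟶ P.Y := (P.I ^ 2).subschemeι

/-- The embedding of `Y⁽²⁾` in `Y`. -/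
def emb2 : P.Y2 ⟶ P.Y := (P.I ^ 3).subschemeι

instance : IsClosedImmersion P.emb0 := inferInstanceAs (IsClosedImmersion P.I.subschemeι)
instance : IsClosedImmersion P.emb1 := inferInstanceAs (IsClosedImmersion (P.I ^ 2).subschemeι)
instance : IsClosedImmersion P.emb2 := inferInstanceAs (IsClosedImmersion (P.I ^ 3).subschemeι)

theorem j12_emb2 : P.j12 ≫ P.emb2 = P.emb1 := Scheme.IdealSheafData.inclusion_subschemeι _

theorem j01_emb1 : P.j01 ≫ P.emb1 = P.emb0 := Scheme.IdealSheafData.inclusion_subschemeι _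

theorem j02_emb2 : P.j02 ≫ P.emb2 = P.emb0 := by
  rw [j02, Category.assoc, j12_emb2, j01_emb1]

theorem range_emb1 : Set.range P.emb1 = (P.I ^ 2).support :=
  Scheme.IdealSheafData.range_subschemeι _

theorem range_emb2 : Set.range P.emb2 = (P.I ^ 3).support :=
  Scheme.IdealSheafData.range_subschemeι _

instance : IsClosedImmersion P.j12 := by
  have : IsClosedImmersion (P.j12 ≫ P.emb2) := by rw [j12_emb2]; infer_instance
  exact IsClosedImmersion.of_comp P.j12 P.emb2

instance : IsClosedImmersion P.j01 := by
  have : IsClosedImmersion (P.j01 ≫ P.emb1) := by rw [j01_emb1]; infer_instance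
  exact IsClosedImmersion.of_comp P.j01 P.emb1

instance : IsClosedImmersion P.j02 := inferInstanceAs (IsClosedImmersion (P.j01 ≫ P.j12))

theorem j12_surjective : Function.Surjective P.j12 := fun y => by
  have hy : P.emb2 y ∈ Set.range P.emb1 := by
    have : P.emb2 y ∈ Set.range P.emb2 := ⟨y, rfl⟩
    rw [range_emb2, Scheme.IdealSheafData.support_pow_succ] at this
    rwa [range_emb1, Scheme.IdealSheafData.support_pow_succ]
  obtain ⟨x, hx⟩ := hy
  refine ⟨x, P.emb2.isEmbedding.injective ?_⟩
  rw [← hx, ← j12_emb2]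
  rfl

variable {P}

theorem exists_aff_le (W : P.Y2.Opens) (x : P.Y2) (hx : x ∈ W) : ∃ V : P.Aff, x ∈ V.1 ∧ V.1 ≤ W := by
  obtain ⟨_, ⟨V, hV, rfl⟩, hxV, hVW⟩ := P.Y2.isBasis_affineOpens.exists_subset_of_mem_open hx W.2
  exact ⟨⟨V, hV⟩, hxV, hVW⟩

theorem isOpensBasis_aff {ι : Type v} (U : ι → P.Aff) (hU : ⨆ i, (U i).1 = ⊤) :
    IsOpensBasis fun V : {V : P.Aff // ∃ i, V.1 ≤ (U i).1} => V.1.1 := fun W x hx => by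
  have hx' : x ∈ ⨆ i, (U i).1 := by rw [hU]; trivial
  obtain ⟨i, hi⟩ := TopologicalSpace.Opens.mem_iSup.1 hx'
  obtain ⟨V, hxV, hV⟩ := exists_aff_le (W ⊓ (U i).1) x ⟨hx, hi⟩
  exact ⟨⟨V, i, hV.trans inf_le_right⟩, hxV, hV.trans inf_le_left⟩

theorem isOpensBasis_aff1 {ι : Type v} (U : ι → P.Aff) (hU : ⨆ i, (U i).1 = ⊤) :
    IsOpensBasis fun V : {V : P.Aff // ∃ i, V.1 ≤ (U i).1} => P.j12 ⁻¹ᵁ V.1.1 := fun W x hx => by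
  obtain ⟨W', hW', e⟩ := P.j12.isEmbedding.isOpen_iff.1 W.2
  have e' : ∀ y, P.j12 y ∈ W' ↔ y ∈ W := fun y => by
    change y ∈ P.j12 ⁻¹' W' ↔ _
    rw [e]; rfl
  obtain ⟨b, hb, hbW⟩ := isOpensBasis_aff U hU ⟨W', hW'⟩ (P.j12 x) ((e' x).2 hx)
  exact ⟨b, hb, fun y hy => (e' y).1 (hbW hy)⟩

theorem isAffineOpen_preX (V : P.Aff) : IsAffineOpen (P.preX V) :=
  (V.2.preimage P.j12).preimage P.j01

theorem isAffineOpen_Y1 (V : P.Aff) : IsAffineOpen (P.j12 ⁻¹ᵁ V.1) := V.2.preimage P.j12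

theorem j12_app_surjective (V : P.Aff) : Function.Surjective (P.j12.app V.1).hom :=
  P.j12.app_surjective V.1 V.2

theorem appX_surjective (V : P.Aff) : Function.Surjective (P.appX V) :=
  (P.j01.app_surjective _ (isAffineOpen_Y1 V)).comp (j12_app_surjective V)

/-- `𝒪_X(V)` is the ring of functions on `X ∩ V`. -/
def oEquiv (V : P.Aff) : P.O V ≃+* Γ(P.X, P.preX V) :=
  RingHom.quotientKerEquivOfSurjective (appX_surjective V)

theorem oEquiv_resO {V W : P.Aff} (h : W ≤ V) (f : P.O V) :
    oEquiv W (P.resO h f) = funRes P.X (P.preX_mono h) (oEquiv V f) := by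
  obtain ⟨r, rfl⟩ := Ideal.Quotient.mk_surjective f
  exact P.appX_resR h r

/-- The affine open subscheme of `Y⁽²⁾` cut out by an affine open subscheme of `Y`. -/
def affOfY (W : P.Y.affineOpens) : P.Aff :=
  ⟨P.emb2 ⁻¹ᵁ W.1, W.2.preimage P.emb2⟩

theorem exists_affOfY_le (W : P.Y2.Opens) (x : P.Y2) (hx : x ∈ W) :
    ∃ V : P.Y.affineOpens, x ∈ (affOfY V).1 ∧ (affOfY V).1 ≤ W := by
  obtain ⟨W', hW', e⟩ := P.emb2.isEmbedding.isOpen_iff.1 W.2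
  have e' : ∀ y, P.emb2 y ∈ W' ↔ y ∈ W := fun y => by
    change y ∈ P.emb2 ⁻¹' W' ↔ _
    rw [e]; rfl
  obtain ⟨_, ⟨V, hV, rfl⟩, hxV, hVW⟩ :=
    P.Y.isBasis_affineOpens.exists_subset_of_mem_open ((e' x).2 hx) hW'
  exact ⟨⟨V, hV⟩, hxV, fun y hy => (e' y).1 (hVW hy)⟩

/-- The restriction of functions from an affine open subscheme of `Y` to `Y⁽²⁾`. -/
def embR (W : P.Y.affineOpens) : Γ(P.Y, W.1) →+* P.R (affOfY W) := (P.emb2.app W.1).hom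

theorem embR_surjective (W : P.Y.affineOpens) : Function.Surjective (embR W) :=
  (P.I ^ 3).subschemeι_app_surjective W

theorem ker_emb0_app (W : P.Y.affineOpens) : RingHom.ker (P.emb0.app W.1).hom = P.I.ideal W :=
  Scheme.IdealSheafData.ker_subschemeι_app _ W

theorem ker_emb1_app (W : P.Y.affineOpens) : RingHom.ker (P.emb1.app W.1).hom = P.I.ideal W ^ 2 :=
  (Scheme.IdealSheafData.ker_subschemeι_app _ W).trans
    (congrFun (Scheme.IdealSheafData.ideal_pow P.I 2) W)

theorem funRes_comp_app {X Y Z : Scheme.{u}} {f : X ⟶ Y} {g : Y ⟶ Z} {k : X ⟶ Z} (hk : f ≫ g = k)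
    (V : Z.Opens) {W : X.Opens} (h : W ≤ k ⁻¹ᵁ V) (h' : W ≤ f ⁻¹ᵁ g ⁻¹ᵁ V) (r : Γ(Z, V)) :
    funRes X h ((k.app V).hom r) = funRes X h' ((f.app (g ⁻¹ᵁ V)).hom ((g.app V).hom r)) := by
  subst hk
  rw [Scheme.Hom.comp_app]
  rfl

theorem preimage_comp {X Y Z : Scheme.{u}} {f : X ⟶ Y} {g : Y ⟶ Z} {k : X ⟶ Z} (hk : f ≫ g = k)
    (V : Z.Opens) : k ⁻¹ᵁ V = f ⁻¹ᵁ g ⁻¹ᵁ V := by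
  subst hk
  rfl

theorem preX_eq (V : P.Aff) : P.j02 ⁻¹ᵁ V.1 = P.preX V := preimage_comp (j02.eq_1 P).symm V.1

theorem preY1_affOfY (W : P.Y.affineOpens) : P.emb1 ⁻¹ᵁ W.1 = P.j12 ⁻¹ᵁ (affOfY W).1 :=
  preimage_comp P.j12_emb2 W.1

theorem preX_affOfY (W : P.Y.affineOpens) : P.emb0 ⁻¹ᵁ W.1 = P.preX (affOfY W) :=
  (preimage_comp P.j01_emb1 W.1).trans (congrArg (P.j01 ⁻¹ᵁ ·) (preY1_affOfY W))

theorem funRes_j02_app (V : P.Aff) (r : P.R V) :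
    funRes P.X (preX_eq V).ge ((P.j02.app V.1).hom r) = P.appX V r :=
  (funRes_comp_app (j02.eq_1 P).symm V.1 (preX_eq V).ge le_rfl r).trans (funRes_self _ _)

theorem j12_app_embR (W : P.Y.affineOpens) (b : Γ(P.Y, W.1)) :
    (P.j12.app (affOfY W).1).hom (embR W b) =
      funRes P.Y1 (preY1_affOfY W).ge ((P.emb1.app W.1).hom b) :=
  ((funRes_comp_app P.j12_emb2 W.1 (preY1_affOfY W).ge le_rfl b).trans (funRes_self _ _)).symm

theorem appX_embR (W : P.Y.affineOpens) (b : Γ(P.Y, W.1)) :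
    P.appX (affOfY W) (embR W b) = funRes P.X (preX_affOfY W).ge ((P.emb0.app W.1).hom b) := by
  have e := funRes_comp_app P.j01_emb1 W.1 (preX_affOfY W).ge
    (P.j01.preimage_mono (preY1_affOfY W).ge) b
  have e' := app_funRes (j := P.j01) (preY1_affOfY W).ge ((P.emb1.app W.1).hom b)
  rw [← j12_app_embR] at e'
  exact e'.trans e.symm

theorem funRes_eq_zero_iff {S : Scheme.{u}} {V W : S.Opens} (h : V = W) (r : Γ(S, V)) :
    funRes S h.ge r = 0 ↔ r = 0 := by
  subst h
  rw [funRes_self]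

theorem j12_app_embR_eq_zero_iff (W : P.Y.affineOpens) (b : Γ(P.Y, W.1)) :
    (P.j12.app (affOfY W).1).hom (embR W b) = 0 ↔ b ∈ P.I.ideal W ^ 2 := by
  rw [j12_app_embR, funRes_eq_zero_iff (preY1_affOfY W), ← ker_emb1_app]
  exact Iff.rfl

theorem appX_embR_eq_zero_iff (W : P.Y.affineOpens) (b : Γ(P.Y, W.1)) :
    P.appX (affOfY W) (embR W b) = 0 ↔ b ∈ P.I.ideal W := by
  rw [appX_embR, funRes_eq_zero_iff (preX_affOfY W), ← ker_emb0_app]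
  exact Iff.rfl

theorem idl_affOfY (W : P.Y.affineOpens) : P.idl (affOfY W) = (P.I.ideal W).map (embR W) := by
  refine le_antisymm (fun r hr => ?_) (Ideal.map_le_iff_le_comap.2 fun b hb =>
    (appX_embR_eq_zero_iff W b).2 hb)
  obtain ⟨b, rfl⟩ := embR_surjective W r
  exact Ideal.mem_map_of_mem _ ((appX_embR_eq_zero_iff W b).1 hr)

/-- The functions that vanish on `Y⁽¹⁾` are the elements of the square of the ideal of `X`. This holds
for the affine open sets of `Y⁽²⁾` that come from affine open sets of `Y`. -/
theorem j12_app_eq_zero_iff_mem_idl_sq (W : P.Y.affineOpens) (r : P.R (affOfY W)) :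
    (P.j12.app (affOfY W).1).hom r = 0 ↔ r ∈ P.idl (affOfY W) ^ 2 := by
  rw [idl_affOfY, ← Ideal.map_pow]
  constructor
  · intro h
    obtain ⟨b, rfl⟩ := embR_surjective W r
    exact Ideal.mem_map_of_mem _ ((j12_app_embR_eq_zero_iff W b).1 h)
  · intro h
    obtain ⟨b, hb, rfl⟩ := (Ideal.mem_map_iff_of_surjective _ (embR_surjective W)).1 h
    exact (j12_app_embR_eq_zero_iff W b).2 hb

theorem toCon_eq_zero_iff (V : P.Aff) (r : P.idl V) : P.toCon V r = 0 ↔ r.1 ∈ P.idl V ^ 2 :=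
  Ideal.toCotangent_eq_zero _ r

theorem mk_eq_zero_iff (V : P.Aff) (r : P.R V) :
    Ideal.Quotient.mk (P.idl V) r = 0 ↔ P.appX V r = 0 := Ideal.Quotient.eq_zero_iff_mem

/-- Over a member of the covering, `𝒪⁽¹⁾` is the quotient of `Sym^{≤ 2} N^*` by its part of
degree `2`. -/
theorem AlgTriv.j12_app_eq_zero_iff {W : P.Y2.Opens} (Φ : P.AlgTriv W) (V : P.Aff) (h : V.1 ≤ W)
    (r : P.R V) : (P.j12.app V.1).hom r = 0 ↔
      (Φ.app ⟨V, h⟩ r).c0 = 0 ∧ (Φ.app ⟨V, h⟩ r).c1 = 0 := by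
  have base : ∀ (V' : P.Y.affineOpens) (h' : (affOfY V').1 ≤ W) (r : P.R (affOfY V')),
      (P.j12.app (affOfY V').1).hom r = 0 ↔
        (Φ.app ⟨affOfY V', h'⟩ r).c0 = 0 ∧ (Φ.app ⟨affOfY V', h'⟩ r).c1 = 0 := fun V' h' r => by
    rw [j12_app_eq_zero_iff_mem_idl_sq, Φ.gr0]
    constructor
    · intro hr
      have hr' : r ∈ P.idl (affOfY V') := Ideal.pow_le_self two_ne_zero hr
      refine ⟨Ideal.Quotient.eq_zero_iff_mem.2 hr', ?_⟩
      rw [Φ.gr1 ⟨affOfY V', h'⟩ ⟨r, hr'⟩]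
      exact (toCon_eq_zero_iff _ ⟨r, hr'⟩).2 hr
    · rintro ⟨h0, h1⟩
      have hr' : r ∈ P.idl (affOfY V') := Ideal.Quotient.eq_zero_iff_mem.1 h0
      rw [Φ.gr1 ⟨affOfY V', h'⟩ ⟨r, hr'⟩] at h1
      exact (toCon_eq_zero_iff _ ⟨r, hr'⟩).1 h1
  constructor
  · intro hr
    -- The element of degree `≤ 1` with the same components vanishes locally.
    have key : (Φ.app ⟨V, h⟩).symm ⟨(Φ.app ⟨V, h⟩ r).c0, (Φ.app ⟨V, h⟩ r).c1, 0⟩ = 0 := by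
      refine fun_eq_of_locally_eq _ _ fun x hx => ?_
      obtain ⟨V', hxV', hV'⟩ := exists_affOfY_le V.1 x hx
      refine ⟨(affOfY V').1, hV', hxV', ?_⟩
      rw [map_zero]
      have e1 := (base V' (hV'.trans h) (P.resR (V := V) (W := affOfY V') hV' r)).1 (by
        change (P.j12.app (affOfY V').1).hom (funRes P.Y2 hV' r) = 0
        rw [app_funRes, hr, map_zero])
      rw [Φ.nat ⟨V, h⟩ ⟨affOfY V', hV'.trans h⟩ hV'] at e1
      change P.resR (V := V) (W := affOfY V') hV' _ = 0
      apply (Φ.app ⟨affOfY V', hV'.trans h⟩).injective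
      rw [Φ.nat ⟨V, h⟩ ⟨affOfY V', hV'.trans h⟩ hV', RingEquiv.apply_symm_apply, map_zero]
      exact Trunc.ext e1.1 e1.2 (map_zero (SymSq.map _))
    rw [map_eq_zero_iff _ (Φ.app ⟨V, h⟩).symm.injective] at key
    exact ⟨congrArg Trunc.c0 key, congrArg Trunc.c1 key⟩
  · rintro ⟨h0, h1⟩
    refine fun_eq_of_locally_eq _ _ fun x hx => ?_
    obtain ⟨V', hxV', hV'⟩ := exists_affOfY_le V.1 (P.j12 x) hx
    refine ⟨P.j12 ⁻¹ᵁ (affOfY V').1, P.j12.preimage_mono hV', hxV', ?_⟩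
    rw [map_zero, ← app_funRes]
    refine (base V' (hV'.trans h) (P.resR (V := V) (W := affOfY V') hV' r)).2 ?_
    rw [Φ.nat ⟨V, h⟩ ⟨affOfY V', hV'.trans h⟩ hV']
    refine ⟨?_, ?_⟩
    · change P.resO _ (Φ.app ⟨V, h⟩ r).c0 = 0
      rw [h0, map_zero]
    · change P.con.res _ (Φ.app ⟨V, h⟩ r).c1 = 0
      rw [h1, map_zero]

theorem AlgTriv.appX_eq_zero_iff {W : P.Y2.Opens} (Φ : P.AlgTriv W) (V : P.Aff) (h : V.1 ≤ W)
    (r : P.R V) : P.appX V r = 0 ↔ (Φ.app ⟨V, h⟩ r).c0 = 0 := by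
  rw [Φ.gr0, mk_eq_zero_iff]

theorem str2_eq : P.str2 = P.emb2 ≫ P.str := rfl

theorem j02_str2 : P.j02 ≫ P.str2 = P.emb0 ≫ P.str := by
  rw [str2_eq, ← Category.assoc, j02_emb2]

theorem appLE_comp {X Y Z : Scheme.{u}} {f : X ⟶ Y} {g : Y ⟶ Z} {k : X ⟶ Z} (hk : f ≫ g = k)
    (U : Z.Opens) {V : Y.Opens} {W : X.Opens} (h : W ≤ k ⁻¹ᵁ U) (h' : V ≤ g ⁻¹ᵁ U)
    (h'' : W ≤ f ⁻¹ᵁ V) (r : Γ(Z, U)) :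
    (k.appLE U W h).hom r = (f.appLE V W h'').hom ((g.appLE U V h').hom r) := by
  subst hk
  exact (congrArg (fun t => t.hom r) (Scheme.Hom.appLE_comp_appLE f g U V W h' h'')).symm

theorem appX_algebraMap (V : P.Aff) (c : κ) : P.appX V (algebraMap κ (P.R V) c) =
    ((P.emb0 ≫ P.str).appLE ⊤ (P.preX V) le_top).hom
      ((Scheme.ΓSpecIso (.of κ)).inv.hom c) := by
  rw [appLE_comp P.j02_str2 ⊤ le_top (V := V.1) le_top (preX_eq V).ge]
  exact (funRes_j02_app V _).symm

/-- Smoothness of `X` over the ground field. -/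
theorem smooth_O (V : P.Aff) : Algebra.Smooth κ (P.O V) := by
  have : Smooth (P.emb0 ≫ P.str) := P.smooth_X
  have h1 := Scheme.Hom.smooth_appLE (P.emb0 ≫ P.str) (isAffineOpen_top (Spec (.of κ)))
    (isAffineOpen_preX V) le_top
  have h2 : RingHom.Smooth (Scheme.ΓSpecIso (.of κ)).inv.hom :=
    RingHom.Smooth.of_bijective
      (Scheme.ΓSpecIso (.of κ)).symm.commRingCatIsoToRingEquiv.bijective
  have h3 : RingHom.Smooth ((oEquiv V).symm : Γ(P.X, P.preX V) →+* P.O V) :=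
    RingHom.Smooth.of_bijective (oEquiv V).symm.bijective
  have h4 := (h2.comp h1).comp h3
  rw [← RingHom.smooth_algebraMap]
  have e : algebraMap κ (P.O V) = ((oEquiv V).symm : Γ(P.X, P.preX V) →+* P.O V).comp
      (((P.emb0 ≫ P.str).appLE ⊤ (P.preX V) le_top).hom.comp
        (Scheme.ΓSpecIso (.of κ)).inv.hom) := by
    refine RingHom.ext fun c => (oEquiv V).injective ?_
    exact (appX_algebraMap V c).trans ((oEquiv V).apply_symm_apply _).symm
  exact e ▸ h4

/-- The differentials of `X` over `κ` form a vector bundle, by smoothness. -/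
theorem finite_projective_omega (V : P.Aff) : Module.Finite (P.O V) Ω[P.O V⁄κ] ∧
    Module.Projective (P.O V) Ω[P.O V⁄κ] := by
  have := smooth_O V
  exact ⟨inferInstance, inferInstance⟩

/-- Intersections of affine open sets are affine, as `Y` is separated. -/
theorem isAffineOpen_inf (U V : P.Aff) : IsAffineOpen (U.1 ⊓ V.1) := by
  have := P.separated_Y
  have : IsSeparated P.str2 := by rw [str2_eq]; infer_instance
  have : P.Y2.IsSeparated := ⟨by
    rw [Subsingleton.elim (Limits.terminal.from P.Y2)
      (P.str2 ≫ Limits.terminal.from (Spec (.of κ)))]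
    infer_instance⟩
  exact U.2.inf V.2

end SmoothPair
end CechExt

namespace CechExt
namespace SmoothPair

/-! ### Models as modules over the structure sheaf of a neighbourhood -/

variable {κ : Type u} [Field κ] {P : SmoothPair κ} {F E : P.ModFam} {ι : Type v} [LinearOrder ι]

/-- A dual basis of `E` over an affine open `V`: generators `e k` over `V`, and linear forms `l k`
over all smaller affine opens. -/
structure DualBasisOver (E : P.ModFam) (V : P.Aff) where
  n : ℕ
  e : Fin n → E.obj V
  l : ∀ W, W ≤ V → Fin n → (E.obj W →ₗ[P.O W] P.O W)
  nat : ∀ {W W' : P.Aff} (hW : W ≤ V) (h : W' ≤ W) k x,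
    P.resO h (l W hW k x) = l W' (h.trans hW) k (E.res h x)
  sum : ∀ (W : P.Aff) (hW : W ≤ V) x, ∑ k, l W hW k x • E.res hW (e k) = x

/-- The dual basis comes from a basis. -/
def DualBasisOver.IsBasis {V : P.Aff} (d : DualBasisOver E V) : Prop :=
  ∀ (W : P.Aff) (hW : W ≤ V) j k, d.l W hW k (E.res hW (d.e j)) = if j = k then 1 else 0

/-- A scheme `S` on which a model becomes a sheaf of modules, via the isomorphisms `Φ_i`: an
infinitesimal neighbourhood of `X`. The open sets of `S` are those of `Y⁽²⁾`. Linear forms on `E`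
induce linear forms `coef` on the model. -/
structure Frame (L : Model F E) (C : CechData E ι) where
  isPresheaf : E.IsPresheaf
  S : Scheme.{u}
  pt : S → P.Y2
  pt_surjective : Function.Surjective pt
  o : P.Aff → S.Opens
  mem_o : ∀ V x, x ∈ o V ↔ pt x ∈ V.1
  isBasis : IsOpensBasis fun V : {V : P.Aff // ∃ i, V.1 ≤ (C.U i).1} => o V.1
  affine : ∀ V, IsAffineOpen (o V)
  o_mono : ∀ {V W : P.Aff}, W ≤ V → o W ≤ o V
  π : ∀ V, P.R V →+* Γ(S, o V)
  π_surjective : ∀ V, Function.Surjective (π V)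
  π_nat : ∀ {V W : P.Aff} (h : W ≤ V) r, π W (P.resR h r) = funRes S (o_mono h) (π V r)
  actR_eq_zero : ∀ i V h r, π V r = 0 → L.actR C i V h r = 0
  res_sec : ∀ {V W : P.Aff} (h : W ≤ V) e, L.res h ((L.fm V).sec e) = (L.fm W).sec (E.res h e)
  coef : ∀ i (V : P.Aff), V.1 ≤ (C.U i).1 → (E.obj V →ₗ[P.O V] P.O V) → L.X V →+ Γ(S, o V)
  coef_act : ∀ i V h f r x, coef i V h f (L.actR C i V h r x) = π V r * coef i V h f x
  coef_sec_zero : ∀ i V h f e, f e = 0 → coef i V h f ((L.fm V).sec e) = 0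
  coef_sec_one : ∀ i V h f e, f e = 1 → coef i V h f ((L.fm V).sec e) = 1
  coef_nat : ∀ i {V W : P.Aff} (h : V.1 ≤ (C.U i).1) (hW : W ≤ V) f f',
    (∀ x, P.resO hW (f x) = f' (E.res hW x)) → ∀ x,
      funRes S (o_mono hW) (coef i V h f x) = coef i W (le_trans hW h) f' (L.res hW x)
  coef_sum : ∀ i V h {n : ℕ} (e : Fin n → E.obj V) (f : Fin n → (E.obj V →ₗ[P.O V] P.O V)),
    (∀ x, ∑ k, f k x • e k = x) → ∀ x (r : Fin n → P.R V), (∀ k, π V (r k) = coef i V h (f k) x) →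
      ∑ k, L.actR C i V h (r k) ((L.fm V).sec (e k)) = x

namespace Frame

variable {L : Model F E} {C : CechData E ι} (Fr : Frame L C)

theorem le_of_o_le {V W : P.Aff} (h : Fr.o W ≤ Fr.o V) : W ≤ V := fun y hy => by
  obtain ⟨x, rfl⟩ := Fr.pt_surjective y
  exact (Fr.mem_o V x).1 (h ((Fr.mem_o W x).2 hy))

/-- The action of functions on `S` on the model, through `Φ_i`. -/
def sm (i : ι) (V : P.Aff) (h : V.1 ≤ (C.U i).1) : Γ(Fr.S, Fr.o V) →+* AddMonoid.End (L.X V) :=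
  RingHom.liftOfSurjective (Fr.π V) (Fr.π_surjective V)
    ⟨L.actR C i V h, fun r hr => Fr.actR_eq_zero i V h r hr⟩

theorem sm_π (i : ι) (V : P.Aff) (h : V.1 ≤ (C.U i).1) (r : P.R V) :
    Fr.sm i V h (Fr.π V r) = L.actR C i V h r :=
  RingHom.liftOfRightInverse_comp_apply _ _ _ _ r

/-- The model over `V ≤ U_i`, as a module over the functions on the open subscheme of `S`
corresponding to `V`. -/
def Obj (_ : Frame L C) (i : ι) (V : P.Aff) (_ : V.1 ≤ (C.U i).1) : Type u := L.X V

instance (i : ι) (V : P.Aff) (h : V.1 ≤ (C.U i).1) : AddCommGroup (Fr.Obj i V h) :=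
  inferInstanceAs (AddCommGroup (L.X V))

instance (i : ι) (V : P.Aff) (h : V.1 ≤ (C.U i).1) : Module Γ(Fr.S, Fr.o V) (Fr.Obj i V h) :=
  Module.compHom (L.X V) (Fr.sm i V h)

theorem π_smul (i : ι) (V : P.Aff) (h : V.1 ≤ (C.U i).1) (r : P.R V) (x : Fr.Obj i V h) :
    Fr.π V r • x = (L.actR C i V h r x : L.X V) :=
  congrArg (fun f : AddMonoid.End (L.X V) => f x) (Fr.sm_π i V h r)

/-- Restriction. -/
def resObj {i : ι} {V : P.Aff} (h : V.1 ≤ (C.U i).1) {W : P.Aff} (hW : W ≤ V) :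
    Fr.Obj i V h →+ Fr.Obj i W (le_trans hW h) := L.res hW

theorem resObj_smul {i : ι} {V : P.Aff} (h : V.1 ≤ (C.U i).1) {W : P.Aff} (hW : W ≤ V)
    (b : Γ(Fr.S, Fr.o V)) (x : Fr.Obj i V h) :
    Fr.resObj h hW (b • x) = funRes Fr.S (Fr.o_mono hW) b • Fr.resObj h hW x := by
  obtain ⟨r, rfl⟩ := Fr.π_surjective V b
  rw [π_smul, ← Fr.π_nat, π_smul]
  exact L.res_actR C i h hW r x

/-- The linear form on the model induced by a linear form on `E`. -/
def coefLin (i : ι) (V : P.Aff) (h : V.1 ≤ (C.U i).1) (f : E.obj V →ₗ[P.O V] P.O V) :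
    Fr.Obj i V h →ₗ[Γ(Fr.S, Fr.o V)] Γ(Fr.S, Fr.o V) where
  toFun := Fr.coef i V h f
  map_add' := map_add _
  map_smul' b x := by
    obtain ⟨r, rfl⟩ := Fr.π_surjective V b
    rw [π_smul]
    exact Fr.coef_act i V h f r x

/-- A section of `E`, as an element of degree `0` of the model. -/
def secObj (i : ι) (V : P.Aff) (h : V.1 ≤ (C.U i).1) (e : E.obj V) : Fr.Obj i V h :=
  (L.fm V).sec e

theorem resObj_secObj {i : ι} {V : P.Aff} (h : V.1 ≤ (C.U i).1) {W : P.Aff} (hW : W ≤ V)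
    (e : E.obj V) :
    Fr.resObj h hW (Fr.secObj i V h e) = Fr.secObj i W (le_trans hW h) (E.res hW e) :=
  Fr.res_sec hW e

section Dual

variable {i : ι} {V : P.Aff} (h : V.1 ≤ (C.U i).1) (d : DualBasisOver E V)

/-- The linear forms on the model induced by a dual basis. -/
abbrev form (W : P.Aff) (hW : W ≤ V) (k : Fin d.n) :
    Fr.Obj i W (le_trans hW h) →ₗ[Γ(Fr.S, Fr.o W)] Γ(Fr.S, Fr.o W) :=
  Fr.coefLin i W (le_trans hW h) (d.l W hW k)

theorem form_nat {W W' : P.Aff} (hW : W ≤ V) (hW' : W' ≤ W) (k : Fin d.n)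
    (x : Fr.Obj i W (le_trans hW h)) :
    funRes Fr.S (Fr.o_mono hW') (Fr.form h d W hW k x) =
      Fr.form h d W' (hW'.trans hW) k (Fr.resObj (le_trans hW h) hW' x) :=
  Fr.coef_nat i (le_trans hW h) hW' _ _ (d.nat hW hW' k) x

theorem sum_form {W : P.Aff} (hW : W ≤ V) (x : Fr.Obj i W (le_trans hW h)) :
    ∑ k, Fr.form h d W hW k x • Fr.secObj i W (le_trans hW h) (E.res hW (d.e k)) = x := by
  choose r hr using fun k => Fr.π_surjective W (Fr.form h d W hW k x)
  have := Fr.coef_sum i W (le_trans hW h) (fun k => E.res hW (d.e k)) (d.l W hW) (d.sum W hW) x r hr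
  refine Eq.trans (Finset.sum_congr rfl fun k _ => ?_) this
  rw [← hr]
  exact Fr.π_smul i W _ _ _

theorem form_ext {W : P.Aff} (hW : W ≤ V) {x y : Fr.Obj i W (le_trans hW h)}
    (hxy : ∀ k, Fr.form h d W hW k x = Fr.form h d W hW k y) : x = y := by
  rw [← Fr.sum_form h d hW x, ← Fr.sum_form h d hW y]
  exact Finset.sum_congr rfl fun k _ => by rw [hxy]

theorem form_secObj (hd : d.IsBasis) {W : P.Aff} (hW : W ≤ V) (j k : Fin d.n) :
    Fr.form h d W hW k (Fr.secObj i W (le_trans hW h) (E.res hW (d.e j))) =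
      if j = k then 1 else 0 := by
  have e := hd W hW j k
  split_ifs at e ⊢
  · exact Fr.coef_sec_one i W _ _ _ e
  · exact Fr.coef_sec_zero i W _ _ _ e

/-- Sections of the model are determined locally. -/
theorem obj_eq_zero_of_local (d : DualBasisOver E V) {W : P.Aff} (hW : W ≤ V) (x : Fr.Obj i W (le_trans hW h))
    (hx : ∀ y ∈ Fr.o W, ∃ (W' : P.Aff) (hW' : W' ≤ W), y ∈ Fr.o W' ∧
      Fr.resObj (le_trans hW h) hW' x = 0) : x = 0 := by
  refine Fr.form_ext h d hW fun k => ?_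
  refine fun_eq_of_locally_eq _ _ fun y hy => ?_
  obtain ⟨W', hW', hyW', e⟩ := hx y hy
  refine ⟨_, Fr.o_mono hW', hyW', ?_⟩
  rw [Fr.form_nat h d hW hW', e, map_zero, map_zero, map_zero]

/-- Sections of the model can be glued. -/
theorem obj_glue (d : DualBasisOver E V) {W : P.Aff} (hW : W ≤ V) (p : P.Aff → Prop)
    (hp : ∀ V V', p V → V' ≤ V → p V') (hle : ∀ W', p W' → W' ≤ W)
    (hcov : ∀ y ∈ Fr.o W, ∃ W', p W' ∧ y ∈ Fr.o W')
    (s : ∀ W' (hp : p W'), Fr.Obj i W' (le_trans (hle W' hp) (le_trans hW h)))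
    (hs : ∀ W' W'' (hp' : p W') (hp'' : p W'') (h'' : W'' ≤ W'),
      Fr.resObj (le_trans (hle W' hp') (le_trans hW h)) h'' (s W' hp') = s W'' hp'') :
    ∃ t : Fr.Obj i W (le_trans hW h), ∀ W' hp', 
      Fr.resObj (le_trans hW h) (hle W' hp') t = s W' hp' := by
  have key : ∀ k, ∃ f : Γ(Fr.S, Fr.o W), ∀ W' (hp' : p W'), funRes Fr.S (Fr.o_mono (hle W' hp')) f =
      Fr.form h d W' ((hle W' hp').trans hW) k (s W' hp') := fun k => by
    obtain ⟨f, hf⟩ := fun_exists_glue Fr.isBasis (Fr.o W) (fun b => p b.1)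
      (fun b b' hb hb' => hp _ _ hb (Fr.le_of_o_le hb')) (fun b hb => Fr.o_mono (hle _ hb))
      (fun y hy => by
        obtain ⟨W', hp', hyW'⟩ := hcov y hy
        exact ⟨⟨W', i, le_trans (hle W' hp') (le_trans hW h)⟩, hp', hyW'⟩)
      (fun b hb => Fr.form h d b.1 ((hle b.1 hb).trans hW) k (s b.1 hb))
      (fun b b' hb hb' hbb => by
        rw [Fr.form_nat h d _ (Fr.le_of_o_le hbb), hs])
    exact ⟨f, fun W' hp' => hf ⟨W', i, le_trans (hle W' hp') (le_trans hW h)⟩ hp'⟩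
  choose f hf using key
  refine ⟨∑ k, f k • Fr.secObj i W (le_trans hW h) (E.res hW (d.e k)), fun W' hp' => ?_⟩
  rw [map_sum, ← Fr.sum_form h d ((hle W' hp').trans hW) (s W' hp')]
  refine Finset.sum_congr rfl fun k _ => ?_
  rw [resObj_smul, hf, resObj_secObj, Fr.isPresheaf.res_res]

end Dual

end Frame

end SmoothPair
end CechExt

namespace CechExt

/-! ### Framings of an extension -/

/-- Two modules with the same reduction modulo a nilpotent ideal are isomorphic, if one of them is
finitely generated and projective. -/
theorem bijective_of_reduction {B X M M' : Type*} [CommRing B] [AddCommGroup X] [Module B X]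
    [AddCommGroup M] [Module B M] [AddCommGroup M'] [Module B M'] [Module.Finite B M]
    [Module.Projective B M] {J : Ideal B} {N : ℕ} (hJ : J ^ N = ⊥) (w : X →ₗ[B] M')
    (red : M →ₗ[B] M') (G : X →ₗ[B] M) (hw : Function.Surjective w)
    (hG : ∀ x, red (G x) = w x)
    (hkw : ∀ x, w x = 0 → x ∈ J • (⊤ : Submodule B X))
    (hkr : ∀ s, red s = 0 → s ∈ J • (⊤ : Submodule B M)) : Function.Bijective G := by
  have hJ' : J ≤ Ideal.jacobson ⊥ := fun a ha =>
    Ideal.radical_le_jacobson ⟨N, by rw [← hJ]; exact Ideal.pow_mem_pow ha N⟩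
  obtain ⟨H, hH⟩ := Module.projective_lifting_property w red hw
  have hH' : ∀ s, w (H s) = red s := fun s => LinearMap.congr_fun hH s
  constructor
  · rw [injective_iff_map_eq_zero]
    intro x hx
    -- `H ∘ G` is the identity modulo `J`, so `x` lies in every power of `J`.
    have hD : ∀ y, y - H (G y) ∈ J • (⊤ : Submodule B X) := fun y => hkw _ (by
      rw [map_sub, hH', hG, sub_self])
    have step : ∀ n, x ∈ J ^ n • (⊤ : Submodule B X) := fun n => by
      induction n with
      | zero => rw [pow_zero, Ideal.one_eq_top, Submodule.top_smul]; trivial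
      | succ n ih =>
        have e : ∀ y ∈ J ^ n • (⊤ : Submodule B X),
            (LinearMap.id - H.comp G : X →ₗ[B] X) y ∈ J ^ (n + 1) • (⊤ : Submodule B X) := fun y hy => by
          have h1 := Submodule.mem_map_of_mem (f := (LinearMap.id - H.comp G : X →ₗ[B] X)) hy
          rw [Submodule.map_smul''] at h1
          rw [pow_succ, Submodule.mul_smul]
          refine Submodule.smul_mono le_rfl ?_ h1
          rintro _ ⟨z, -, rfl⟩
          exact hD z
        have := e x ih
        rwa [LinearMap.sub_apply, LinearMap.comp_apply, hx, map_zero, sub_zero] at this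
    have := step N
    rwa [hJ, Submodule.bot_smul] at this
  · rw [← LinearMap.range_eq_top, ← top_le_iff]
    refine Submodule.le_of_le_smul_of_le_jacobson_bot Module.Finite.fg_top hJ' fun s _ => ?_
    obtain ⟨x, hx⟩ := hw (red s)
    have h1 : s - G x ∈ J • (⊤ : Submodule B M) := hkr _ (by rw [map_sub, hG, hx, sub_self])
    have h2 := Submodule.add_mem_sup (LinearMap.mem_range_self G x) h1
    rwa [add_sub_cancel] at h2

namespace SmoothPair

variable {κ : Type u} [Field κ] {P : SmoothPair κ} {F E : P.ModFam} {ι : Type v} [LinearOrder ι]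
  {L : Model F E} {C : CechData E ι}

/-- A closed subscheme `S'` of `S` with a sheaf of modules `M'`, to which the copies of the model
over the members of the covering reduce. -/
structure Target (Fr : Frame L C) where
  S' : Scheme.{u}
  j : S' ⟶ Fr.S
  [isAffineHom : IsAffineHom j]
  M' : S'.Modules
  w : ∀ i (V : P.Aff) (h : V.1 ≤ (C.U i).1), Fr.Obj i V h →+ Γ(M', j ⁻¹ᵁ Fr.o V)
  w_surjective : ∀ i V h, Function.Surjective (w i V h)
  w_smul : ∀ i V h (b : Γ(Fr.S, Fr.o V)) (x : Fr.Obj i V h),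
    w i V h (b • x) = (j.app (Fr.o V)).hom b • w i V h x
  w_nat : ∀ i (V W : P.Aff) (h : V.1 ≤ (C.U i).1) (hW : W ≤ V) (x : Fr.Obj i V h),
    w i W (le_trans hW h) (Fr.resObj h hW x) =
      secRes M' (j.preimage_mono (Fr.o_mono hW)) (w i V h x)
  mem_of_w : ∀ i V h (x : Fr.Obj i V h), w i V h x = 0 →
    x ∈ RingHom.ker (j.app (Fr.o V)).hom • (⊤ : Submodule Γ(Fr.S, Fr.o V) (Fr.Obj i V h))
  nilpotent : ∀ i (V : P.Aff), V.1 ≤ (C.U i).1 →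
    RingHom.ker (j.app (Fr.o V)).hom ^ 3 = (⊥ : Ideal Γ(Fr.S, Fr.o V))

attribute [instance] Target.isAffineHom

variable {Fr : Frame L C}

/-- An isomorphism over `U_i` of a sheaf of modules on `S` with the model, compatible with the
reduction maps. -/
structure Framing (T : Target Fr) {M : Fr.S.Modules}
    (ρ : M ⟶ (Scheme.Modules.pushforward T.j).obj T.M') (i : ι) where
  app : ∀ (V : P.Aff) (h : V.1 ≤ (C.U i).1), Γ(M, Fr.o V) ≃+ Fr.Obj i V h
  smul : ∀ V h (b : Γ(Fr.S, Fr.o V)) s, app V h (b • s) = b • app V h s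
  nat : ∀ (V W : P.Aff) (h : V.1 ≤ (C.U i).1) (hW : W ≤ V) s,
    app W (le_trans hW h) (secRes M (Fr.o_mono hW) s) = Fr.resObj h hW (app V h s)
  w_app : ∀ V h s, T.w i V h (app V h s) = secMap T.j ρ (Fr.o V) s

/-- Vector bundles that reduce to `M'` are isomorphic to the model over the members of the
covering. -/
theorem nonempty_framing (T : Target Fr) {M : Fr.S.Modules}
    (ρ : M ⟶ (Scheme.Modules.pushforward T.j).obj T.M') (hM : IsVectorBundle M)
    (hM' : IsVectorBundle T.M') (hρ : IsReduction T.j ρ) (i : ι) (d : DualBasisOver E (C.U i)) :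
    Nonempty (Framing T ρ i) := by
  have h0 : (C.U i).1 ≤ (C.U i).1 := le_rfl
  -- Lifts `t k` to `M` of the elements of a dual basis define a map from the model to `M`, which is
  -- an isomorphism because it is one modulo a nilpotent ideal.
  choose t ht using fun k => hρ.surjective hM hM' (Fr.affine (C.U i))
    (T.w i (C.U i) h0 (Fr.secObj i _ h0 (d.e k)))
  let G (V : P.Aff) (h : V.1 ≤ (C.U i).1) : Fr.Obj i V h →ₗ[Γ(Fr.S, Fr.o V)] Γ(M, Fr.o V) :=
    ∑ k, (Fr.form h0 d V h k).smulRight (secRes M (Fr.o_mono h) (t k))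
  have hG : ∀ V h x, G V h x = ∑ k, Fr.form h0 d V h k x • secRes M (Fr.o_mono h) (t k) :=
    fun V h x => LinearMap.sum_apply _ _ _
  have hred : ∀ V h x, secMap T.j ρ (Fr.o V) (G V h x) = T.w i V h x := fun V h x => by
    rw [hG, map_sum]
    conv_rhs => rw [← Fr.sum_form h0 d h x, map_sum]
    refine Finset.sum_congr rfl fun k _ => ?_
    rw [secMap_smul, secMap_secRes, T.w_smul, ht, ← T.w_nat, Fr.resObj_secObj]
  have hbij : ∀ V h, Function.Bijective (G V h) := fun V h => by
    obtain ⟨_, _⟩ := hM.finite_projective (Fr.affine V)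
    let _ : Module Γ(Fr.S, Fr.o V) Γ(T.M', T.j ⁻¹ᵁ Fr.o V) :=
      Module.compHom _ (T.j.app (Fr.o V)).hom
    exact bijective_of_reduction (T.nilpotent i V h)
      (M' := Γ(T.M', T.j ⁻¹ᵁ Fr.o V))
      { T.w i V h with map_smul' := T.w_smul i V h }
      { secMap T.j ρ (Fr.o V) with map_smul' := secMap_smul ρ }
      (G V h) (T.w_surjective i V h) (hred V h) (T.mem_of_w i V h)
      (fun s hs => hρ.mem_smul_top hM (Fr.affine V) s hs)
  have hnat : ∀ (V W : P.Aff) (h : V.1 ≤ (C.U i).1) (hW : W ≤ V) x,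
      G W (le_trans hW h) (Fr.resObj h hW x) = secRes M (Fr.o_mono hW) (G V h x) :=
    fun V W h hW x => by
      rw [hG, hG, map_sum]
      refine Finset.sum_congr rfl fun k _ => ?_
      rw [secRes_smul, secRes_secRes, Fr.form_nat h0 d h hW]
  let e (V : P.Aff) (h : V.1 ≤ (C.U i).1) := LinearEquiv.ofBijective (G V h) (hbij V h)
  exact ⟨{
    app := fun V h => (e V h).symm.toAddEquiv
    smul := fun V h b s => (e V h).symm.map_smul b s
    nat := fun V W h hW s => by
      obtain ⟨x, rfl⟩ := (e V h).surjective s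
      refine (e W (le_trans hW h)).symm_apply_eq.2 ?_
      refine Eq.trans ?_ (hnat V W h hW _).symm
      exact congrArg (fun x => secRes M (Fr.o_mono hW) (e V h x)) ((e V h).symm_apply_apply x).symm
    w_app := fun V h s => by
      obtain ⟨x, rfl⟩ := (e V h).surjective s
      refine Eq.trans ?_ (hred V h x).symm
      exact congrArg (T.w i V h) ((e V h).symm_apply_apply x) }⟩

end SmoothPair
end CechExt

namespace CechExt
namespace SmoothPair

variable {κ : Type u} [Field κ] {P : SmoothPair κ} {F E : P.ModFam} {ι : Type v} [LinearOrder ι]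
  {L : Model F E} {C : CechData E ι} {Fr : Frame L C}

/-! ### The cochain of an extension -/

/-- The kernel of the reduction is the part of top degree. -/
def Target.KerEqInc (T : Target Fr) : Prop :=
  ∀ i (V : P.Aff) (h : V.1 ≤ (C.U i).1) (x : L.X V),
    T.w i V h x = 0 ↔ ∃ ν, x = (L.fm V).inc ν

/-- The transition maps induce the identity on `M'`. -/
def Target.Compat (T : Target Fr) (t : Transition L C) : Prop :=
  ∀ (p : Ix2 ι) (V : P.Aff) (h : V.1 ≤ U2 C.U p) (x : L.X V),
    T.w p.1.1 V (h.trans inf_le_left) (t.T p V h x) = T.w p.1.2 V (h.trans inf_le_right) x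

variable {T : Target Fr}

theorem Target.Compat.twist {t : Transition L C} (ht : T.Compat t) (hT : T.KerEqInc)
    (m : C1 C.U (endSheaf F E)) : T.Compat (t.twist m) := fun p V h x => by
  refine ((T.w p.1.1 V (h.trans inf_le_left)).map_add (t.T p V h x) _).trans ?_
  exact (congrArg₂ (· + ·) (ht p V h x) ((hT _ _ _ _).2 ⟨_, rfl⟩)).trans (add_zero _)

theorem Target.KerEqInc.exists_add (hT : T.KerEqInc) {i : ι} {V : P.Aff} {h : V.1 ≤ (C.U i).1}
    {x y : L.X V} (hxy : T.w i V h x = T.w i V h y) : ∃ ν, x = y + (L.fm V).inc ν := by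
  obtain ⟨ν, hν⟩ := (hT i V h (x - y)).1
    (((T.w i V h).map_sub x y).trans (sub_eq_zero.2 hxy))
  exact ⟨ν, by rw [← hν, add_sub_cancel]⟩

variable {M : Fr.S.Modules} {ρ : M ⟶ (Scheme.Modules.pushforward T.j).obj T.M'}

/-- A framing over `V`, as an isomorphism with the model. -/
def Framing.equiv {i : ι} (Ψ : Framing T ρ i) (V : P.Aff) (h : V.1 ≤ (C.U i).1) :
    Γ(M, Fr.o V) ≃+ L.X V := Ψ.app V h

theorem Framing.equiv_smul {i : ι} (Ψ : Framing T ρ i) (V : P.Aff) (h : V.1 ≤ (C.U i).1)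
    (r : P.R V) (s : Γ(M, Fr.o V)) :
    Ψ.equiv V h (Fr.π V r • s) = L.actR C i V h r (Ψ.equiv V h s) :=
  (Ψ.smul V h _ s).trans (Fr.π_smul i V h r _)

theorem Framing.symm_act {i : ι} (Ψ : Framing T ρ i) (V : P.Aff) (h : V.1 ≤ (C.U i).1)
    (r : P.R V) (x : L.X V) :
    (Ψ.equiv V h).symm (L.actR C i V h r x) = Fr.π V r • (Ψ.equiv V h).symm x := by
  rw [AddEquiv.symm_apply_eq, Ψ.equiv_smul, AddEquiv.apply_symm_apply]

theorem Framing.equiv_nat {i : ι} (Ψ : Framing T ρ i) (V W : P.Aff) (h : V.1 ≤ (C.U i).1)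
    (hW : W ≤ V) (s : Γ(M, Fr.o V)) :
    Ψ.equiv W (le_trans hW h) (secRes M (Fr.o_mono hW) s) = L.res hW (Ψ.equiv V h s) :=
  Ψ.nat V W h hW s

theorem Framing.symm_nat {i : ι} (Ψ : Framing T ρ i) (V W : P.Aff) (h : V.1 ≤ (C.U i).1)
    (hW : W ≤ V) (x : L.X V) : (Ψ.equiv W (le_trans hW h)).symm (L.res hW x) =
      secRes M (Fr.o_mono hW) ((Ψ.equiv V h).symm x) := by
  rw [AddEquiv.symm_apply_eq, Ψ.equiv_nat V W h hW, AddEquiv.apply_symm_apply]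

theorem Framing.w_equiv {i : ι} (Ψ : Framing T ρ i) (V : P.Aff) (h : V.1 ≤ (C.U i).1)
    (s : Γ(M, Fr.o V)) : T.w i V h (Ψ.equiv V h s) = secMap T.j ρ (Fr.o V) s := Ψ.w_app V h s

theorem Framing.secMap_symm {i : ι} (Ψ : Framing T ρ i) (V : P.Aff) (h : V.1 ≤ (C.U i).1)
    (x : L.X V) : secMap T.j ρ (Fr.o V) ((Ψ.equiv V h).symm x) = T.w i V h x := by
  rw [← Ψ.w_equiv V h, AddEquiv.apply_symm_apply]

/-- The framings are related by the transition maps. -/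
def IsGluing (Ψ : ∀ i, Framing T ρ i) (t : Transition L C) : Prop :=
  ∀ (p : Ix2 ι) (V : P.Aff) (h : V.1 ≤ U2 C.U p) (s : Γ(M, Fr.o V)),
    (Ψ p.1.1).equiv V (h.trans inf_le_left) s =
      t.T p V h ((Ψ p.1.2).equiv V (h.trans inf_le_right) s)

theorem IsGluing.isCocycle {Ψ : ∀ i, Framing T ρ i} {t : Transition L C} (h : IsGluing Ψ t) :
    t.IsCocycle := fun q V hV x => by
  obtain ⟨s, rfl⟩ := ((Ψ q.1.2.2).equiv V
    (hV.trans (inf_le_right.trans inf_le_right))).surjective x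
  have h1 := h (jh q) V (hV.trans (U3_jh C.U q)) s
  have h2 := h (ij q) V (hV.trans (U3_ij C.U q)) s
  have h3 := h (ih q) V (hV.trans (U3_ih C.U q)) s
  exact (congrArg (t.T (ij q) V _) h1.symm).trans (h2.symm.trans h3)

/-- The transition map `Ψ_i ∘ Ψ_j⁻¹` of framings. -/
def transitionMap (Ψ : ∀ i, Framing T ρ i) (p : Ix2 ι) (V : P.Aff) (h : V.1 ≤ U2 C.U p) :
    L.X V →+ L.X V :=
  ((Ψ p.1.1).equiv V (h.trans inf_le_left)).toAddMonoidHom.comp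
    ((Ψ p.1.2).equiv V (h.trans inf_le_right)).symm.toAddMonoidHom

theorem transitionMap_equiv (Ψ : ∀ i, Framing T ρ i) (p : Ix2 ι) (V : P.Aff)
    (h : V.1 ≤ U2 C.U p) (s : Γ(M, Fr.o V)) :
    transitionMap Ψ p V h ((Ψ p.1.2).equiv V (h.trans inf_le_right) s) =
      (Ψ p.1.1).equiv V (h.trans inf_le_left) s :=
  congrArg ((Ψ p.1.1).equiv V _) (((Ψ p.1.2).equiv V _).symm_apply_apply s)

theorem transitionMap_act (Ψ : ∀ i, Framing T ρ i) (p : Ix2 ι) (V : P.Aff) (h : V.1 ≤ U2 C.U p)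
    (r : P.R V) (x : L.X V) :
    transitionMap Ψ p V h (L.actR C p.1.2 V (h.trans inf_le_right) r x) =
      L.actR C p.1.1 V (h.trans inf_le_left) r (transitionMap Ψ p V h x) := by
  change (Ψ p.1.1).equiv V _ (((Ψ p.1.2).equiv V _).symm _) =
    L.actR C p.1.1 V _ r ((Ψ p.1.1).equiv V _ (((Ψ p.1.2).equiv V _).symm x))
  rw [Framing.symm_act, Framing.equiv_smul]

theorem transitionMap_nat (Ψ : ∀ i, Framing T ρ i) (p : Ix2 ι) (V : P.Aff) (h : V.1 ≤ U2 C.U p)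
    (W : P.Aff) (hW : W ≤ V) (x : L.X V) :
    L.res hW (transitionMap Ψ p V h x) = transitionMap Ψ p W (le_trans hW h) (L.res hW x) := by
  change L.res hW ((Ψ p.1.1).equiv V _ (((Ψ p.1.2).equiv V _).symm x)) =
    (Ψ p.1.1).equiv W _ (((Ψ p.1.2).equiv W _).symm (L.res hW x))
  rw [Framing.symm_nat (Ψ p.1.2) V W (h.trans inf_le_right) hW, ← Framing.equiv_nat]

theorem w_transitionMap (Ψ : ∀ i, Framing T ρ i) (p : Ix2 ι) (V : P.Aff) (h : V.1 ≤ U2 C.U p)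
    (x : L.X V) : T.w p.1.1 V (h.trans inf_le_left) (transitionMap Ψ p V h x) =
      T.w p.1.2 V (h.trans inf_le_right) x :=
  ((Ψ p.1.1).w_equiv V _ _).trans ((Ψ p.1.2).secMap_symm V _ x)

/-- The transition maps of any framings are a twist of given transition maps. -/
theorem existsUnique_isGluing (hT : T.KerEqInc) {t : Transition L C} (ht : T.Compat t)
    (Ψ : ∀ i, Framing T ρ i) : ∃! m, IsGluing Ψ (t.twist m) := by
  obtain ⟨m, hm, huniq⟩ := t.existsUnique_twist (transitionMap Ψ) (transitionMap_act Ψ)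
    (transitionMap_nat Ψ) (fun p V h x => hT.exists_add (h := h.trans inf_le_left)
      ((w_transitionMap Ψ p V h x).trans (ht p V h x).symm))
  refine ⟨m, fun p V h s => ?_, fun m' hm' => huniq m' fun p V h x => ?_⟩
  · exact (transitionMap_equiv Ψ p V h s).symm.trans (hm p V h _)
  · refine (hm' p V h (((Ψ p.1.2).equiv V (h.trans inf_le_right)).symm x)).trans ?_
    exact congrArg ((t.twist m').T p V h) (((Ψ p.1.2).equiv V _).apply_symm_apply x)

/-! ### Isomorphisms of extensions -/

variable {M₁ : Fr.S.Modules} {ρ₁ : M₁ ⟶ (Scheme.Modules.pushforward T.j).obj T.M'}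

/-- `1 + n`, for a linear map `n : E → F ⊗ E`. -/
def unip (L : Model F E) {W : P.Y2.Opens} (n : (endSheaf F E).obj (.op W)) (V : P.Aff)
    (h : V.1 ≤ W) : L.X V →+ L.X V :=
  AddMonoidHom.id _ + (L.fm V).inc.comp ((ev n V h).toAddMonoidHom.comp (L.fm V).p)

theorem unip_apply {W : P.Y2.Opens} (n : (endSheaf F E).obj (.op W)) (V : P.Aff)
    (h : V.1 ≤ W) (x : L.X V) : unip L n V h x = x + (L.fm V).inc (ev n V h ((L.fm V).p x)) := rfl

theorem unip_neg_unip {W : P.Y2.Opens} (n : (endSheaf F E).obj (.op W)) (V : P.Aff)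
    (h : V.1 ≤ W) (x : L.X V) : unip L (-n) V h (unip L n V h x) = x := by
  rw [unip_apply, unip_apply, map_add, (L.fm V).p_inc, add_zero, ev_neg, LinearMap.neg_apply,
    map_neg, add_neg_cancel_right]

theorem unip_nat {W : P.Y2.Opens} (n : (endSheaf F E).obj (.op W)) {V V' : P.Aff}
    (h : V.1 ≤ W) (hV : V' ≤ V) (x : L.X V) :
    L.res hV (unip L n V h x) = unip L n V' (le_trans hV h) (L.res hV x) := by
  rw [unip_apply, unip_apply, map_add, L.res_inc, L.p_res, ev_nat]

theorem unip_act {i : ι} (n : (endSheaf F E).obj (.op (C.U i).1)) (V : P.Aff)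
    (h : V.1 ≤ (C.U i).1) (r : P.R V) (x : L.X V) :
    unip L n V h (L.actR C i V h r x) = L.actR C i V h r (unip L n V h x) := by
  rw [unip_apply, unip_apply, map_add, L.actR_apply, L.actR_apply, (L.fm V).p_act,
    (L.fm V).act_inc, map_smul]

/-- Compatibility of `1 + n` with twisted transition maps is the coboundary relation. -/
theorem unip_twist_iff (t : Transition L C) (m m' : C1 C.U (endSheaf F E))
    (n : C0 C.U (endSheaf F E)) :
    m - m' = d0 C.U _ n ↔ ∀ (p : Ix2 ι) (V : P.Aff) (h : V.1 ≤ U2 C.U p) (x : L.X V),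
      unip L (n p.1.1) V (h.trans inf_le_left) ((t.twist m).T p V h x) =
        (t.twist m').T p V h (unip L (n p.1.2) V (h.trans inf_le_right) x) := by
  have key : ∀ (p : Ix2 ι) (V : P.Aff) (h : V.1 ≤ U2 C.U p),
      (∀ x : L.X V, unip L (n p.1.1) V (h.trans inf_le_left) ((t.twist m).T p V h x) =
        (t.twist m').T p V h (unip L (n p.1.2) V (h.trans inf_le_right) x)) ↔
      ev ((m - m') p) V h = ev (d0 C.U _ n p) V h := fun p V h => by
    have e : ∀ x : L.X V, unip L (n p.1.1) V (h.trans inf_le_left) ((t.twist m).T p V h x) -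
        (t.twist m').T p V h (unip L (n p.1.2) V (h.trans inf_le_right) x) =
        (L.fm V).inc (ev ((m - m') p) V h ((L.fm V).p x)) -
          (L.fm V).inc (ev (d0 C.U _ n p) V h ((L.fm V).p x)) := fun x => by
      have e1 : ev ((m - m') p) V h = ev (m p) V h - ev (m' p) V h := rfl
      rw [e1, ev_d0, unip_apply, unip_apply, (t.twist m).p, t.twist_apply, map_add,
        (t.twist m').inc, t.twist_apply, LinearMap.sub_apply, LinearMap.sub_apply, map_sub, map_sub]
      abel
    constructor
    · intro hx
      refine (L.fm V).linear_unique fun x => ?_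
      rw [← sub_eq_zero, ← e, hx, sub_self]
    · intro hx x
      rw [← sub_eq_zero, e, hx, sub_self]
  constructor
  · intro h p V hV
    exact (key p V hV).2 (by rw [h])
  · intro h
    exact funext fun p => endSheaf_ext fun V hV => (key p V hV).1 (h p V hV)

/-- A `0`-cochain that bounds the difference of two cochains defines a morphism of extensions. -/
theorem exists_hom_of_d0 {Ψ : ∀ i, Framing T ρ i} {Ψ₁ : ∀ i, Framing T ρ₁ i} {t : Transition L C}
    {m m₁ : C1 C.U (endSheaf F E)} (hT : T.KerEqInc) (hΨ : IsGluing Ψ (t.twist m))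
    (hΨ₁ : IsGluing Ψ₁ (t.twist m₁)) (n : C0 C.U (endSheaf F E)) (hn : m - m₁ = d0 C.U _ n) :
    ∃ f : M ⟶ M₁, f ≫ ρ₁ = ρ ∧ ∀ i V h (s : Γ(M, Fr.o V)),
      (Ψ₁ i).equiv V h ((f.app (Fr.o V)).hom s) = unip L (n i) V h ((Ψ i).equiv V h s) := by
  have hn' := (unip_twist_iff t m m₁ n).1 hn
  -- The local isomorphisms `Ψ₁⁻¹ (1 + n) Ψ` agree on the overlaps.
  have hlt : ∀ (p : Ix2 ι) (V : P.Aff) (h : V.1 ≤ U2 C.U p) (s : Γ(M, Fr.o V)),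
      ((Ψ₁ p.1.1).equiv V (h.trans inf_le_left)).symm
        (unip L (n p.1.1) V (h.trans inf_le_left) ((Ψ p.1.1).equiv V (h.trans inf_le_left) s)) =
      ((Ψ₁ p.1.2).equiv V (h.trans inf_le_right)).symm
        (unip L (n p.1.2) V (h.trans inf_le_right) ((Ψ p.1.2).equiv V (h.trans inf_le_right) s)) :=
    fun p V h s => by
      rw [AddEquiv.symm_apply_eq, hΨ₁ p V h, AddEquiv.apply_symm_apply, hΨ p V h, hn']
  have hind : ∀ (i k : ι) (V : P.Aff) (hi : V.1 ≤ (C.U i).1) (hk : V.1 ≤ (C.U k).1)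
      (s : Γ(M, Fr.o V)),
      ((Ψ₁ i).equiv V hi).symm (unip L (n i) V hi ((Ψ i).equiv V hi s)) =
      ((Ψ₁ k).equiv V hk).symm (unip L (n k) V hk ((Ψ k).equiv V hk s)) := fun i k V hi hk s => by
    rcases lt_trichotomy i k with h | rfl | h
    · exact hlt ⟨(i, k), h⟩ V (le_inf hi hk) s
    · rfl
    · exact (hlt ⟨(k, i), h⟩ V (le_inf hk hi) s).symm
  choose c hc using fun b : {V : P.Aff // ∃ i, V.1 ≤ (C.U i).1} => b.2
  obtain ⟨f, hf⟩ := exists_hom_of_basis (M := M) (N := M₁) Fr.isBasis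
    (fun b => ((Ψ₁ (c b)).equiv b.1 (hc b)).symm.toAddMonoidHom.comp
      ((unip L (n (c b)) b.1 (hc b)).comp ((Ψ (c b)).equiv b.1 (hc b)).toAddMonoidHom))
    (fun b r s => by
      obtain ⟨r, rfl⟩ := Fr.π_surjective b.1 r
      change ((Ψ₁ (c b)).equiv b.1 (hc b)).symm (unip L (n (c b)) b.1 (hc b)
        ((Ψ (c b)).equiv b.1 (hc b) (Fr.π b.1 r • s))) = _
      rw [Framing.equiv_smul, unip_act, Framing.symm_act]
      rfl)
    (fun b b' h s => by
      have hb : b'.1 ≤ b.1 := Fr.le_of_o_le h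
      refine (hind (c b') (c b) b'.1 (hc b') (le_trans hb (hc b)) _).trans ?_
      rw [(Ψ (c b)).equiv_nat b.1 b'.1 (hc b) hb, ← unip_nat, Framing.symm_nat]
      rfl)
  have hf' : ∀ i V h (s : Γ(M, Fr.o V)),
      (Ψ₁ i).equiv V h ((f.app (Fr.o V)).hom s) = unip L (n i) V h ((Ψ i).equiv V h s) :=
    fun i V h s => by
      rw [← AddEquiv.eq_symm_apply]
      exact (hf ⟨V, i, h⟩ s).trans (hind _ _ V _ _ s)
  refine ⟨f, hom_ext_of_basis Fr.isBasis fun b s => ?_, hf'⟩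
  obtain ⟨V, i, h⟩ := b
  change secMap T.j ρ₁ (Fr.o V) ((f.app (Fr.o V)).hom s) = secMap T.j ρ (Fr.o V) s
  rw [← (Ψ₁ i).w_equiv V h, hf' i V h, ← (Ψ i).w_equiv V h]
  refine ((T.w i V h).map_add ((Ψ i).equiv V h s) _).trans ?_
  exact (congrArg (_ + ·) ((hT i V h _).2 ⟨_, rfl⟩)).trans (add_zero _)

/-- Two extensions are isomorphic if and only if their cochains differ by a coboundary. -/
theorem extIso_iff {Ψ : ∀ i, Framing T ρ i} {Ψ₁ : ∀ i, Framing T ρ₁ i} {t : Transition L C}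
    {m m₁ : C1 C.U (endSheaf F E)} (hT : T.KerEqInc) (hΨ : IsGluing Ψ (t.twist m))
    (hΨ₁ : IsGluing Ψ₁ (t.twist m₁)) :
    ExtIso T.j ρ ρ₁ ↔ ∃ n, m - m₁ = d0 C.U _ n := by
  constructor
  · rintro ⟨f, hf⟩
    have hfs : ∀ V (s : Γ(M, Fr.o V)), secMap T.j ρ₁ (Fr.o V) ((f.hom.app (Fr.o V)).hom s) =
        secMap T.j ρ (Fr.o V) s := fun V s => by
      rw [← hf]; rfl
    -- In the framings, an isomorphism of extensions is the identity modulo the top degree.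
    let A (i : ι) (V : P.Aff) (h : V.1 ≤ (C.U i).1) : L.X V →+ L.X V :=
      ((Ψ₁ i).equiv V h).toAddMonoidHom.comp ((f.hom.app (Fr.o V)).hom.comp
        ((Ψ i).equiv V h).symm.toAddMonoidHom)
    have hA : ∀ i V h s, A i V h ((Ψ i).equiv V h s) =
        (Ψ₁ i).equiv V h ((f.hom.app (Fr.o V)).hom s) := fun i V h s =>
      congrArg (fun s => (Ψ₁ i).equiv V h ((f.hom.app (Fr.o V)).hom s))
        (((Ψ i).equiv V h).symm_apply_apply s)
    have hAact : ∀ i V h r x, A i V h (L.actR C i V h r x) = L.actR C i V h r (A i V h x) :=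
      fun i V h r x => by
        obtain ⟨s, rfl⟩ := ((Ψ i).equiv V h).surjective x
        rw [← Framing.equiv_smul, hA, hA, ← Framing.equiv_smul]
        exact congrArg ((Ψ₁ i).equiv V h) ((f.hom.app_smul (Fr.π V r) s))
    have hAnat : ∀ i V h W (hW : W ≤ V) x, L.res hW (A i V h x) =
        A i W (le_trans hW h) (L.res hW x) := fun i V h W hW x => by
      obtain ⟨s, rfl⟩ := ((Ψ i).equiv V h).surjective x
      rw [← Framing.equiv_nat, hA, hA, ← Framing.equiv_nat]
      exact congrArg ((Ψ₁ i).equiv W _) (hom_app_secRes f.hom (Fr.o_mono hW) s).symm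
    have key : ∀ i, ∃ n : (endSheaf F E).obj (.op (C.U i).1), ∀ V h x,
        A i V h x = unip L n V h x := fun i => by
      choose n hn using fun (V : P.Aff) (h : V.1 ≤ (C.U i).1) =>
        Transition.exists_linear h h (A i V h) (AddMonoidHom.id _) (hAact i V h) (fun r x => rfl)
          (fun x => hT.exists_add (h := h) (by
            obtain ⟨s, rfl⟩ := ((Ψ i).equiv V h).surjective x
            rw [hA]
            exact ((Ψ₁ i).w_equiv V h _).trans ((hfs V s).trans ((Ψ i).w_equiv V h s).symm)))
      obtain ⟨m, hm⟩ := exists_endSheaf n fun V V' hV h x =>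
        Transition.linear_nat h (fun x => hAnat i V hV V' h x) (fun x => rfl)
          (hn V hV) (hn V' (le_trans h hV)) x
      refine ⟨m, fun V h x => ?_⟩
      rw [unip_apply, hm]
      exact hn V h x
    choose n hn using key
    refine ⟨n, (unip_twist_iff t m m₁ n).2 fun p V h x => ?_⟩
    obtain ⟨s, rfl⟩ := ((Ψ p.1.2).equiv V (h.trans inf_le_right)).surjective x
    rw [← hΨ p V h, ← hn, ← hn, hA, hA, hΨ₁ p V h]
  · rintro ⟨n, hn⟩
    obtain ⟨f, hf, hf'⟩ := exists_hom_of_d0 hT hΨ hΨ₁ n hn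
    obtain ⟨g, -, hg'⟩ := exists_hom_of_d0 hT hΨ₁ hΨ (-n) (by rw [map_neg, ← hn, neg_sub])
    refine ⟨⟨f, g, hom_ext_of_basis Fr.isBasis fun b s => ?_,
      hom_ext_of_basis Fr.isBasis fun b s => ?_⟩, hf⟩
    · obtain ⟨V, i, h⟩ := b
      refine ((Ψ i).equiv V h).injective ((hg' i V h ((f.app (Fr.o V)).hom s)).trans ?_)
      rw [hf']
      exact unip_neg_unip _ _ _ _
    · obtain ⟨V, i, h⟩ := b
      refine ((Ψ₁ i).equiv V h).injective ((hf' i V h ((g.app (Fr.o V)).hom s)).trans ?_)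
      rw [hg']
      have := unip_neg_unip (L := L) (-n i) V h ((Ψ₁ i).equiv V h s)
      rwa [neg_neg] at this

end SmoothPair
end CechExt

namespace CechExt

/-! ### Gluing the models along a cocycle -/

section SymmExt

variable {G ι : Type*} [Group G] [LinearOrder ι] (p : ι → Prop)
  (g : ∀ i k, p i → p k → i < k → G)

/-- The extension to all pairs of indices of transition elements given for `i < k`. -/
def symmExt (i k : ι) (hi : p i) (hk : p k) : G :=
  if h : i < k then g i k hi hk h else if h : k < i then (g k i hk hi h)⁻¹ else 1

theorem symmExt_of_lt {i k : ι} (hi : p i) (hk : p k) (h : i < k) :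
    symmExt p g i k hi hk = g i k hi hk h := dif_pos h

theorem symmExt_self {i : ι} (hi : p i) : symmExt p g i i hi hi = 1 := by
  rw [symmExt, dif_neg (lt_irrefl i), dif_neg (lt_irrefl i)]

theorem symmExt_inv (i k : ι) (hi : p i) (hk : p k) :
    (symmExt p g i k hi hk)⁻¹ = symmExt p g k i hk hi := by
  rcases lt_trichotomy i k with h | rfl | h
  · rw [symmExt, symmExt, dif_pos h, dif_neg h.not_gt, dif_pos h]
  · rw [symmExt_self, inv_one]
  · rw [symmExt, symmExt, dif_pos h, dif_neg h.not_gt, dif_pos h, inv_inv]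

/-- A cocycle on increasing triples extends to a cocycle on all triples. -/
theorem symmExt_mul
    (hg : ∀ i k l hi hk hl (h : i < k) (h' : k < l),
      g i k hi hk h * g k l hk hl h' = g i l hi hl (h.trans h')) (i k l : ι) (hi : p i) (hk : p k)
    (hl : p l) : symmExt p g i k hi hk * symmExt p g k l hk hl = symmExt p g i l hi hl := by
  -- The relation is symmetric in the three indices when written as follows.
  let R (i k l : {i // p i}) : Prop := symmExt p g i k i.2 k.2 * symmExt p g k l k.2 l.2 *
    symmExt p g l i l.2 i.2 = 1
  have cyc : ∀ {i k l}, R i k l → R k l i := fun {i k l} h => by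
    change _ * _ * _ = (1 : G) at h ⊢
    rwa [mul_assoc, mul_eq_one_comm] at h
  have rev : ∀ {i k l}, R i k l → R i l k := fun {i k l} h => by
    change _ * _ * _ = (1 : G) at h ⊢
    rw [← inv_eq_one, mul_inv_rev, mul_inv_rev, symmExt_inv, symmExt_inv, symmExt_inv, ← mul_assoc]
      at h
    exact h
  have lt : ∀ {i k l : {i // p i}}, i.1 < k.1 → k.1 < l.1 → R i k l := fun {i k l} h h' => by
    change _ * _ * _ = (1 : G)
    rw [symmExt_of_lt p g i.2 k.2 h, symmExt_of_lt p g k.2 l.2 h', hg, ← symmExt_inv p g i l,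
      symmExt_of_lt p g i.2 l.2 (h.trans h'), mul_inv_cancel]
  have eq : ∀ {i l : {i // p i}}, R i i l := fun {i l} => by
    change _ * _ * _ = (1 : G)
    rw [symmExt_self, one_mul, ← symmExt_inv p g i l, mul_inv_cancel]
  have all : ∀ i k l : {i // p i}, R i k l := fun i k l => by
    rcases lt_trichotomy i.1 k.1 with h | h | h
    · rcases lt_trichotomy k.1 l.1 with h' | h' | h'
      · exact lt h h'
      · obtain rfl := Subtype.ext h'
        exact cyc (cyc eq)
      · rcases lt_trichotomy i.1 l.1 with h'' | h'' | h''
        · exact rev (lt h'' h')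
        · obtain rfl := Subtype.ext h''
          exact cyc eq
        · exact cyc (lt h'' h)
    · obtain rfl := Subtype.ext h
      exact eq
    · rcases lt_trichotomy i.1 l.1 with h' | h' | h'
      · exact cyc (cyc (rev (lt h h')))
      · obtain rfl := Subtype.ext h'
        exact cyc eq
      · rcases lt_trichotomy k.1 l.1 with h'' | h'' | h''
        · exact cyc (cyc (lt h'' h'))
        · obtain rfl := Subtype.ext h''
          exact cyc (cyc eq)
        · exact cyc (rev (lt h'' h))
  have h : _ * _ * _ = (1 : G) := all ⟨i, hi⟩ ⟨k, hk⟩ ⟨l, hl⟩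
  rw [mul_eq_one_iff_eq_inv, symmExt_inv] at h
  exact h

end SymmExt

namespace SmoothPair

variable {κ : Type u} [Field κ] {P : SmoothPair κ} {F E : P.ModFam} {ι : Type v} [LinearOrder ι]
  {L : Model F E} {C : CechData E ι} {Fr : Frame L C} {T : Target Fr}

/-- A transition map is bijective, because it is bijective on the top degree and on the quotient by it. -/
theorem Transition.bijective {t : Transition L C} (hT : T.KerEqInc) (ht : T.Compat t) (p : Ix2 ι)
    (V : P.Aff) (h : V.1 ≤ U2 C.U p) : Function.Bijective (t.T p V h) := by
  constructor
  · rw [injective_iff_map_eq_zero]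
    intro x hx
    have h1 := ht p V h x
    rw [hx] at h1
    obtain ⟨ν, rfl⟩ := (hT _ V _ x).1 (h1.symm.trans (map_zero (T.w p.1.1 V _)))
    rwa [t.inc] at hx
  · intro y
    obtain ⟨x, hx⟩ := T.w_surjective p.1.2 V (h.trans inf_le_right)
      (T.w p.1.1 V (h.trans inf_le_left) y)
    obtain ⟨ν, hν⟩ := hT.exists_add (i := p.1.1) (h := h.trans inf_le_left) (x := y)
      (y := t.T p V h x) (hx.symm.trans (ht p V h x).symm)
    exact ⟨(show L.X V from x) + (L.fm V).inc ν, ((t.T p V h).map_add _ _).trans (by rw [t.inc, hν])⟩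

/-- Transition maps for all pairs of indices, satisfying the cocycle condition. -/
structure FullTransition (T : Target Fr) where
  τ : ∀ (i k : ι) (V : P.Aff), V.1 ≤ (C.U i).1 → V.1 ≤ (C.U k).1 → (L.X V ≃+ L.X V)
  comp : ∀ i k l V hi hk hl x, τ i k V hi hk (τ k l V hk hl x) = τ i l V hi hl x
  act : ∀ i k V hi hk r x, τ i k V hi hk (L.actR C k V hk r x) = L.actR C i V hi r (τ i k V hi hk x)
  nat : ∀ i k V hi hk (W : P.Aff) (hW : W ≤ V) x,
    L.res hW (τ i k V hi hk x) = τ i k W (le_trans hW hi) (le_trans hW hk) (L.res hW x)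
  w : ∀ i k V hi hk x, T.w i V hi (τ i k V hi hk x) = T.w k V hk x

theorem FullTransition.self (τ : FullTransition T) (i V hi x) : τ.τ i i V hi hi x = x :=
  (τ.τ i i V hi hi).injective (τ.comp i i i V hi hi hi x)

/-- The cocycle condition for increasing triples gives transition maps for all pairs of indices. -/
theorem exists_fullTransition (hT : T.KerEqInc) {t : Transition L C} (ht : T.Compat t)
    (hc : t.IsCocycle) : ∃ τ : FullTransition T, ∀ (p : Ix2 ι) (V : P.Aff) (h : V.1 ≤ U2 C.U p) x,
      τ.τ p.1.1 p.1.2 V (h.trans inf_le_left) (h.trans inf_le_right) x = t.T p V h x := by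
  let g (V : P.Aff) (i k : ι) (hi : V.1 ≤ (C.U i).1) (hk : V.1 ≤ (C.U k).1) (h : i < k) :
      Equiv.Perm (L.X V) := Equiv.ofBijective (t.T ⟨(i, k), h⟩ V (le_inf hi hk))
        (Transition.bijective hT ht ⟨(i, k), h⟩ V (le_inf hi hk))
  let σ (i k : ι) (V : P.Aff) (hi : V.1 ≤ (C.U i).1) (hk : V.1 ≤ (C.U k).1) :
      Equiv.Perm (L.X V) := symmExt (fun i => V.1 ≤ (C.U i).1) (g V) i k hi hk
  have hcomp : ∀ i k l V hi hk hl x, σ i k V hi hk (σ k l V hk hl x) = σ i l V hi hl x :=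
    fun i k l V hi hk hl x => DFunLike.congr_fun (symmExt_mul _ (g V)
      (fun i k l hi hk hl h h' => Equiv.ext fun x =>
        hc ⟨(i, k, l), h, h'⟩ V (le_inf hi (le_inf hk hl)) x) i k l hi hk hl) x
  have hlt : ∀ i k V hi hk (h : i < k) x, σ i k V hi hk x = t.T ⟨(i, k), h⟩ V (le_inf hi hk) x :=
    fun i k V hi hk h x => DFunLike.congr_fun (symmExt_of_lt _ (g V) hi hk h) x
  have hself : ∀ i V hi x, σ i i V hi hi x = x := fun i V hi x =>
    (σ i i V hi hi).injective (hcomp i i i V hi hi hi x)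
  -- A property of transition maps that passes to inverses holds for all pairs of indices.
  have ind : ∀ q : ι → ι → Prop, (∀ i k, i < k → q i k) → (∀ i, q i i) →
      (∀ i k, q i k → q k i) → ∀ i k, q i k := fun q h1 h2 h3 i k => by
    rcases lt_trichotomy i k with h | rfl | h
    · exact h1 i k h
    · exact h2 i
    · exact h3 k i (h1 k i h)
  have hadd : ∀ i k V hi hk x y, σ i k V hi hk (x + y) = σ i k V hi hk x + σ i k V hi hk y := by
    refine ind (fun i k => ∀ V hi hk x y, σ i k V hi hk (x + y) =
      σ i k V hi hk x + σ i k V hi hk y) ?_ ?_ ?_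
    · intro i k h V hi hk x y
      rw [hlt i k V hi hk h, hlt i k V hi hk h, hlt i k V hi hk h, map_add]
    · intro i V hi hk x y
      rw [hself, hself, hself]
    · intro i k h V hk hi x y
      apply (σ i k V hi hk).injective
      rw [hcomp, hself, h, hcomp, hself, hcomp, hself]
  let τ (i k : ι) (V : P.Aff) (hi : V.1 ≤ (C.U i).1) (hk : V.1 ≤ (C.U k).1) : L.X V ≃+ L.X V :=
    { σ i k V hi hk with map_add' := hadd i k V hi hk }
  replace hcomp : ∀ i k l V hi hk hl x, τ i k V hi hk (τ k l V hk hl x) = τ i l V hi hl x := hcomp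
  replace hself : ∀ i V hi x, τ i i V hi hi x = x := hself
  replace hlt : ∀ i k V hi hk (h : i < k) x,
    τ i k V hi hk x = t.T ⟨(i, k), h⟩ V (le_inf hi hk) x := hlt
  refine ⟨⟨τ, hcomp, fun i k => ?_, fun i k => ?_, fun i k => ?_⟩,
    fun p V h x => hlt _ _ V _ _ p.2 x⟩
  · refine ind (fun i k => ∀ V hi hk r x, τ i k V hi hk (L.actR C k V hk r x) =
      L.actR C i V hi r (τ i k V hi hk x)) ?_ ?_ ?_ i k
    · intro i k h V hi hk r x
      rw [hlt i k V hi hk h, hlt i k V hi hk h]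
      exact t.act ⟨(i, k), h⟩ V (le_inf hi hk) r x
    · intro i V hi hk r x
      rw [hself, hself]
    · intro i k h V hk hi r x
      apply (τ i k V hi hk).injective
      rw [hcomp, hself, h, hcomp, hself]
  · refine ind (fun i k => ∀ V hi hk (W : P.Aff) (hW : W ≤ V) x, L.res hW (τ i k V hi hk x) =
      τ i k W (le_trans hW hi) (le_trans hW hk) (L.res hW x)) ?_ ?_ ?_ i k
    · intro i k h V hi hk W hW x
      rw [hlt i k V hi hk h, hlt i k W _ _ h]
      exact t.nat ⟨(i, k), h⟩ V (le_inf hi hk) W hW x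
    · intro i V hi hk W hW x
      rw [hself, hself]
    · intro i k h V hk hi W hW x
      apply (τ i k W (le_trans hW hi) (le_trans hW hk)).injective
      rw [hcomp, hself, ← h V hi hk W hW, hcomp, hself]
  · refine ind (fun i k => ∀ V hi hk x, T.w i V hi (τ i k V hi hk x) = T.w k V hk x)
      ?_ ?_ ?_ i k
    · intro i k h V hi hk x
      rw [hlt i k V hi hk h]
      exact ht ⟨(i, k), h⟩ V (le_inf hi hk) x
    · intro i V hi hk x
      rw [hself]
    · intro i k h V hk hi x
      rw [← h V hi hk, hcomp, hself]

namespace FullTransition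

variable (τ : FullTransition T)

/-- A transition map, as a map of modules over the functions on `S`. -/
def map (i k : ι) (V : P.Aff) (hi : V.1 ≤ (C.U i).1) (hk : V.1 ≤ (C.U k).1) :
    Fr.Obj k V hk ≃ₗ[Γ(Fr.S, Fr.o V)] Fr.Obj i V hi :=
  { τ.τ i k V hi hk with
    map_smul' := fun b x => by
      obtain ⟨r, rfl⟩ := Fr.π_surjective V b
      rw [Fr.π_smul]
      refine (τ.act i k V hi hk r x).trans (Fr.π_smul i V hi r _).symm }

theorem map_map (i k l : ι) (V : P.Aff) (hi : V.1 ≤ (C.U i).1) (hk : V.1 ≤ (C.U k).1)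
    (hl : V.1 ≤ (C.U l).1) (x : Fr.Obj l V hl) :
    τ.map i k V hi hk (τ.map k l V hk hl x) = τ.map i l V hi hl x :=
  τ.comp i k l V hi hk hl x

theorem map_self (i : ι) (V : P.Aff) (hi : V.1 ≤ (C.U i).1) (x : Fr.Obj i V hi) :
    τ.map i i V hi hi x = x := τ.self i V hi x

theorem res_map (i k : ι) (V : P.Aff) (hi : V.1 ≤ (C.U i).1) (hk : V.1 ≤ (C.U k).1) (W : P.Aff)
    (hW : W ≤ V) (x : Fr.Obj k V hk) : Fr.resObj hi hW (τ.map i k V hi hk x) =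
      τ.map i k W (le_trans hW hi) (le_trans hW hk) (Fr.resObj hk hW x) :=
  τ.nat i k V hi hk W hW x

theorem w_map (i k : ι) (V : P.Aff) (hi : V.1 ≤ (C.U i).1) (hk : V.1 ≤ (C.U k).1)
    (x : Fr.Obj k V hk) : T.w i V hi (τ.map i k V hi hk x) = T.w k V hk x :=
  τ.w i k V hi hk x

end FullTransition

theorem resObj_self {i : ι} (V : P.Aff) (h : V.1 ≤ (C.U i).1) (x : Fr.Obj i V h) :
    Fr.resObj h le_rfl x = x := L.res_self V x

theorem resObj_resObj {i : ι} {V W W' : P.Aff} (h : V.1 ≤ (C.U i).1) (hW : W ≤ V) (hW' : W' ≤ W)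
    (x : Fr.Obj i V h) :
    Fr.resObj (le_trans hW h) hW' (Fr.resObj h hW x) = Fr.resObj h (hW'.trans hW) x :=
  L.res_res hW hW' x

/-- A choice of a member of the covering containing a small affine open. -/
def idx (C : CechData E ι) (b : {V : P.Aff // ∃ i, V.1 ≤ (C.U i).1}) : ι := b.2.choose

theorem le_idx (b : {V : P.Aff // ∃ i, V.1 ≤ (C.U i).1}) : b.1.1 ≤ (C.U (idx C b)).1 :=
  b.2.choose_spec

/-- The sheaf obtained by gluing the copies of the model. Its sections over a small affine open set
are the elements of the copy with index `idx`. -/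
def glueing (τ : FullTransition T) (d : ∀ i, DualBasisOver E (C.U i)) : BasisModule Fr.S where
  B := {V : P.Aff // ∃ i, V.1 ≤ (C.U i).1}
  o b := Fr.o b.1
  isBasis := Fr.isBasis
  G b := Fr.Obj (idx C b) b.1 (le_idx b)
  res {b b'} h := (τ.map (idx C b') (idx C b) b'.1 (le_idx b')
    (le_trans (Fr.le_of_o_le h) (le_idx b))).toAddMonoidHom.comp
      (Fr.resObj (le_idx b) (Fr.le_of_o_le h))
  res_smul {b b'} h r x := by
    change τ.map _ _ _ _ _ (Fr.resObj _ _ (r • x)) = _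
    rw [Fr.resObj_smul, map_smul]
    rfl
  res_self b x := (τ.map_self _ _ _ _).trans (resObj_self b.1 (le_idx b) x)
  res_res {b b' b''} h h' x := by
    change τ.map _ _ _ _ _ (Fr.resObj _ _ (τ.map _ _ _ _ _ (Fr.resObj _ _ x))) = _
    rw [τ.res_map, τ.map_map, resObj_resObj]
    rfl
  sep b x hx := by
    refine Fr.obj_eq_zero_of_local le_rfl (d (idx C b)) (le_idx b) x fun y hy => ?_
    obtain ⟨b', h, hyb', e⟩ := hx y hy
    refine ⟨b'.1, Fr.le_of_o_le h, hyb', ?_⟩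
    exact (map_eq_zero_iff _ (τ.map (idx C b') (idx C b) b'.1 (le_idx b') _).injective).1 e
  glue b p hp hle hcov s hs := by
    have hle' : ∀ b', p b' → b'.1 ≤ b.1 := fun b' hb' => Fr.le_of_o_le (hle b' hb')
    obtain ⟨t, ht⟩ := Fr.obj_glue le_rfl (d (idx C b)) (le_idx b)
      (fun W => ∃ h : ∃ i, W.1 ≤ (C.U i).1, p ⟨W, h⟩)
      (fun W W' hW h => ⟨⟨_, le_trans h hW.1.choose_spec⟩, hp _ _ hW.2 (Fr.o_mono h)⟩)
      (fun W hW => hle' _ hW.2)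
      (fun y hy => by
        obtain ⟨b', hb', hyb'⟩ := hcov y hy
        exact ⟨b'.1, ⟨b'.2, hb'⟩, hyb'⟩)
      (fun W hW => τ.map (idx C b) (idx C ⟨W, hW.1⟩) W (le_trans (hle' _ hW.2) (le_idx b))
        (le_idx ⟨W, hW.1⟩) (s ⟨W, hW.1⟩ hW.2))
      (fun W W' hW hW' h => by
        rw [τ.res_map, ← hs ⟨W, hW.1⟩ ⟨W', hW'.1⟩ hW.2 hW'.2 (Fr.o_mono h)]
        exact (τ.map_map _ _ _ _ _ _ _ _).symm)
    refine ⟨t, fun b' hb' => ?_⟩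
    change τ.map _ _ _ _ _ (Fr.resObj _ _ t) = _
    rw [ht b'.1 ⟨b'.2, hb'⟩, τ.map_map]
    exact τ.map_self _ _ _ _

end SmoothPair
end CechExt

namespace CechExt

/-- Sections that are a basis over the members of a basis of the topology are a basis over all
open sets. -/
theorem isBasisOn_of_basis {S : Scheme.{u}} {M : S.Modules} {B : Type*} {o : B → S.Opens}
    (hB : IsOpensBasis o) {U : S.Opens} {n : ℕ} (b : Fin n → Γ(M, U))
    (hb : ∀ c (h : o c ≤ U), Function.Bijective fun a : Fin n → Γ(S, o c) =>
      ∑ k, a k • secRes M h (b k)) : IsBasisOn M b := by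
  intro V h
  constructor
  · intro a a' haa
    refine funext fun k => fun_eq_of_locally_eq _ _ fun x hx => ?_
    obtain ⟨c, hxc, hc⟩ := hB V x hx
    refine ⟨o c, hc, hxc, ?_⟩
    refine congrFun ((hb c (hc.trans h)).1 (a₁ := fun k => funRes S hc (a k))
      (a₂ := fun k => funRes S hc (a' k)) ?_) k
    have := congrArg (secRes M hc) haa
    exact (secRes_sum_smul b h hc a).symm.trans (this.trans (secRes_sum_smul b h hc a'))
  · intro x
    choose a ha using fun c (hc : o c ≤ V) => (hb c (hc.trans h)).2 (secRes M hc x)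
    have key : ∀ k, ∃ f : Γ(S, V), ∀ c hc, funRes S hc f = a c hc k := fun k =>
      fun_exists_glue hB V (fun c => o c ≤ V) (fun c c' hc hcc => hcc.trans hc) (fun c hc => hc)
        (fun y hy => let ⟨c, hyc, hc⟩ := hB V y hy; ⟨c, hc, hyc⟩) (fun c hc => a c hc k)
        (fun c c' hc hc' hcc => by
          refine congrFun ((hb c' (hc'.trans h)).1 (a₁ := fun k => funRes S hcc (a c hc k))
            (a₂ := a c' hc') ?_) k
          refine (secRes_sum_smul b (hc.trans h) hcc (a c hc)).symm.trans ?_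
          refine (congrArg (secRes M hcc) (ha c hc)).trans ?_
          rw [secRes_secRes]
          exact (ha c' hc').symm)
    choose f hf using key
    refine ⟨f, eq_of_locally_eq M _ _ fun y hy => ?_⟩
    obtain ⟨c, hyc, hc⟩ := hB V y hy
    refine ⟨o c, hc, hyc, ?_⟩
    refine (secRes_sum_smul b h hc f).trans ((Finset.sum_congr rfl fun k _ => ?_).trans (ha c hc))
    rw [hf k c hc]

namespace SmoothPair

variable {κ : Type u} [Field κ] {P : SmoothPair κ} {F E : P.ModFam} {ι : Type v} [LinearOrder ι]
  {L : Model F E} {C : CechData E ι} {Fr : Frame L C} {T : Target Fr}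

/-- Local freeness, in terms of families of modules. -/
def ModFam.IsLocallyFree (E : P.ModFam) : Prop :=
  ∀ (x : P.Y2) (W : P.Y2.Opens), x ∈ W → ∃ V : P.Aff, x ∈ V.1 ∧ V.1 ≤ W ∧
    ∃ d : DualBasisOver E V, d.IsBasis

variable {M : Fr.S.Modules} {ρ : M ⟶ (Scheme.Modules.pushforward T.j).obj T.M'}

/-- A sheaf that is isomorphic to the model over the members of the covering reduces to `M'`. -/
theorem Framing.isReduction (Ψ : ∀ i, Framing T ρ i) :
    IsReduction T.j ρ := by
  constructor
  · intro W e x hx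
    obtain ⟨⟨V, i, h⟩, hxV, hV⟩ := Fr.isBasis W x hx
    obtain ⟨y, hy⟩ := T.w_surjective i V h
      (secRes T.M' (T.j.preimage_mono hV) e)
    refine ⟨Fr.o V, hV, hxV, ((Ψ i).equiv V h).symm y, ?_⟩
    exact ((Ψ i).secMap_symm V h y).trans hy
  · intro W s hs x hx
    obtain ⟨⟨V, i, h⟩, hxV, hV⟩ := Fr.isBasis W x hx
    refine ⟨Fr.o V, hV, hxV, ?_⟩
    have h0 : T.w i V h ((Ψ i).app V h (secRes M hV s)) = 0 := by
      rw [(Ψ i).w_app, secMap_secRes]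
      exact (congrArg _ hs).trans (map_zero _)
    have h1 := T.mem_of_w i V h _ h0
    let e : Fr.Obj i V h ≃ₗ[Γ(Fr.S, Fr.o V)] Γ(M, Fr.o V) :=
      ({ (Ψ i).app V h with map_smul' := (Ψ i).smul V h } :
        Γ(M, Fr.o V) ≃ₗ[Γ(Fr.S, Fr.o V)] Fr.Obj i V h).symm
    have h2 := Submodule.mem_map_of_mem (f := e.toLinearMap) h1
    rw [Submodule.map_smul''] at h2
    have h3 := Submodule.smul_mono (le_refl (RingHom.ker (T.j.app (Fr.o V)).hom)) le_top h2
    have e1 : e.toLinearMap ((Ψ i).app V h (secRes M hV s)) = secRes M hV s :=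
      ((Ψ i).app V h).symm_apply_apply _
    rw [e1] at h3
    exact h3

/-- A sheaf that is isomorphic to the model over the members of the covering is locally free, as a local
basis of `E` is a local basis of the model. -/
theorem Framing.isVectorBundle (hE : E.IsLocallyFree) (Ψ : ∀ i, Framing T ρ i) :
    IsVectorBundle M := by
  intro x
  obtain ⟨⟨V₀, i, h₀⟩, hxV₀, -⟩ := Fr.isBasis ⊤ x trivial
  obtain ⟨V, hxV, hV, d, hd⟩ := hE (Fr.pt x) V₀.1 ((Fr.mem_o V₀ x).1 hxV₀)
  have h : V.1 ≤ (C.U i).1 := hV.trans h₀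
  refine ⟨Fr.o V, (Fr.mem_o V x).2 hxV, d.n,
    fun k => ((Ψ i).app V h).symm (Fr.secObj i V h (d.e k)), ?_⟩
  refine isBasisOn_of_basis Fr.isBasis _ fun c hc => ?_
  have hcV : c.1 ≤ V := Fr.le_of_o_le hc
  have key : ∀ a : Fin d.n → Γ(Fr.S, Fr.o c.1),
      (Ψ i).app c.1 (le_trans hcV h) (∑ k, a k • secRes M hc
        (((Ψ i).app V h).symm (Fr.secObj i V h (d.e k)))) =
      ∑ k, a k • Fr.secObj i c.1 (le_trans hcV h) (E.res hcV (d.e k)) := fun a => by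
    rw [map_sum]
    refine Finset.sum_congr rfl fun k _ => ?_
    rw [(Ψ i).smul, (Ψ i).nat V c.1 h hcV, AddEquiv.apply_symm_apply, Fr.resObj_secObj]
  constructor
  · intro a a' haa
    have e := congrArg ((Ψ i).app c.1 (le_trans hcV h)) haa
    have e' := (key a).symm.trans (e.trans (key a'))
    refine funext fun k => ?_
    have e'' := congrArg (Fr.form h d c.1 hcV k) e'
    simpa only [map_sum, map_smul, Fr.form_secObj h d hd hcV, smul_eq_mul, mul_ite, mul_one,
      mul_zero, Finset.sum_ite_eq', Finset.mem_univ, if_true] using e''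
  · intro s
    refine ⟨fun k => Fr.form h d c.1 hcV k ((Ψ i).app c.1 (le_trans hcV h) s),
      ((Ψ i).app c.1 (le_trans hcV h)).injective ((key _).trans ?_)⟩
    exact Fr.sum_form h d hcV _

/-- Transition maps that satisfy the cocycle condition come from an extension. -/
theorem exists_isGluing (hT : T.KerEqInc) {t : Transition L C} (ht : T.Compat t)
    (hc : t.IsCocycle) (d : ∀ i, DualBasisOver E (C.U i)) :
    ∃ (M : Fr.S.Modules) (ρ : M ⟶ (Scheme.Modules.pushforward T.j).obj T.M')
      (Ψ : ∀ i, Framing T ρ i), IsGluing Ψ t := by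
  obtain ⟨τ, hτ⟩ := exists_fullTransition hT ht hc
  let D := glueing τ d
  have hres : ∀ (b b' : D.B) (h : D.o b' ≤ D.o b) (x : D.G b), D.res h x =
      τ.map (idx C b') (idx C b) b'.1 (le_idx b')
        (le_trans (Fr.le_of_o_le h) (le_idx b)) (Fr.resObj (le_idx b) (Fr.le_of_o_le h) x) :=
    fun b b' h x => rfl
  obtain ⟨ρ, hρ⟩ := exists_hom_of_basis (M := D.toModules)
    (N := (Scheme.Modules.pushforward T.j).obj T.M') D.isBasis
    (fun b => (T.w (idx C b) b.1 (le_idx b)).comp (D.ev b))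
    (fun b r s => by
      refine (congrArg (T.w (idx C b) b.1 (le_idx b)) (D.ev_smul b r s)).trans ?_
      exact T.w_smul _ _ _ _ _)
    (fun b b' h s => by
      refine (congrArg (T.w (idx C b') b'.1 (le_idx b'))
        ((D.ev_secRes h s).trans (hres b b' h _))).trans ?_
      refine (τ.w_map _ _ _ _ _ _).trans ?_
      exact T.w_nat _ _ _ (le_idx b) (Fr.le_of_o_le h) _)
  let f (b : {V : P.Aff // ∃ i, V.1 ≤ (C.U i).1}) :
      Γ(D.toModules, Fr.o b.1) →+ Fr.Obj (idx C b) b.1 (le_idx b) := D.ev b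
  have hf : ∀ b, Function.Bijective (f b) := D.ev_bijective
  have hfs : ∀ b (r : Γ(Fr.S, Fr.o b.1)) (s : Γ(D.toModules, Fr.o b.1)),
      f b (r • s) = r • f b s := fun b r s => D.ev_smul b r s
  have hfr : ∀ b b' (h : b'.1 ≤ b.1) (s : Γ(D.toModules, Fr.o b.1)),
      f b' (secRes D.toModules (Fr.o_mono h) s) = τ.map (idx C b') (idx C b) b'.1 (le_idx b')
        (le_trans h (le_idx b)) (Fr.resObj (le_idx b) h (f b s)) := fun b b' h s =>
    (D.ev_secRes (b := b) (b' := b') (Fr.o_mono h) s).trans (hres b b' (Fr.o_mono h) _)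
  -- Sections of the glued sheaf are elements of the copy of the model with index `idx`; the framing
  -- over `U_i` transports them to the copy with index `i`.
  let app (i : ι) (V : P.Aff) (h : V.1 ≤ (C.U i).1) : Γ(D.toModules, Fr.o V) ≃+ Fr.Obj i V h :=
    (AddEquiv.ofBijective (f ⟨V, i, h⟩) (hf _)).trans
        (τ.map i (idx C ⟨V, i, h⟩) V h (le_idx (C := C) ⟨V, i, h⟩)).toAddEquiv
  have happ : ∀ (i : ι) (V : P.Aff) (h : V.1 ≤ (C.U i).1) (s : Γ(D.toModules, Fr.o V)),
      app i V h s = τ.map i (idx C ⟨V, i, h⟩) V h (le_idx (C := C) ⟨V, i, h⟩) (f ⟨V, i, h⟩ s) :=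
    fun i V h s => rfl
  let Ψ (i : ι) : Framing T ρ i :=
    { app := app i
      smul := fun V h b s => by
        rw [happ, happ, hfs ⟨V, i, h⟩ b s, map_smul]
      nat := fun V W h hW s => by
        rw [happ, happ, τ.res_map, hfr ⟨V, i, h⟩ ⟨W, i, le_trans hW h⟩ hW s]
        exact τ.map_map _ _ _ _ _ _ _ _
      w_app := fun V h s => by
        rw [happ, τ.w_map]
        exact (hρ ⟨V, i, h⟩ s).symm }
  refine ⟨D.toModules, ρ, Ψ, fun p V h s => ?_⟩
  have h₂ := h.trans inf_le_right
  have e := τ.map_map p.1.1 p.1.2 (idx C ⟨V, p.1.2, h₂⟩) V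
    (h.trans inf_le_left) h₂ (le_idx (C := C) ⟨V, p.1.2, h₂⟩) (f ⟨V, p.1.2, h₂⟩ s)
  exact e.symm.trans (hτ p V h _)

end SmoothPair
end CechExt

namespace CechExt
namespace SmoothPair

/-! ### The models on the first and second order neighbourhoods -/

variable {κ : Type u} [Field κ] {P : SmoothPair κ}

theorem contr_nat {F E : P.ModFam} {V W : P.Aff} (h : W ≤ V) (f : E.obj V →ₗ[P.O V] P.O V)
    (f' : E.obj W →ₗ[P.O W] P.O W) (hf : ∀ x, P.resO h (f x) = f' (E.res h x))
    (x : F.obj V ⊗[P.O V] E.obj V) :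
    F.res h (contr f x) = contr f' (resTensor F E h x) := by
  induction x using TensorProduct.induction_on with
  | zero => simp only [map_zero]
  | tmul n e => rw [contr_tmul, resTensor_tmul, contr_tmul, map_smulₛₗ, hf]
  | add x y hx hy => simp only [map_add, hx, hy]

variable {E : P.ModFam} {ι : Type v} [LinearOrder ι]

/-- The components of degree `≤ 1` of `Φ r` determine the restriction of `r` to `Y⁽¹⁾`. -/
theorem AlgTriv.j12_app_eq_iff {W : P.Y2.Opens} (Φ : P.AlgTriv W) (V : P.Aff) (h : V.1 ≤ W)
    (r r' : P.R V) : (P.j12.app V.1).hom r = (P.j12.app V.1).hom r' ↔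
      (Φ.app ⟨V, h⟩ r).c0 = (Φ.app ⟨V, h⟩ r').c0 ∧ (Φ.app ⟨V, h⟩ r).c1 = (Φ.app ⟨V, h⟩ r').c1 := by
  have e := Φ.j12_app_eq_zero_iff V h (r - r')
  rw [map_sub, sub_eq_zero, map_sub, sub_eq_add_neg, Trunc.add_c0, Trunc.add_c1, Trunc.neg_c0,
    Trunc.neg_c1, ← sub_eq_add_neg, ← sub_eq_add_neg, sub_eq_zero, sub_eq_zero] at e
  exact e

/-- The element of `𝒪⁽¹⁾(V)` with given components of degree `≤ 1`. -/
def AlgTriv.mk1 {W : P.Y2.Opens} (Φ : P.AlgTriv W) (V : P.Aff) (h : V.1 ≤ W) (f : P.O V)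
    (n : P.con.obj V) : Γ(P.Y1, P.j12 ⁻¹ᵁ V.1) :=
  (P.j12.app V.1).hom ((Φ.app ⟨V, h⟩).symm ⟨f, n, 0⟩)

theorem AlgTriv.j12_app_eq_mk1_iff {W : P.Y2.Opens} (Φ : P.AlgTriv W) (V : P.Aff) (h : V.1 ≤ W)
    (r : P.R V) (f n) : (P.j12.app V.1).hom r = Φ.mk1 V h f n ↔
      (Φ.app ⟨V, h⟩ r).c0 = f ∧ (Φ.app ⟨V, h⟩ r).c1 = n := by
  rw [mk1, Φ.j12_app_eq_iff V h, RingEquiv.apply_symm_apply]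

theorem AlgTriv.mk1_nat {W : P.Y2.Opens} (Φ : P.AlgTriv W) {V V' : P.Aff} (h : V.1 ≤ W)
    (hV : V' ≤ V) (f n) : funRes P.Y1 (P.j12.preimage_mono hV) (Φ.mk1 V h f n) =
      Φ.mk1 V' (le_trans hV h) (P.resO hV f) (P.con.res hV n) := by
  rw [mk1, ← app_funRes (j := P.j12) (show V'.1 ≤ V.1 from hV)]
  refine (Φ.j12_app_eq_mk1_iff V' _ _ _ _).2 ?_
  have e := Φ.nat ⟨V, h⟩ ⟨V', le_trans hV h⟩ hV ((Φ.app ⟨V, h⟩).symm ⟨f, n, 0⟩)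
  rw [RingEquiv.apply_symm_apply] at e
  exact ⟨congrArg Trunc.c0 e, congrArg Trunc.c1 e⟩

variable (C : CechData E ι) (hE : E.IsPresheaf)

/-- The linear form on `(𝒪_X ⊕ N^*) ⊗ E` induced by a linear form on `E`. -/
def coef1 (i : ι) (V : P.Aff) (h : V.1 ≤ (C.U i).1) (f : E.obj V →ₗ[P.O V] P.O V) :
    E.obj V × (P.con.obj V ⊗[P.O V] E.obj V) →+ Γ(P.Y1, P.j12 ⁻¹ᵁ V.1) :=
  AddMonoidHom.mk' (fun x => (C.Φ i).mk1 V h (f x.1) (contr f x.2)) fun x y => by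
    rw [AlgTriv.mk1, AlgTriv.mk1, AlgTriv.mk1, ← map_add, ← map_add]
    congr 2
    refine Trunc.ext (map_add f _ _) (map_add (contr f) _ _) (add_zero _).symm

/-- `Y⁽¹⁾`, with the model `(𝒪_X ⊕ N^*) ⊗ E`. -/
def frame1 : Frame (model1 hE) C where
  isPresheaf := hE
  S := P.Y1
  pt := P.j12
  pt_surjective := P.j12_surjective
  o V := P.j12 ⁻¹ᵁ V.1
  mem_o _ _ := Iff.rfl
  isBasis := isOpensBasis_aff1 C.U C.cover
  affine := isAffineOpen_Y1
  o_mono h := P.j12.preimage_mono h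
  π V := (P.j12.app V.1).hom
  π_surjective := j12_app_surjective
  π_nat h r := app_funRes (j := P.j12) h r
  actR_eq_zero i V h r hr := by
    obtain ⟨h0, h1⟩ := ((C.Φ i).j12_app_eq_zero_iff V h r).1 hr
    refine AddMonoidHom.ext fun x => ?_
    refine Prod.ext (α := E.obj V) (β := P.con.obj V ⊗[P.O V] E.obj V) ?_ ?_
    · change ((C.Φ i).app ⟨V, h⟩ r).c0 • x.1 = 0
      rw [h0, zero_smul]
    · change ((C.Φ i).app ⟨V, h⟩ r).c0 • x.2 + ((C.Φ i).app ⟨V, h⟩ r).c1 ⊗ₜ x.1 = 0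
      rw [h0, h1, zero_smul, TensorProduct.zero_tmul, add_zero]
  res_sec h e := Prod.ext rfl (map_zero (resTensor P.con E h))
  coef := coef1 C
  coef_act i V h f r x := by
    have e : (P.j12.app V.1).hom (r * ((C.Φ i).app ⟨V, h⟩).symm ⟨f x.1, contr f x.2, 0⟩) =
        (C.Φ i).mk1 V h (f (((C.Φ i).app ⟨V, h⟩ r).c0 • x.1))
          (contr f (((C.Φ i).app ⟨V, h⟩ r).c0 • x.2 + ((C.Φ i).app ⟨V, h⟩ r).c1 ⊗ₜ x.1)) := by
      rw [(C.Φ i).j12_app_eq_mk1_iff V h, map_mul, RingEquiv.apply_symm_apply, Trunc.mul_c0,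
        Trunc.mul_c1, map_smul, map_add, map_smul, contr_tmul]
      exact ⟨rfl, rfl⟩
    rw [map_mul] at e
    exact e.symm
  coef_sec_zero i V h f e he := by
    refine (((C.Φ i).j12_app_eq_mk1_iff V h 0 _ _).2 ?_).symm.trans (map_zero _)
    rw [map_zero]
    exact ⟨he.symm, (map_zero (contr f)).symm⟩
  coef_sec_one i V h f e he := by
    refine (((C.Φ i).j12_app_eq_mk1_iff V h 1 _ _).2 ?_).symm.trans (map_one _)
    rw [map_one]
    exact ⟨he.symm, (map_zero (contr f)).symm⟩
  coef_nat i V W h hW f f' hf x := by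
    refine ((C.Φ i).mk1_nat h hW _ _).trans ?_
    rw [hf, contr_nat hW f f' hf]
    rfl
  coef_sum i V h n e f hef x r hr := by
    have hd : IsDualBasis e f := hef
    have hr' : ∀ k, ((C.Φ i).app ⟨V, h⟩ (r k)).c0 = f k x.1 ∧
        ((C.Φ i).app ⟨V, h⟩ (r k)).c1 = contr (f k) x.2 := fun k =>
      ((C.Φ i).j12_app_eq_mk1_iff V h _ _ _).1 (hr k)
    have e1 : ∀ k, (model1 hE).actR C i V h (r k) (((model1 hE).fm V).sec (e k)) =
        (f k x.1 • e k, contr (f k) x.2 ⊗ₜ e k) := fun k => by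
      rw [← (hr' k).1, ← (hr' k).2]
      refine Prod.ext (α := E.obj V) (β := P.con.obj V ⊗[P.O V] E.obj V) rfl ?_
      change ((C.Φ i).app ⟨V, h⟩ (r k)).c0 • (0 : P.con.obj V ⊗[P.O V] E.obj V) + _ = _
      rw [smul_zero, zero_add]
      rfl
    refine (Finset.sum_congr rfl fun k _ => e1 k).trans ?_
    refine Prod.ext (α := E.obj V) (β := P.con.obj V ⊗[P.O V] E.obj V) ?_ ?_
    · exact (Prod.fst_sum ..).trans (hef x.1)
    · exact (Prod.snd_sum ..).trans (hd.sum_contr_tmul x.2)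

/-- The linear form on `Sym^{≤ 2} N^* ⊗ E` induced by a linear form on `E`. -/
def coef2 (i : ι) (V : P.Aff) (h : V.1 ≤ (C.U i).1) (f : E.obj V →ₗ[P.O V] P.O V) :
    E.obj V × (P.con.obj V ⊗[P.O V] E.obj V) × (P.con2.obj V ⊗[P.O V] E.obj V) →+ P.R V :=
  AddMonoidHom.mk' (fun x => ((C.Φ i).app ⟨V, h⟩).symm ⟨f x.1, contr f x.2.1, contr f x.2.2⟩)
    fun x y => by
      rw [← map_add]
      congr 1
      exact Trunc.ext (map_add f _ _) (map_add (contr f) _ _) (map_add (contr f) _ _)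

/-- `Y⁽²⁾`, with the model `Sym^{≤ 2} N^* ⊗ E`. -/
def frame2 : Frame (model2 hE) C where
  isPresheaf := hE
  S := P.Y2
  pt := id
  pt_surjective := Function.surjective_id
  o V := V.1
  mem_o _ _ := Iff.rfl
  isBasis := isOpensBasis_aff C.U C.cover
  affine V := V.2
  o_mono h := h
  π V := RingHom.id _
  π_surjective V := Function.surjective_id
  π_nat h r := rfl
  actR_eq_zero i V h r hr := by
    have hr' : r = 0 := hr
    rw [hr', map_zero]
  res_sec h e := Prod.ext rfl (Prod.ext (map_zero (resTensor P.con E h))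
    (map_zero (resTensor P.con2 E h)))
  coef := coef2 C
  coef_act i V h f r x := by
    apply ((C.Φ i).app ⟨V, h⟩).injective
    refine ((RingEquiv.apply_symm_apply _ _).trans ?_).trans (map_mul _ _ _).symm
    refine Eq.trans ?_ (congrArg (_ * ·) (RingEquiv.apply_symm_apply _ _).symm)
    refine Trunc.ext (map_smul f _ _) ?_ ?_
    · change contr f (((C.Φ i).app ⟨V, h⟩ r).c0 • x.2.1 + ((C.Φ i).app ⟨V, h⟩ r).c1 ⊗ₜ x.1) = _
      rw [map_add, map_smul, contr_tmul]
      rfl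
    · change contr f (((C.Φ i).app ⟨V, h⟩ r).c0 • x.2.2 + nMul ((C.Φ i).app ⟨V, h⟩ r).c1 x.2.1 +
        ((C.Φ i).app ⟨V, h⟩ r).c2 ⊗ₜ x.1) = ((C.Φ i).app ⟨V, h⟩ r).c0 • contr f x.2.2 +
        f x.1 • ((C.Φ i).app ⟨V, h⟩ r).c2 + SymSq.mul ((C.Φ i).app ⟨V, h⟩ r).c1 (contr f x.2.1)
      rw [map_add, map_add, map_smul, contr_tmul, contr_nMul]
      abel
  coef_sec_zero i V h f e he := by
    refine ((C.Φ i).app ⟨V, h⟩).symm_apply_eq.2 (Eq.trans ?_ (map_zero _).symm)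
    exact Trunc.ext he (map_zero (contr f)) (map_zero (contr f))
  coef_sec_one i V h f e he := by
    refine ((C.Φ i).app ⟨V, h⟩).symm_apply_eq.2 (Eq.trans ?_ (map_one _).symm)
    exact Trunc.ext he (map_zero (contr f)) (map_zero (contr f))
  coef_nat i V W h hW f f' hf x := by
    have e := (C.Φ i).nat ⟨V, h⟩ ⟨W, le_trans hW h⟩ hW (coef2 C i V h f x)
    refine (RingEquiv.symm_apply_eq _).2 ?_ |>.symm
    refine Eq.trans ?_ e.symm
    refine Eq.trans ?_ (congrArg (Trunc.map (P.con.res hW)) (RingEquiv.apply_symm_apply _ _)).symm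
    exact Trunc.ext (hf x.1).symm (contr_nat hW f f' hf _).symm (contr_nat hW f f' hf _).symm
  coef_sum i V h n e f hef x r hr := by
    have hd : IsDualBasis e f := hef
    have hr' : ∀ k, (C.Φ i).app ⟨V, h⟩ (r k) = ⟨f k x.1, contr (f k) x.2.1, contr (f k) x.2.2⟩ :=
      fun k => ((C.Φ i).app ⟨V, h⟩).symm_apply_eq.1 (hr k).symm |>.symm
    have e1 : ∀ k, (model2 hE).actR C i V h (r k) (((model2 hE).fm V).sec (e k)) =
        (f k x.1 • e k, contr (f k) x.2.1 ⊗ₜ e k, contr (f k) x.2.2 ⊗ₜ e k) := fun k => by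
      rw [Model.actR_apply, hr']
      refine Prod.ext (α := E.obj V) rfl (Prod.ext (α := P.con.obj V ⊗[P.O V] E.obj V) ?_ ?_)
      · change f k x.1 • (0 : P.con.obj V ⊗[P.O V] E.obj V) + _ = _
        rw [smul_zero, zero_add]
        rfl
      · change f k x.1 • (0 : P.con2.obj V ⊗[P.O V] E.obj V) + nMul _ 0 + _ = _
        rw [smul_zero, map_zero, zero_add, zero_add]
        rfl
    refine (Finset.sum_congr rfl fun k _ => e1 k).trans ?_
    refine Prod.ext (α := E.obj V) ?_ (Prod.ext (α := P.con.obj V ⊗[P.O V] E.obj V) ?_ ?_)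
    · exact (Prod.fst_sum ..).trans (hef x.1)
    · exact ((congrArg Prod.fst (Prod.snd_sum ..)).trans (Prod.fst_sum ..)).trans
        (hd.sum_contr_tmul x.2.1)
    · exact ((congrArg Prod.snd (Prod.snd_sum ..)).trans (Prod.snd_sum ..)).trans
        (hd.sum_contr_tmul x.2.2)

end SmoothPair
end CechExt

namespace CechExt

/-! ### Dual bases of a vector bundle on `X` -/

theorem IsBasisOn.equiv_symm_nat {S : Scheme.{u}} {M : S.Modules} {V : S.Opens} {n : ℕ}
    {b : Fin n → Γ(M, V)} (hb : IsBasisOn M b) {W W' : S.Opens} (h : W ≤ V) (h' : W' ≤ W)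
    (x : Γ(M, W)) (k : Fin n) : funRes S h' ((hb.equiv h).symm x k) =
      (hb.equiv (h'.trans h)).symm (secRes M h' x) k := by
  obtain ⟨a, rfl⟩ := (hb.equiv h).surjective x
  have e : secRes M h' (hb.equiv h a) = hb.equiv (h'.trans h) fun k => funRes S h' (a k) :=
    secRes_sum_smul b h h' a
  rw [e, LinearEquiv.symm_apply_apply, LinearEquiv.symm_apply_apply]

theorem IsBasisOn.equiv_symm_apply {S : Scheme.{u}} {M : S.Modules} {V : S.Opens} {n : ℕ}
    {b : Fin n → Γ(M, V)} (hb : IsBasisOn M b) {W : S.Opens} (h : W ≤ V) (j k : Fin n) :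
    (hb.equiv h).symm (secRes M h (b j)) k = if j = k then 1 else 0 := by
  have e : hb.equiv h (Pi.single j 1) = secRes M h (b j) := by
    change ∑ k, (Pi.single j 1 : Fin n → Γ(S, W)) k • secRes M h (b k) = _
    rw [Finset.sum_eq_single j, Pi.single_eq_same, one_smul]
    · intro k _ hk
      rw [Pi.single_eq_of_ne hk, zero_smul]
    · intro h
      exact absurd (Finset.mem_univ j) h
  rw [← e, LinearEquiv.symm_apply_apply, Pi.single_apply]
  simp only [eq_comm]

namespace SmoothPair

variable {κ : Type u} [Field κ] {P : SmoothPair κ} {E : P.X.Modules}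

/-- A linear form on the sections over `X ∩ V`, as a linear form on `E(V)`. -/
def formO (V : P.Aff) (l : Γ(E, P.preX V) →ₗ[Γ(P.X, P.preX V)] Γ(P.X, P.preX V)) :
    (ofModules E).obj V →ₗ[P.O V] P.O V where
  toFun x := (oEquiv V).symm (l x)
  map_add' x y := (congrArg (oEquiv V).symm (map_add l x y)).trans (map_add _ _ _)
  map_smul' f x := by
    refine ((oEquiv V).symm_apply_eq).2 ?_
    rw [smul_eq_mul, map_mul, RingEquiv.apply_symm_apply]
    exact map_smul l (oEquiv V f) (show Γ(E, P.preX V) from x)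

/-- Dual bases over `X ∩ V` are dual bases over `V`. -/
def dualBasisOver (V : P.Aff) (n : ℕ) (e : Fin n → Γ(E, P.preX V))
    (l : ∀ W : P.X.Opens, W ≤ P.preX V → Fin n → (Γ(E, W) →ₗ[Γ(P.X, W)] Γ(P.X, W)))
    (hl : ∀ (W W' : P.X.Opens) (hW : W ≤ P.preX V) (h : W' ≤ W) k x,
      funRes P.X h (l W hW k x) = l W' (h.trans hW) k (secRes E h x))
    (hs : ∀ (W : P.X.Opens) (hW : W ≤ P.preX V) x, ∑ k, l W hW k x • secRes E hW (e k) = x) :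
    DualBasisOver (ofModules E) V where
  n := n
  e := e
  l W hW k := formO W (l (P.preX W) (P.preX_mono hW) k)
  nat {W W'} hW h k x := by
    apply (oEquiv W').injective
    rw [oEquiv_resO]
    refine (congrArg (funRes P.X (P.preX_mono h)) ((oEquiv W).apply_symm_apply _)).trans ?_
    exact (hl (P.preX W) (P.preX W') (P.preX_mono hW) (P.preX_mono h) k x).trans
      ((oEquiv W').apply_symm_apply _).symm
  sum W hW x := by
    refine Eq.trans (Finset.sum_congr rfl fun k _ => ?_) (hs (P.preX W) (P.preX_mono hW) x)
    exact congrArg (fun t : Γ(P.X, P.preX W) => t • secRes E (P.preX_mono hW) (e k))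
      ((oEquiv W).apply_symm_apply _)

theorem dualBasisOver_isBasis (V : P.Aff) (n : ℕ) (e : Fin n → Γ(E, P.preX V))
    (l : ∀ W : P.X.Opens, W ≤ P.preX V → Fin n → (Γ(E, W) →ₗ[Γ(P.X, W)] Γ(P.X, W))) (hl hs)
    (hd : ∀ (W : P.X.Opens) (hW : W ≤ P.preX V) j k,
      l W hW k (secRes E hW (e j)) = if j = k then 1 else 0) :
    (dualBasisOver V n e l hl hs).IsBasis := fun W hW j k => by
  have h := hd (P.preX W) (P.preX_mono hW) j k
  refine ((oEquiv W).symm_apply_eq).2 (h.trans ?_)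
  by_cases hjk : j = k
  · exact (if_pos hjk).trans
      ((map_one (oEquiv W)).symm.trans (congrArg (oEquiv W) (if_pos hjk).symm))
  · exact (if_neg hjk).trans
      ((map_zero (oEquiv W)).symm.trans (congrArg (oEquiv W) (if_neg hjk).symm))

theorem nonempty_dualBasisOver (hE : IsVectorBundle E) (V : P.Aff) :
    Nonempty (DualBasisOver (ofModules E) V) := by
  obtain ⟨n, e, l, hl, hs⟩ := exists_dualBasis hE (isAffineOpen_preX V)
  exact ⟨dualBasisOver V n e l hl hs⟩

theorem j01_surjective : Function.Surjective P.j01 := fun y => by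
  have hy : P.emb1 y ∈ Set.range P.emb0 := by
    have : P.emb1 y ∈ Set.range P.emb1 := ⟨y, rfl⟩
    rw [range_emb1, Scheme.IdealSheafData.support_pow_succ] at this
    exact (Scheme.IdealSheafData.range_subschemeι P.I).ge this
  obtain ⟨x, hx⟩ := hy
  refine ⟨x, P.emb1.isEmbedding.injective ?_⟩
  rw [← hx, ← j01_emb1]
  rfl

theorem exists_opens_preimage_eq {S' S : Scheme.{u}} (j : S' ⟶ S) [IsClosedImmersion j]
    (U : S'.Opens) : ∃ U' : S.Opens, j ⁻¹ᵁ U' = U := by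
  obtain ⟨U1, hU1, e1⟩ := j.isEmbedding.isOpen_iff.1 U.2
  exact ⟨⟨U1, hU1⟩, TopologicalSpace.Opens.ext e1⟩

theorem exists_aff_preX_le {U : P.X.Opens} {W : P.Y2.Opens} {x : P.X} (hxU : x ∈ U)
    (hxW : P.j12 (P.j01 x) ∈ W) :
    ∃ V : P.Aff, P.j12 (P.j01 x) ∈ V.1 ∧ V.1 ≤ W ∧ P.preX V ≤ U := by
  obtain ⟨U1, rfl⟩ := exists_opens_preimage_eq P.j01 U
  obtain ⟨U2, rfl⟩ := exists_opens_preimage_eq P.j12 U1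
  obtain ⟨V, hxV, hV⟩ := exists_aff_le (W ⊓ U2) (P.j12 (P.j01 x)) ⟨hxW, hxU⟩
  exact ⟨V, hxV, hV.trans inf_le_left,
    P.j01.preimage_mono (P.j12.preimage_mono (hV.trans inf_le_right))⟩

theorem exists_dualBasisOver_isBasis {V : P.Aff} {n : ℕ} {b : Fin n → Γ(E, P.preX V)}
    (hb : IsBasisOn E b) : ∃ d : DualBasisOver (ofModules E) V, d.IsBasis :=
  ⟨_, dualBasisOver_isBasis V n b
    (fun _ hW k => (LinearMap.proj k).comp (hb.equiv hW).symm.toLinearMap)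
    (fun _ _ hW h x k => hb.equiv_symm_nat hW h k x)
    (fun _ hW x => (hb.equiv hW).apply_symm_apply x)
    fun _ hW j k => hb.equiv_symm_apply hW j k⟩

theorem isLocallyFree_ofModules (hE : IsVectorBundle E) : (ofModules E).IsLocallyFree := by
  intro x W hxW
  obtain ⟨x1, rfl⟩ := P.j12_surjective x
  obtain ⟨x0, rfl⟩ := j01_surjective x1
  obtain ⟨U, hxU, n, b, hb⟩ := hE x0
  obtain ⟨V, hxV, hVW, hVU⟩ := exists_aff_preX_le hxU hxW
  obtain ⟨d, hd⟩ := exists_dualBasisOver_isBasis (IsBasisOn.restrict (M := E) (b := b) hb hVU)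
  exact ⟨V, hxV, hVW, d, hd⟩

/-! ### The reduction maps of the models -/

/-- The ideal of `X` in `Y⁽²⁾` is nilpotent. -/
theorem idl_pow_three {W : P.Y2.Opens} (Φ : P.AlgTriv W) (V : P.Aff) (h : V.1 ≤ W) :
    P.idl V ^ 3 = ⊥ := by
  have h0 : ∀ r ∈ P.idl V, (Φ.app ⟨V, h⟩ r).c0 = 0 := fun r hr =>
    (Φ.appX_eq_zero_iff V h r).1 hr
  rw [pow_succ, pow_two, ← le_bot_iff, Ideal.mul_le]
  intro r hr s hs
  refine (Ideal.mul_le (K := Submodule.comap (LinearMap.mulRight (P.R V) s) ⊥)).2 ?_ hr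
  intro a ha b hb
  change a * b * s = 0
  apply (Φ.app ⟨V, h⟩).injective
  rw [map_mul, map_mul, map_zero]
  ext <;> simp [h0 _ ha, h0 _ hb, h0 _ hs]

theorem ker_pow_three {S' S : Scheme.{u}} (j : S' ⟶ S) {o : S.Opens} {V : P.Aff}
    (π : P.R V →+* Γ(S, o)) (hπ : Function.Surjective π)
    (hj : ∀ r, (j.app o).hom (π r) = 0 → P.appX V r = 0) {W : P.Y2.Opens} (Φ : P.AlgTriv W)
    (h : V.1 ≤ W) : RingHom.ker (j.app o).hom ^ 3 = (⊥ : Ideal Γ(S, o)) := by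
  have e : RingHom.ker (j.app o).hom ≤ (P.idl V).map π := fun b hb => by
    obtain ⟨r, rfl⟩ := hπ b
    exact Ideal.mem_map_of_mem _ (hj r hb)
  refine le_bot_iff.1 ((Ideal.pow_right_mono e 3).trans ?_)
  rw [← Ideal.map_pow, idl_pow_three Φ V h, Ideal.map_bot]

variable {ι : Type v} [LinearOrder ι]

theorem Frame.act_mem {F E : P.ModFam} {L : Model F E} {C : CechData E ι} (Fr : Frame L C) {i : ι}
    {V : P.Aff} {h : V.1 ≤ (C.U i).1} {J : Ideal Γ(Fr.S, Fr.o V)}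
    {t : Trunc (P.O V) (P.con.obj V)} (ht : Fr.π V (((C.Φ i).app ⟨V, h⟩).symm t) ∈ J)
    (x : Fr.Obj i V h) : (show Fr.Obj i V h from (L.fm V).act t x) ∈
      J • (⊤ : Submodule Γ(Fr.S, Fr.o V) (Fr.Obj i V h)) := by
  have h1 := Submodule.smul_mem_smul ht
    (Submodule.mem_top (R := Γ(Fr.S, Fr.o V)) (x := x))
  have h2 : (L.actR C i V h (((C.Φ i).app ⟨V, h⟩).symm t) x : L.X V) = (L.fm V).act t x :=
    congrArg (fun t => (L.fm V).act t x) (RingEquiv.apply_symm_apply ((C.Φ i).app ⟨V, h⟩) t)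
  exact ((Fr.π_smul i V h _ x).trans h2) ▸ h1

variable (C : CechData (ofModules E) ι)

/-- `Y⁽¹⁾`, with the model `(𝒪_X ⊕ N^*) ⊗ E`. -/
abbrev frameY1 : Frame (model1 (ofModules_isPresheaf E)) C := frame1 C (ofModules_isPresheaf E)

/-- `Y⁽²⁾`, with the model `Sym^{≤ 2} N^* ⊗ E`. -/
abbrev frameY2 : Frame (model2 (ofModules_isPresheaf E)) C := frame2 C (ofModules_isPresheaf E)

/-- The part of degree `1` of `(𝒪_X ⊕ N^*) ⊗ E` is generated by the ideal of `X`. -/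
theorem inc1_mem (J : ∀ V : P.Aff, Ideal Γ((frameY1 C).S, (frameY1 C).o V))
    (hJ : ∀ V r, P.appX V r = 0 → (frameY1 C).π V r ∈ J V)
    (i : ι) (V : P.Aff) (h : V.1 ≤ (C.U i).1)
    (ν : P.con.obj V ⊗[P.O V] (ofModules E).obj V) :
    (show (frameY1 C).Obj i V h from (0, ν)) ∈
      J V • (⊤ : Submodule Γ((frameY1 C).S, (frameY1 C).o V) ((frameY1 C).Obj i V h)) := by
  induction ν using TensorProduct.induction_on with
  | zero => exact zero_mem _
  | tmul n e =>
    have h1 := (frameY1 C).act_mem (h := h) (J := J V) (t := ⟨0, n, 0⟩)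
      (hJ V _ (((C.Φ i).appX_eq_zero_iff V h _).2 (congrArg Trunc.c0
        (RingEquiv.apply_symm_apply ((C.Φ i).app ⟨V, h⟩) ⟨0, n, 0⟩))))
      ((frameY1 C).secObj i V h e)
    have h3 : ((model1 (ofModules_isPresheaf E)).fm V).act ⟨0, n, 0⟩
        ((frameY1 C).secObj i V h e) = (0, n ⊗ₜ e) := by
      change ((0 : P.O V) • e, (0 : P.O V) • (0 : P.con.obj V ⊗[P.O V] (ofModules E).obj V) +
        n ⊗ₜ e) = (0, n ⊗ₜ e)
      rw [zero_smul, zero_smul, zero_add]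
    exact h3 ▸ h1
  | add x y hx hy =>
    have e : (show (frameY1 C).Obj i V h from (0, x + y)) =
        (show (frameY1 C).Obj i V h from (0, x)) + (show (frameY1 C).Obj i V h from (0, y)) :=
      Prod.ext (add_zero (M := (ofModules E).obj V) 0).symm rfl
    exact e ▸ add_mem hx hy

/-- `(𝒪_X ⊕ N^*) ⊗ E` reduces to `E` on `X`. -/
def target1 : Target (frameY1 C) where
  S' := P.X
  j := P.j01
  isAffineHom := inferInstanceAs (IsAffineHom (X := P.X) (Y := P.Y1) P.j01)
  M' := E
  w i V h := AddMonoidHom.fst ((ofModules E).obj V) (P.con.obj V ⊗[P.O V] (ofModules E).obj V)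
  w_surjective i V h x := ⟨(x, 0), rfl⟩
  w_smul i V h b x := by
    obtain ⟨r, rfl⟩ := j12_app_surjective V b
    refine (congrArg Prod.fst ((frameY1 C).π_smul i V h r x)).trans ?_
    refine (congrArg (· • Prod.fst x) ((C.Φ i).gr0 ⟨V, h⟩ r)).trans ?_
    rfl
  w_nat i V W h hW x := rfl
  mem_of_w i V h x hx := by
    have e : x = (show (frameY1 C).Obj i V h from (0, Prod.snd x)) := Prod.ext hx rfl
    rw [e]
    exact inc1_mem C (fun V => RingHom.ker (P.j01.app (P.j12 ⁻¹ᵁ V.1)).hom) (fun V r hr => hr)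
      i V h (Prod.snd x)
  nilpotent i V h := ker_pow_three P.j01 (P.j12.app V.1).hom (j12_app_surjective V)
    (fun r hr => hr) (C.Φ i) h

theorem target1_kerEqInc : (target1 C).KerEqInc := fun _ _ _ x =>
  ⟨fun hx => ⟨x.2, Prod.ext hx rfl⟩, fun ⟨_, hν⟩ => hν ▸ rfl⟩

end SmoothPair
end CechExt

namespace CechExt
namespace SmoothPair

/-! ### Extensions to the first order neighbourhood -/

variable {κ : Type u} [Field κ] {P : SmoothPair κ} {E : P.X.Modules} {ι : Type v} [LinearOrder ι]
  {C : CechData (ofModules E) ι} {E1 : P.Y1.Modules}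
  {ρ : E1 ⟶ (Scheme.Modules.pushforward P.j01).obj E}

/-- An isomorphism with `(𝒪_X ⊕ N^*) ⊗ E`, as a framing. -/
def Triv1.framing {i : ι} (Ψ : Triv1 (C.Φ i) ρ) : Framing (target1 C) ρ i where
  app V h := Ψ.app ⟨V, h⟩
  smul V h b s := by
    obtain ⟨r, rfl⟩ := j12_app_surjective V b
    exact (Ψ.smul ⟨V, h⟩ r s).trans ((frameY1 C).π_smul i V h r (Ψ.app ⟨V, h⟩ s)).symm
  nat V W h hW s := Ψ.nat ⟨V, h⟩ ⟨W, le_trans hW h⟩ hW s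
  w_app V h s := Ψ.gr0 ⟨V, h⟩ s

/-- A framing, as an isomorphism with `(𝒪_X ⊕ N^*) ⊗ E`. -/
def Framing.triv1 {i : ι} (Ψ : Framing (target1 C) ρ i) : Triv1 (C.Φ i) ρ where
  app V := Ψ.app V.1 V.2
  gr0 V s := Ψ.w_app V.1 V.2 s
  smul V r s := (Ψ.smul V.1 V.2 _ s).trans ((frameY1 C).π_smul i V.1 V.2 r (Ψ.app V.1 V.2 s))
  nat V W h s := Ψ.nat V.1 W.1 V.2 h s

theorem nonempty_triv1 (hE : IsVectorBundle E) (hρ : IsExt1 ρ) :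
    Nonempty (∀ i, Triv1 (C.Φ i) ρ) :=
  ⟨fun i => (nonempty_framing (target1 C) ρ hρ.1 hE hρ.2 i
    (nonempty_dualBasisOver hE (C.U i)).some).some.triv1⟩

variable [CharZero κ]

theorem isGluing1_iff (Ψ : ∀ i, Triv1 (C.Φ i) ρ) (m : C1 C.U (endSheaf P.con (ofModules E))) :
    C.IsGluing1 Ψ m ↔ IsGluing (fun i => (Ψ i).framing)
      ((C.transition1 (ofModules_isPresheaf E)).twist m) := by
  refine forall₄_congr fun p V h s => ?_
  have e := C.twist_transition1_apply (ofModules_isPresheaf E) m p V h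
    ((Ψ p.1.2).app ⟨V, h.trans inf_le_right⟩ s)
  exact ⟨fun h => h.trans e.symm, fun h => h.trans e⟩

theorem target1_compat : (target1 C).Compat (C.transition1 (ofModules_isPresheaf E)) :=
  fun _ _ _ _ => rfl

theorem exists_extension1 (hE : IsVectorBundle E) {m : C1 C.U (endSheaf P.con (ofModules E))}
    (hm : ((C.transition1 (ofModules_isPresheaf E)).twist m).IsCocycle) :
    ∃ (E1 : P.Y1.Modules) (ρ : E1 ⟶ (Scheme.Modules.pushforward P.j01).obj E), IsExt1 ρ ∧
      ∃ Ψ : ∀ i, Triv1 (C.Φ i) ρ, C.IsGluing1 Ψ m := by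
  obtain ⟨E1, ρ, Ψ, hΨ⟩ := exists_isGluing (target1_kerEqInc C)
    (target1_compat.twist (target1_kerEqInc C) m) hm
    (fun i => (nonempty_dualBasisOver hE (C.U i)).some)
  exact ⟨E1, ρ, ⟨Framing.isVectorBundle (isLocallyFree_ofModules hE) Ψ, Framing.isReduction Ψ⟩,
    fun i => (Ψ i).triv1, (isGluing1_iff _ m).2 hΨ⟩

theorem existsUnique_isGluing1 (Ψ : ∀ i, Triv1 (C.Φ i) ρ) : ∃! m, C.IsGluing1 Ψ m := by
  obtain ⟨m, hm, h⟩ := existsUnique_isGluing (target1_kerEqInc C) target1_compat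
    (fun i => (Ψ i).framing)
  exact ⟨m, (isGluing1_iff Ψ m).2 hm, fun m' hm' => h m' ((isGluing1_iff Ψ m').1 hm')⟩

theorem isCocycle_of_isGluing1 {Ψ : ∀ i, Triv1 (C.Φ i) ρ}
    {m : C1 C.U (endSheaf P.con (ofModules E))} (h : C.IsGluing1 Ψ m) :
    ((C.transition1 (ofModules_isPresheaf E)).twist m).IsCocycle :=
  ((isGluing1_iff Ψ m).1 h).isCocycle

theorem extIso1_iff {E1' : P.Y1.Modules} {ρ' : E1' ⟶ (Scheme.Modules.pushforward P.j01).obj E}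
    {Ψ : ∀ i, Triv1 (C.Φ i) ρ} {Ψ' : ∀ i, Triv1 (C.Φ i) ρ'} {m m'} (h : C.IsGluing1 Ψ m)
    (h' : C.IsGluing1 Ψ' m') : ExtIso P.j01 ρ ρ' ↔ ∃ n, m - m' = d0 C.U _ n :=
  extIso_iff (target1_kerEqInc C) ((isGluing1_iff Ψ m).1 h) ((isGluing1_iff Ψ' m').1 h')

end SmoothPair
end CechExt

namespace CechExt
namespace SmoothPair

/-! ### Extensions to the second order neighbourhood -/

variable {κ : Type u} [Field κ] {P : SmoothPair κ} {E : P.X.Modules} {ι : Type v} [LinearOrder ι]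

section Reductions

variable (C : CechData (ofModules E) ι)

/-- The part of degree `2` of `Sym^{≤ 2} N^* ⊗ E` is generated by the ideal of `Y⁽¹⁾`. -/
theorem inc2_mem {i : ι} {V : P.Aff} {h : V.1 ≤ (C.U i).1}
    {J : Ideal Γ((frameY2 C).S, (frameY2 C).o V)}
    (hJ : ∀ r : P.R V, (P.j12.app V.1).hom r = 0 → (frameY2 C).π V r ∈ J)
    (ν : P.con2.obj V ⊗[P.O V] (ofModules E).obj V) :
    (show (frameY2 C).Obj i V h from (0, 0, ν)) ∈
      J • (⊤ : Submodule Γ((frameY2 C).S, (frameY2 C).o V) ((frameY2 C).Obj i V h)) := by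
  induction ν using TensorProduct.induction_on with
  | zero => exact zero_mem _
  | tmul s e =>
    have hr := RingEquiv.apply_symm_apply ((C.Φ i).app ⟨V, h⟩) ⟨0, 0, s⟩
    have h1 := (frameY2 C).act_mem (h := h) (J := J) (t := ⟨0, 0, s⟩)
      (hJ _ (((C.Φ i).j12_app_eq_zero_iff V h _).2
        ⟨congrArg Trunc.c0 hr, congrArg Trunc.c1 hr⟩)) ((frameY2 C).secObj i V h e)
    have h3 : ((model2 (ofModules_isPresheaf E)).fm V).act ⟨0, 0, s⟩
        ((frameY2 C).secObj i V h e) = (0, 0, s ⊗ₜ e) := by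
      change ((0 : P.O V) • e, (0 : P.O V) • (0 : P.con.obj V ⊗[P.O V] (ofModules E).obj V) +
        (0 : P.con.obj V) ⊗ₜ e, (0 : P.O V) • (0 : P.con2.obj V ⊗[P.O V] (ofModules E).obj V) +
        nMul (0 : P.con.obj V) (0 : P.con.obj V ⊗[P.O V] (ofModules E).obj V) + s ⊗ₜ e) =
        (0, 0, s ⊗ₜ e)
      rw [zero_smul, zero_smul, zero_smul, TensorProduct.zero_tmul, zero_add, zero_add, map_zero,
        zero_add]
    exact h3 ▸ h1
  | add x y hx hy =>
    have e : (show (frameY2 C).Obj i V h from (0, 0, x + y)) =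
        (show (frameY2 C).Obj i V h from (0, 0, x)) +
          (show (frameY2 C).Obj i V h from (0, 0, y)) :=
      Prod.ext (add_zero (M := (ofModules E).obj V) 0).symm
        (Prod.ext (add_zero (M := P.con.obj V ⊗[P.O V] (ofModules E).obj V) 0).symm rfl)
    exact e ▸ add_mem hx hy

/-- The part of degree `1` of `Sym^{≤ 2} N^* ⊗ E` is contained in the submodule generated by the ideal
of `X`. -/
theorem inc21_mem {i : ι} {V : P.Aff} {h : V.1 ≤ (C.U i).1}
    {J : Ideal Γ((frameY2 C).S, (frameY2 C).o V)}
    (hJ : ∀ r : P.R V, P.appX V r = 0 → (frameY2 C).π V r ∈ J)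
    (ν : P.con.obj V ⊗[P.O V] (ofModules E).obj V) :
    (show (frameY2 C).Obj i V h from (0, ν, 0)) ∈
      J • (⊤ : Submodule Γ((frameY2 C).S, (frameY2 C).o V) ((frameY2 C).Obj i V h)) := by
  induction ν using TensorProduct.induction_on with
  | zero => exact zero_mem _
  | tmul n e =>
    have h1 := (frameY2 C).act_mem (h := h) (J := J) (t := ⟨0, n, 0⟩)
      (hJ _ (((C.Φ i).appX_eq_zero_iff V h _).2 (congrArg Trunc.c0
        (RingEquiv.apply_symm_apply ((C.Φ i).app ⟨V, h⟩) ⟨0, n, 0⟩))))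
      ((frameY2 C).secObj i V h e)
    have h3 : ((model2 (ofModules_isPresheaf E)).fm V).act ⟨0, n, 0⟩
        ((frameY2 C).secObj i V h e) = (0, n ⊗ₜ e, 0) := by
      change ((0 : P.O V) • e, (0 : P.O V) • (0 : P.con.obj V ⊗[P.O V] (ofModules E).obj V) +
        n ⊗ₜ e, (0 : P.O V) • (0 : P.con2.obj V ⊗[P.O V] (ofModules E).obj V) +
        nMul n (0 : P.con.obj V ⊗[P.O V] (ofModules E).obj V) +
          (0 : P.con2.obj V) ⊗ₜ e) = (0, n ⊗ₜ e, 0)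
      rw [zero_smul, zero_smul, zero_smul, TensorProduct.zero_tmul, zero_add, zero_add, map_zero,
        zero_add]
    exact h3 ▸ h1
  | add x y hx hy =>
    have e : (show (frameY2 C).Obj i V h from (0, x + y, 0)) =
        (show (frameY2 C).Obj i V h from (0, x, 0)) +
          (show (frameY2 C).Obj i V h from (0, y, 0)) :=
      Prod.ext (add_zero (M := (ofModules E).obj V) 0).symm
        (Prod.ext rfl (add_zero (M := P.con2.obj V ⊗[P.O V] (ofModules E).obj V) 0).symm)
    exact e ▸ add_mem hx hy

/-- Truncation of the model `Sym^{≤ 2} N^* ⊗ E` in degrees `≤ 1`. -/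
def trunc21 (E : P.ModFam) (V : P.Aff) :
    E.obj V × (P.con.obj V ⊗[P.O V] E.obj V) × (P.con2.obj V ⊗[P.O V] E.obj V) →+
      E.obj V × (P.con.obj V ⊗[P.O V] E.obj V) :=
  (AddMonoidHom.id _).prodMap (AddMonoidHom.fst _ _)

theorem eq_of_trunc21_eq_zero {E : P.ModFam} {V : P.Aff}
    {x : E.obj V × (P.con.obj V ⊗[P.O V] E.obj V) × (P.con2.obj V ⊗[P.O V] E.obj V)}
    (hx : trunc21 E V x = 0) : x = (0, 0, x.2.2) := by
  obtain ⟨a, b, c⟩ := x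
  have h1 : a = 0 := congrArg Prod.fst hx
  have h2 : b = 0 := congrArg Prod.snd hx
  rw [h1, h2]

/-- `Sym^{≤ 2} N^* ⊗ E` reduces to `E` on `X`. -/
def target02 : Target (frameY2 C) where
  S' := P.X
  j := P.j02
  isAffineHom := inferInstanceAs (IsAffineHom P.j02)
  M' := E
  w i V h := (secRes E (preX_eq V).le).comp (AddMonoidHom.fst ((ofModules E).obj V)
    ((P.con.obj V ⊗[P.O V] (ofModules E).obj V) ×
      (P.con2.obj V ⊗[P.O V] (ofModules E).obj V)))
  w_surjective i V h x :=
    ⟨(secRes E (preX_eq V).ge x, 0, 0), (secRes_secRes E _ _ x).trans (secRes_self E _ x)⟩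
  w_smul i V h r x := by
    refine (congrArg (fun y => secRes E (preX_eq V).le (Prod.fst y))
      ((frameY2 C).π_smul i V h r x)).trans ?_
    refine (congrArg (fun t : P.O V => secRes E (preX_eq V).le
      (show Γ(E, P.preX V) from t • Prod.fst x)) ((C.Φ i).gr0 ⟨V, h⟩ r)).trans ?_
    refine (secRes_smul E (preX_eq V).le (P.appX V r)
      (show Γ(E, P.preX V) from Prod.fst x)).trans ?_
    refine congrArg (fun t : Γ(P.X, P.j02 ⁻¹ᵁ V.1) => t • secRes E (preX_eq V).le
      (show Γ(E, P.preX V) from Prod.fst x)) ?_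
    rw [← funRes_j02_app V r]
    exact (funRes_funRes _ _ _).trans (funRes_self _ _)
  w_nat i V W h hW x := (secRes_secRes E _ _ _).trans (secRes_secRes E _ _ _).symm
  mem_of_w i V h x hx := by
    have hx' : (Prod.fst x : (ofModules E).obj V) = 0 := by
      have h1 := congrArg (secRes E (preX_eq V).ge) hx
      exact ((secRes_self E _ _).symm.trans (secRes_secRes E _ _ _).symm).trans
        (h1.trans (map_zero _))
    have e : x = (show (frameY2 C).Obj i V h from (0, (Prod.snd x).1, 0)) +
        (show (frameY2 C).Obj i V h from (0, 0, (Prod.snd x).2)) :=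
      Prod.ext (hx'.trans (add_zero (M := (ofModules E).obj V) 0).symm)
        (Prod.ext (add_zero (M := P.con.obj V ⊗[P.O V] (ofModules E).obj V) _).symm
          (zero_add (M := P.con2.obj V ⊗[P.O V] (ofModules E).obj V) _).symm)
    have hJ : ∀ r : P.R V, P.appX V r = 0 → (P.j02.app V.1).hom r = 0 := fun r hr => by
      rw [← funRes_j02_app V r] at hr
      have h1 := congrArg (funRes P.X (preX_eq V).le) hr
      exact ((funRes_self _ _).symm.trans (funRes_funRes _ _ _).symm).trans
        (h1.trans (map_zero _))
    rw [e]
    exact add_mem (inc21_mem C (fun r hr => hJ r hr) (Prod.snd x).1)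
      (inc2_mem C (fun r hr => hJ r ((congrArg (P.j01.app (P.j12 ⁻¹ᵁ V.1)).hom hr).trans
        (map_zero _))) (Prod.snd x).2)
  nilpotent i V h := ker_pow_three P.j02 (RingHom.id _) Function.surjective_id
    (fun r hr => by
      rw [← funRes_j02_app V r]
      exact (congrArg (funRes P.X (preX_eq V).ge) hr).trans (map_zero _)) (C.Φ i) h

variable {E1 : P.Y1.Modules} {ρ1 : E1 ⟶ (Scheme.Modules.pushforward P.j01).obj E}

theorem Triv1.symm_smul {W : P.Y2.Opens} {Φ : P.AlgTriv W} (Ψ : Triv1 Φ ρ1) (V : P.AffIn W)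
    (r : P.R V.1) (x) : (Ψ.app V).symm ((Φ.app V r).act1 x) =
      smulSec E1 (P.j12 ⁻¹ᵁ V.1.1) ((P.j12.app V.1.1).hom r) ((Ψ.app V).symm x) := by
  rw [AddEquiv.symm_apply_eq, Ψ.smul, AddEquiv.apply_symm_apply]

theorem Triv1.symm_nat {W : P.Y2.Opens} {Φ : P.AlgTriv W} (Ψ : Triv1 Φ ρ1) (V V' : P.AffIn W)
    (h : V'.1 ≤ V.1) (x) : (Ψ.app V').symm
      ((ofModules E).res h x.1, resTensor P.con (ofModules E) h x.2) =
      secRes E1 (P.j12.preimage_mono h) ((Ψ.app V).symm x) := by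
  rw [AddEquiv.symm_apply_eq]
  refine Eq.trans ?_ (Ψ.nat V V' h _).symm
  rw [AddEquiv.apply_symm_apply]

/-- `Sym^{≤ 2} N^* ⊗ E` reduces to the extension `E1` on `Y⁽¹⁾`, via the isomorphisms `Ψ_i`. -/
def target2 (Ψ1 : ∀ i, Triv1 (C.Φ i) ρ1) : Target (frameY2 C) where
  S' := P.Y1
  j := P.j12
  isAffineHom := inferInstanceAs (IsAffineHom P.j12)
  M' := E1
  w i V h := ((Ψ1 i).app ⟨V, h⟩).symm.toAddMonoidHom.comp (trunc21 (ofModules E) V)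
  w_surjective i V h x := ⟨((((Ψ1 i).app ⟨V, h⟩) x).1, (((Ψ1 i).app ⟨V, h⟩) x).2, 0),
    ((Ψ1 i).app ⟨V, h⟩).symm_apply_apply x⟩
  w_smul i V h r x := by
    refine (congrArg (fun y => ((Ψ1 i).app ⟨V, h⟩).symm (trunc21 (ofModules E) V y))
      ((frameY2 C).π_smul i V h r x)).trans ?_
    exact (Ψ1 i).symm_smul ⟨V, h⟩ r (trunc21 (ofModules E) V x)
  w_nat i V W h hW x := (Ψ1 i).symm_nat ⟨V, h⟩ ⟨W, le_trans hW h⟩ hW (trunc21 (ofModules E) V x)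
  mem_of_w i V h x hx := by
    have hx' : trunc21 (ofModules E) V x = 0 :=
      ((Ψ1 i).app ⟨V, h⟩).symm.injective (hx.trans (map_zero _).symm)
    have e : x = (show (frameY2 C).Obj i V h from (0, 0, (Prod.snd x).2)) :=
      eq_of_trunc21_eq_zero hx'
    rw [e]
    exact inc2_mem C (fun r hr => hr) (Prod.snd x).2
  nilpotent i V h := ker_pow_three P.j12 (RingHom.id _) Function.surjective_id
    (fun r hr => (congrArg (P.j01.app (P.j12 ⁻¹ᵁ V.1)).hom hr).trans (map_zero _)) (C.Φ i) h

theorem target2_kerEqInc (Ψ1 : ∀ i, Triv1 (C.Φ i) ρ1) : (target2 C Ψ1).KerEqInc := by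
  intro i V h x
  constructor
  · intro hx
    have hx' : trunc21 (ofModules E) V x = 0 :=
      ((Ψ1 i).app ⟨V, h⟩).symm.injective (hx.trans (map_zero _).symm)
    exact ⟨_, eq_of_trunc21_eq_zero hx'⟩
  · rintro ⟨ν, rfl⟩
    exact map_zero ((Ψ1 i).app ⟨V, h⟩).symm

end Reductions

end SmoothPair
end CechExt

namespace CechExt
namespace SmoothPair

variable {κ : Type u} [Field κ] {P : SmoothPair κ} {E : P.X.Modules} {ι : Type v} [LinearOrder ι]
  {C : CechData (ofModules E) ι} {E1 : P.Y1.Modules}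
  {ρ1 : E1 ⟶ (Scheme.Modules.pushforward P.j01).obj E} {Ψ1 : ∀ i, Triv1 (C.Φ i) ρ1}
  {E2 : P.Y2.Modules} {ρ : E2 ⟶ (Scheme.Modules.pushforward P.j12).obj E1}

/-- An isomorphism with `Sym^{≤ 2} N^* ⊗ E`, as a framing. -/
def Triv2.framing {i : ι} (Ψ : Triv2 (Ψ1 i) ρ) : Framing (target2 C Ψ1) ρ i where
  app V h := Ψ.app ⟨V, h⟩
  smul V h r s :=
    (Ψ.smul ⟨V, h⟩ r s).trans ((frameY2 C).π_smul i V h r (Ψ.app ⟨V, h⟩ s)).symm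
  nat V W h hW s := Ψ.nat ⟨V, h⟩ ⟨W, le_trans hW h⟩ hW s
  w_app V h s := ((Ψ1 i).app ⟨V, h⟩).symm_apply_eq.2 (Ψ.lift ⟨V, h⟩ s)

/-- A framing, as an isomorphism with `Sym^{≤ 2} N^* ⊗ E`. -/
def Framing.triv2 {i : ι} (Ψ : Framing (target2 C Ψ1) ρ i) : Triv2 (Ψ1 i) ρ where
  app V := Ψ.app V.1 V.2
  lift V s := ((Ψ1 i).app V).symm_apply_eq.1 (Ψ.w_app V.1 V.2 s)
  smul V r s := (Ψ.smul V.1 V.2 _ s).trans ((frameY2 C).π_smul i V.1 V.2 r (Ψ.app V.1 V.2 s))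
  nat V W h s := Ψ.nat V.1 W.1 V.2 h s

theorem nonempty_triv2 (hE : IsVectorBundle E) (hE1 : IsVectorBundle E1) (hρ : IsExt12 ρ) :
    Nonempty (∀ i, Triv2 (Ψ1 i) ρ) :=
  ⟨fun i => (nonempty_framing (target2 C Ψ1) ρ hρ.1 hE1 hρ.2 i
    (nonempty_dualBasisOver hE (C.U i)).some).some.triv2⟩

theorem H2.mk_eq_zero_iff {U : ι → P.Aff} {F : P.Y2.Opensᵒᵖ ⥤ AddCommGrpCat.{u}} {z : C2 U F}
    (hz : d2 U F z = 0) : H2.mk U F z hz = 0 ↔ ∃ m, z = -d1 U F m := by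
  rw [H2.mk, QuotientAddGroup.eq_zero_iff]
  change z ∈ (d1 U F).range ↔ _
  constructor
  · rintro ⟨m, rfl⟩
    exact ⟨-m, by rw [map_neg, neg_neg]⟩
  · rintro ⟨m, rfl⟩
    exact ⟨-m, map_neg _ _⟩

variable [CharZero κ] {m1 : C1 C.U (endSheaf P.con (ofModules E))}

theorem isGluing2_iff (Ψ : ∀ i, Triv2 (Ψ1 i) ρ) (m1 : C1 C.U (endSheaf P.con (ofModules E)))
    (m2 : C1 C.U (endSheaf P.con2 (ofModules E))) :
    C.IsGluing2 Ψ m1 m2 ↔ IsGluing (fun i => (Ψ i).framing)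
      ((C.transition2 (ofModules_isPresheaf E) m1).twist m2) := by
  refine forall₄_congr fun p V h s => ?_
  have e := C.twist_transition2_apply (ofModules_isPresheaf E) m1 m2 p V h
    ((Ψ p.1.2).app ⟨V, h.trans inf_le_right⟩ s)
  exact ⟨fun h => h.trans e.symm, fun h => h.trans e⟩

theorem target2_compat (h1 : C.IsGluing1 Ψ1 m1) :
    (target2 C Ψ1).Compat (C.transition2 (ofModules_isPresheaf E) m1) := fun p V h x => by
  refine ((Ψ1 p.1.1).app ⟨V, h.trans inf_le_left⟩).symm_apply_eq.2 ?_
  refine Eq.trans ?_ (h1 p V h _).symm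
  exact congrArg (fun y : (ofModules E).obj V × (P.con.obj V ⊗[P.O V] (ofModules E).obj V) =>
      (y.1, y.2 + C.M1 m1 p V h y.1))
    (((Ψ1 p.1.2).app ⟨V, h.trans inf_le_right⟩).apply_symm_apply
      (trunc21 (ofModules E) V x)).symm

theorem exists_extension2 (hE : IsVectorBundle E) (h1 : C.IsGluing1 Ψ1 m1)
    {m2 : C1 C.U (endSheaf P.con2 (ofModules E))}
    (hm : ((C.transition2 (ofModules_isPresheaf E) m1).twist m2).IsCocycle) :
    ∃ (E2 : P.Y2.Modules) (ρ : E2 ⟶ (Scheme.Modules.pushforward P.j12).obj E1), IsExt12 ρ ∧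
      ∃ Ψ : ∀ i, Triv2 (Ψ1 i) ρ, C.IsGluing2 Ψ m1 m2 := by
  obtain ⟨E2, ρ, Ψ, hΨ⟩ := exists_isGluing (target2_kerEqInc C Ψ1)
    ((target2_compat h1).twist (target2_kerEqInc C Ψ1) m2) hm
    (fun i => (nonempty_dualBasisOver hE (C.U i)).some)
  exact ⟨E2, ρ, ⟨Framing.isVectorBundle (isLocallyFree_ofModules hE) Ψ, Framing.isReduction Ψ⟩,
    fun i => (Ψ i).triv2, (isGluing2_iff _ m1 m2).2 hΨ⟩

theorem existsUnique_isGluing2 (h1 : C.IsGluing1 Ψ1 m1) (Ψ : ∀ i, Triv2 (Ψ1 i) ρ) :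
    ∃! m2, C.IsGluing2 Ψ m1 m2 := by
  obtain ⟨m, hm, h⟩ := existsUnique_isGluing (target2_kerEqInc C Ψ1) (target2_compat h1)
    (fun i => (Ψ i).framing)
  exact ⟨m, (isGluing2_iff Ψ m1 m).2 hm, fun m' hm' => h m' ((isGluing2_iff Ψ m1 m').1 hm')⟩

theorem isCocycle_of_isGluing2 {Ψ : ∀ i, Triv2 (Ψ1 i) ρ}
    {m2 : C1 C.U (endSheaf P.con2 (ofModules E))} (h : C.IsGluing2 Ψ m1 m2) :
    ((C.transition2 (ofModules_isPresheaf E) m1).twist m2).IsCocycle :=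
  ((isGluing2_iff Ψ m1 m2).1 h).isCocycle

theorem extIso2_iff {E2' : P.Y2.Modules} {ρ' : E2' ⟶ (Scheme.Modules.pushforward P.j12).obj E1}
    {Ψ : ∀ i, Triv2 (Ψ1 i) ρ} {Ψ' : ∀ i, Triv2 (Ψ1 i) ρ'} {m m'} (h : C.IsGluing2 Ψ m1 m)
    (h' : C.IsGluing2 Ψ' m1 m') : ExtIso P.j12 ρ ρ' ↔ ∃ n, m - m' = d0 C.U _ n :=
  extIso_iff (target2_kerEqInc C Ψ1) ((isGluing2_iff Ψ m1 m).1 h) ((isGluing2_iff Ψ' m1 m').1 h')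

/-! ### Classification of the extensions -/

/-- Existence and classification of the extensions of `E` to `Y⁽¹⁾`: the cochains of extensions are the
solutions of `-δm¹ = a¹At(E)`. -/
theorem classification1 (hE : IsVectorBundle E) (C : CechData (ofModules E) ι) :
    ∃ z : C2 C.U (endSheaf P.con (ofModules E)), (∀ t V h, ev (z t) V h = C.a1At t V h) ∧
      d2 C.U _ z = 0 ∧
      ((∃ (E1 : P.Y1.Modules) (ρ : E1 ⟶ (Scheme.Modules.pushforward P.j01).obj E), IsExt1 ρ) ↔
        ∃ m : C1 C.U (endSheaf P.con (ofModules E)), z = -d1 C.U _ m) ∧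
      (∀ m : C1 C.U (endSheaf P.con (ofModules E)), z = -d1 C.U _ m →
        ∃ (E1 : P.Y1.Modules) (ρ : E1 ⟶ (Scheme.Modules.pushforward P.j01).obj E), IsExt1 ρ ∧
          ∃ Ψ : ∀ i, Triv1 (C.Φ i) ρ, C.IsGluing1 Ψ m) ∧
      (∀ (E1 : P.Y1.Modules) (ρ : E1 ⟶ (Scheme.Modules.pushforward P.j01).obj E), IsExt1 ρ →
        Nonempty (∀ i, Triv1 (C.Φ i) ρ) ∧ ∀ Ψ : ∀ i, Triv1 (C.Φ i) ρ,
          (∃! m, C.IsGluing1 Ψ m) ∧ ∀ m, C.IsGluing1 Ψ m → z = -d1 C.U _ m) := by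
  obtain ⟨z, hz, hd⟩ := C.exists_isDefect1 (ofModules_isPresheaf E)
  have hc : ∀ {E1 : P.Y1.Modules} {ρ : E1 ⟶ (Scheme.Modules.pushforward P.j01).obj E}
      {Ψ : ∀ i, Triv1 (C.Φ i) ρ} {m}, C.IsGluing1 Ψ m → z = -d1 C.U _ m := fun h =>
    (hd.twist_isCocycle_iff _).1 (isCocycle_of_isGluing1 h)
  refine ⟨z, hz, hd.d2_eq_zero, ⟨?_, ?_⟩, ?_, ?_⟩
  · rintro ⟨E1, ρ, hρ⟩
    obtain ⟨Ψ⟩ := nonempty_triv1 (C := C) hE hρ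
    obtain ⟨m, hm, -⟩ := existsUnique_isGluing1 Ψ
    exact ⟨m, hc hm⟩
  · rintro ⟨m, hm⟩
    obtain ⟨E1, ρ, hρ, -⟩ := exists_extension1 hE ((hd.twist_isCocycle_iff _).2 hm)
    exact ⟨E1, ρ, hρ⟩
  · exact fun m hm => exists_extension1 hE ((hd.twist_isCocycle_iff _).2 hm)
  · exact fun E1 ρ hρ =>
      ⟨nonempty_triv1 hE hρ, fun Ψ => ⟨existsUnique_isGluing1 Ψ, fun m hm => hc hm⟩⟩

/-- Existence and classification of the extensions of `E1` to `Y⁽²⁾`: the cochains of extensions are the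
solutions of `-δm² = o`. -/
theorem classification2 (hE : IsVectorBundle E) (hflat : ∀ i, (C.conn i).IsFlat)
    (hρ1 : IsExt1 ρ1) (h1 : C.IsGluing1 Ψ1 m1) :
    ∃ z : C2 C.U (endSheaf P.con2 (ofModules E)),
      (∀ t V h e, ev (z t) V h e = C.obs2 m1 t V h e) ∧ d2 C.U _ z = 0 ∧
      ((∃ (E2 : P.Y2.Modules) (ρ : E2 ⟶ (Scheme.Modules.pushforward P.j12).obj E1),
          IsExt12 ρ) ↔
        ∃ m2 : C1 C.U (endSheaf P.con2 (ofModules E)), z = -d1 C.U _ m2) ∧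
      (∀ m2 : C1 C.U (endSheaf P.con2 (ofModules E)), z = -d1 C.U _ m2 →
        ∃ (E2 : P.Y2.Modules) (ρ : E2 ⟶ (Scheme.Modules.pushforward P.j12).obj E1), IsExt12 ρ ∧
          ∃ Ψ2 : ∀ i, Triv2 (Ψ1 i) ρ, C.IsGluing2 Ψ2 m1 m2) ∧
      (∀ (E2 : P.Y2.Modules) (ρ : E2 ⟶ (Scheme.Modules.pushforward P.j12).obj E1), IsExt12 ρ →
        Nonempty (∀ i, Triv2 (Ψ1 i) ρ) ∧ ∀ Ψ2 : ∀ i, Triv2 (Ψ1 i) ρ,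
          (∃! m2, C.IsGluing2 Ψ2 m1 m2) ∧ ∀ m2, C.IsGluing2 Ψ2 m1 m2 → z = -d1 C.U _ m2) := by
  obtain ⟨z, hz, hd⟩ := CechData.exists_isDefect2 finite_projective_omega hflat
    (isCocycle_of_isGluing1 h1)
  have hc : ∀ {E2 : P.Y2.Modules} {ρ : E2 ⟶ (Scheme.Modules.pushforward P.j12).obj E1}
      {Ψ : ∀ i, Triv2 (Ψ1 i) ρ} {m}, C.IsGluing2 Ψ m1 m → z = -d1 C.U _ m := fun h =>
    (hd.twist_isCocycle_iff _).1 (isCocycle_of_isGluing2 h)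
  refine ⟨z, hz, hd.d2_eq_zero, ⟨?_, ?_⟩, ?_, ?_⟩
  · rintro ⟨E2, ρ, hρ⟩
    obtain ⟨Ψ⟩ := nonempty_triv2 (Ψ1 := Ψ1) hE hρ1.1 hρ
    obtain ⟨m, hm, -⟩ := existsUnique_isGluing2 h1 Ψ
    exact ⟨m, hc hm⟩
  · rintro ⟨m, hm⟩
    obtain ⟨E2, ρ, hρ, -⟩ := exists_extension2 hE h1 ((hd.twist_isCocycle_iff _).2 hm)
    exact ⟨E2, ρ, hρ⟩
  · exact fun m hm => exists_extension2 hE h1 ((hd.twist_isCocycle_iff _).2 hm)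
  · exact fun E2 ρ hρ =>
      ⟨nonempty_triv2 hE hρ1.1 hρ, fun Ψ => ⟨existsUnique_isGluing2 h1 Ψ, fun m hm => hc hm⟩⟩

end SmoothPair
end CechExt

namespace CechExt
namespace SmoothPair

/-! ### The cochains of an extension of `E` to the second order neighbourhood -/

variable {κ : Type u} [Field κ] [CharZero κ] {P : SmoothPair κ} {ι : Type v} [LinearOrder ι]

namespace CechData

variable {E : P.ModFam} {C : CechData E ι} {hE : E.IsPresheaf}

theorem trunc21_twist (m1 : C1 C.U (endSheaf P.con E)) (m2 : C1 C.U (endSheaf P.con2 E))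
    (p : Ix2 ι) (V : P.Aff) (h : V.1 ≤ U2 C.U p) (x : (model2 hE).X V) :
    trunc21 E V (((C.transition2 hE m1).twist m2).T p V h x) =
      ((C.transition1 hE).twist m1).T p V h (trunc21 E V x) :=
  (congrArg (trunc21 E V) (twist_transition2_apply C hE m1 m2 p V h x)).trans
    (twist_transition1_apply C hE m1 p V h (trunc21 E V x)).symm

theorem isCocycle1_of_isCocycle2 {m1 : C1 C.U (endSheaf P.con E)}
    {m2 : C1 C.U (endSheaf P.con2 E)} (h : ((C.transition2 hE m1).twist m2).IsCocycle) :
    ((C.transition1 hE).twist m1).IsCocycle := fun t V hV x => by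
  have e := congrArg (trunc21 E V) (h t V hV (x.1, x.2, 0))
  have e1 := trunc21_twist (hE := hE) m1 m2 (jh t) V (hV.trans (U3_jh C.U t)) (x.1, x.2, 0)
  have e2 := trunc21_twist (hE := hE) m1 m2 (ij t) V (hV.trans (U3_ij C.U t))
    (((C.transition2 hE m1).twist m2).T (jh t) V (hV.trans (U3_jh C.U t)) (x.1, x.2, 0))
  have e3 := trunc21_twist (hE := hE) m1 m2 (ih t) V (hV.trans (U3_ih C.U t)) (x.1, x.2, 0)
  refine Eq.trans (congrArg (((C.transition1 hE).twist m1).T (ij t) V _) ?_)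
    (e2.symm.trans (e.trans e3))
  exact e1.symm

/-- Equivariant maps between the copies of `Sym^{≤ 2} N^* ⊗ E` that induce the identity on `E`
respect the filtration by degree. -/
theorem trunc21_eq_zero (p : Ix2 ι) (V : P.Aff) (h : V.1 ≤ U2 C.U p)
    (U : (model2 hE).X V →+ (model2 hE).X V)
    (hact : ∀ r x, U ((model2 hE).actR C p.1.2 V (h.trans inf_le_right) r x) =
      (model2 hE).actR C p.1.1 V (h.trans inf_le_left) r (U x))
    (ν : P.con2.obj V ⊗[P.O V] E.obj V) : trunc21 E V (U (0, 0, ν)) = 0 := by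
  induction ν using TensorProduct.induction_on with
  | zero => exact (congrArg (trunc21 E V) (map_zero U)).trans (map_zero _)
  | tmul s e =>
    -- `(0, 0, s ⊗ e)` is a multiple of `(e, 0, 0)` by `s`, and `exp φ` fixes `s`.
    have hr := RingEquiv.apply_symm_apply ((C.Φ p.1.2).app ⟨V, h.trans inf_le_right⟩) ⟨0, 0, s⟩
    have hr' := C.phi_exp p V h (((C.Φ p.1.2).app ⟨V, h.trans inf_le_right⟩).symm ⟨0, 0, s⟩)
    rw [hr] at hr'
    have h1 := hact (((C.Φ p.1.2).app ⟨V, h.trans inf_le_right⟩).symm ⟨0, 0, s⟩) (e, 0, 0)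
    have h2 : (model2 hE).actR C p.1.2 V (h.trans inf_le_right)
        (((C.Φ p.1.2).app ⟨V, h.trans inf_le_right⟩).symm ⟨0, 0, s⟩) (e, 0, 0) =
        (0, 0, s ⊗ₜ e) := by
      refine (congrArg (fun t => ((model2 hE).fm V).act t (e, 0, 0)) hr).trans ?_
      change ((0 : P.O V) • e, (0 : P.O V) • (0 : P.con.obj V ⊗[P.O V] E.obj V) +
        (0 : P.con.obj V) ⊗ₜ e, (0 : P.O V) • (0 : P.con2.obj V ⊗[P.O V] E.obj V) +
        nMul (0 : P.con.obj V) (0 : P.con.obj V ⊗[P.O V] E.obj V) + s ⊗ₜ e) = (0, 0, s ⊗ₜ e)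
      rw [zero_smul, zero_smul, zero_smul, TensorProduct.zero_tmul, zero_add, zero_add, map_zero,
        zero_add]
    refine (congrArg (fun y => trunc21 E V (U y)) h2.symm).trans ?_
    refine (congrArg (trunc21 E V) h1).trans ?_
    refine (congrArg (fun t => trunc21 E V (((model2 hE).fm V).act t (U (e, 0, 0)))) hr'.symm).trans
      ?_
    have h3 : ∀ y : E.obj V × (P.con.obj V ⊗[P.O V] E.obj V),
        ((C.phi p V h).exp ⟨0, 0, s⟩).act1 y = 0 := fun y => by
      refine Prod.ext (zero_smul _ _) ?_
      change (0 : P.O V) • y.2 + (0 + (C.phi p V h).A1 0) ⊗ₜ y.1 = 0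
      rw [map_zero, add_zero, TensorProduct.zero_tmul, zero_smul, add_zero]
    exact h3 (trunc21 E V (U (e, 0, 0)))
  | add x y hx hy =>
    have e : ((0, 0, x + y) : (model2 hE).X V) = (0, 0, x) + (0, 0, y) :=
      Prod.ext (add_zero (M := E.obj V) 0).symm
        (Prod.ext (add_zero (M := P.con.obj V ⊗[P.O V] E.obj V) 0).symm rfl)
    refine (congrArg (fun y => trunc21 E V (U y)) e).trans ?_
    refine (congrArg (trunc21 E V) (map_add U _ _)).trans ?_
    refine (map_add (trunc21 E V) (U (0, 0, x)) (U (0, 0, y))).trans ?_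
    exact (congrArg₂ (· + ·) hx hy).trans (add_zero 0)

/-- Equivariant maps between the copies of `Sym^{≤ 2} N^* ⊗ E` that induce the identity on `E` are
exponentials of derivations. -/
theorem exists_twist_transition2
    (U : ∀ (p : Ix2 ι) (V : P.Aff), V.1 ≤ U2 C.U p → ((model2 hE).X V →+ (model2 hE).X V))
    (hact : ∀ (p : Ix2 ι) (V : P.Aff) (h : V.1 ≤ U2 C.U p) r x,
      U p V h ((model2 hE).actR C p.1.2 V (h.trans inf_le_right) r x) =
        (model2 hE).actR C p.1.1 V (h.trans inf_le_left) r (U p V h x))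
    (hnat : ∀ p V h (W : P.Aff) (hW : W ≤ V) x,
      (model2 hE).res hW (U p V h x) = U p W (le_trans hW h) ((model2 hE).res hW x))
    (hp : ∀ p V h x, ((model2 hE).fm V).p (U p V h x) = ((model2 hE).fm V).p x) :
    ∃ (m1 : C1 C.U (endSheaf P.con E)) (m2 : C1 C.U (endSheaf P.con2 E)), ∀ p V h x,
      U p V h x = ((C.transition2 hE m1).twist m2).T p V h x := by
  -- The truncation in degrees `≤ 1` determines `m1`; the difference that remains determines `m2`.
  let lift (V : P.Aff) : (model1 hE).X V →+ (model2 hE).X V :=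
    AddMonoidHom.mk' (fun x => ((x.1, x.2, 0) : E.obj V × (P.con.obj V ⊗[P.O V] E.obj V) ×
      (P.con2.obj V ⊗[P.O V] E.obj V))) fun x y =>
        Prod.ext rfl (Prod.ext rfl (add_zero (M := P.con2.obj V ⊗[P.O V] E.obj V) 0).symm)
  let U1 (p : Ix2 ι) (V : P.Aff) (h : V.1 ≤ U2 C.U p) : (model1 hE).X V →+ (model1 hE).X V :=
    (show (model2 hE).X V →+ (model1 hE).X V from trunc21 E V).comp ((U p V h).comp (lift V))
  have hU1 : ∀ p V h (x : (model2 hE).X V), U1 p V h (trunc21 E V x) = trunc21 E V (U p V h x) :=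
    fun p V h x => by
      have e : x = lift V (trunc21 E V x) +
          (show (model2 hE).X V from (0, 0, Prod.snd (Prod.snd x))) :=
        Prod.ext (add_zero (M := E.obj V) _).symm
          (Prod.ext (add_zero (M := P.con.obj V ⊗[P.O V] E.obj V) _).symm
            (zero_add (M := P.con2.obj V ⊗[P.O V] E.obj V) _).symm)
      have h1 := congrArg (fun y => trunc21 E V (U p V h y)) e
      refine (h1.trans ((congrArg (trunc21 E V) (map_add (U p V h) _ _)).trans ?_)).symm
      refine (map_add (trunc21 E V) (U p V h (lift V (trunc21 E V x))) _).trans ?_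
      exact (congrArg (_ + ·) (trunc21_eq_zero p V h (U p V h) (hact p V h) _)).trans (add_zero _)
  obtain ⟨m1, hm1, -⟩ := (C.transition1 hE).existsUnique_twist U1
    (fun p V h r x => by
      have h1 := hU1 p V h ((model2 hE).actR C p.1.2 V (h.trans inf_le_right) r (lift V x))
      have h2 := congrArg (trunc21 E V) (hact p V h r (lift V x))
      exact h1.trans h2)
    (fun p V h W hW x => by
      have h1 := hU1 p W (le_trans hW h) ((model2 hE).res hW (lift V x))
      have h2 := congrArg (trunc21 E W) (hnat p V h W hW (lift V x))
      exact h2.trans h1.symm)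
    (fun p V h x => ⟨(U1 p V h x).2 - ((C.transition1 hE).T p V h x).2,
      Prod.ext ((hp p V h (lift V x)).trans (add_zero (M := E.obj V) x.1).symm)
        (add_sub_cancel (((C.transition1 hE).T p V h x).2) (U1 p V h x).2).symm⟩)
  obtain ⟨m2, hm2, -⟩ := (C.transition2 hE m1).existsUnique_twist U hact hnat
    (fun p V h x => by
      have h1 : trunc21 E V (U p V h x) = trunc21 E V ((C.transition2 hE m1).T p V h x) :=
        (hU1 p V h x).symm.trans ((hm1 p V h (trunc21 E V x)).trans
          (twist_transition1_apply C hE m1 p V h (trunc21 E V x)))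
      exact ⟨(U p V h x).2.2 - ((C.transition2 hE m1).T p V h x).2.2,
        Prod.ext ((congrArg Prod.fst h1).trans (add_zero (M := E.obj V) _).symm)
          (Prod.ext ((congrArg Prod.snd h1).trans
            (add_zero (M := P.con.obj V ⊗[P.O V] E.obj V) _).symm)
            (add_sub_cancel (((C.transition2 hE m1).T p V h x).2.2) (U p V h x).2.2).symm)⟩)
  exact ⟨m1, m2, hm2⟩

end CechData

/-- An extension of `E` to `Y⁽²⁾` provides both cochains `m¹` and `m²`, without reference to the
extension to `Y⁽¹⁾` that it induces. -/
theorem exists_isCocycle2 {E : P.X.Modules} (hE : IsVectorBundle E) (C : CechData (ofModules E) ι)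
    {E2 : P.Y2.Modules} {ρ : E2 ⟶ (Scheme.Modules.pushforward P.j02).obj E} (hρ : IsExt2 ρ) :
    ∃ m1 m2, ((C.transition2 (ofModules_isPresheaf E) m1).twist m2).IsCocycle := by
  have Ψ (i : ι) : Framing (target02 C) ρ i :=
    (nonempty_framing (target02 C) ρ hρ.1 hE hρ.2 i (nonempty_dualBasisOver hE (C.U i)).some).some
  obtain ⟨m1, m2, hm⟩ := CechData.exists_twist_transition2 (C := C) (hE := ofModules_isPresheaf E)
    (transitionMap Ψ) (transitionMap_act Ψ) (transitionMap_nat Ψ)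
    (fun p V h x => by
      have h1 := w_transitionMap Ψ p V h x
      have h2 := congrArg (secRes E (preX_eq V).ge) h1
      exact ((secRes_self E _ _).symm.trans (secRes_secRes E _ _ _).symm).trans
        (h2.trans ((secRes_secRes E _ _ _).trans (secRes_self E _ _))))
  refine ⟨m1, m2, IsGluing.isCocycle (Ψ := Ψ) fun p V h s => ?_⟩
  exact (transitionMap_equiv Ψ p V h s).symm.trans (hm p V h _)

end SmoothPair
end CechExt

namespace CechExt
namespace SmoothPair

/-! ### The trace of the obstruction -/

variable {κ : Type u} [Field κ] {P : SmoothPair κ} {ι : Type v} [LinearOrder ι]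

section Cochains

variable {F : P.Y2.Opensᵒᵖ ⥤ AddCommGrpCat.{u}}

theorem restr_restr {W W' W'' : P.Y2.Opens} (h : W' ≤ W) (h' : W'' ≤ W') (x : F.obj (.op W)) :
    restr F h' (restr F h x) = restr F (h'.trans h) x :=
  (congrArg (fun f => f.hom x) (F.map_comp (homOfLE h).op (homOfLE h').op)).symm

theorem restr_d1 {U : ι → P.Aff} (m : C1 U F) (t : Ix3 ι) {W : P.Y2.Opens} (h : W ≤ U3 U t) :
    restr F h (d1 U F m t) = restr F (h.trans (U3_jh U t)) (m (jh t)) -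
      restr F (h.trans (U3_ih U t)) (m (ih t)) + restr F (h.trans (U3_ij U t)) (m (ij t)) := by
  rw [← restr_restr (U3_jh U t) h, ← restr_restr (U3_ih U t) h, ← restr_restr (U3_ij U t) h,
    ← map_sub, ← map_add]
  rfl

theorem d2_d1 (U : ι → P.Aff) (m : C1 U F) : d2 U F (d1 U F m) = 0 := by
  funext t
  obtain ⟨⟨i, j, k, l⟩, hij, hjk, hkl⟩ := t
  have hik : i < k := lt_trans hij hjk
  have hjl : j < l := lt_trans hjk hkl
  have hil : i < l := lt_trans hij hjl
  have hi : U4 U ⟨(i, j, k, l), hij, hjk, hkl⟩ ≤ (U i).1 := inf_le_left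
  have hj : U4 U ⟨(i, j, k, l), hij, hjk, hkl⟩ ≤ (U j).1 := inf_le_right.trans inf_le_left
  have hk : U4 U ⟨(i, j, k, l), hij, hjk, hkl⟩ ≤ (U k).1 :=
    inf_le_right.trans (inf_le_right.trans inf_le_left)
  have hl : U4 U ⟨(i, j, k, l), hij, hjk, hkl⟩ ≤ (U l).1 :=
    inf_le_right.trans (inf_le_right.trans inf_le_right)
  have e1 := restr_d1 m ⟨(j, k, l), hjk, hkl⟩ (le_inf hj (le_inf hk hl))
  have e2 := restr_d1 m ⟨(i, k, l), hik, hkl⟩ (le_inf hi (le_inf hk hl))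
  have e3 := restr_d1 m ⟨(i, j, l), hij, hjl⟩ (le_inf hi (le_inf hj hl))
  have e4 := restr_d1 m ⟨(i, j, k), hij, hjk⟩ (le_inf hi (le_inf hj hk))
  have key : ∀ x y z a b c : F.obj (.op (U4 U ⟨(i, j, k, l), hij, hjk, hkl⟩)),
      x - y + z - (x - a + b) + (y - a + c) - (z - b + c) = 0 := fun x y z a b c => by abel
  refine Eq.trans ?_ (key (restr F (le_inf hk hl) (m ⟨(k, l), hkl⟩))
    (restr F (le_inf hj hl) (m ⟨(j, l), hjl⟩)) (restr F (le_inf hj hk) (m ⟨(j, k), hjk⟩))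
    (restr F (le_inf hi hl) (m ⟨(i, l), hil⟩)) (restr F (le_inf hi hk) (m ⟨(i, k), hik⟩))
    (restr F (le_inf hi hj) (m ⟨(i, j), hij⟩)))
  exact congrArg₂ (· - ·) (congrArg₂ (· + ·) (congrArg₂ (· - ·) e1 e2) e3) e4

end Cochains

theorem res_trc {F E : P.ModFam} (hE : E.IsPresheaf) {V W : P.Aff} (d : DualBasisOver E V)
    (hW : W ≤ V) (f : E.obj V →ₗ[P.O V] F.obj V ⊗[P.O V] E.obj V)
    (f' : E.obj W →ₗ[P.O W] F.obj W ⊗[P.O W] E.obj W)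
    (hf : ∀ x, resTensor F E hW (f x) = f' (E.res hW x)) :
    F.res hW (trc (F.obj V) f) = trc (F.obj W) f' := by
  have h1 : IsDualBasis (fun k => E.res le_rfl (d.e k)) (d.l V le_rfl) := d.sum V le_rfl
  have h2 : IsDualBasis (fun k => E.res hW (d.e k)) (d.l W hW) := d.sum W hW
  rw [h1.trc_eq, h2.trc_eq, map_sum]
  refine Finset.sum_congr rfl fun k _ => ?_
  rw [contr_nat hW _ (d.l W hW k) (d.nat le_rfl hW k), hf, hE.res_res]

section EndAb

variable {E : P.ModFam} {W : P.Y2.Opens}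

theorem evAb2_restr {W' : P.Y2.Opens} (hW : W' ≤ W) (x : (endAb E).obj (.op W)) (V : P.Aff)
    (h : V.1 ≤ W') : evAb2 (restr (endAb E) hW x) V h = evAb2 x V (h.trans hW) :=
  funRes_funRes hW h (Subtype.val (p := (· ∈ endAbOn E W)) x).2

theorem evAb1_d1 (U : ι → P.Aff) (c : C1 U (endAb E)) (t : Ix3 ι) (V : P.Aff)
    (h : V.1 ≤ U3 U t) : evAb1 (d1 U _ c t) V h = evAb1 (c (jh t)) V (h.trans (U3_jh U t)) -
      evAb1 (c (ih t)) V (h.trans (U3_ih U t)) + evAb1 (c (ij t)) V (h.trans (U3_ij U t)) := rfl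

theorem evAb2_d1 (U : ι → P.Aff) (c : C1 U (endAb E)) (t : Ix3 ι) (V : P.Aff)
    (h : V.1 ≤ U3 U t) : evAb2 (d1 U _ c t) V h = evAb2 (c (jh t)) V (h.trans (U3_jh U t)) -
      evAb2 (c (ih t)) V (h.trans (U3_ih U t)) + evAb2 (c (ij t)) V (h.trans (U3_ij U t)) := by
  rw [← evAb2_restr (U3_jh U t) _ V h, ← evAb2_restr (U3_ih U t) _ V h,
    ← evAb2_restr (U3_ij U t) _ V h]
  refine (map_add (funRes P.Y2 h) _ _).trans ?_
  exact congrArg (· + _) (map_sub (funRes P.Y2 h) _ _)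

/-- Sections of `ℰnd^{0,2}_{ab}` over an affine open, in terms of the isomorphism `Φ`. -/
theorem exists_endAb {V₀ : P.Aff} (hV₀ : V₀.1 ≤ W) (Φ : P.AlgTriv W)
    (f : ∀ V : P.Aff, V ≤ V₀ → (E.obj V →ₗ[P.O V] P.con.obj V ⊗[P.O V] E.obj V))
    (hf : ∀ (V V' : P.Aff) (hV : V ≤ V₀) (h : V' ≤ V) x,
      resTensor P.con E h (f V hV x) = f V' (le_trans h hV) (E.res h x))
    (s : ∀ V : P.Aff, V ≤ V₀ → P.con2.obj V)
    (hs : ∀ (V V' : P.Aff) (hV : V ≤ V₀) (h : V' ≤ V),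
      P.con2.res h (s V hV) = s V' (le_trans h hV))
    (hE : E.IsPresheaf) (d : DualBasisOver E V₀) :
    ∃ x : (endAb E).obj (.op V₀.1), ∀ V hV, evAb1 x V hV = f V hV ∧
      Φ.app ⟨V, hV.trans hV₀⟩ (evAb2 x V hV) = ⟨0, trc _ (f V hV), s V hV⟩ := by
  let g : P.R V₀ := (Φ.app ⟨V₀, hV₀⟩).symm ⟨0, trc _ (f V₀ le_rfl), s V₀ le_rfl⟩
  have hg : ∀ (V : P.Aff) (hV : V ≤ V₀),
      Φ.app ⟨V, le_trans hV hV₀⟩ (P.resR hV g) = ⟨0, trc _ (f V hV), s V hV⟩ := fun V hV => by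
    refine (Φ.nat ⟨V₀, hV₀⟩ ⟨V, le_trans hV hV₀⟩ hV g).trans ?_
    refine (congrArg (Trunc.map (P.con.res hV))
      (RingEquiv.apply_symm_apply (Φ.app ⟨V₀, hV₀⟩) _)).trans ?_
    exact Trunc.ext (map_zero (P.resO hV)) (res_trc hE d hV _ _ (hf V₀ V le_rfl hV))
      (hs V₀ V le_rfl hV)
  have hmem : ∀ V : P.AffIn V₀.1, P.conToO1 V.1 (trc (P.con.obj V.1) (f V.1 V.2)) =
      Ideal.Quotient.mk (P.idl V.1 ^ 2) (P.resR (V := V₀) V.2 g) := fun V => by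
    have h0 : P.resR (V := V₀) V.2 g ∈ P.idl V.1 := by
      rw [← Ideal.Quotient.eq_zero_iff_mem, ← Φ.gr0 ⟨V.1, le_trans V.2 hV₀⟩]
      exact congrArg Trunc.c0 (hg V.1 V.2)
    have h1 : P.toCon V.1 ⟨_, h0⟩ = trc (P.con.obj V.1) (f V.1 V.2) :=
      (Φ.gr1 ⟨V.1, le_trans V.2 hV₀⟩ ⟨_, h0⟩).symm.trans (congrArg Trunc.c1 (hg V.1 V.2))
    rw [← h1]
    exact Ideal.toCotangent_to_quotient_square _ _
  exact ⟨⟨⟨⟨fun V => f V.1 V.2, fun V V' h x => hf V.1 V'.1 V.2 h x⟩, g⟩, hmem⟩,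
    fun V hV => ⟨rfl, hg V hV⟩⟩

end EndAb

variable [CharZero κ]

/-- The trace of the second obstruction. -/
theorem CechData.sum_contr_obs2 {E : P.ModFam} (C : CechData E ι) (m : C1 C.U (endSheaf P.con E))
    (t : Ix3 ι) (V : P.Aff) (h : V.1 ≤ U3 C.U t) {n : ℕ} {e : Fin n → E.obj V}
    {l : Fin n → E.obj V →ₗ[P.O V] P.O V} (he : IsDualBasis e l) :
    ∑ k, contr (l k) (C.obs2 m t V h (e k)) =
      (C.phi (ij t) V (h.trans (U3_ij C.U t))).a2 (trc _ (C.atiyah t V h)) +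
        half κ (P.O V) • (C.phi (ij t) V (h.trans (U3_ij C.U t))).L1
          (trc _ (ev (m (jh t)) V (h.trans (U3_jh C.U t)))) -
        half κ (P.O V) • (C.phi (jh t) V (h.trans (U3_jh C.U t))).L1
          (trc _ (ev (m (ij t)) V (h.trans (U3_ij C.U t))) +
            (C.phi (ij t) V (h.trans (U3_ij C.U t))).a1 (trc _ (C.atiyah t V h))) := by
  have e1 := he.trc_rTensor (C.phi (ij t) V (h.trans (U3_ij C.U t))).a2 (C.atiyah t V h)
  rw [he.trc_eq] at e1
  have e2 := he.sum_contr_brLin (ev (m (ij t)) V (h.trans (U3_ij C.U t)))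
    (ev (m (jh t)) V (h.trans (U3_jh C.U t)))
  have e3 := he.sum_contr_br (C.phi (ij t) V (h.trans (U3_ij C.U t)))
    (C.nab_leibniz (ij t).1.2 V ((h.trans (U3_ij C.U t)).trans inf_le_right))
    (ev (m (jh t)) V (h.trans (U3_jh C.U t)))
  have e4 := he.sum_contr_br (C.phi (jh t) V (h.trans (U3_jh C.U t)))
    (C.nab_leibniz (jh t).1.2 V ((h.trans (U3_jh C.U t)).trans inf_le_right))
    (ev (m (ij t)) V (h.trans (U3_ij C.U t)) + C.a1At t V h)
  have e5 : trc _ (C.a1At t V h) = _ :=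
    he.trc_rTensor (C.phi (ij t) V (h.trans (U3_ij C.U t))).a1 (C.atiyah t V h)
  rw [map_add, e5] at e4
  have e6 : ∀ k, contr (l k) (C.obs2 m t V h (e k)) = contr (l k) (C.a2At t V h (e k)) +
      half κ (P.O V) • contr (l k) (brLin (ev (m (ij t)) V (h.trans (U3_ij C.U t)))
        (ev (m (jh t)) V (h.trans (U3_jh C.U t))) (e k)) +
      half κ (P.O V) • contr (l k) (C.brs (ij t) V (h.trans (U3_ij C.U t))
        (ev (m (jh t)) V (h.trans (U3_jh C.U t))) (e k)) -
      half κ (P.O V) • contr (l k) (C.brs (jh t) V (h.trans (U3_jh C.U t))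
        (ev (m (ij t)) V (h.trans (U3_ij C.U t)) + C.a1At t V h) (e k)) := fun k => by
    have e7 : ∀ x y z w : P.con2.obj V ⊗[P.O V] E.obj V, contr (l k) (x + half κ (P.O V) • y +
        half κ (P.O V) • z - half κ (P.O V) • w) = contr (l k) x + half κ (P.O V) • contr (l k) y +
        half κ (P.O V) • contr (l k) z - half κ (P.O V) • contr (l k) w := fun x y z w => by
      rw [map_sub, map_add, map_add, map_smul, map_smul, map_smul]
    exact e7 _ _ _ _
  simp only [e6, Finset.sum_sub_distrib, Finset.sum_add_distrib, ← Finset.smul_sum]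
  refine congrArg₂ (· - ·) (congrArg₂ (· + ·) ((congrArg₂ (· + ·) e1 ?_).trans (add_zero _)) ?_) ?_
  · exact (congrArg (half κ (P.O V) • ·) e2).trans (smul_zero _)
  · exact congrArg (half κ (P.O V) • ·) e3
  · exact congrArg (half κ (P.O V) • ·) e4

end SmoothPair

/-- The relation between the traces of `m¹`, `m²` and of the obstructions. -/
theorem trace_identity {A N S : Type*} [Ring A] [AddCommGroup N] [AddCommGroup S] [Module A S] {c : A}
    (hc : ∀ x : S, c • (x + x) = x) {L L' L'' : N →+ S} (hL : ∀ n, L'' n = L n + L' n)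
    {t t' t'' a : N} {s s' s'' b : S} (h1 : a = -(t' - t'' + t))
    (h2 : b + c • L t' - c • L' (t + a) = -(s' - s'' + s)) :
    -(s' + c • L' t' + L t') + (s'' + c • L'' t'') - (s + c • L t) = b + c • L a := by
  have e1 : t'' = t' + t + a := by rw [h1]; abel
  have e2 : b = -(s' - s'' + s) + c • L' (t + a) - c • L t' := by rw [← h2]; abel
  have e3 := hc (L t')
  rw [smul_add] at e3
  rw [e1, e2, hL]
  nth_rewrite 1 [← e3]
  simp only [map_add, smul_add]
  abel

end CechExt

namespace CechExt
namespace SmoothPair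

/-! ### The abelian part of the obstruction -/

variable {κ : Type u} [Field κ] [CharZero κ] {P : SmoothPair κ} {ι : Type v} [LinearOrder ι]

namespace CechData

variable {E : P.ModFam} {C : CechData E ι} {hE : E.IsPresheaf}

/-- The function `-(Tr m¹_ij + Tr m²_ij)` on `Y⁽²⁾`, with respect to the isomorphism
`exp(-φ_ij/2) ∘ Φ_i`, together with `-m¹_ij`. -/
theorem exists_abCochain (hE : E.IsPresheaf) (hd : ∀ V, Nonempty (DualBasisOver E V))
    (m1 : C1 C.U (endSheaf P.con E)) (m2 : C1 C.U (endSheaf P.con2 E)) :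
    ∃ c : C1 C.U (endAb E), ∀ (p : Ix2 ι) (V : P.Aff) (h : V.1 ≤ U2 C.U p),
      evAb1 (c p) V h = -ev (m1 p) V h ∧
      (C.Φ p.1.1).app ⟨V, h.trans inf_le_left⟩ (evAb2 (c p) V h) =
        ⟨0, -trc _ (ev (m1 p) V h), -(trc _ (ev (m2 p) V h) +
          half κ (P.O V) • (C.phi p V h).L1 (trc _ (ev (m1 p) V h)))⟩ := by
  have key : ∀ p : Ix2 ι, ∃ x : (endAb E).obj (.op (U2 C.U p)), ∀ (V : P.Aff) (h : V.1 ≤ U2 C.U p),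
      evAb1 x V h = -ev (m1 p) V h ∧
      (C.Φ p.1.1).app ⟨V, h.trans inf_le_left⟩ (evAb2 x V h) =
        ⟨0, trc _ (-ev (m1 p) V h), -(trc _ (ev (m2 p) V h) +
          half κ (P.O V) • (C.phi p V h).L1 (trc _ (ev (m1 p) V h)))⟩ := fun p => by
    let V₀ : P.Aff := ⟨U2 C.U p, isAffineOpen_inf (C.U p.1.1) (C.U p.1.2)⟩
    have hle : ∀ V : P.Aff, V.1 ≤ U2 C.U p → V ≤ V₀ := fun V h => h
    refine exists_endAb (V₀ := V₀) inf_le_left (C.Φ p.1.1) (fun V h => -ev (m1 p) V h)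
      (fun V V' hV h x => ?_) (fun V h => -(trc _ (ev (m2 p) V h) +
        half κ (P.O V) • (C.phi p V h).L1 (trc _ (ev (m1 p) V h)))) (fun V V' hV h => ?_) hE
      (hd V₀).some
    · rw [LinearMap.neg_apply, map_neg, ev_nat]
      rfl
    · obtain ⟨d⟩ := hd V
      have e1 := res_trc hE d h _ _ (ev_nat (m1 p) hV h)
      have e2 := res_trc hE d h _ _ (ev_nat (m2 p) hV h)
      have e3 := FiltDer.L1_nat (C.phi_exp_nat p V hV h) (trc _ (ev (m1 p) V hV))
      rw [map_neg, map_add, map_smulₛₗ, e2, FiltDer.map_half (P.resO_algebraMap h)]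
      refine congrArg (fun y => -(_ + half κ (P.O V') • y)) (e3.trans ?_)
      rw [e1]
  choose c hc using key
  exact ⟨c, fun p V h => ⟨(hc p V h).1, (hc p V h).2.trans (by rw [map_neg])⟩⟩

/-- The traces of the cochains of an extension to `Y⁽²⁾` form a cochain whose coboundary is the
abelian part of the obstruction. -/
theorem exists_abCoboundary (hd : ∀ V, Nonempty (DualBasisOver E V))
    (hΩ : ∀ V : P.Aff, Module.Finite (P.O V) Ω[P.O V⁄κ] ∧ Module.Projective (P.O V) Ω[P.O V⁄κ])
    (hflat : ∀ i, (C.conn i).IsFlat) {m1 : C1 C.U (endSheaf P.con E)}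
    {m2 : C1 C.U (endSheaf P.con2 E)} (h : ((C.transition2 hE m1).twist m2).IsCocycle) :
    ∃ c : C1 C.U (endAb E), ∀ t V h, evAb1 (d1 C.U _ c t) V h = C.a1At t V h ∧
      evAb2 (d1 C.U _ c t) V h = C.trObs t V h := by
  obtain ⟨z1, hz1, hd1⟩ := C.exists_isDefect1 hE
  have hm1 := isCocycle1_of_isCocycle2 h
  obtain ⟨z2, hz2, hd2⟩ := exists_isDefect2 hΩ hflat hm1
  have e1 : z1 = -d1 C.U _ m1 := (hd1.twist_isCocycle_iff m1).1 hm1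
  have e2 : z2 = -d1 C.U _ m2 := (hd2.twist_isCocycle_iff m2).1 h
  obtain ⟨c, hc⟩ := exists_abCochain hE hd m1 m2
  refine ⟨c, fun t V hV => ?_⟩
  have f1 : C.a1At t V hV = -(ev (m1 (jh t)) V (hV.trans (U3_jh C.U t)) -
      ev (m1 (ih t)) V (hV.trans (U3_ih C.U t)) + ev (m1 (ij t)) V (hV.trans (U3_ij C.U t))) := by
    rw [← hz1, e1]
    rfl
  have f2 : ev (z2 t) V hV = -(ev (m2 (jh t)) V (hV.trans (U3_jh C.U t)) -
      ev (m2 (ih t)) V (hV.trans (U3_ih C.U t)) + ev (m2 (ij t)) V (hV.trans (U3_ij C.U t))) := by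
    rw [e2]
    rfl
  constructor
  · rw [evAb1_d1, (hc _ V _).1, (hc _ V _).1, (hc _ V _).1, f1]
    abel
  · obtain ⟨d⟩ := hd V
    have he : IsDualBasis _ (d.l V le_rfl) := d.sum V le_rfl
    -- The traces of the two coboundary relations.
    have g1 : (C.phi (ij t) V (hV.trans (U3_ij C.U t))).a1 (trc _ (C.atiyah t V hV)) = _ :=
      (he.trc_rTensor _ _).symm.trans (congrArg (trc (P.con.obj V)) f1)
    rw [map_neg, map_add, map_sub] at g1
    have g2 := (he.trc_eq (ev (z2 t) V hV)).trans
      ((Finset.sum_congr rfl fun k _ => congrArg (contr (d.l V le_rfl k)) (hz2 t V hV _)).trans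
        (C.sum_contr_obs2 m1 t V hV he))
    rw [f2, map_neg, map_add, map_sub] at g2
    apply ((C.Φ t.1.1).app ⟨V, hV.trans inf_le_left⟩).injective
    have a1 := (hc (ij t) V (hV.trans (U3_ij C.U t))).2
    have a2 := (hc (ih t) V (hV.trans (U3_ih C.U t))).2
    have a3 := (C.phi_exp (ij t) V (hV.trans (U3_ij C.U t))
      (evAb2 (c (jh t)) V (hV.trans (U3_jh C.U t)))).symm.trans
      (congrArg (C.phi (ij t) V (hV.trans (U3_ij C.U t))).exp
        (hc (jh t) V (hV.trans (U3_jh C.U t))).2)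
    rw [evAb2_d1, map_add, map_sub]
    refine (congrArg₂ (· + ·) (congrArg₂ (· - ·) a3 a2) a1).trans ?_
    refine Eq.trans ?_ (RingEquiv.apply_symm_apply _ _).symm
    rw [sub_eq_add_neg]
    refine Trunc.ext ?_ ?_ ?_
    · change (0 : P.O V) + -0 + 0 = 0
      rw [neg_zero, add_zero, add_zero]
    · change -trc _ (ev (m1 (jh t)) V _) + (C.phi (ij t) V _).A1 0 + - -trc _ (ev (m1 (ih t)) V _) +
        -trc _ (ev (m1 (ij t)) V _) = (C.phi (ij t) V _).a1 (trc _ (C.atiyah t V hV))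
      rw [g1, map_zero]
      abel
    · refine Eq.trans ?_ (trace_identity (c := half κ (P.O V)) half_smul_add
        (FiltDer.L1_of_exp_comp (C.phi_exp_comp t V hV)) g1 g2.symm)
      change -(_ + half κ (P.O V) • _) + (C.phi (ij t) V _).L1 (-_) + (C.phi (ij t) V _).A2 0 +
        half κ (P.O V) • (C.phi (ij t) V _).L1 ((C.phi (ij t) V _).A1 0) + - -_ + -_ = _
      have key : ∀ x y z w : P.con2.obj V, -x + -y + z + -w = -(x + y) + z - w := by
        intros
        abel
      rw [map_neg, map_zero, map_zero, map_zero, smul_zero, add_zero, add_zero, neg_neg]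
      exact key _ _ _ _

end CechData

end SmoothPair
end CechExt

end

/-- `E` is a vector bundle on a smooth closed `X ⊆ Y`, and `C` consists of an affine covering,
isomorphisms `Φ_i` and connections `∇_i`. -/
theorem mainTheorem6 {κ : Type u} [Field κ] [CharZero κ] (P : SmoothPair κ) (E : P.X.Modules)
    (hE : IsVectorBundle E) {ι : Type v} [LinearOrder ι] (C : CechData (ofModules E) ι) :
    -- Extensions of `E` to `Y⁽¹⁾`.
    (∃ z : C2 C.U (endSheaf P.con (ofModules E)), (∀ t V h, ev (z t) V h = C.a1At t V h) ∧
      d2 C.U _ z = 0 ∧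
      -- Existence.
      ((∃ (E1 : P.Y1.Modules) (ρ : E1 ⟶ (Scheme.Modules.pushforward P.j01).obj E), IsExt1 ρ) ↔
        ∃ m : C1 C.U (endSheaf P.con (ofModules E)), z = -d1 C.U _ m) ∧
      -- Every solution `m` comes from an extension.
      (∀ m : C1 C.U (endSheaf P.con (ofModules E)), z = -d1 C.U _ m →
        ∃ (E1 : P.Y1.Modules) (ρ : E1 ⟶ (Scheme.Modules.pushforward P.j01).obj E), IsExt1 ρ ∧
          ∃ Ψ : ∀ i, Triv1 (C.Φ i) ρ, C.IsGluing1 Ψ m) ∧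
      -- Every extension comes from a solution `m`.
      (∀ (E1 : P.Y1.Modules) (ρ : E1 ⟶ (Scheme.Modules.pushforward P.j01).obj E), IsExt1 ρ →
        Nonempty (∀ i, Triv1 (C.Φ i) ρ) ∧ ∀ Ψ : ∀ i, Triv1 (C.Φ i) ρ,
          (∃! m, C.IsGluing1 Ψ m) ∧ ∀ m, C.IsGluing1 Ψ m → z = -d1 C.U _ m) ∧
      -- Isomorphic extensions correspond to cohomologous solutions.
      (∀ (E1 E1' : P.Y1.Modules) (ρ : E1 ⟶ (Scheme.Modules.pushforward P.j01).obj E)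
        (ρ' : E1' ⟶ (Scheme.Modules.pushforward P.j01).obj E), IsExt1 ρ → IsExt1 ρ' →
        ∀ (Ψ : ∀ i, Triv1 (C.Φ i) ρ) (Ψ' : ∀ i, Triv1 (C.Φ i) ρ') (m m'),
          C.IsGluing1 Ψ m → C.IsGluing1 Ψ' m' →
          (ExtIso P.j01 ρ ρ' ↔ ∃ n, m - m' = d0 C.U _ n))) ∧
    -- Extensions of `E⁽¹⁾` to `Y⁽²⁾`.
    ((∀ i, (C.conn i).IsFlat) →
      ∀ (E1 : P.Y1.Modules) (ρ1 : E1 ⟶ (Scheme.Modules.pushforward P.j01).obj E), IsExt1 ρ1 →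
      ∀ (Ψ1 : ∀ i, Triv1 (C.Φ i) ρ1) (m1 : C1 C.U (endSheaf P.con (ofModules E))),
        C.IsGluing1 Ψ1 m1 →
      ∃ z : C2 C.U (endSheaf P.con2 (ofModules E)),
        (∀ t V h e, ev (z t) V h e = C.obs2 m1 t V h e) ∧
        (∃ hz : d2 C.U _ z = 0,
          (∃ (E2 : P.Y2.Modules) (ρ : E2 ⟶ (Scheme.Modules.pushforward P.j12).obj E1),
            IsExt12 ρ) ↔ H2.mk C.U _ z hz = 0) ∧
        ((∃ (E2 : P.Y2.Modules) (ρ : E2 ⟶ (Scheme.Modules.pushforward P.j12).obj E1),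
            IsExt12 ρ) ↔
          ∃ m2 : C1 C.U (endSheaf P.con2 (ofModules E)), z = -d1 C.U _ m2) ∧
        (∀ m2 : C1 C.U (endSheaf P.con2 (ofModules E)), z = -d1 C.U _ m2 →
          ∃ (E2 : P.Y2.Modules) (ρ : E2 ⟶ (Scheme.Modules.pushforward P.j12).obj E1), IsExt12 ρ ∧
            ∃ Ψ2 : ∀ i, Triv2 (Ψ1 i) ρ, C.IsGluing2 Ψ2 m1 m2) ∧
        (∀ (E2 : P.Y2.Modules) (ρ : E2 ⟶ (Scheme.Modules.pushforward P.j12).obj E1), IsExt12 ρ →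
          Nonempty (∀ i, Triv2 (Ψ1 i) ρ) ∧ ∀ Ψ2 : ∀ i, Triv2 (Ψ1 i) ρ,
            (∃! m2, C.IsGluing2 Ψ2 m1 m2) ∧ ∀ m2, C.IsGluing2 Ψ2 m1 m2 → z = -d1 C.U _ m2) ∧
        (∀ (E2 E2' : P.Y2.Modules) (ρ : E2 ⟶ (Scheme.Modules.pushforward P.j12).obj E1)
          (ρ' : E2' ⟶ (Scheme.Modules.pushforward P.j12).obj E1), IsExt12 ρ → IsExt12 ρ' →
          ∀ (Ψ2 : ∀ i, Triv2 (Ψ1 i) ρ) (Ψ2' : ∀ i, Triv2 (Ψ1 i) ρ') (m2 m2'),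
            C.IsGluing2 Ψ2 m1 m2 → C.IsGluing2 Ψ2' m1 m2' →
            (ExtIso P.j12 ρ ρ' ↔ ∃ n, m2 - m2' = d0 C.U _ n))) ∧
    -- The abelian part of the obstruction.
    ((∀ i, (C.conn i).IsFlat) →
      (∃ (E2 : P.Y2.Modules) (ρ : E2 ⟶ (Scheme.Modules.pushforward P.j02).obj E), IsExt2 ρ) →
      ∃ z : C2 C.U (endAb (ofModules E)),
        (∀ t V h, evAb1 (z t) V h = C.a1At t V h ∧ evAb2 (z t) V h = C.trObs t V h) ∧
        ∃ hz : d2 C.U _ z = 0, H2.mk C.U _ z hz = 0) := by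
  refine ⟨?_, ?_, ?_⟩
  · obtain ⟨z, h1, h2, h3, h4, h5⟩ := classification1 hE C
    exact ⟨z, h1, h2, h3, h4, h5, fun _ _ _ _ _ _ _ _ _ _ h h' => extIso1_iff h h'⟩
  · intro hflat E1 ρ1 hρ1 Ψ1 m1 hm1
    obtain ⟨z, h1, h2, h3, h4, h5⟩ := classification2 hE hflat hρ1 hm1
    exact ⟨z, h1, ⟨h2, h3.trans (H2.mk_eq_zero_iff h2).symm⟩, h3, h4, h5,
      fun _ _ _ _ _ _ _ _ _ _ h h' => extIso2_iff h h'⟩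
  · rintro hflat ⟨E2, ρ, hρ⟩
    obtain ⟨m1, m2, h⟩ := exists_isCocycle2 hE C hρ
    obtain ⟨c, hc⟩ :=
      CechData.exists_abCoboundary (nonempty_dualBasisOver hE) finite_projective_omega hflat h
    exact ⟨d1 C.U _ c, hc, d2_d1 C.U c, (H2.mk_eq_zero_iff _).2 ⟨-c, by rw [map_neg, neg_neg]⟩⟩
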